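/- **Setting.** Fix a signature $\Sigma$ of type definitions $Y=A$ (contractive: $A$ is not itself a type variable) and well-typed process definitions $\Omega\vdash X=P::x{:}A$, for intuitionistic linear logic session types $A ::= 1\mid\oplus\{\ell{:}A_\ell\}_{\ell\in I}\mid\&\{\ell{:}A_\ell\}_{\ell\in I}\mid A\otimes B\mid A\multimap B\mid Y$ (labels $\ell$, finite $I$), with equi-recursive types (types with the same infinite unfolding are identified). Terms $x.k;P$, $\mathbf{case}\,x(\ell\Rightarrow Q_\ell)$, $\mathbf{send}\,z\,x;P$, $z\leftarrow\mathbf{recv}\,x;P$, $\mathbf{close}\,x$, $\mathbf{wait}\,x;Q$, spawning of a defined process, and forwarders $F_Y$ (defined as the identity expansion of the definition of $Y$) are typed by the usual linear sequent calculus $\Omega\vdash P::x{:}A$. A configuration is a multiset of processes $\mathbf{proc}(x_\alpha,P)$, providing along the channel $x_\alpha$, and messages $\mathbf{msg}(\mathbf{close}\,y_\alpha)$, $\mathbf{msg}(y_\alpha.k)$, $\mathbf{msg}(\mathbf{send}\,z_\beta\,y_\alpha)$. A channel $y_\alpha$ has a base $y$ and a generation $\alpha\in\mathbb N$. Configurations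 are typed linearly, $\Delta\Vdash\mathcal D::\Delta'$. They step ($\mapsto$) by the asynchronous rules: a send along $y_\alpha$ creates a message and the sender continues with $y_{\alpha+1}$ in place of $y_\alpha$; a receive consumes the message and continues with $y_{\alpha+1}$; a spawn creates a process providing along $x_0$ with $x$ fresh; $F_Y$ unfolds. Bound channels are taken up to renaming of their bases, but not of their generations. $\mathrm{Tree}(\Delta\Vdash K)$, where $K$ is $x_\alpha{:}A$ or an anonymous unobservable root $\_{:}1$, is the set of $\mathcal D$ with $\Delta\Vdash\mathcal D::K$, where channels are used linearly and distinct generations of one base occur together only if linked by pending messages. For $m\in\mathbb N$ the relation $\mathcal E[\![\Delta\Vdash K]\!]^m$ on configurations is defined by recursion on $m$. $\mathcal E[\![\Delta\Vdash K]\!]^0$ consists of all pairs in $\mathrm{Tree}(\Delta\Vdash K)$. $(\mathcal D_1;\mathcal D_2)\in\mathcal E[\![\Delta\Vdash K]\!]^{m+1}$ iff both are in $\mathrm{Tree}(\Delta\Vdash K)$ and for every $\mathcal D_1\mapsto^*\mathcal D_1'$ there is $\mathcal D_2\mapsto^*\mathcal D_2'$ such that every free channel with a message to be sent along it in $\mathcal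 D_1'$ also has one in $\mathcal D_2'$, and, with "related" below meaning related by $\mathcal E$ at index $m$: * (output) whenever $\mathcal D_1'$ has a message along a free channel $y_\alpha$ that is positive ($1,\oplus,\otimes$) in $K$ or negative ($\&,\multimap$) in $\Delta$: both $\mathcal D_1',\mathcal D_2'$ have the same message along $y_\alpha$ and, if it is a label $k$, the remaining configurations are related at the interface with $y_\alpha$ replaced by $y_{\alpha+1}{:}A_k$; if it is $\mathbf{close}\,y_\alpha$, then $\Delta$ is empty and both configurations are just this message; if it is a channel $x_\beta$ (of type $A$, $y_\alpha{:}A\otimes B$ or $A\multimap B$), then, for one splitting $\Delta_1,\Delta_2$ of the other channels of $\Delta$ and after renaming of bound channels, each configuration consists of the message, a tree in $\mathrm{Tree}(\Delta_1\Vdash x_\beta{:}A)$ and a rest; the two trees are related at $\Delta_1\Vdash x_\beta{:}A$, and the two rests are related at the interface given by $\Delta_2$, $y_{\alpha+1}{:}B$ (on the side of $y_\alpha$) and the unchanged $K$ if $y_\alpha$ is in $\Delta$; * (input) whenever a process of $\mathcal D_1'$ waits to receive along a free channel $y_\alpha$ that is negative in $K$ or positive in $\Delta$: for every message along $y_\alpha$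 allowed by its type (every label; $\mathbf{close}\,y_\alpha$; every new channel $x_\beta$), adding that message to both $\mathcal D_1'$ and $\mathcal D_2'$ yields configurations related at the interface in which $y_\alpha$ is replaced by $y_{\alpha+1}$ at the continuation type (removed in case of $\mathbf{close}$) and a received $x_\beta{:}A$ is added to the left. **Lemma (Linking).** Let $u_\alpha{:}T$ be a channel, $\Delta$ a context, $K$ a root and $\mathcal D_1,\mathcal D_2$ configurations. Then $$\forall m.\ (\mathcal D_1;\mathcal D_2)\in\mathcal E[\![\Delta,u_\alpha{:}T\Vdash K]\!]^m$$ if and only if for all contexts $\Delta'$ and all configurations $\mathcal T_1,\mathcal T_2$ such that $\forall m.\ (\mathcal T_1;\mathcal T_2)\in\mathcal E[\![\Delta'\Vdash u_\alpha{:}T]\!]^m$, and such that the channels of $\mathcal T_i$ and $\Delta'$ are named apart from those of $\mathcal D_i$, $\Delta$ and $K$ for $i=1,2$ (the only common channel is $u_\alpha$ and the only common base is $u$), we have $$\forall k.\ (\mathcal T_1\mathcal D_1;\mathcal T_2\mathcal D_2)\in\mathcal E[\![\Delta',\Delta\Vdash K]\!]^k .$$ -/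

import Mathlib

/-! Intuitionistic linear logic session types with general recursive types: types, terms, typing,
configurations, asynchronous dynamics, and the recursive session logical relation. -/

namespace ILST

/-- A run-time channel `y_α`: a base `y` and a generation `α`. -/
structure Chan where
  base : ℕ
  gen : ℕ
  deriving DecidableEq

/-- The next generation `y_{α+1}` of the channel `y_α`. -/
def Chan.succ (y : Chan) : Chan := ⟨y.base, y.gen + 1⟩

/-- The substitution `[y_{α+1} / y_α]` on channels. -/
def bump (y c : Chan) : Chan := if c = y then y.succ else c

/-- Renaming of bases; generations cannot be renamed. -/
def Chan.rename (π : Equiv.Perm ℕ) (c : Chan) : Chan := ⟨π c.base, c.gen⟩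

/-! ### Types -/

/-- Session types over labels `L` and type variables `TN`. -/
inductive Ty (L TN : Type) : Type
  | one : Ty L TN
  | plus (I : Finset L) (A : {l // l ∈ I} → Ty L TN) : Ty L TN
  | amp (I : Finset L) (A : {l // l ∈ I} → Ty L TN) : Ty L TN
  | tensor (A B : Ty L TN) : Ty L TN
  | lolli (A B : Ty L TN) : Ty L TN
  | tvar (Y : TN) : Ty L TN

/-- Positive head connective: the provider sends. -/
def Ty.Pos {L TN : Type} : Ty L TN → Prop
  | .one => True
  | .plus _ _ => True
  | .tensor _ _ => True
  | _ => False

/-- Negative head connective: the provider receives. -/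
def Ty.Neg {L TN : Type} : Ty L TN → Prop
  | .amp _ _ => True
  | .lolli _ _ => True
  | _ => False

/-! ### Terms -/

/-- Terms with free names in `V`. A binder (`recv`, `spawn`) adds the name `none`, so that terms
are taken up to renaming of bound variables and substitution of names is `map`.
`PN` is the set of names of defined processes. -/
inductive Proc (L TN PN : Type) : Type → Type 1
  /-- `x.k; P` -/
  | sendLab {V : Type} (x : V) (k : L) (P : Proc L TN PN V) : Proc L TN PN V
  /-- `case x (l ⇒ Q_l)_{l ∈ I}` -/
  | case {V : Type} (x : V) (I : Finset L) (Q : {l // l ∈ I} → Proc L TN PN V) : Proc L TN PN V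
  /-- `send z x; P` -/
  | send {V : Type} (z x : V) (P : Proc L TN PN V) : Proc L TN PN V
  /-- `z ← recv x; P`, binding `z` -/
  | recv {V : Type} (x : V) (P : Proc L TN PN (Option V)) : Proc L TN PN V
  /-- `close x` -/
  | close {V : Type} (x : V) : Proc L TN PN V
  /-- `wait x; Q` -/
  | wait {V : Type} (x : V) (Q : Proc L TN PN V) : Proc L TN PN V
  /-- `x ← X ← args; Q`, binding `x` -/
  | spawn {V : Type} (X : PN) (args : List V) (Q : Proc L TN PN (Option V)) : Proc L TN PN V
  /-- The forwarder `F_Y` of the type variable `Y`, providing `y` and using `z` -/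
  | fwd {V : Type} (Y : TN) (y z : V) : Proc L TN PN V

/-- Substitution of names for names. -/
def Proc.map {L TN PN : Type} : {V W : Type} → (V → W) → Proc L TN PN V → Proc L TN PN W
  | _, _, f, .sendLab x k P => .sendLab (f x) k (P.map f)
  | _, _, f, .case x I Q => .case (f x) I (fun l => (Q l).map f)
  | _, _, f, .send z x P => .send (f z) (f x) (P.map f)
  | _, _, f, .recv x P => .recv (f x) (P.map (Option.map f))
  | _, _, f, .close x => .close (f x)
  | _, _, f, .wait x Q => .wait (f x) (Q.map f)
  | _, _, f, .spawn X args Q => .spawn X (args.map f) (Q.map (Option.map f))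
  | _, _, f, .fwd Y y z => .fwd Y (f y) (f z)

/-- The free names of a term. -/
def Proc.names {L TN PN : Type} : {V : Type} → Proc L TN PN V → Set V
  | _, .sendLab x _ P => {x} ∪ P.names
  | _, .case x _ Q => {x} ∪ {v | ∃ l, v ∈ (Q l).names}
  | _, .send z x P => {z, x} ∪ P.names
  | _, .recv x P => {x} ∪ {v | some v ∈ P.names}
  | _, .close x => {x}
  | _, .wait x Q => {x} ∪ Q.names
  | _, .spawn _ args Q => {v | v ∈ args} ∪ {v | some v ∈ Q.names}
  | _, .fwd _ y z => {y, z}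

/-- The term waits to receive a message along `y`. -/
inductive Proc.WaitsOn {L TN PN V : Type} (y : V) : Proc L TN PN V → Prop
  | case (I : Finset L) (Q : {l // l ∈ I} → Proc L TN PN V) : Proc.WaitsOn y (.case y I Q)
  | recv (P : Proc L TN PN (Option V)) : Proc.WaitsOn y (.recv y P)
  | wait (Q : Proc L TN PN V) : Proc.WaitsOn y (.wait y Q)

/-- The identity expansion: the forwarder at type `A` providing `y` and using `z`. -/
def fwder {L TN PN : Type} : Ty L TN → {V : Type} → V → V → Proc L TN PN V
  | .one, _, y, z => .wait z (.close y)
  | .plus I A, _, y, z => .case z I (fun l => .sendLab y l.1 (fwder (A l) y z))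
  | .amp I A, _, y, z => .case y I (fun l => .sendLab z l.1 (fwder (A l) y z))
  | .tensor _ B, _, y, z => .recv z (.send none (some y) (fwder B (some y) (some z)))
  | .lolli _ B, _, y, z => .recv y (.send none (some z) (fwder B (some y) (some z)))
  | .tvar Y, _, y, z => .fwd Y y z

/-! ### Signatures and typing of terms -/

/-- A definition `Ω ⊢ X = P :: x : A`. The body names the `i`-th variable of `Ω` by `some i` and
the provided variable `x` by `none`. -/
structure ProcDef (L TN PN : Type) where
  params : List (Ty L TN)
  ty : Ty L TN
  body : Proc L TN PN (Option (Fin params.length))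

/-- A signature: type definitions `Y = A` and process definitions. -/
structure Signature (L TN PN : Type) where
  tdef : TN → Ty L TN
  pdef : PN → ProcDef L TN PN

/-- Linear typing contexts. -/
abbrev Ctx (L TN V : Type) := Multiset (V × Ty L TN)

section typing

variable {L TN PN : Type} (Sg : Signature L TN PN)

/-- Unfold a type variable at the head. -/
def Signature.unf : Ty L TN → Ty L TN
  | .tvar Y => Sg.tdef Y
  | A => A

/-- Equal head connectives with immediate components related by `R`. -/
inductive HeadRel (R : Ty L TN → Ty L TN → Prop) : Ty L TN → Ty L TN → Prop
  | one : HeadRel R .one .one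
  | plus (I : Finset L) (A B : {l // l ∈ I} → Ty L TN) (h : ∀ l, R (A l) (B l)) :
      HeadRel R (.plus I A) (.plus I B)
  | amp (I : Finset L) (A B : {l // l ∈ I} → Ty L TN) (h : ∀ l, R (A l) (B l)) :
      HeadRel R (.amp I A) (.amp I B)
  | tensor (A A' B B' : Ty L TN) (h : R A A') (h' : R B B') :
      HeadRel R (.tensor A B) (.tensor A' B')
  | lolli (A A' B B' : Ty L TN) (h : R A A') (h' : R B B') :
      HeadRel R (.lolli A B) (.lolli A' B')

/-- Equi-recursive type equality: equality of the infinite unfoldings, that is, the largest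
relation that is compatible with head unfolding. -/
def Signature.TyEq (A B : Ty L TN) : Prop :=
  ∃ R : Ty L TN → Ty L TN → Prop,
    (∀ A B, R A B → HeadRel R (Sg.unf A) (Sg.unf B)) ∧ R A B

/-- Contexts with the same names, at equal types. -/
def Signature.CtxEq {V : Type} (Γ Γ' : Ctx L TN V) : Prop :=
  Multiset.Rel (fun p q => p.1 = q.1 ∧ Sg.TyEq p.2 q.2) Γ Γ'

/-- Typing of terms, `Γ ⊢ P :: x : A`. Types are equi-recursive, so they can be replaced by equal
ones everywhere (`conv`); the unfolding of a type variable on either side of the turnstile is an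
instance, see `tyEq_tdef`. -/
inductive Typed : {V : Type} → Ctx L TN V → Proc L TN PN V → V → Ty L TN → Prop
  | plusR {V : Type} (Γ : Ctx L TN V) (x : V) (I : Finset L) (A : {l // l ∈ I} → Ty L TN)
      (k : {l // l ∈ I}) (P : Proc L TN PN V) (h : Typed Γ P x (A k)) :
      Typed Γ (.sendLab x k.1 P) x (.plus I A)
  | plusL {V : Type} (Γ : Ctx L TN V) (x y : V) (I : Finset L) (A : {l // l ∈ I} → Ty L TN)
      (C : Ty L TN) (Q : {l // l ∈ I} → Proc L TN PN V)
      (h : ∀ k, Typed ((x, A k) ::ₘ Γ) (Q k) y C) :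
      Typed ((x, .plus I A) ::ₘ Γ) (.case x I Q) y C
  | ampR {V : Type} (Γ : Ctx L TN V) (x : V) (I : Finset L) (A : {l // l ∈ I} → Ty L TN)
      (Q : {l // l ∈ I} → Proc L TN PN V) (h : ∀ k, Typed Γ (Q k) x (A k)) :
      Typed Γ (.case x I Q) x (.amp I A)
  | ampL {V : Type} (Γ : Ctx L TN V) (x y : V) (I : Finset L) (A : {l // l ∈ I} → Ty L TN)
      (C : Ty L TN) (k : {l // l ∈ I}) (P : Proc L TN PN V)
      (h : Typed ((x, A k) ::ₘ Γ) P y C) :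
      Typed ((x, .amp I A) ::ₘ Γ) (.sendLab x k.1 P) y C
  | tensorR {V : Type} (Γ : Ctx L TN V) (x z : V) (A B : Ty L TN) (P : Proc L TN PN V)
      (h : Typed Γ P x B) :
      Typed ((z, A) ::ₘ Γ) (.send z x P) x (.tensor A B)
  | tensorL {V : Type} (Γ : Ctx L TN V) (x y : V) (A B C : Ty L TN)
      (P : Proc L TN PN (Option V))
      (h : Typed ((none, A) ::ₘ (some x, B) ::ₘ Γ.map (Prod.map some id)) P (some y) C) :
      Typed ((x, .tensor A B) ::ₘ Γ) (.recv x P) y C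
  | lolliR {V : Type} (Γ : Ctx L TN V) (x : V) (A B : Ty L TN) (P : Proc L TN PN (Option V))
      (h : Typed ((none, A) ::ₘ Γ.map (Prod.map some id)) P (some x) B) :
      Typed Γ (.recv x P) x (.lolli A B)
  | lolliL {V : Type} (Γ : Ctx L TN V) (x y z : V) (A B C : Ty L TN) (P : Proc L TN PN V)
      (h : Typed ((x, B) ::ₘ Γ) P y C) :
      Typed ((z, A) ::ₘ (x, .lolli A B) ::ₘ Γ) (.send z x P) y C
  | oneR {V : Type} (x : V) : Typed 0 (.close x) x .one
  | oneL {V : Type} (Γ : Ctx L TN V) (x y : V) (C : Ty L TN) (Q : Proc L TN PN V)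
      (h : Typed Γ Q y C) :
      Typed ((x, .one) ::ₘ Γ) (.wait x Q) y C
  | spawn {V : Type} (Γ : Ctx L TN V) (X : PN) (args : List V) (y : V) (C : Ty L TN)
      (Q : Proc L TN PN (Option V)) (hlen : args.length = (Sg.pdef X).params.length)
      (h : Typed ((none, (Sg.pdef X).ty) ::ₘ Γ.map (Prod.map some id)) Q (some y) C) :
      Typed (((args.zip (Sg.pdef X).params : List (V × Ty L TN)) : Ctx L TN V) + Γ)
        (.spawn X args Q) y C
  | fwd {V : Type} (Y : TN) (y z : V) : Typed {(z, .tvar Y)} (.fwd Y y z) y (Sg.tdef Y)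
  | conv {V : Type} (Γ Γ' : Ctx L TN V) (P : Proc L TN PN V) (x : V) (A A' : Ty L TN)
      (h : Typed Γ P x A) (hΓ : Sg.CtxEq Γ Γ') (hA : Sg.TyEq A A') : Typed Γ' P x A'

/-- Well-formed signatures: type definitions are contractive (the right-hand side is not itself a
type variable) and the bodies of process definitions are well-typed. -/
structure Signature.WF : Prop where
  contractive : ∀ Y Z, Sg.tdef Y ≠ .tvar Z
  bodies : ∀ X, Typed Sg
    ((Finset.univ.val : Multiset (Fin (Sg.pdef X).params.length)).map
      (fun i => (some i, (Sg.pdef X).params.get i)))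
    (Sg.pdef X).body none (Sg.pdef X).ty

/-- A type variable equals its definition. -/
theorem tyEq_tdef (hSg : Sg.WF) (Y : TN) : Sg.TyEq (.tvar Y) (Sg.tdef Y) := by
  have key : ∀ B : Ty L TN, (∀ Z, B ≠ .tvar Z) →
      HeadRel (fun A B => Sg.unf A = Sg.unf B) B B := by
    intro B hB
    cases B with
    | one => exact .one
    | plus I A => exact .plus I A A (fun _ => rfl)
    | amp I A => exact .amp I A A (fun _ => rfl)
    | tensor A B => exact .tensor A A B B rfl rfl
    | lolli A B => exact .lolli A A B B rfl rfl
    | tvar Z => exact absurd rfl (hB Z)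
  have nv : ∀ (A : Ty L TN) Z, Sg.unf A ≠ .tvar Z := by
    intro A Z
    cases A <;> simp [Signature.unf, hSg.contractive]
  refine ⟨fun A B => Sg.unf A = Sg.unf B, fun A B h => ?_, ?_⟩
  · rw [← h]
    exact key _ (nv A)
  · change Sg.tdef Y = Sg.unf (Sg.tdef Y)
    have := hSg.contractive Y
    cases hh : Sg.tdef Y with
    | tvar Z => exact absurd hh (this Z)
    | _ => rfl

end typing

/-! ### Configurations -/

/-- Messages. -/
inductive Msg (L : Type) : Type
  /-- `close y` -/
  | close (y : Chan) : Msg L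
  /-- `y.k` -/
  | lab (y : Chan) (k : L) : Msg L
  /-- `send z y` -/
  | send (z y : Chan) : Msg L

/-- The channel along which a message is sent. -/
def Msg.carrier {L : Type} : Msg L → Chan
  | .close y => y
  | .lab y _ => y
  | .send _ y => y

/-- The channels of a message, including the continuation of its carrier. -/
def Msg.chans {L : Type} : Msg L → Set Chan
  | .close y => {y}
  | .lab y _ => {y, y.succ}
  | .send z y => {z, y, y.succ}

/-- The message links `y` to its next generation. -/
inductive Msg.Links {L : Type} (y : Chan) : Msg L → Prop
  | lab (k : L) : Msg.Links y (.lab y k)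
  | send (z : Chan) : Msg.Links y (.send z y)

/-- Renaming in messages. -/
def Msg.map {L : Type} (f : Chan → Chan) : Msg L → Msg L
  | .close y => .close (f y)
  | .lab y k => .lab (f y) k
  | .send z y => .send (f z) (f y)

/-- Processes `proc(x, P)` and message processes `msg(M)`. -/
inductive Node (L TN PN : Type) : Type 1
  | proc (x : Chan) (P : Proc L TN PN Chan) : Node L TN PN
  | msg (M : Msg L) : Node L TN PN

/-- The channels of a node. -/
def Node.chans {L TN PN : Type} : Node L TN PN → Set Chan
  | .proc x P => {x} ∪ P.names
  | .msg M => M.chans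

/-- Renaming in nodes. -/
def Node.map {L TN PN : Type} (f : Chan → Chan) : Node L TN PN → Node L TN PN
  | .proc x P => .proc (f x) (P.map f)
  | .msg M => .msg (M.map f)

/-- Configurations. Juxtaposition of configurations is the sum of multisets. -/
abbrev Config (L TN PN : Type) := Multiset (Node L TN PN)

/-- The right-hand side `K` of an interface `Δ ⊩ K`: either `some (x, A)` for `x : A`, or `none`
for the anonymous, unobservable root `_ : 1`. -/
abbrev Root (L TN : Type) := Option (Chan × Ty L TN)

section configurations

variable {L TN PN : Type}

/-- The domain of a context. -/
def dom (Δ : Ctx L TN Chan) : Set Chan := {c | ∃ A, (c, A) ∈ Δ}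

/-- The channels that occur in a configuration. -/
def confChans (C : Config L TN PN) : Set Chan := {c | ∃ n ∈ C, c ∈ n.chans}

/-- The free channels of an interface. -/
def ifaceChans (Δ : Ctx L TN Chan) (K : Root L TN) : Set Chan :=
  dom Δ ∪ {c | ∃ A, K = some (c, A)}

/-- The channels that occur in a configuration or in its interface. -/
def allChans (Δ : Ctx L TN Chan) (K : Root L TN) (C : Config L TN PN) : Set Chan :=
  ifaceChans Δ K ∪ confChans C

/-- The bases of a set of channels. -/
def bases (S : Set Chan) : Set ℕ := Chan.base '' S

variable (Sg : Signature L TN PN)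

/-- Typing of messages, `Δ ⊢ M :: x : A`. -/
inductive MsgTyped : Ctx L TN Chan → Msg L → Chan → Ty L TN → Prop
  | plusR (y : Chan) (I : Finset L) (A : {l // l ∈ I} → Ty L TN) (k : {l // l ∈ I}) :
      MsgTyped {(y.succ, A k)} (.lab y k.1) y (.plus I A)
  | ampL (x : Chan) (I : Finset L) (A : {l // l ∈ I} → Ty L TN) (k : {l // l ∈ I}) :
      MsgTyped {(x, .amp I A)} (.lab x k.1) x.succ (A k)
  | tensorR (z y : Chan) (A B : Ty L TN) :
      MsgTyped {(z, A), (y.succ, B)} (.send z y) y (.tensor A B)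
  | lolliL (z x : Chan) (A B : Ty L TN) :
      MsgTyped {(z, A), (x, .lolli A B)} (.send z x) x.succ B
  | oneR (y : Chan) : MsgTyped 0 (.close y) y .one

/-- Typing of configurations, `Δ₀ ⊩ C :: Δ`. Channels are used linearly: juxtaposed contexts and
configurations have no channel in common, apart from those along which they are linked. -/
inductive ConfTyped : Ctx L TN Chan → Config L TN PN → Ctx L TN Chan → Prop
  | emp₁ (x : Chan) (A : Ty L TN) : ConfTyped {(x, A)} 0 {(x, A)}
  | emp₂ : ConfTyped 0 0 0
  | comp (Δ₀ Δ₀' Δ : Ctx L TN Chan) (C C₁ : Config L TN PN) (x : Chan) (A : Ty L TN)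
      (h : ConfTyped Δ₀ C Δ) (h₁ : ConfTyped Δ₀' C₁ {(x, A)})
      (hd : Disjoint (dom Δ₀ ∪ confChans C ∪ dom Δ) (dom Δ₀' ∪ confChans C₁ ∪ {x})) :
      ConfTyped (Δ₀ + Δ₀') (C + C₁) ((x, A) ::ₘ Δ)
  | proc (Δ₀ Δ₀' Δ : Ctx L TN Chan) (C : Config L TN PN) (x : Chan) (A : Ty L TN)
      (P : Proc L TN PN Chan)
      (h : ConfTyped Δ₀ C Δ) (hP : Typed Sg (Δ₀' + Δ) P x A)
      (hnd : (x ::ₘ Δ₀'.map Prod.fst).Nodup)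
      (hd : Disjoint (dom Δ₀ ∪ confChans C ∪ dom Δ) ({x} ∪ dom Δ₀')) :
      ConfTyped (Δ₀ + Δ₀') (C + {.proc x P}) {(x, A)}
  | msg (Δ₀ Δ₀' Δ : Ctx L TN Chan) (C : Config L TN PN) (x : Chan) (A : Ty L TN) (M : Msg L)
      (h : ConfTyped Δ₀ C Δ) (hM : MsgTyped (Δ₀' + Δ) M x A)
      (hnd : (x ::ₘ Δ₀'.map Prod.fst).Nodup)
      (hd : Disjoint (dom Δ₀ ∪ confChans C ∪ dom Δ) ({x} ∪ dom Δ₀')) :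
      ConfTyped (Δ₀ + Δ₀') (C + {.msg M}) {(x, A)}
  | conv (Δ₀ Δ₀' Δ Δ' : Ctx L TN Chan) (C : Config L TN PN) (h : ConfTyped Δ₀ C Δ)
      (h₀ : Sg.CtxEq Δ₀ Δ₀') (h₁ : Sg.CtxEq Δ Δ') : ConfTyped Δ₀' C Δ'

/-- Discipline of generations: different generations of one base occur together only if they are
linked by the messages pending between them (so that the next generation of a channel is a new
name whenever a process allocates it). -/
def Lineage (Δ : Ctx L TN Chan) (K : Root L TN) (D : Config L TN PN) : Prop :=
  ∀ c ∈ allChans Δ K D, ∀ c' ∈ allChans Δ K D, c.base = c'.base → c.gen < c'.gen →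
    ∃ M : Msg L, Node.msg M ∈ D ∧ M.Links c

/-- `D ∈ Tree(Δ ⊩ K)`. -/
def Tree (Δ : Ctx L TN Chan) (K : Root L TN) (D : Config L TN PN) : Prop :=
  (match K with
    | some (x, A) => ConfTyped Sg Δ D {(x, A)}
    | none => ∃ z, ConfTyped Sg Δ D {(z, .one)}) ∧
  Lineage Δ K D

/-! ### Asynchronous dynamics -/

/-- The multiset rewriting rules. `N` is a set of bases that fresh channels have to avoid besides
those of the configuration; it is used for the free channels. -/
inductive Step (N : Set ℕ) : Config L TN PN → Config L TN PN → Prop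
  | spawn (C : Config L TN PN) (y : Chan) (X : PN) (args : List Chan)
      (Q : Proc L TN PN (Option Chan)) (hlen : args.length = (Sg.pdef X).params.length) (b : ℕ)
      (hN : b ∉ N) (hb : b ∉ bases (confChans (C + {.proc y (.spawn X args Q)}))) :
      Step N (C + {.proc y (.spawn X args Q)})
        (C + {.proc ⟨b, 0⟩ ((Sg.pdef X).body.map
                (fun o => o.elim ⟨b, 0⟩ (fun i => args.get (i.cast hlen.symm)))),
              .proc y (Q.map (fun o => o.elim ⟨b, 0⟩ id))})
  | fwd (C : Config L TN PN) (y z : Chan) (Y : TN) :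
      Step N (C + {.proc y (.fwd Y y z)}) (C + {.proc y (fwder (Sg.tdef Y) y z)})
  | oneSnd (C : Config L TN PN) (y : Chan) :
      Step N (C + {.proc y (.close y)}) (C + {.msg (.close y)})
  | oneRcv (C : Config L TN PN) (y x : Chan) (hne : x ≠ y) (Q : Proc L TN PN Chan) :
      Step N (C + {.msg (.close y), .proc x (.wait y Q)}) (C + {.proc x Q})
  | plusSnd (C : Config L TN PN) (y : Chan) (k : L) (P : Proc L TN PN Chan) :
      Step N (C + {.proc y (.sendLab y k P)})
        (C + {.proc y.succ (P.map (bump y)), .msg (.lab y k)})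
  | plusRcv (C : Config L TN PN) (y u : Chan) (hne : u ≠ y) (I : Finset L)
      (Q : {l // l ∈ I} → Proc L TN PN Chan) (k : {l // l ∈ I}) :
      Step N (C + {.msg (.lab y k.1), .proc u (.case y I Q)})
        (C + {.proc u ((Q k).map (bump y))})
  | ampSnd (C : Config L TN PN) (y x : Chan) (hne : x ≠ y) (k : L) (P : Proc L TN PN Chan) :
      Step N (C + {.proc y (.sendLab x k P)})
        (C + {.msg (.lab x k), .proc y (P.map (bump x))})
  | ampRcv (C : Config L TN PN) (y : Chan) (I : Finset L)
      (Q : {l // l ∈ I} → Proc L TN PN Chan) (k : {l // l ∈ I}) :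
      Step N (C + {.proc y (.case y I Q), .msg (.lab y k.1)})
        (C + {.proc y.succ ((Q k).map (bump y))})
  | tensorSnd (C : Config L TN PN) (x y : Chan) (P : Proc L TN PN Chan) :
      Step N (C + {.proc y (.send x y P)})
        (C + {.proc y.succ (P.map (bump y)), .msg (.send x y)})
  | tensorRcv (C : Config L TN PN) (x y u : Chan) (hne : u ≠ y) (P : Proc L TN PN (Option Chan)) :
      Step N (C + {.msg (.send x y), .proc u (.recv y P)})
        (C + {.proc u (P.map (fun o => o.elim x (bump y)))})
  | lolliSnd (C : Config L TN PN) (x u y : Chan) (hne : u ≠ y) (P : Proc L TN PN Chan) :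
      Step N (C + {.proc y (.send x u P)})
        (C + {.msg (.send x u), .proc y (P.map (bump u))})
  | lolliRcv (C : Config L TN PN) (x y : Chan) (P : Proc L TN PN (Option Chan)) :
      Step N (C + {.proc y (.recv y P), .msg (.send x y)})
        (C + {.proc y.succ (P.map (fun o => o.elim x (bump y)))})

/-- Zero or more steps of a configuration at the interface `Δ ⊩ K`. -/
def Steps (Δ : Ctx L TN Chan) (K : Root L TN) : Config L TN PN → Config L TN PN → Prop :=
  Relation.ReflTransGen (Step Sg (bases (ifaceChans Δ K)))

/-! ### The logical relation -/

/-- `Υ`: the channels of the interface along which `D` has a message to be sent. -/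
def Ups (Δ : Ctx L TN Chan) (K : Root L TN) (D : Config L TN PN) : Set Chan :=
  {y | y ∈ ifaceChans Δ K ∧ ∃ M : Msg L, Node.msg M ∈ D ∧ M.carrier = y}

/-- `Θ`: the channels of the interface along which some process of `D` waits to receive. -/
def Thet (Δ : Ctx L TN Chan) (K : Root L TN) (D : Config L TN PN) : Set Chan :=
  {y | y ∈ ifaceChans Δ K ∧ ∃ x P, Node.proc x P ∈ D ∧ P.WaitsOn y}

/-- `Out(Δ ⊩ K)`. -/
def OutCh (Δ : Ctx L TN Chan) (K : Root L TN) : Set Chan :=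
  {y | (∃ T, (y, T) ∈ Δ ∧ (Sg.unf T).Neg) ∨ ∃ T, K = some (y, T) ∧ (Sg.unf T).Pos}

/-- `In(Δ ⊩ K)`. -/
def InCh (Δ : Ctx L TN Chan) (K : Root L TN) : Set Chan :=
  {y | (∃ T, (y, T) ∈ Δ ∧ (Sg.unf T).Pos) ∨ ∃ T, K = some (y, T) ∧ (Sg.unf T).Neg}

/-- `α`-variance of configurations at the interface `Δ ⊩ K`: bound channels can be renamed, but
only their bases. -/
def AlphaEq (Δ : Ctx L TN Chan) (K : Root L TN) (D D' : Config L TN PN) : Prop :=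
  ∃ π : Equiv.Perm ℕ, (∀ b ∈ bases (ifaceChans Δ K), π b = b) ∧
    D' = D.map (Node.map (Chan.rename π))

/-- The value interpretation with focus `· ; y` (a message to be sent along `y`). The relation `R`
is the term interpretation at the preceding index. A sent channel `x` can be bound in both
configurations, whence the `α`-variants. -/
inductive VOut (R : Ctx L TN Chan → Root L TN → Config L TN PN → Config L TN PN → Prop)
    (Δ : Ctx L TN Chan) (K : Root L TN) (y : Chan) (D₁ D₂ : Config L TN PN) : Prop
  | oneR (T : Ty L TN) (hK : K = some (y, T)) (hT : Sg.unf T = .one) (hΔ : Δ = 0)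
      (t₁ : Tree Sg Δ K D₁) (t₂ : Tree Sg Δ K D₂)
      (h₁ : D₁ = {.msg (.close y)}) (h₂ : D₂ = {.msg (.close y)})
  | plusR (T : Ty L TN) (I : Finset L) (A : {l // l ∈ I} → Ty L TN)
      (hK : K = some (y, T)) (hT : Sg.unf T = .plus I A)
      (t₁ : Tree Sg Δ K D₁) (t₂ : Tree Sg Δ K D₂)
      (k : {l // l ∈ I}) (D₁' D₂' : Config L TN PN)
      (h₁ : D₁ = D₁' + {.msg (.lab y k.1)}) (h₂ : D₂ = D₂' + {.msg (.lab y k.1)})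
      (h : R Δ (some (y.succ, A k)) D₁' D₂')
  | tensorR (T A B : Ty L TN) (hK : K = some (y, T)) (hT : Sg.unf T = .tensor A B)
      (t₁ : Tree Sg Δ K D₁) (t₂ : Tree Sg Δ K D₂)
      (Δ' Δ'' : Ctx L TN Chan) (hΔ : Δ = Δ' + Δ'') (x : Chan)
      (D₁' D₂' T₁ T₂ : Config L TN PN)
      (h₁ : AlphaEq Δ K D₁ (D₁' + T₁ + {.msg (.send x y)}))
      (h₂ : AlphaEq Δ K D₂ (D₂' + T₂ + {.msg (.send x y)}))
      (s₁ : Tree Sg Δ'' (some (x, A)) T₁) (s₂ : Tree Sg Δ'' (some (x, A)) T₂)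
      (hT' : R Δ'' (some (x, A)) T₁ T₂) (hD' : R Δ' (some (y.succ, B)) D₁' D₂')
  | ampL (T : Ty L TN) (I : Finset L) (A : {l // l ∈ I} → Ty L TN) (Δ' : Ctx L TN Chan)
      (hΔ : Δ = (y, T) ::ₘ Δ') (hT : Sg.unf T = .amp I A)
      (t₁ : Tree Sg Δ K D₁) (t₂ : Tree Sg Δ K D₂)
      (k : {l // l ∈ I}) (D₁' D₂' : Config L TN PN)
      (h₁ : D₁ = {.msg (.lab y k.1)} + D₁') (h₂ : D₂ = {.msg (.lab y k.1)} + D₂')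
      (h : R ((y.succ, A k) ::ₘ Δ') K D₁' D₂')
  | lolliL (T A B : Ty L TN) (Δ' Δ'' : Ctx L TN Chan)
      (hΔ : Δ = (y, T) ::ₘ (Δ' + Δ'')) (hT : Sg.unf T = .lolli A B)
      (t₁ : Tree Sg Δ K D₁) (t₂ : Tree Sg Δ K D₂) (x : Chan)
      (T₁ T₂ D₁'' D₂'' : Config L TN PN)
      (h₁ : AlphaEq Δ K D₁ (T₁ + {.msg (.send x y)} + D₁''))
      (h₂ : AlphaEq Δ K D₂ (T₂ + {.msg (.send x y)} + D₂''))
      (s₁ : Tree Sg Δ' (some (x, A)) T₁) (s₂ : Tree Sg Δ' (some (x, A)) T₂)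
      (hT' : R Δ' (some (x, A)) T₁ T₂) (hD' : R ((y.succ, B) ::ₘ Δ'') K D₁'' D₂'')

/-- The value interpretation with focus `y ; ·` (a process waits to receive along `y`). A received
channel `x` is new: its base is not that of a free channel, nor, bound channels being renamed
apart, that of a bound channel of the two configurations. -/
inductive VIn (R : Ctx L TN Chan → Root L TN → Config L TN PN → Config L TN PN → Prop)
    (Δ : Ctx L TN Chan) (K : Root L TN) (y : Chan) (D₁ D₂ : Config L TN PN) : Prop
  | ampR (T : Ty L TN) (I : Finset L) (A : {l // l ∈ I} → Ty L TN)
      (hK : K = some (y, T)) (hT : Sg.unf T = .amp I A)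
      (t₁ : Tree Sg Δ K D₁) (t₂ : Tree Sg Δ K D₂)
      (h : ∀ k : {l // l ∈ I}, R Δ (some (y.succ, A k))
        (D₁ + {.msg (.lab y k.1)}) (D₂ + {.msg (.lab y k.1)}))
  | lolliR (T A B : Ty L TN) (hK : K = some (y, T)) (hT : Sg.unf T = .lolli A B)
      (t₁ : Tree Sg Δ K D₁) (t₂ : Tree Sg Δ K D₂)
      (h : ∀ x : Chan, x.base ∉ bases (allChans Δ K D₁ ∪ allChans Δ K D₂) →
        R ((x, A) ::ₘ Δ) (some (y.succ, B))
          (D₁ + {.msg (.send x y)}) (D₂ + {.msg (.send x y)}))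
  | oneL (T : Ty L TN) (Δ' : Ctx L TN Chan) (hΔ : Δ = (y, T) ::ₘ Δ') (hT : Sg.unf T = .one)
      (t₁ : Tree Sg Δ K D₁) (t₂ : Tree Sg Δ K D₂)
      (h : R Δ' K ({.msg (.close y)} + D₁) ({.msg (.close y)} + D₂))
  | plusL (T : Ty L TN) (I : Finset L) (A : {l // l ∈ I} → Ty L TN) (Δ' : Ctx L TN Chan)
      (hΔ : Δ = (y, T) ::ₘ Δ') (hT : Sg.unf T = .plus I A)
      (t₁ : Tree Sg Δ K D₁) (t₂ : Tree Sg Δ K D₂)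
      (h : ∀ k : {l // l ∈ I}, R ((y.succ, A k) ::ₘ Δ') K
        ({.msg (.lab y k.1)} + D₁) ({.msg (.lab y k.1)} + D₂))
  | tensorL (T A B : Ty L TN) (Δ' : Ctx L TN Chan)
      (hΔ : Δ = (y, T) ::ₘ Δ') (hT : Sg.unf T = .tensor A B)
      (t₁ : Tree Sg Δ K D₁) (t₂ : Tree Sg Δ K D₂)
      (h : ∀ x : Chan, x.base ∉ bases (allChans Δ K D₁ ∪ allChans Δ K D₂) →
        R ((x, A) ::ₘ (y.succ, B) ::ₘ Δ') K
          ({.msg (.send x y)} + D₁) ({.msg (.send x y)} + D₂))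

/-- The term interpretation `(D₁; D₂) ∈ ℰ⟦Δ ⊩ K⟧ᵐ`. -/
def E : ℕ → Ctx L TN Chan → Root L TN → Config L TN PN → Config L TN PN → Prop
  | 0, Δ, K, D₁, D₂ => Tree Sg Δ K D₁ ∧ Tree Sg Δ K D₂
  | m + 1, Δ, K, D₁, D₂ =>
      Tree Sg Δ K D₁ ∧ Tree Sg Δ K D₂ ∧
      ∀ D₁', Steps Sg Δ K D₁ D₁' →
        ∃ D₂', Steps Sg Δ K D₂ D₂' ∧ Ups Δ K D₁' ⊆ Ups Δ K D₂' ∧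
          (∀ y ∈ OutCh Sg Δ K, y ∈ Ups Δ K D₁' → VOut Sg (E m) Δ K y D₁' D₂') ∧
          (∀ y ∈ InCh Sg Δ K, y ∈ Thet Δ K D₁' → VIn Sg (E m) Δ K y D₁' D₂')

/-- The channels of `T : Δ' ⊩ u` and of `D : Δ, u ⊩ K` are named apart, so that juxtaposing
`T` and `D` links them along `u` and captures no other channel: a base is shared only if it is that
of `u` (some generations of `u` can be bound in `T` or in `D`), and the only shared channel
is `u`. -/
def Apart (u : Chan × Ty L TN) (Δ' : Ctx L TN Chan) (T : Config L TN PN)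
    (Δ : Ctx L TN Chan) (K : Root L TN) (D : Config L TN PN) : Prop :=
  ∀ c ∈ allChans Δ' (some u) T, ∀ c' ∈ allChans (u ::ₘ Δ) K D,
    (c.base = c'.base → c.base = u.1.base) ∧ (c = c' → c = u.1)

end configurations

end ILST

/-!
The relation `E` only demands that, at each index, *some* reduct of the second configuration matches
a given reduct of the first one. The relation `EAll` at all indices is nevertheless a simulation
(`EAll.steps`): the reduct can be chosen independently of the index. Only finitely many observations
can be made of a configuration, hence a single reduct serves infinitely many indices as far as the
shape of the observations is concerned. Reduction is confluent up to renaming of bound bases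
(`Tree.confluent`), and confluence makes `E` invariant under reduction of the second configuration
(`E_fwd`), so that what is observed of the other candidates can be transported to the chosen one.

The delicate observation is that of a sent channel, where a tree is split in two. A `case` without
branches can be typed with any additional channels (`Absorb`), so a tree may contain junk (`Junk`):
a part that is named apart from the rest and is held in place only by such a term. The two parts of
a tree are unique up to junk. Junk can be added and removed without affecting `E` (`E_add`,
`E_rem`), and hence the relation can be moved from one splitting to another one
(`E.send_transfer`). With an anonymous root, the junk may be what provides the root (`Sink`); it can
then be removed only if another sink remains (`Removable`). In `EAll.steps` the reduct is therefore
chosen in such a way that it contains a sink, unless no reduct does.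

Now consider composites (`Comp`): pairs of configurations obtained by linking `n` pairs from `EAll`
along bound channels, where the second component is taken up to renaming. An observation of a
composite is an observation of the component that owns the observed channel (`Comp.exists_obs`), and
what remains to be related after the observation is again a composite (`OutN.link`, `InN.link`).
Single steps of composites are simulated, by strong induction on `n` (`Comp.stepSim`). A step inside
of one component is simulated by that component. If instead one component receives a message `M`
from the other one, the output clause for the sender and the input clause for the receiver split `M`
off on both sides and add it to the receiver; the step then takes place inside of the receiver,
which consists of fewer pairs (`Dual.sim_msg`). If `M` carries a channel, the subtree provided along
that channel becomes a further component. Hence composites are closed under steps and observations,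
and are related by `E` at all indices (`CompAny.eAll`).

From left to right, the lemma on linking is the case of two pairs (`CompAny.link`). From right to
left, link with the empty configuration at the interface `u : T ⊩ u : T` (`EAll.zero`).

Typing derivations are analysed over types modulo equality (`QTyped`, `NT`), where the conversion
rules disappear, and typed configurations through topologically sorted sequences of nodes (`Flat`),
which describe the linear use of channels (`Lin`).
-/

namespace ILST

open Multiset (mem_add singleton_add mem_cons map_cons cons_add nodup_cons exists_cons_of_mem
  add_cons nodup_add pair_comm mem_cons_self cons_inj_right cons_zero insert_eq_cons map_map
  mem_map mem_singleton_self nodup_of_le cons_ne_zero cons_eq_cons mem_of_le mem_singleton map_id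
  mem_map_of_mem filter_add mem_cons_of_mem)
open Set (disjoint_left subset_union_left mem_union disjoint_union_left subset_union_right
  mem_singleton_iff finite_singleton disjoint_union_right union_assoc empty_union image_union
  mem_image empty_subset mem_ofPred_eq finite_empty toFinite)

/-! ### Renaming of terms -/

section terms

variable {L TN PN : Type}

theorem Proc.map_congr {V : Type} (P : Proc L TN PN V) :
    ∀ {W : Type} (f g : V → W), (∀ v ∈ P.names, f v = g v) → P.map f = P.map g := by
  induction P with
  | sendLab x k P ih =>
    intro W f g h
    simp only [Proc.map, h x (by simp [Proc.names]),
      ih f g (fun v hv => h v (by simp [Proc.names, hv]))]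
  | case x I Q ih =>
    intro W f g h
    simp only [Proc.map, h x (by simp [Proc.names])]
    congr 1
    funext l
    exact ih l f g (fun v hv => h v (by simp only [Proc.names]; exact Or.inr ⟨l, hv⟩))
  | send z x P ih =>
    intro W f g h
    simp only [Proc.map, h x (by simp [Proc.names]), h z (by simp [Proc.names]),
      ih f g (fun v hv => h v (by simp [Proc.names, hv]))]
  | recv x P ih =>
    intro W f g h
    simp only [Proc.map, h x (by simp [Proc.names])]
    congr 1
    refine ih _ _ (fun v hv => ?_)
    cases v with
    | none => rfl
    | some v => simp [h v (by simp [Proc.names, hv])]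
  | close x =>
    intro W f g h
    simp only [Proc.map, h x (by simp [Proc.names])]
  | wait x Q ih =>
    intro W f g h
    simp only [Proc.map, h x (by simp [Proc.names]),
      ih f g (fun v hv => h v (by simp [Proc.names, hv]))]
  | spawn X args Q ih =>
    intro W f g h
    simp only [Proc.map]
    congr 1
    · exact List.map_congr_left (fun v hv => h v (by simp [Proc.names, hv]))
    · refine ih _ _ (fun v hv => ?_)
      cases v with
      | none => rfl
      | some v => simp [h v (by simp [Proc.names, hv])]
  | fwd Y y z =>
    intro W f g h
    simp only [Proc.map, h y (by simp [Proc.names]), h z (by simp [Proc.names])]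

theorem Proc.map_map {V : Type} (P : Proc L TN PN V) :
    ∀ {W X : Type} (f : V → W) (g : W → X), (P.map f).map g = P.map (g ∘ f) := by
  induction P <;> intro W X f g <;> simp_all [Proc.map, Option.map_comp_map]

theorem Proc.map_id {V : Type} (P : Proc L TN PN V) : P.map id = P := by
  induction P <;> simp_all [Proc.map]

theorem Proc.names_map {V : Type} (P : Proc L TN PN V) :
    ∀ {W : Type} (f : V → W), (P.map f).names = f '' P.names := by
  have opt : ∀ {V W : Type} (f : V → W) (S : Set (Option V)),
      {w | some w ∈ Option.map f '' S} = f '' {v | some v ∈ S} := by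
    intro V W f S
    ext w
    constructor
    · rintro ⟨o, ho, h⟩
      cases o with
      | none => simp at h
      | some v => exact ⟨v, ho, by simpa using h⟩
    · rintro ⟨v, hv, rfl⟩
      exact ⟨some v, hv, rfl⟩
  induction P with
  | case x I Q ih =>
    intro W f
    simp only [Proc.map, Proc.names, ih, image_union, Set.image_singleton]
    congr 1
    ext w
    simp only [mem_ofPred_eq, mem_image]
    constructor
    · rintro ⟨l, v, hv, rfl⟩; exact ⟨v, ⟨l, hv⟩, rfl⟩
    · rintro ⟨v, ⟨l, hv⟩, rfl⟩; exact ⟨l, v, hv, rfl⟩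
  | recv x P ih =>
    intro W f
    simp only [Proc.map, Proc.names, ih, image_union, Set.image_singleton, opt]
  | spawn X args Q ih =>
    intro W f
    simp only [Proc.map, Proc.names, ih, image_union, opt]
    congr 1
    ext w
    simp
  | send z x P ih =>
    intro W f
    simp only [Proc.map, Proc.names, ih, image_union, Set.image_pair]
  | fwd Y y z =>
    intro W f
    simp only [Proc.map, Proc.names, Set.image_pair]
  | _ => 
    intro W f
    simp_all [Proc.map, Proc.names, Set.image_insert_eq]

theorem Proc.names_finite {V : Type} (P : Proc L TN PN V) : P.names.Finite := by
  have opt : ∀ {V : Type} (S : Set (Option V)), S.Finite → {v | some v ∈ S}.Finite :=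
    fun S hS => hS.preimage (Option.some_injective _).injOn
  induction P with
  | case x I Q ih =>
    have : {v | ∃ l, v ∈ (Q l).names} = ⋃ l, (Q l).names := by ext; simp
    simp only [Proc.names, this]
    exact (finite_singleton _).union (Set.finite_iUnion ih)
  | recv x P ih => exact (finite_singleton _).union (opt _ ih)
  | spawn X args Q ih => exact (List.finite_toSet args).union (opt _ ih)
  | sendLab x k P ih => exact (finite_singleton _).union ih
  | send z x P ih => exact (toFinite {z, x}).union ih
  | close x => exact finite_singleton _
  | wait x Q ih => exact (finite_singleton _).union ih
  | fwd Y y z => exact toFinite {y, z}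

theorem fwder_map (A : Ty L TN) : ∀ {V W : Type} (f : V → W) (y z : V),
    (fwder (PN := PN) A y z).map f = fwder A (f y) (f z) := by
  induction A <;> intro V W f y z <;> simp_all [fwder, Proc.map]

theorem fwder_names (A : Ty L TN) : ∀ {V : Type} (y z : V),
    (fwder (PN := PN) A y z).names ⊆ {y, z} := by
  induction A with
  | one => intro V y z v hv; simp [fwder, Proc.names] at hv ⊢; tauto
  | plus I A ih =>
    intro V y z v hv
    simp only [fwder, Proc.names] at hv
    rcases hv with hv | ⟨l, hv | hv⟩
    · simp_all
    · simp_all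
    · exact ih l y z hv
  | amp I A ih =>
    intro V y z v hv
    simp only [fwder, Proc.names] at hv
    rcases hv with hv | ⟨l, hv | hv⟩
    · simp_all
    · simp_all
    · exact ih l y z hv
  | tensor A B ihA ih =>
    intro V y z v hv
    simp only [fwder, Proc.names] at hv
    rcases hv with hv | hv | hv
    · simp_all
    · simp_all
    · simpa using ih _ _ hv
  | lolli A B ihA ih =>
    intro V y z v hv
    simp only [fwder, Proc.names] at hv
    rcases hv with hv | hv | hv
    · simp_all
    · simp_all
    · simpa using ih _ _ hv
  | tvar Y => intro V y z v hv; simpa [fwder, Proc.names] using hv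

theorem Proc.WaitsOn.mem_names {V : Type} {y : V} {P : Proc L TN PN V} (h : P.WaitsOn y) :
    y ∈ P.names := by
  cases h <;> simp [Proc.names]

theorem Proc.WaitsOn.map {V W : Type} {y : V} {P : Proc L TN PN V} (h : P.WaitsOn y) (f : V → W) :
    (P.map f).WaitsOn (f y) := by
  cases h
  · exact .case _ _
  · exact .recv _
  · exact .wait _

/-- The term is about to send a message along `y`. -/
inductive Proc.SendsOn {V : Type} (y : V) : Proc L TN PN V → Prop
  | sendLab (k : L) (P : Proc L TN PN V) : Proc.SendsOn y (.sendLab y k P)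
  | send (z : V) (P : Proc L TN PN V) : Proc.SendsOn y (.send z y P)

end terms

/-! ### Renaming of channels, messages and nodes -/

section chanRenaming

variable {L TN PN : Type}
variable {c y : Chan} {π : Equiv.Perm ℕ} {M : Msg L} {D : Config L TN PN} {Δ : Ctx L TN Chan}
  {K : Root L TN}

@[simp] theorem Chan.rename_base (π : Equiv.Perm ℕ) (c : Chan) : (c.rename π).base = π c.base := rfl
@[simp] theorem Chan.rename_gen (π : Equiv.Perm ℕ) (c : Chan) : (c.rename π).gen = c.gen := rfl
@[simp] theorem Chan.succ_base (c : Chan) : c.succ.base = c.base := rfl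
@[simp] theorem Chan.succ_gen (c : Chan) : c.succ.gen = c.gen + 1 := rfl

theorem Chan.ext' {d : Chan} (h : c.base = d.base) (h' : c.gen = d.gen) : c = d := by
  cases c; cases d; simp_all

theorem Chan.succ_ne (c : Chan) : c.succ ≠ c := by
  intro h; have := congrArg Chan.gen h; simp at this

theorem Chan.succ_inj {d : Chan} (h : c.succ = d.succ) : c = d := by
  have h1 := congrArg Chan.gen h; have h2 := congrArg Chan.base h
  exact Chan.ext' (by simpa using h2) (by simpa using h1)

theorem Chan.rename_succ (π : Equiv.Perm ℕ) (c : Chan) : (c.succ).rename π = (c.rename π).succ :=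
  rfl

theorem Chan.rename_injective (π : Equiv.Perm ℕ) : Function.Injective (Chan.rename π) := by
  intro c d h
  have h1 := congrArg Chan.gen h; have h2 := congrArg Chan.base h
  exact Chan.ext' (by simpa using h2) (by simpa using h1)

theorem Chan.rename_mul (π ρ : Equiv.Perm ℕ) (c : Chan) :
    (c.rename ρ).rename π = c.rename (π * ρ) := rfl

theorem Chan.rename_eq_self (h : π c.base = c.base) : c.rename π = c := Chan.ext' h rfl

theorem bump_base (y c : Chan) : (bump y c).base = c.base := by
  unfold bump; split <;> simp_all

@[simp] theorem bump_self (y : Chan) : bump y y = y.succ := by simp [bump]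

theorem bump_of_ne (h : c ≠ y) : bump y c = c := by simp [bump, h]

theorem bump_rename (π : Equiv.Perm ℕ) (y c : Chan) :
    (bump y c).rename π = bump (y.rename π) (c.rename π) := by
  unfold bump
  by_cases h : c = y
  · simp [h, Chan.rename_succ]
  · simp [h, (Chan.rename_injective π).eq_iff]

/-- Renaming of the bases of a node. -/
abbrev Node.ren (π : Equiv.Perm ℕ) : Node L TN PN → Node L TN PN := Node.map (Chan.rename π)

/-- Renaming of the bases of a configuration. -/
abbrev cren (π : Equiv.Perm ℕ) (D : Config L TN PN) : Config L TN PN := D.map (Node.ren π)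

theorem Msg.map_map (M : Msg L) (f g : Chan → Chan) : (M.map f).map g = M.map (g ∘ f) := by
  cases M <;> rfl

@[simp] theorem Msg.carrier_map (M : Msg L) (f : Chan → Chan) :
    (M.map f).carrier = f M.carrier := by
  cases M <;> rfl

theorem Msg.chans_ren (M : Msg L) (π : Equiv.Perm ℕ) :
    (M.map (Chan.rename π)).chans = Chan.rename π '' M.chans := by
  cases M <;> simp [Msg.map, Msg.chans, Set.image_insert_eq, Chan.rename_succ]

theorem Msg.map_eq_self {f : Chan → Chan} (h : ∀ c ∈ M.chans, f c = c) : M.map f = M := by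
  cases M <;> simp [Msg.chans] at h <;> simp [Msg.map, h]

theorem Msg.Links.carrier (h : M.Links y) : M.carrier = y := by
  cases h <;> rfl

theorem Msg.carrier_mem (M : Msg L) : M.carrier ∈ M.chans := by
  cases M <;> simp [Msg.carrier, Msg.chans]

theorem Msg.Links.ren (h : M.Links y) (π : Equiv.Perm ℕ) :
    (M.map (Chan.rename π)).Links (y.rename π) := by
  cases h
  · exact .lab _
  · exact .send _

theorem Node.chans_ren (n : Node L TN PN) (π : Equiv.Perm ℕ) :
    (n.ren π).chans = Chan.rename π '' n.chans := by
  cases n with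
  | proc x P => simp [Node.ren, Node.map, Node.chans, Proc.names_map, Set.image_insert_eq]
  | msg M => simp [Node.ren, Node.map, Node.chans, Msg.chans_ren]

theorem Node.ren_mul (π ρ : Equiv.Perm ℕ) (n : Node L TN PN) :
    (n.ren ρ).ren π = n.ren (π * ρ) := by
  cases n with
  | proc x P => simp [Node.ren, Node.map, Proc.map_map]; exact ⟨rfl, rfl⟩
  | msg M => simp [Node.ren, Node.map, Msg.map_map]; rfl

theorem Node.ren_eq_self {n : Node L TN PN} (h : ∀ c ∈ n.chans, π c.base = c.base) :
    n.ren π = n := by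
  have h' : ∀ c ∈ n.chans, c.rename π = c := fun c hc => Chan.rename_eq_self (h c hc)
  cases n with
  | proc x P =>
    have e : P.map (Chan.rename π) = P := by
      conv_rhs => rw [← P.map_id]
      exact P.map_congr _ _ (fun v hv => h' v (by simp [Node.chans, hv]))
    simp [Node.ren, Node.map, e, h' x (by simp [Node.chans])]
  | msg M =>
    simp only [Node.ren, Node.map]
    rw [Msg.map_eq_self h']

theorem Node.chans_finite (n : Node L TN PN) : n.chans.Finite := by
  cases n with
  | proc x P => exact (finite_singleton _).union P.names_finite
  | msg M =>
    cases M with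
    | close y => exact finite_singleton y
    | lab y k => exact toFinite {y, y.succ}
    | send z y => exact toFinite {z, y, y.succ}

theorem confChans_zero : confChans (0 : Config L TN PN) = ∅ := by
  ext; simp [confChans]

theorem confChans_add (C D : Config L TN PN) : confChans (C + D) = confChans C ∪ confChans D := by
  ext c
  simp only [confChans, mem_add, mem_ofPred_eq, mem_union]
  constructor
  · rintro ⟨n, h | h, hc⟩
    · exact Or.inl ⟨n, h, hc⟩
    · exact Or.inr ⟨n, h, hc⟩
  · rintro (⟨n, h, hc⟩ | ⟨n, h, hc⟩)
    · exact ⟨n, Or.inl h, hc⟩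
    · exact ⟨n, Or.inr h, hc⟩

theorem confChans_cons (n : Node L TN PN) (D : Config L TN PN) :
    confChans (n ::ₘ D) = n.chans ∪ confChans D := by
  ext c
  simp [confChans]

theorem confChans_singleton (n : Node L TN PN) : confChans ({n} : Config L TN PN) = n.chans := by
  ext c
  simp [confChans]

theorem mem_confChans {n : Node L TN PN} (hn : n ∈ D) (hc : c ∈ n.chans) : c ∈ confChans D :=
  ⟨n, hn, hc⟩

theorem confChans_finite (D : Config L TN PN) : (confChans D).Finite := by
  induction D using Multiset.induction with
  | empty => rw [confChans_zero]; exact finite_empty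
  | cons n D ih => rw [confChans_cons]; exact n.chans_finite.union ih

theorem confChans_cren (π : Equiv.Perm ℕ) (D : Config L TN PN) :
    confChans (cren π D) = Chan.rename π '' confChans D := by
  induction D using Multiset.induction with
  | empty => simp [cren, confChans_zero]
  | cons n D ih =>
    simp only [cren] at ih
    simp only [cren, map_cons, confChans_cons, ih, Node.chans_ren, image_union]

theorem bases_union (A B : Set Chan) : bases (A ∪ B) = bases A ∪ bases B := image_union _ _ _

theorem bases_ren (π : Equiv.Perm ℕ) (A : Set Chan) :
    bases (Chan.rename π '' A) = π '' bases A := by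
  simp only [bases, Set.image_image]; rfl

theorem bases_mono {A B : Set Chan} (h : A ⊆ B) : bases A ⊆ bases B := Set.image_mono h

theorem mem_bases {A : Set Chan} (h : c ∈ A) : c.base ∈ bases A := ⟨c, h, rfl⟩

theorem cren_mul (π ρ : Equiv.Perm ℕ) (D : Config L TN PN) :
    cren π (cren ρ D) = cren (π * ρ) D := by
  simp only [cren, map_map, Function.comp_def, Node.ren_mul]

theorem cren_eq_self (h : ∀ b ∈ bases (confChans D), π b = b) : cren π D = D := by
  conv_rhs => rw [← map_id D]
  exact Multiset.map_congr rfl (fun n hn => Node.ren_eq_self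
    (fun c hc => h _ (mem_bases (mem_confChans hn hc))))

theorem cren_congr {ρ : Equiv.Perm ℕ} (h : ∀ b ∈ bases (confChans D), π b = ρ b) :
    cren π D = cren ρ D := by
  have : cren (ρ⁻¹ * π) D = D := cren_eq_self (fun b hb => by simp [h b hb])
  have h2 := cren_mul ρ (ρ⁻¹ * π) D
  rw [this, mul_inv_cancel_left] at h2
  exact h2.symm

@[simp] theorem cren_one (D : Config L TN PN) : cren 1 D = D := cren_eq_self (fun _ _ => rfl)

theorem cren_inv_cren (π : Equiv.Perm ℕ) (D : Config L TN PN) : cren π⁻¹ (cren π D) = D := by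
  rw [cren_mul, inv_mul_cancel, cren_one]

theorem cren_cren_inv (π : Equiv.Perm ℕ) (D : Config L TN PN) : cren π (cren π⁻¹ D) = D := by
  rw [cren_mul, mul_inv_cancel, cren_one]

theorem cren_add (π : Equiv.Perm ℕ) (C D : Config L TN PN) :
    cren π (C + D) = cren π C + cren π D := Multiset.map_add _ _ _

theorem cren_msg (π : Equiv.Perm ℕ) (M : Msg L) :
    cren π ({.msg M} : Config L TN PN) = {.msg (M.map (Chan.rename π))} := rfl

/-- Renaming of the bases of a context. -/
def ctxren (π : Equiv.Perm ℕ) (Δ : Ctx L TN Chan) : Ctx L TN Chan :=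
  Δ.map (Prod.map (Chan.rename π) id)

/-- Renaming of the bases of a root. -/
def rootren (π : Equiv.Perm ℕ) (K : Root L TN) : Root L TN :=
  Option.map (Prod.map (Chan.rename π) id) K

theorem dom_ctxren (π : Equiv.Perm ℕ) (Δ : Ctx L TN Chan) :
    dom (ctxren π Δ) = Chan.rename π '' dom Δ := by
  ext c
  simp only [dom, ctxren, mem_map, mem_ofPred_eq, mem_image]
  constructor
  · rintro ⟨A, ⟨c', A'⟩, h, h'⟩
    simp only [Prod.map_apply, id, Prod.mk.injEq] at h'
    exact ⟨c', ⟨A', h⟩, h'.1⟩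
  · rintro ⟨c', ⟨A, h⟩, rfl⟩
    exact ⟨A, (c', A), h, rfl⟩

theorem ifaceChans_ren (π : Equiv.Perm ℕ) (Δ : Ctx L TN Chan) (K : Root L TN) :
    ifaceChans (ctxren π Δ) (rootren π K) = Chan.rename π '' ifaceChans Δ K := by
  simp only [ifaceChans, dom_ctxren, image_union]
  congr 1
  ext c
  cases K with
  | none => simp [rootren]
  | some p => 
    obtain ⟨x, A⟩ := p
    simp [rootren, Prod.ext_iff, eq_comm]

theorem allChans_ren (π : Equiv.Perm ℕ) (Δ : Ctx L TN Chan) (K : Root L TN) (D : Config L TN PN) :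
    allChans (ctxren π Δ) (rootren π K) (cren π D) = Chan.rename π '' allChans Δ K D := by
  simp only [allChans, ifaceChans_ren, confChans_cren, image_union]

theorem ctxren_mul (π ρ : Equiv.Perm ℕ) (Δ : Ctx L TN Chan) :
    ctxren π (ctxren ρ Δ) = ctxren (π * ρ) Δ := by
  simp only [ctxren, map_map]; rfl

theorem rootren_mul (π ρ : Equiv.Perm ℕ) (K : Root L TN) :
    rootren π (rootren ρ K) = rootren (π * ρ) K := by
  cases K <;> rfl

theorem ctxren_eq_self (h : ∀ b ∈ bases (dom Δ), π b = b) : ctxren π Δ = Δ := by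
  conv_rhs => rw [← map_id Δ]
  refine Multiset.map_congr rfl (fun p hp => ?_)
  exact Prod.ext (Chan.rename_eq_self (h _ (mem_bases ⟨p.2, hp⟩))) rfl

theorem rootren_eq_self (h : ∀ (x : Chan) (A : Ty L TN), K = some (x, A) → π x.base = x.base) :
    rootren π K = K := by
  cases K with
  | none => rfl
  | some p => exact congrArg some (Prod.ext (Chan.rename_eq_self (h p.1 p.2 rfl)) rfl)

/-- The renaming fixes the free channels of the interface. -/
def Fixes (π : Equiv.Perm ℕ) (Δ : Ctx L TN Chan) (K : Root L TN) : Prop :=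
  ∀ b ∈ bases (ifaceChans Δ K), π b = b

theorem Fixes.ctx (h : Fixes π Δ K) : ctxren π Δ = Δ :=
  ctxren_eq_self (fun b hb => h b (bases_mono subset_union_left hb))

theorem Fixes.root (h : Fixes π Δ K) : rootren π K = K :=
  rootren_eq_self (fun _ A hx => h _ (mem_bases (Or.inr ⟨A, hx⟩)))

theorem Fixes.inv (h : Fixes π Δ K) : Fixes π⁻¹ Δ K :=
  fun b hb => by
    rw [Equiv.Perm.inv_eq_iff_eq]; exact (h b hb).symm

theorem Fixes.mul {ρ : Equiv.Perm ℕ} (h : Fixes π Δ K) (h' : Fixes ρ Δ K) : Fixes (π * ρ) Δ K :=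
  fun b hb => by
    simp [h' b hb, h b hb]

theorem dom_finite (Δ : Ctx L TN Chan) : (dom Δ).Finite := by
  have : dom Δ = {c | c ∈ Δ.map Prod.fst} := by ext; simp [dom]
  rw [this]; exact Multiset.finite_toSet _

theorem ifaceChans_finite (Δ : Ctx L TN Chan) (K : Root L TN) : (ifaceChans Δ K).Finite := by
  refine (dom_finite Δ).union ?_
  cases K with
  | none => simp
  | some p => exact (finite_singleton p.1).subset (by rintro c ⟨A, h⟩; cases h; rfl)

theorem allChans_finite (Δ : Ctx L TN Chan) (K : Root L TN) (D : Config L TN PN) :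
    (allChans Δ K D).Finite := (ifaceChans_finite Δ K).union (confChans_finite D)

theorem bases_finite {S : Set Chan} (h : S.Finite) : (bases S).Finite := h.image _

/-- A finite set of bases can be moved away from any finite set. -/
theorem exists_avoiding {A B : Set ℕ} (hA : A.Finite) (hB : B.Finite) :
    ∃ π : Equiv.Perm ℕ, (∀ b ∈ B, b ∉ A → π b = b) ∧ (∀ a ∈ A, π a ∉ A ∧ π a ∉ B) ∧
      ∀ b, π (π b) = b := by
  classical
  obtain ⟨c, hc⟩ : ∃ c, ∀ b ∈ A ∪ B, b < c := by
    obtain ⟨m, hm⟩ := (hA.union hB).bddAbove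
    exact ⟨m + 1, fun b hb => Nat.lt_succ_of_le (hm hb)⟩
  let f : ℕ → ℕ := fun b => if b ∈ A then b + c else if c ≤ b ∧ b - c ∈ A then b - c else b
  have hlt : ∀ a ∈ A, a < c := fun a ha => hc a (Or.inl ha)
  have f1 : ∀ a ∈ A, f a = a + c := fun a ha => by simp [f, ha]
  have nA : ∀ a, a + c ∉ A := fun a h => by have := hlt _ h; omega
  have f2 : ∀ a ∈ A, f (a + c) = a := fun a ha => by simp [f, ha, nA]
  have f3 : ∀ b, b ∉ A → ¬ (c ≤ b ∧ b - c ∈ A) → f b = b := fun b h h' => by simp [f, h, h']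
  have inv : Function.Involutive f := by
    intro b
    by_cases h : b ∈ A
    · rw [f1 b h, f2 b h]
    · by_cases h' : c ≤ b ∧ b - c ∈ A
      · have : b = (b - c) + c := by omega
        rw [this, f2 _ h'.2, f1 _ h'.2]
      · rw [f3 b h h', f3 b h h']
  refine ⟨inv.toPerm, fun b hb hA => ?_, fun a ha => ?_, inv⟩
  · refine f3 b hA (fun h => ?_)
    have := hc b (Or.inr hb); omega
  · change f a ∉ A ∧ f a ∉ B
    rw [f1 a ha]
    refine ⟨nA a, fun h => ?_⟩
    have := hc _ (Or.inr h); omega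

theorem exists_fresh {A : Set ℕ} (hA : A.Finite) : ∃ b, b ∉ A := hA.exists_notMem

end chanRenaming

/-! ### Equi-recursive types as a quotient -/

section quotient

variable {L TN PN : Type} (Sg : Signature L TN PN)
variable {A B T : Ty L TN} {p p' : Bool} {I : Finset L}

/-- The class of a type modulo equi-recursive equality. -/
abbrev QTy : Type := Quot Sg.TyEq

/-- Contexts over types modulo equi-recursive equality. -/
abbrev QCtx (V : Type) : Type := Multiset (V × QTy Sg)

/-- The class of a type. -/
def Signature.q (A : Ty L TN) : QTy Sg := Quot.mk _ A

/-- The context of the classes of the types of a context. -/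
def Signature.qc {V : Type} (Γ : Ctx L TN V) : QCtx Sg V := Γ.map (Prod.map id Sg.q)

variable {Sg}

theorem HeadRel.mono {R S : Ty L TN → Ty L TN → Prop} (h : ∀ A B, R A B → S A B)
    (hR : HeadRel R A B) : HeadRel S A B := by
  cases hR with
  | one => exact .one
  | plus I A B hh => exact .plus I A B (fun l => h _ _ (hh l))
  | amp I A B hh => exact .amp I A B (fun l => h _ _ (hh l))
  | tensor A A' B B' h1 h2 => exact .tensor _ _ _ _ (h _ _ h1) (h _ _ h2)
  | lolli A A' B B' h1 h2 => exact .lolli _ _ _ _ (h _ _ h1) (h _ _ h2)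

theorem TyEq.head (h : Sg.TyEq A B) : HeadRel Sg.TyEq (Sg.unf A) (Sg.unf B) := by
  obtain ⟨R, hR, hAB⟩ := h
  exact (hR A B hAB).mono (fun A B h => ⟨R, hR, h⟩)

theorem unf_ne_tvar (hSg : Sg.WF) (A : Ty L TN) (Z : TN) : Sg.unf A ≠ .tvar Z := by
  cases A <;> simp [Signature.unf, hSg.contractive]

theorem TyEq.refl (hSg : Sg.WF) (A : Ty L TN) : Sg.TyEq A A := by
  refine ⟨Eq, ?_, rfl⟩
  rintro A _ rfl
  have := unf_ne_tvar hSg A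
  cases h : Sg.unf A with
  | one => exact .one
  | plus I A => exact .plus I A A (fun _ => rfl)
  | amp I A => exact .amp I A A (fun _ => rfl)
  | tensor A B => exact .tensor A A B B rfl rfl
  | lolli A B => exact .lolli A A B B rfl rfl
  | tvar Z => exact absurd h (this Z)

theorem HeadRel.flip {R : Ty L TN → Ty L TN → Prop} (h : HeadRel R A B) :
    HeadRel (fun A B => R B A) B A := by
  cases h with
  | one => exact .one
  | plus I A B hh => exact .plus I _ _ hh
  | amp I A B hh => exact .amp I _ _ hh
  | tensor A A' B B' h1 h2 => exact .tensor _ _ _ _ h1 h2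
  | lolli A A' B B' h1 h2 => exact .lolli _ _ _ _ h1 h2

theorem TyEq.symm (h : Sg.TyEq A B) : Sg.TyEq B A := by
  obtain ⟨R, hR, hAB⟩ := h
  exact ⟨fun A B => R B A, fun A B h => (hR _ _ h).flip, hAB⟩

theorem TyEq.trans {C : Ty L TN} (h : Sg.TyEq A B) (h' : Sg.TyEq B C) : Sg.TyEq A C := by
  refine ⟨fun A C => ∃ B, Sg.TyEq A B ∧ Sg.TyEq B C, ?_, B, h, h'⟩
  rintro A C ⟨B, h, h'⟩
  have h1 := TyEq.head h
  have h2 := TyEq.head h'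
  generalize Sg.unf A = A' at h1
  generalize Sg.unf B = B' at h1 h2
  generalize Sg.unf C = C' at h2
  cases h1 with
  | one => cases h2; exact .one
  | plus I A B hh => cases h2 with | plus _ _ _ h2 => exact .plus I _ _ (fun l => ⟨_, hh l, h2 l⟩)
  | amp I A B hh => cases h2 with | amp _ _ _ h2 => exact .amp I _ _ (fun l => ⟨_, hh l, h2 l⟩)
  | tensor A A' B B' h1 h1' =>
    cases h2 with | tensor _ _ _ _ h2 h2' => exact .tensor _ _ _ _ ⟨_, h1, h2⟩ ⟨_, h1', h2'⟩
  | lolli A A' B B' h1 h1' =>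
    cases h2 with | lolli _ _ _ _ h2 h2' => exact .lolli _ _ _ _ ⟨_, h1, h2⟩ ⟨_, h1', h2'⟩

theorem q_eq (hSg : Sg.WF) : Sg.q A = Sg.q B ↔ Sg.TyEq A B := by
  have e : Equivalence Sg.TyEq := ⟨TyEq.refl hSg, TyEq.symm, TyEq.trans⟩
  constructor
  · intro h; exact e.eqvGen_iff.1 (Quot.eqvGen_exact h)
  · exact fun h => Quot.sound h

theorem q_unf (hSg : Sg.WF) (A : Ty L TN) : Sg.q (Sg.unf A) = Sg.q A := by
  cases A with
  | tvar Y => exact (q_eq hSg).2 (TyEq.symm (tyEq_tdef Sg hSg Y))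
  | _ => rfl

theorem qc_eq (hSg : Sg.WF) {V : Type} {Γ Γ' : Ctx L TN V} :
    Sg.qc Γ = Sg.qc Γ' ↔ Sg.CtxEq Γ Γ' := by
  rw [← Multiset.rel_eq]
  simp only [Signature.qc, Multiset.rel_map, Signature.CtxEq]
  have : ∀ p q : V × Ty L TN, Prod.map id Sg.q p = Prod.map id Sg.q q ↔
      p.1 = q.1 ∧ Sg.TyEq p.2 q.2 := by
    intro p q
    simp [Prod.ext_iff, q_eq hSg]
  simp only [this]

theorem qc_surjective {V : Type} (Γ : QCtx Sg V) : ∃ Γ' : Ctx L TN V, Sg.qc Γ' = Γ := by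
  induction Γ using Multiset.induction with
  | empty => exact ⟨0, rfl⟩
  | cons p Γ ih =>
    obtain ⟨Γ', rfl⟩ := ih
    obtain ⟨x, t⟩ := p
    obtain ⟨A, rfl⟩ := Quot.exists_rep t
    exact ⟨(x, A) ::ₘ Γ', by simp [Signature.qc]; rfl⟩

@[simp] theorem qc_zero {V : Type} : Sg.qc (0 : Ctx L TN V) = 0 := rfl

@[simp] theorem qc_cons {V : Type} (x : V) (A : Ty L TN) (Γ : Ctx L TN V) :
    Sg.qc ((x, A) ::ₘ Γ) = (x, Sg.q A) ::ₘ Sg.qc Γ := by simp [Signature.qc]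

@[simp] theorem qc_singleton {V : Type} (x : V) (A : Ty L TN) :
    Sg.qc {(x, A)} = {(x, Sg.q A)} := rfl

@[simp] theorem qc_add {V : Type} (Γ Γ' : Ctx L TN V) : Sg.qc (Γ + Γ') = Sg.qc Γ + Sg.qc Γ' := by
  simp [Signature.qc]

theorem qc_map {V W : Type} (f : V → W) (Γ : Ctx L TN V) :
    Sg.qc (Γ.map (Prod.map f id)) = (Sg.qc Γ).map (Prod.map f id) := by
  simp only [Signature.qc, map_map]; rfl

/-- The type `⊕` (for `p = true`) or `&` (for `p = false`). -/
def labTy (p : Bool) (I : Finset L) (A : {l // l ∈ I} → Ty L TN) : Ty L TN :=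
  if p then .plus I A else .amp I A

/-- The type `A ⊗ B` (for `p = true`) or `A ⊸ B` (for `p = false`). -/
def sendTy (p : Bool) (A B : Ty L TN) : Ty L TN := if p then .tensor A B else .lolli A B

theorem unf_labTy (p : Bool) (I : Finset L) (A : {l // l ∈ I} → Ty L TN) :
    Sg.unf (labTy p I A) = labTy p I A := by cases p <;> rfl

theorem unf_sendTy (p : Bool) (A B : Ty L TN) : Sg.unf (sendTy p A B) = sendTy p A B := by
  cases p <;> rfl

theorem q_labTy (hSg : Sg.WF) {A : {l // l ∈ I} → Ty L TN} (h : Sg.q (labTy p I A) = Sg.q T) :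
    ∃ A', Sg.unf T = labTy p I A' ∧ ∀ l, Sg.q (A l) = Sg.q (A' l) := by
  have := TyEq.head ((q_eq hSg).1 h)
  rw [unf_labTy] at this
  generalize Sg.unf T = T' at *
  cases p
  · change HeadRel _ (.amp I A) _ at this
    cases this with | amp _ _ B hh => exact ⟨B, rfl, fun l => (q_eq hSg).2 (hh l)⟩
  · change HeadRel _ (.plus I A) _ at this
    cases this with | plus _ _ B hh => exact ⟨B, rfl, fun l => (q_eq hSg).2 (hh l)⟩

theorem q_sendTy (hSg : Sg.WF) (h : Sg.q (sendTy p A B) = Sg.q T) :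
    ∃ A' B', Sg.unf T = sendTy p A' B' ∧ Sg.q A = Sg.q A' ∧ Sg.q B = Sg.q B' := by
  have := TyEq.head ((q_eq hSg).1 h)
  rw [unf_sendTy] at this
  generalize Sg.unf T = T' at *
  cases p
  · change HeadRel _ (.lolli A B) _ at this
    cases this with
    | lolli _ A' _ B' h h' => exact ⟨A', B', rfl, (q_eq hSg).2 h, (q_eq hSg).2 h'⟩
  · change HeadRel _ (.tensor A B) _ at this
    cases this with
    | tensor _ A' _ B' h h' => exact ⟨A', B', rfl, (q_eq hSg).2 h, (q_eq hSg).2 h'⟩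

/-- The polarity of the head connective. -/
def Ty.Pol : Bool → Ty L TN → Prop
  | true, A => A.Pos
  | false, A => A.Neg

/-- The polarity of a class of types. -/
def QPol (p : Bool) (t : QTy Sg) : Prop := ∃ T, Sg.q T = t ∧ (Sg.unf T).Pol p

theorem HeadRel.pol {R : Ty L TN → Ty L TN → Prop} (h : HeadRel R A B) (p : Bool) :
    A.Pol p ↔ B.Pol p := by
  cases p <;> cases h <;> simp [Ty.Pol, Ty.Pos, Ty.Neg]

theorem qpol_q (hSg : Sg.WF) : QPol p (Sg.q T) ↔ (Sg.unf T).Pol p := by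
  constructor
  · rintro ⟨T', h, hp⟩
    exact ((TyEq.head ((q_eq hSg).1 h)).pol p).1 hp
  · exact fun h => ⟨T, rfl, h⟩

theorem Ty.Pol.unique (h : A.Pol p) (h' : A.Pol p') : p = p' := by
  cases p <;> cases p' <;> cases A <;> simp_all [Ty.Pol, Ty.Pos, Ty.Neg]

theorem QPol.unique (hSg : Sg.WF) {t : QTy Sg} (h : QPol p t) (h' : QPol p' t) : p = p' := by
  obtain ⟨T, rfl⟩ := Quot.exists_rep t
  exact Ty.Pol.unique ((qpol_q hSg).1 h) ((qpol_q hSg).1 h')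

theorem labTy_pol (p : Bool) (I : Finset L) (A : {l // l ∈ I} → Ty L TN) : (labTy p I A).Pol p := by
  cases p <;> simp [labTy, Ty.Pol, Ty.Pos, Ty.Neg]

theorem sendTy_pol (p : Bool) (A B : Ty L TN) : (sendTy p A B).Pol p := by
  cases p <;> simp [sendTy, Ty.Pol, Ty.Pos, Ty.Neg]

theorem qpol_labTy (hSg : Sg.WF) (p : Bool) (I : Finset L) (A : {l // l ∈ I} → Ty L TN) :
    QPol p (Sg.q (labTy p I A)) := (qpol_q hSg).2 (by rw [unf_labTy]; exact labTy_pol p I A)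

theorem qpol_sendTy (hSg : Sg.WF) (p : Bool) (A B : Ty L TN) :
    QPol p (Sg.q (sendTy p A B)) := (qpol_q hSg).2 (by rw [unf_sendTy]; exact sendTy_pol p A B)

theorem qpol_one (hSg : Sg.WF) : QPol true (Sg.q .one) := (qpol_q hSg).2 trivial

theorem labTy_inj {I' : Finset L} {A : {l // l ∈ I} → Ty L TN} {A' : {l // l ∈ I'} → Ty L TN}
    (h : labTy p I A = labTy p I' A') : I = I' ∧ HEq A A' := by
  cases p <;> simpa [labTy] using h

theorem sendTy_inj {A' B' : Ty L TN} (h : sendTy p A B = sendTy p A' B') : A = A' ∧ B = B' := by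
  cases p <;> simpa [sendTy] using h

theorem labTy_ne_sendTy {A : {l // l ∈ I} → Ty L TN} {A' B' : Ty L TN} :
    labTy p I A ≠ sendTy p' A' B' := by
  cases p <;> cases p' <;> simp [labTy, sendTy]

theorem labTy_ne_one {A : {l // l ∈ I} → Ty L TN} : labTy p I A ≠ .one := by
  cases p <;> simp [labTy]

theorem sendTy_ne_one : sendTy p A B ≠ .one := by
  cases p <;> simp [sendTy]

/-! ### Typing of terms over the quotient -/

variable (Sg)

/-- Typing of terms over types modulo equality. The rules are those of `Typed` except for `conv`,
which the quotient makes superfluous, so that derivations can be inverted by case analysis. -/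
inductive QTyped : {V : Type} → QCtx Sg V → Proc L TN PN V → V → QTy Sg → Prop
  | plusR {V : Type} (Γ : QCtx Sg V) (x : V) (I : Finset L) (A : {l // l ∈ I} → Ty L TN)
      (k : {l // l ∈ I}) (P : Proc L TN PN V) (h : QTyped Γ P x (Sg.q (A k))) :
      QTyped Γ (.sendLab x k.1 P) x (Sg.q (.plus I A))
  | plusL {V : Type} (Γ : QCtx Sg V) (x y : V) (I : Finset L) (A : {l // l ∈ I} → Ty L TN)
      (C : QTy Sg) (Q : {l // l ∈ I} → Proc L TN PN V)
      (h : ∀ k, QTyped ((x, Sg.q (A k)) ::ₘ Γ) (Q k) y C) :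
      QTyped ((x, Sg.q (.plus I A)) ::ₘ Γ) (.case x I Q) y C
  | ampR {V : Type} (Γ : QCtx Sg V) (x : V) (I : Finset L) (A : {l // l ∈ I} → Ty L TN)
      (Q : {l // l ∈ I} → Proc L TN PN V) (h : ∀ k, QTyped Γ (Q k) x (Sg.q (A k))) :
      QTyped Γ (.case x I Q) x (Sg.q (.amp I A))
  | ampL {V : Type} (Γ : QCtx Sg V) (x y : V) (I : Finset L) (A : {l // l ∈ I} → Ty L TN)
      (C : QTy Sg) (k : {l // l ∈ I}) (P : Proc L TN PN V)
      (h : QTyped ((x, Sg.q (A k)) ::ₘ Γ) P y C) :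
      QTyped ((x, Sg.q (.amp I A)) ::ₘ Γ) (.sendLab x k.1 P) y C
  | tensorR {V : Type} (Γ : QCtx Sg V) (x z : V) (A B : Ty L TN) (P : Proc L TN PN V)
      (h : QTyped Γ P x (Sg.q B)) :
      QTyped ((z, Sg.q A) ::ₘ Γ) (.send z x P) x (Sg.q (.tensor A B))
  | tensorL {V : Type} (Γ : QCtx Sg V) (x y : V) (A B : Ty L TN) (C : QTy Sg)
      (P : Proc L TN PN (Option V))
      (h : QTyped ((none, Sg.q A) ::ₘ (some x, Sg.q B) ::ₘ Γ.map (Prod.map some id)) P (some y) C) :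
      QTyped ((x, Sg.q (.tensor A B)) ::ₘ Γ) (.recv x P) y C
  | lolliR {V : Type} (Γ : QCtx Sg V) (x : V) (A B : Ty L TN) (P : Proc L TN PN (Option V))
      (h : QTyped ((none, Sg.q A) ::ₘ Γ.map (Prod.map some id)) P (some x) (Sg.q B)) :
      QTyped Γ (.recv x P) x (Sg.q (.lolli A B))
  | lolliL {V : Type} (Γ : QCtx Sg V) (x y z : V) (A B : Ty L TN) (C : QTy Sg)
      (P : Proc L TN PN V) (h : QTyped ((x, Sg.q B) ::ₘ Γ) P y C) :
      QTyped ((z, Sg.q A) ::ₘ (x, Sg.q (.lolli A B)) ::ₘ Γ) (.send z x P) y C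
  | oneR {V : Type} (x : V) : QTyped 0 (.close x) x (Sg.q .one)
  | oneL {V : Type} (Γ : QCtx Sg V) (x y : V) (C : QTy Sg) (Q : Proc L TN PN V)
      (h : QTyped Γ Q y C) :
      QTyped ((x, Sg.q .one) ::ₘ Γ) (.wait x Q) y C
  | spawn {V : Type} (Γ : QCtx Sg V) (X : PN) (args : List V) (y : V) (C : QTy Sg)
      (Q : Proc L TN PN (Option V)) (hlen : args.length = (Sg.pdef X).params.length)
      (h : QTyped ((none, Sg.q (Sg.pdef X).ty) ::ₘ Γ.map (Prod.map some id)) Q (some y) C) :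
      QTyped (Sg.qc ((args.zip (Sg.pdef X).params : List (V × Ty L TN)) : Ctx L TN V) + Γ)
        (.spawn X args Q) y C
  | fwd {V : Type} (Y : TN) (y z : V) :
      QTyped {(z, Sg.q (.tvar Y))} (.fwd Y y z) y (Sg.q (Sg.tdef Y))

variable {Sg}

theorem Typed.quot (hSg : Sg.WF) {V : Type} {Γ : Ctx L TN V} {P : Proc L TN PN V} {x : V}
    (h : Typed Sg Γ P x A) : QTyped Sg (Sg.qc Γ) P x (Sg.q A) := by
  induction h with
  | plusR Γ x I A k P h ih => exact .plusR _ x I A k P ih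
  | plusL Γ x y I A C Q h ih =>
    rw [qc_cons]; exact .plusL _ x y I A _ Q (fun k => by simpa using ih k)
  | ampR Γ x I A Q h ih => exact .ampR _ x I A Q ih
  | ampL Γ x y I A C k P h ih =>
    rw [qc_cons]; exact .ampL _ x y I A _ k P (by simpa using ih)
  | tensorR Γ x z A B P h ih => rw [qc_cons]; exact .tensorR _ x z A B P ih
  | tensorL Γ x y A B C P h ih =>
    rw [qc_cons]; exact .tensorL _ x y A B _ P (by simpa [qc_map] using ih)
  | lolliR Γ x A B P h ih => exact .lolliR _ x A B P (by simpa [qc_map] using ih)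
  | lolliL Γ x y z A B C P h ih =>
    rw [qc_cons, qc_cons]; exact .lolliL _ x y z A B _ P (by simpa using ih)
  | oneR x => exact .oneR x
  | oneL Γ x y C Q h ih => rw [qc_cons]; exact .oneL _ x y _ Q ih
  | spawn Γ X args y C Q hlen h ih =>
    rw [qc_add]; exact .spawn _ X args y _ Q hlen (by simpa [qc_map] using ih)
  | fwd Y y z => exact .fwd Y y z
  | conv Γ Γ' P x A A' h hΓ hA ih =>
    rw [← (qc_eq hSg).2 hΓ, ← (q_eq hSg).2 hA]; exact ih

theorem QTyped.lift (hSg : Sg.WF) {V : Type} {Γ : QCtx Sg V} {P : Proc L TN PN V} {x : V}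
    {A : QTy Sg} (h : QTyped Sg Γ P x A) :
    ∀ (Γ' : Ctx L TN V) (A' : Ty L TN), Sg.qc Γ' = Γ → Sg.q A' = A → Typed Sg Γ' P x A' := by
  have conv : ∀ {V : Type} {Γ Γ' : Ctx L TN V} {P : Proc L TN PN V} {x : V} {A A' : Ty L TN},
      Typed Sg Γ P x A → Sg.qc Γ' = Sg.qc Γ → Sg.q A' = Sg.q A → Typed Sg Γ' P x A' :=
    fun h h1 h2 => .conv _ _ _ _ _ _ h ((qc_eq hSg).1 h1.symm) ((q_eq hSg).1 h2.symm)
  induction h with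
  | plusR Γ x I A k P h ih =>
    intro Γ' A' hΓ hA
    exact conv (.plusR Γ' x I A k P (ih _ _ hΓ rfl)) rfl hA
  | plusL Γ x y I A C Q h ih =>
    intro Γ' A' hΓ hA
    obtain ⟨Γ₀, rfl⟩ := qc_surjective Γ
    exact conv (.plusL Γ₀ x y I A A' Q (fun k => ih k _ _ (by simp) hA)) (by simp [hΓ]) rfl
  | ampR Γ x I A Q h ih =>
    intro Γ' A' hΓ hA
    exact conv (.ampR Γ' x I A Q (fun k => ih k _ _ hΓ rfl)) rfl hA
  | ampL Γ x y I A C k P h ih =>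
    intro Γ' A' hΓ hA
    obtain ⟨Γ₀, rfl⟩ := qc_surjective Γ
    exact conv (.ampL Γ₀ x y I A A' k P (ih _ _ (by simp) hA)) (by simp [hΓ]) rfl
  | tensorR Γ x z A B P h ih =>
    intro Γ' A' hΓ hA
    obtain ⟨Γ₀, rfl⟩ := qc_surjective Γ
    exact conv (.tensorR Γ₀ x z A B P (ih _ _ rfl rfl)) (by simp [hΓ]) hA
  | tensorL Γ x y A B C P h ih =>
    intro Γ' A' hΓ hA
    obtain ⟨Γ₀, rfl⟩ := qc_surjective Γ
    exact conv (.tensorL Γ₀ x y A B A' P (ih _ _ (by simp [qc_map]) hA)) (by simp [hΓ]) rfl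
  | lolliR Γ x A B P h ih =>
    intro Γ' A' hΓ hA
    obtain ⟨Γ₀, rfl⟩ := qc_surjective Γ
    exact conv (.lolliR Γ₀ x A B P (ih _ _ (by simp [qc_map]) rfl)) hΓ hA
  | lolliL Γ x y z A B C P h ih =>
    intro Γ' A' hΓ hA
    obtain ⟨Γ₀, rfl⟩ := qc_surjective Γ
    exact conv (.lolliL Γ₀ x y z A B A' P (ih _ _ (by simp) hA)) (by simp [hΓ]) rfl
  | oneR x =>
    intro Γ' A' hΓ hA
    exact conv (.oneR x) hΓ hA
  | oneL Γ x y C Q h ih =>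
    intro Γ' A' hΓ hA
    obtain ⟨Γ₀, rfl⟩ := qc_surjective Γ
    exact conv (.oneL Γ₀ x y A' Q (ih _ _ rfl hA)) (by simp [hΓ]) rfl
  | spawn Γ X args y C Q hlen h ih =>
    intro Γ' A' hΓ hA
    obtain ⟨Γ₀, rfl⟩ := qc_surjective Γ
    exact conv (.spawn Γ₀ X args y A' Q hlen (ih _ _ (by simp [qc_map]) hA)) (by simp [hΓ]) rfl
  | fwd Y y z =>
    intro Γ' A' hΓ hA
    exact conv (.fwd Y y z) (by simp [hΓ]) hA

theorem QTyped.map {V : Type} {Γ : QCtx Sg V} {P : Proc L TN PN V} {x : V} {A : QTy Sg}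
    (h : QTyped Sg Γ P x A) : ∀ {W : Type} (f : V → W),
    QTyped Sg (Γ.map (Prod.map f id)) (P.map f) (f x) A := by
  have opt : ∀ {V W : Type} (f : V → W) (Γ : QCtx Sg V),
      (Γ.map (Prod.map some id)).map (Prod.map (Option.map f) id) =
        (Γ.map (Prod.map f id)).map (Prod.map some id) := by
    intro V W f Γ; simp only [map_map]; rfl
  induction h with
  | plusR Γ x I A k P h ih => intro W f; exact .plusR _ _ I A k _ (ih f)
  | plusL Γ x y I A C Q h ih =>
    intro W f
    simp only [map_cons, Prod.map_apply, id, Proc.map] at ih ⊢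
    exact .plusL _ _ _ I A _ _ (fun k => ih k f)
  | ampR Γ x I A Q h ih => intro W f; exact .ampR _ _ I A _ (fun k => ih k f)
  | ampL Γ x y I A C k P h ih =>
    intro W f
    simp only [map_cons, Prod.map_apply, id, Proc.map] at ih ⊢
    exact .ampL _ _ _ I A _ k _ (ih f)
  | tensorR Γ x z A B P h ih =>
    intro W f
    simp only [map_cons, Prod.map_apply, id, Proc.map]
    exact .tensorR _ _ _ A B _ (ih f)
  | tensorL Γ x y A B C P h ih =>
    intro W f
    have := ih (Option.map f)
    simp only [map_cons, Prod.map_apply, id, Proc.map, opt] at this ⊢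
    exact .tensorL _ _ _ A B _ _ this
  | lolliR Γ x A B P h ih =>
    intro W f
    have := ih (Option.map f)
    simp only [map_cons, Prod.map_apply, id, Proc.map, opt] at this ⊢
    exact .lolliR _ _ A B _ this
  | lolliL Γ x y z A B C P h ih =>
    intro W f
    have := ih f
    simp only [map_cons, Prod.map_apply, id, Proc.map] at this ⊢
    exact .lolliL _ _ _ _ A B _ _ this
  | oneR x => intro W f; exact .oneR _
  | oneL Γ x y C Q h ih =>
    intro W f
    simp only [map_cons, Prod.map_apply, id, Proc.map]
    exact .oneL _ _ _ _ _ (ih f)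
  | spawn Γ X args y C Q hlen h ih =>
    intro W f
    have := ih (Option.map f)
    simp only [map_cons, Multiset.map_add, Prod.map_apply, id, Proc.map, opt] at this ⊢
    have e : (Sg.qc (V := _) ((args.zip (Sg.pdef X).params : List (_ × Ty L TN)) : Ctx L TN _)).map
        (Prod.map f id) =
        Sg.qc (((args.map f).zip (Sg.pdef X).params : List (W × Ty L TN)) : Ctx L TN W) := by
      rw [← qc_map, List.zip_map_left]; rfl
    rw [e]
    exact .spawn _ X _ _ _ _ (by simpa using hlen) this
  | fwd Y y z => intro W f; exact .fwd Y _ _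

end quotient

/-! ### Properties of term typing -/

section termTyping

variable {L TN PN : Type} {Sg : Signature L TN PN}
variable {A : QTy Sg}

/-- The names of a context. -/
abbrev keys {V α : Type} (Γ : Multiset (V × α)) : Multiset V := Γ.map Prod.fst

theorem keys_opt {V α : Type} {Γ : Multiset (V × α)} {v : V} :
    some v ∈ keys (Γ.map (Prod.map some id)) ↔ v ∈ keys Γ := by
  simp [keys]

theorem none_notMem_keys_opt {V α : Type} {Γ : Multiset (V × α)} :
    (none : Option V) ∉ keys (Γ.map (Prod.map some id)) := by
  simp [keys]

theorem keys_qc {V : Type} (Γ : Ctx L TN V) : keys (Sg.qc Γ) = keys Γ := by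
  simp only [keys, Signature.qc, map_map]; rfl

theorem keys_zip {V : Type} {args : List V} {Ps : List (Ty L TN)} (h : args.length = Ps.length) :
    keys (Sg.qc ((args.zip Ps : List (V × Ty L TN)) : Ctx L TN V)) = args := by
  rw [keys_qc]
  simp only [keys, Multiset.map_coe]
  rw [List.map_fst_zip h.le]

theorem QTyped.names {V : Type} {Γ : QCtx Sg V} {P : Proc L TN PN V} {x : V}
    (h : QTyped Sg Γ P x A) : ∀ v ∈ P.names, v ∈ keys Γ ∨ v = x := by
  induction h with
  | plusR Γ x I A k P h ih =>
    rintro v (rfl | hv)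
    · exact Or.inr rfl
    · exact ih v hv
  | plusL Γ x y I A C Q h ih =>
    rintro v (rfl | ⟨l, hv⟩)
    · simp
    · simpa using ih l v hv
  | ampR Γ x I A Q h ih =>
    rintro v (rfl | ⟨l, hv⟩)
    · exact Or.inr rfl
    · exact ih l v hv
  | ampL Γ x y I A C k P h ih =>
    rintro v (rfl | hv)
    · simp
    · simpa using ih v hv
  | tensorR Γ x z A B P h ih =>
    rintro v ((rfl | rfl) | hv)
    · simp
    · simp
    · rcases ih v hv with h | h
      · left; simp only [keys, map_cons, mem_cons]; exact Or.inr h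
      · exact Or.inr h
  | tensorL Γ x y A B C P h ih =>
    rintro v (rfl | hv)
    · simp
    · simpa using ih _ hv
  | lolliR Γ x A B P h ih =>
    rintro v (rfl | hv)
    · simp
    · simpa using ih _ hv
  | lolliL Γ x y z A B C P h ih =>
    rintro v ((rfl | rfl) | hv)
    · simp
    · simp
    · have := ih v hv
      simp only [keys, map_cons, mem_cons] at this ⊢
      tauto
  | oneR x => rintro v rfl; simp
  | oneL Γ x y C Q h ih =>
    rintro v (rfl | hv)
    · simp
    · have := ih v hv
      simp only [keys, map_cons, mem_cons] at this ⊢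
      tauto
  | spawn Γ X args y C Q hlen h ih =>
    rintro v (hv | hv)
    · left
      rw [keys, Multiset.map_add, mem_add]
      exact Or.inl (by rw [← keys, keys_zip hlen]; exact hv)
    · rcases ih _ hv with h | h
      · left
        rw [keys, Multiset.map_add, mem_add]
        right
        simpa using h
      · exact Or.inr (by simpa using h)
  | fwd Y y z => 
    rintro v (rfl | rfl) <;> simp

theorem fwder_typed (hSg : Sg.WF) (A : Ty L TN) : ∀ {V : Type} (y z : V),
    QTyped Sg {(z, Sg.q A)} (fwder (PN := PN) A y z) y (Sg.q A) := by
  induction A with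
  | one => intro V y z; exact .oneL 0 z y _ _ (.oneR y)
  | plus I A ih =>
    intro V y z
    exact .plusL 0 z y I A _ _ (fun k => .plusR _ _ I A k _ (ih k y z))
  | amp I A ih =>
    intro V y z
    exact .ampR _ y I A _ (fun k => .ampL 0 z y I A _ k _ (ih k y z))
  | tensor A B ihA ihB =>
    intro V y z
    exact .tensorL 0 z y A B _ _ (.tensorR _ _ _ A B _ (ihB _ _))
  | lolli A B ihA ihB =>
    intro V y z
    exact .lolliR _ y A B _ (.lolliL 0 (some z) (some y) none A B _ _ (ihB _ _))
  | tvar Y =>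
    intro V y z
    have := QTyped.fwd (Sg := Sg) Y y z
    rwa [(q_eq hSg).2 (TyEq.symm (tyEq_tdef Sg hSg Y))] at this

theorem cons_eq_add {α : Type} {a : α} {Γ Δ Ξ : Multiset α} (h : a ::ₘ Γ = Δ + Ξ) (ha : a ∉ Ξ) :
    ∃ Δ', Δ = a ::ₘ Δ' ∧ Γ = Δ' + Ξ := by
  have : a ∈ Δ + Ξ := h ▸ mem_cons_self a Γ
  rcases mem_add.1 this with h1 | h1
  · obtain ⟨Δ', rfl⟩ := exists_cons_of_mem h1
    refine ⟨Δ', rfl, ?_⟩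
    rw [cons_add] at h
    exact cons_inj_right a |>.1 h
  · exact absurd h1 ha

theorem add_eq_add_of_disjoint {α : Type} {Z Γ Δ Ξ : Multiset α} (h : Z + Γ = Δ + Ξ)
    (ha : ∀ a ∈ Z, a ∉ Ξ) : ∃ Δ', Δ = Z + Δ' ∧ Γ = Δ' + Ξ := by
  induction Z using Multiset.induction generalizing Δ with
  | empty => exact ⟨Δ, by simp, by simpa using h⟩
  | cons a Z ih =>
    rw [cons_add] at h
    obtain ⟨Δ', rfl, h'⟩ := cons_eq_add h (ha a (by simp))
    obtain ⟨Δ'', rfl, h''⟩ := ih h' (fun b hb => ha b (by simp [hb]))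
    exact ⟨Δ'', by simp, h''⟩

theorem mem_keys {V α : Type} {Γ : Multiset (V × α)} {p : V × α} (h : p ∈ Γ) : p.1 ∈ keys Γ :=
  mem_map_of_mem _ h

/-- Channels that a term does not mention can be removed from its context. -/
theorem QTyped.strengthen {V : Type} {Γ' : QCtx Sg V} {P : Proc L TN PN V} {x : V}
    (h : QTyped Sg Γ' P x A) :
    ∀ Γ Ξ : QCtx Sg V, Γ' = Γ + Ξ → (∀ v ∈ keys Ξ, v ∉ P.names) → QTyped Sg Γ P x A := by
  have aux : ∀ {V : Type} {Γ Ξ Δ : QCtx Sg V} {x : V} {t : QTy Sg} {S : Set V},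
      (x, t) ::ₘ Γ = Δ + Ξ → (∀ v ∈ keys Ξ, v ∉ S) → x ∈ S →
      ∃ Δ', Δ = (x, t) ::ₘ Δ' ∧ Γ = Δ' + Ξ := fun e h hx =>
    cons_eq_add e (fun h' => h _ (mem_keys h') hx)
  have opt : ∀ {V : Type} {Ξ : QCtx Sg V} {S : Set (Option V)} {S' : Set V},
      (∀ v ∈ keys Ξ, v ∉ S') → (∀ v, some v ∈ S → v ∈ S') →
      ∀ v ∈ keys (Ξ.map (Prod.map some id)), v ∉ S := by
    intro V Ξ S S' h h' v hv hS
    cases v with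
    | none => exact none_notMem_keys_opt hv
    | some v => exact h v (keys_opt.1 hv) (h' v hS)
  induction h with
  | plusR Γ₁ x I A k P h ih =>
    intro Γ Ξ e hΞ
    exact .plusR _ _ I A k _ (ih Γ Ξ e (fun v hv hn => hΞ v hv (Or.inr hn)))
  | plusL Γ₁ x y I A C Q h ih =>
    intro Γ Ξ e hΞ
    obtain ⟨Γ, rfl, rfl⟩ := aux e hΞ (Or.inl rfl)
    exact .plusL _ _ _ I A _ _ (fun k => ih k _ Ξ (by simp)
      (fun v hv hn => hΞ v hv (Or.inr ⟨k, hn⟩)))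
  | ampR Γ₁ x I A Q h ih =>
    intro Γ Ξ e hΞ
    exact .ampR _ _ I A _ (fun k => ih k _ Ξ e (fun v hv hn => hΞ v hv (Or.inr ⟨k, hn⟩)))
  | ampL Γ₁ x y I A C k P h ih =>
    intro Γ Ξ e hΞ
    obtain ⟨Γ, rfl, rfl⟩ := aux e hΞ (Or.inl rfl)
    exact .ampL _ _ _ I A _ k _ (ih _ Ξ (by simp) (fun v hv hn => hΞ v hv (Or.inr hn)))
  | tensorR Γ₁ x z A B P h ih =>
    intro Γ Ξ e hΞ
    obtain ⟨Γ, rfl, rfl⟩ := aux e hΞ (Or.inl (Or.inl rfl))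
    exact .tensorR _ _ _ A B _ (ih _ Ξ rfl (fun v hv hn => hΞ v hv (Or.inr hn)))
  | tensorL Γ₁ x y A B C P h ih =>
    intro Γ Ξ e hΞ
    obtain ⟨Γ, rfl, rfl⟩ := aux e hΞ (Or.inl rfl)
    exact .tensorL _ _ _ A B _ _ (ih _ (Ξ.map (Prod.map some id)) (by simp)
      (opt hΞ (fun v hv => Or.inr hv)))
  | lolliR Γ₁ x A B P h ih =>
    intro Γ Ξ e hΞ
    subst e
    exact .lolliR _ _ A B _ (ih _ (Ξ.map (Prod.map some id)) (by simp)
      (opt hΞ (fun v hv => Or.inr hv)))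
  | lolliL Γ₁ x y z A B C P h ih =>
    intro Γ Ξ e hΞ
    obtain ⟨Γ, rfl, e'⟩ := aux e hΞ (show z ∈ ({z, x} ∪ P.names : Set _) from Or.inl (Or.inl rfl))
    obtain ⟨Γ, rfl, rfl⟩ := aux e' hΞ (show x ∈ ({z, x} ∪ P.names : Set _) from Or.inl (Or.inr rfl))
    exact .lolliL _ _ _ _ A B _ _ (ih _ Ξ (by simp) (fun v hv hn => hΞ v hv (Or.inr hn)))
  | oneR x =>
    intro Γ Ξ e hΞ
    have := (add_eq_zero.1 e.symm).1
    subst this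
    exact .oneR x
  | oneL Γ₁ x y C Q h ih =>
    intro Γ Ξ e hΞ
    obtain ⟨Γ, rfl, rfl⟩ := aux e hΞ (Or.inl rfl)
    exact .oneL _ _ _ _ _ (ih _ Ξ rfl (fun v hv hn => hΞ v hv (Or.inr hn)))
  | spawn Γ₁ X args y C Q hlen h ih =>
    intro Γ Ξ e hΞ
    obtain ⟨Γ, rfl, rfl⟩ := add_eq_add_of_disjoint e (fun p hp hΞp => hΞ p.1 (mem_keys hΞp)
      (Or.inl (by have := mem_keys hp; rw [keys_zip hlen] at this; exact this)))
    exact .spawn _ X args _ _ _ hlen (ih _ (Ξ.map (Prod.map some id)) (by simp)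
      (opt hΞ (fun v hv => Or.inr hv)))
  | fwd Y y z =>
    intro Γ Ξ e hΞ
    obtain ⟨Γ, rfl, e'⟩ := aux (Γ := 0) e hΞ (show z ∈ ({y, z} : Set _) from Or.inr rfl)
    obtain rfl := (add_eq_zero.1 e'.symm).1
    exact .fwd Y y z

/-- The term reaches a `case` without branches on every path, so that it can be typed with any
additional channels. -/
inductive Absorb : {V : Type} → Proc L TN PN V → Prop
  | sendLab {V : Type} (x : V) (k : L) (P : Proc L TN PN V) : Absorb P → Absorb (.sendLab x k P)
  | case {V : Type} (x : V) (I : Finset L) (Q : {l // l ∈ I} → Proc L TN PN V) :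
      (∀ l, Absorb (Q l)) → Absorb (.case x I Q)
  | send {V : Type} (z x : V) (P : Proc L TN PN V) : Absorb P → Absorb (.send z x P)
  | recv {V : Type} (x : V) (P : Proc L TN PN (Option V)) : Absorb P → Absorb (.recv x P)
  | wait {V : Type} (x : V) (Q : Proc L TN PN V) : Absorb Q → Absorb (.wait x Q)
  | spawn {V : Type} (X : PN) (args : List V) (Q : Proc L TN PN (Option V)) : Absorb Q →
      Absorb (.spawn X args Q)

theorem QTyped.weaken {V : Type} {Γ : QCtx Sg V} {P : Proc L TN PN V} {x : V}
    (h : QTyped Sg Γ P x A) : Absorb P → ∀ Ξ : QCtx Sg V, QTyped Sg (Γ + Ξ) P x A := by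
  induction h with
  | plusR Γ₁ x I A k P h ih =>
    rintro (⟨_, _, _, ha⟩ | _) Ξ
    exact .plusR _ _ I A k _ (ih ha Ξ)
  | plusL Γ₁ x y I A C Q h ih =>
    rintro (_ | ⟨_, _, _, ha⟩) Ξ
    exact cons_add _ _ _ ▸ .plusL _ _ _ I A _ _ (fun k => by simpa using ih k (ha k) Ξ)
  | ampR Γ₁ x I A Q h ih =>
    rintro (_ | ⟨_, _, _, ha⟩) Ξ
    exact .ampR _ _ I A _ (fun k => ih k (ha k) Ξ)
  | ampL Γ₁ x y I A C k P h ih =>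
    rintro (⟨_, _, _, ha⟩ | _) Ξ
    exact cons_add _ _ _ ▸ .ampL _ _ _ I A _ k _ (by simpa using ih ha Ξ)
  | tensorR Γ₁ x z A B P h ih =>
    intro ha Ξ
    cases ha with
    | send _ _ _ ha => exact cons_add _ _ _ ▸ .tensorR _ _ _ A B _ (ih ha Ξ)
  | tensorL Γ₁ x y A B C P h ih =>
    intro ha Ξ
    cases ha with
    | recv _ _ ha =>
      exact cons_add _ _ _ ▸ .tensorL _ _ _ A B _ _
        (by simpa using ih ha (Ξ.map (Prod.map some id)))
  | lolliR Γ₁ x A B P h ih =>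
    intro ha Ξ
    cases ha with
    | recv _ _ ha =>
      exact .lolliR _ _ A B _ (by simpa using ih ha (Ξ.map (Prod.map some id)))
  | lolliL Γ₁ x y z A B C P h ih =>
    intro ha Ξ
    cases ha with
    | send _ _ _ ha =>
      rw [cons_add, cons_add]
      exact .lolliL _ _ _ _ A B _ _ (by simpa using ih ha Ξ)
  | oneR x => intro ha; cases ha
  | oneL Γ₁ x y C Q h ih =>
    intro ha Ξ
    cases ha with
    | wait _ _ ha => exact cons_add _ _ _ ▸ .oneL _ _ _ _ _ (ih ha Ξ)
  | spawn Γ₁ X args y C Q hlen h ih =>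
    intro ha Ξ
    cases ha with
    | spawn _ _ _ ha =>
      rw [add_assoc]
      exact .spawn _ X args _ _ _ hlen (by simpa using ih ha (Ξ.map (Prod.map some id)))
  | fwd Y y z => intro ha; cases ha

theorem QTyped.absorb {V : Type} {Γ : QCtx Sg V} {P : Proc L TN PN V} {x : V}
    (h : QTyped Sg Γ P x A) : ∀ v ∈ keys Γ, v ∉ P.names → Absorb P := by
  induction h with
  | plusR Γ₁ x I A k P h ih =>
    intro v hv hn
    exact .sendLab _ _ _ (ih v hv (fun h => hn (Or.inr h)))
  | plusL Γ₁ x y I A C Q h ih =>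
    intro v hv hn
    exact .case _ _ _ (fun l => ih l v (by simpa using hv) (fun h => hn (Or.inr ⟨l, h⟩)))
  | ampR Γ₁ x I A Q h ih =>
    intro v hv hn
    exact .case _ _ _ (fun l => ih l v hv (fun h => hn (Or.inr ⟨l, h⟩)))
  | ampL Γ₁ x y I A C k P h ih =>
    intro v hv hn
    exact .sendLab _ _ _ (ih v (by simpa using hv) (fun h => hn (Or.inr h)))
  | tensorR Γ₁ x z A B P h ih =>
    intro v hv hn
    refine .send _ _ _ (ih v ?_ (fun h => hn (Or.inr h)))
    simp only [keys, map_cons, mem_cons] at hv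
    exact hv.resolve_left (fun h => hn (Or.inl (Or.inl h)))
  | tensorL Γ₁ x y A B C P h ih =>
    intro v hv hn
    refine .recv _ _ (ih (some v) ?_ (fun h => hn (Or.inr h)))
    simp only [keys, map_cons, mem_cons] at hv ⊢
    rcases hv with rfl | hv
    · exact Or.inr (Or.inl rfl)
    · exact Or.inr (Or.inr (keys_opt.2 hv))
  | lolliR Γ₁ x A B P h ih =>
    intro v hv hn
    refine .recv _ _ (ih (some v) ?_ (fun h => hn (Or.inr h)))
    simp only [keys, map_cons, mem_cons]
    exact Or.inr (keys_opt.2 hv)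
  | lolliL Γ₁ x y z A B C P h ih =>
    intro v hv hn
    refine .send _ _ _ (ih v ?_ (fun h => hn (Or.inr h)))
    simp only [keys, map_cons, mem_cons] at hv ⊢
    exact hv.resolve_left (fun h => hn (Or.inl (Or.inl h)))
  | oneR x => intro v hv; simp at hv
  | oneL Γ₁ x y C Q h ih =>
    intro v hv hn
    refine .wait _ _ (ih v ?_ (fun h => hn (Or.inr h)))
    simp only [keys, map_cons, mem_cons] at hv
    exact hv.resolve_left (fun h => hn (Or.inl h))
  | spawn Γ₁ X args y C Q hlen h ih =>
    intro v hv hn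
    refine .spawn _ _ _ (ih (some v) ?_ (fun h => hn (Or.inr h)))
    rw [keys, Multiset.map_add, mem_add] at hv
    simp only [keys, map_cons, mem_cons]
    rcases hv with hv | hv
    · rw [← keys, keys_zip hlen] at hv; exact absurd (Or.inl hv) hn
    · exact Or.inr (keys_opt.2 hv)
  | fwd Y y z =>
    intro v hv hn
    simp only [keys, Multiset.map_singleton, mem_singleton] at hv
    exact absurd (Or.inr hv) hn

end termTyping

/-! ### Typing of nodes -/

section nodeTyping

variable {L TN PN : Type} (Sg : Signature L TN PN)
variable {M : Msg L} {x : Chan} {n : Node L TN PN}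

/-- Typing of messages over types modulo equality. -/
inductive QMsg : QCtx Sg Chan → Msg L → Chan → QTy Sg → Prop
  | plusR (y : Chan) (I : Finset L) (A : {l // l ∈ I} → Ty L TN) (k : {l // l ∈ I}) :
      QMsg {(y.succ, Sg.q (A k))} (.lab y k.1) y (Sg.q (.plus I A))
  | ampL (x : Chan) (I : Finset L) (A : {l // l ∈ I} → Ty L TN) (k : {l // l ∈ I}) :
      QMsg {(x, Sg.q (.amp I A))} (.lab x k.1) x.succ (Sg.q (A k))
  | tensorR (z y : Chan) (A B : Ty L TN) :
      QMsg {(z, Sg.q A), (y.succ, Sg.q B)} (.send z y) y (Sg.q (.tensor A B))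
  | lolliL (z x : Chan) (A B : Ty L TN) :
      QMsg {(z, Sg.q A), (x, Sg.q (.lolli A B))} (.send z x) x.succ (Sg.q B)
  | oneR (y : Chan) : QMsg 0 (.close y) y (Sg.q .one)

/-- Typing of nodes: the context, the provided channel and its type. -/
inductive NT : QCtx Sg Chan → Node L TN PN → Chan → QTy Sg → Prop
  | proc (Γ : QCtx Sg Chan) (x : Chan) (P : Proc L TN PN Chan) (A : QTy Sg)
      (h : QTyped Sg Γ P x A) : NT Γ (.proc x P) x A
  | msg (Γ : QCtx Sg Chan) (M : Msg L) (x : Chan) (A : QTy Sg) (h : QMsg Sg Γ M x A) :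
      NT Γ (.msg M) x A

variable {Sg}

theorem MsgTyped.quot {Γ : Ctx L TN Chan} {A : Ty L TN} (h : MsgTyped Γ M x A) :
    QMsg Sg (Sg.qc Γ) M x (Sg.q A) := by
  cases h
  · exact .plusR _ _ _ _
  · exact .ampL _ _ _ _
  · exact .tensorR _ _ _ _
  · exact .lolliL _ _ _ _
  · exact .oneR _

theorem QMsg.lift {Γ : QCtx Sg Chan} {A : QTy Sg} (h : QMsg Sg Γ M x A) :
    ∃ Γ' A', Sg.qc Γ' = Γ ∧ Sg.q A' = A ∧ MsgTyped Γ' M x A' := by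
  cases h
  · exact ⟨_, _, rfl, rfl, .plusR _ _ _ _⟩
  · exact ⟨_, _, rfl, rfl, .ampL _ _ _ _⟩
  · exact ⟨_, _, rfl, rfl, .tensorR _ _ _ _⟩
  · exact ⟨_, _, rfl, rfl, .lolliL _ _ _ _⟩
  · exact ⟨_, _, rfl, rfl, .oneR _⟩

theorem QMsg.ren {Γ : QCtx Sg Chan} {A : QTy Sg} (h : QMsg Sg Γ M x A) (π : Equiv.Perm ℕ) :
    QMsg Sg (Γ.map (Prod.map (Chan.rename π) id)) (M.map (Chan.rename π)) (x.rename π) A := by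
  cases h with
  | plusR _ I A k => exact .plusR (Chan.rename π x) I A k
  | ampL x I A k => exact .ampL (Chan.rename π x) I A k
  | tensorR z _ A B => exact .tensorR (Chan.rename π z) (Chan.rename π x) A B
  | lolliL z x A B => exact .lolliL (Chan.rename π z) (Chan.rename π x) A B
  | oneR => exact .oneR _

theorem NT.ren {Γ : QCtx Sg Chan} {A : QTy Sg} (h : NT Sg Γ n x A) (π : Equiv.Perm ℕ) :
    NT Sg (Γ.map (Prod.map (Chan.rename π) id)) (n.ren π) (x.rename π) A := by
  cases h with
  | proc _ _ _ h => exact .proc _ _ _ _ (QTyped.map h _)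
  | msg _ _ _ h => exact .msg _ _ _ _ (QMsg.ren h π)

theorem NT.chans {Γ : QCtx Sg Chan} {A : QTy Sg} (h : NT Sg Γ n x A) :
    ∀ c ∈ n.chans, c ∈ keys Γ ∨ c = x := by
  cases h with
  | proc _ _ _ h =>
    rintro c (rfl | hc)
    · exact Or.inr rfl
    · exact h.names c hc
  | msg _ _ _ h =>
    cases h <;> intro c hc <;> simp [Node.chans, Msg.chans, keys] at hc ⊢ <;> tauto

theorem NT.prov_mem {Γ : QCtx Sg Chan} {A : QTy Sg} (h : NT Sg Γ n x A) : x ∈ n.chans := by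
  cases h with
  | proc _ _ _ h => exact Or.inl rfl
  | msg _ _ _ h => cases h <;> simp [Node.chans, Msg.chans]

/-- The node is about to send along `y` or is a message along `y` (`Ev true y`), or it waits to
receive along `y` (`Ev false y`). -/
inductive Ev : Bool → Chan → Node L TN PN → Prop
  | msg (M : Msg L) : Ev true M.carrier (.msg M)
  | sends (x y : Chan) (P : Proc L TN PN Chan) (h : P.SendsOn y) : Ev true y (.proc x P)
  | waits (x y : Chan) (P : Proc L TN PN Chan) (h : P.WaitsOn y) : Ev false y (.proc x P)

/-- The node sends along a channel that it provides at a positive or uses at a negative type, and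
receives along a channel that it provides at a negative or uses at a positive type. -/
theorem NT.ev_pol (hSg : Sg.WF) {Γ : QCtx Sg Chan} {y : Chan} {A : QTy Sg} {b : Bool}
    (h : NT Sg Γ n x A) (he : Ev b y n) : (x = y ∧ QPol b A) ∨ ∃ B, (y, B) ∈ Γ ∧ QPol (!b) B := by
  cases he with
  | msg M =>
    cases h with | msg _ _ _ h =>
    cases h with
    | plusR y I A k => exact Or.inl ⟨rfl, qpol_labTy hSg true I A⟩
    | ampL y I A k => exact Or.inr ⟨_, by simp [Msg.carrier]; rfl, qpol_labTy hSg false I A⟩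
    | tensorR z y A B => exact Or.inl ⟨rfl, qpol_sendTy hSg true A B⟩
    | lolliL z y A B =>
      exact Or.inr ⟨Sg.q (.lolli A B), by simp [Msg.carrier], qpol_sendTy hSg false A B⟩
    | oneR y => exact Or.inl ⟨rfl, qpol_one hSg⟩
  | sends x' y P hP =>
    cases h with | proc _ _ _ h =>
    cases hP with
    | sendLab k P =>
      cases h with
      | plusR _ _ I A k P h => exact Or.inl ⟨rfl, qpol_labTy hSg true I A⟩
      | ampL Γ _ _ I A C k P h => exact Or.inr ⟨_, by simp; left; rfl, qpol_labTy hSg false I A⟩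
    | send z P =>
      cases h with
      | tensorR _ _ _ A B _ h => exact Or.inl ⟨rfl, qpol_sendTy hSg true A B⟩
      | lolliL _ _ _ _ A B _ _ h =>
        exact Or.inr ⟨Sg.q (.lolli A B), by simp, qpol_sendTy hSg false A B⟩
  | waits x' y P hP =>
    cases h with | proc _ _ _ h =>
    cases hP with
    | case I Q =>
      cases h with
      | plusL Γ _ _ I A C Q h => exact Or.inr ⟨_, by simp; left; rfl, qpol_labTy hSg true I A⟩
      | ampR _ _ I A Q h => exact Or.inl ⟨rfl, qpol_labTy hSg false I A⟩
    | recv P =>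
      cases h with
      | tensorL _ _ _ A B _ _ h => exact Or.inr ⟨_, by simp; left; rfl, qpol_sendTy hSg true A B⟩
      | lolliR _ _ A B _ h => exact Or.inl ⟨rfl, qpol_sendTy hSg false A B⟩
    | wait Q =>
      cases h with
      | oneL _ _ _ _ _ h => exact Or.inr ⟨Sg.q .one, by simp, qpol_one hSg⟩

end nodeTyping

/-! ### Configurations as sequences of nodes -/

section flat

variable {L TN PN : Type} (Sg : Signature L TN PN)
variable {C D : Config L TN PN} {n₁ n₂ : Node L TN PN} {P : Multiset Chan}

/-- A topologically sorted configuration: starting from the channels `Δ`, each node consumes some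
of the available channels and provides one more. `P` collects the provided channels, `S` is the
context that is left. -/
inductive Flat : QCtx Sg Chan → Config L TN PN → Multiset Chan → QCtx Sg Chan → Prop
  | nil (Δ : QCtx Sg Chan) : Flat Δ 0 0 Δ
  | snoc (Δ : QCtx Sg Chan) (D : Config L TN PN) (P : Multiset Chan) (Γ Θ : QCtx Sg Chan)
      (n : Node L TN PN) (x : Chan) (A : QTy Sg) (h : Flat Δ D P (Γ + Θ)) (hn : NT Sg Γ n x A) :
      Flat Δ (n ::ₘ D) (x ::ₘ P) ((x, A) ::ₘ Θ)

variable {Sg}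

theorem keys_add {V α : Type} (Γ Δ : Multiset (V × α)) : keys (Γ + Δ) = keys Γ + keys Δ :=
  Multiset.map_add _ _ _

theorem keys_cons {V α : Type} (x : V) (A : α) (Γ : Multiset (V × α)) :
    keys ((x, A) ::ₘ Γ) = x ::ₘ keys Γ := map_cons _ _ _

theorem Flat.frame {Δ S : QCtx Sg Chan} (h : Flat Sg Δ D P S) (Ξ : QCtx Sg Chan) :
    Flat Sg (Δ + Ξ) D P (S + Ξ) := by
  induction h with
  | nil => exact .nil _
  | snoc D P Γ Θ n x A h hn ih =>
    rw [cons_add]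
    exact .snoc _ _ _ Γ (Θ + Ξ) _ _ _ (by rwa [← add_assoc]) hn

theorem Flat.trans {Δ S S' : QCtx Sg Chan} {D' : Config L TN PN} {P' : Multiset Chan}
    (h : Flat Sg Δ D P S) (h' : Flat Sg S D' P' S') : Flat Sg Δ (D + D') (P + P') S' := by
  induction h' with
  | nil => simpa using h
  | snoc D P Γ Θ n x A h' hn ih =>
    rw [add_cons, add_cons]
    exact .snoc _ _ _ Γ Θ _ _ _ ih hn

theorem Flat.single {Γ : QCtx Sg Chan} {n : Node L TN PN} {x : Chan} {A : QTy Sg}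
    (hn : NT Sg Γ n x A) (Θ : QCtx Sg Chan) : Flat Sg (Γ + Θ) {n} {x} ((x, A) ::ₘ Θ) :=
  .snoc _ 0 0 Γ Θ n x A (.nil _) hn

theorem Flat.keys_le {Δ S : QCtx Sg Chan} (h : Flat Sg Δ D P S) : keys S ≤ keys Δ + P := by
  induction h with
  | nil => simp
  | snoc D P Γ Θ n x A h hn ih =>
    rw [keys_cons, add_cons]
    rw [keys_add] at ih
    exact Multiset.cons_le_cons _ (le_trans (Multiset.le_add_left _ _) ih)

theorem Flat.split {Δ S : QCtx Sg Chan} (h : Flat Sg Δ D P S) :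
    ∀ (n : Node L TN PN) (C : Config L TN PN), D = n ::ₘ C →
    ∃ C₁ C₂ P₁ P₂ Γ Θ x A, C = C₁ + C₂ ∧ P = P₁ + x ::ₘ P₂ ∧ Flat Sg Δ C₁ P₁ (Γ + Θ) ∧
      NT Sg Γ n x A ∧ Flat Sg ((x, A) ::ₘ Θ) C₂ P₂ S := by
  induction h with
  | nil => intro n C h; exact absurd h.symm cons_ne_zero
  | snoc D P Γ Θ n x A h hn ih =>
    intro n' C e
    rcases cons_eq_cons.1 e with ⟨rfl, rfl⟩ | ⟨_, C', rfl, rfl⟩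
    · exact ⟨D, 0, P, 0, Γ, Θ, x, A, by simp, by
        simp only [← singleton_add, add_zero]; abel, h, hn, .nil _⟩
    · obtain ⟨C₁, C₂, P₁, P₂, Γ', Θ', x', A', rfl, rfl, h1, h2, h3⟩ := ih _ _ rfl
      exact ⟨C₁, n ::ₘ C₂, P₁, x ::ₘ P₂, Γ', Θ', x', A', by simp, by
        simp only [← singleton_add]; abel, h1, h2, .snoc _ _ _ _ _ _ _ _ h3 hn⟩

/-- A channel that is available all along and not provided can be removed. -/
theorem Flat.unframe {Δ S : QCtx Sg Chan} (h : Flat Sg Δ D P S) :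
    ∀ (y : Chan) (B T : QTy Sg) (Θ S' : QCtx Sg Chan),
      Δ = (y, B) ::ₘ Θ → S = (y, T) ::ₘ S' → y ∉ keys Θ → y ∉ P → B = T ∧ Flat Sg Θ D P S' := by
  induction h with
  | nil =>
    rintro y B T Θ S' rfl e hy -
    rcases cons_eq_cons.1 e with ⟨h, rfl⟩ | ⟨_, C, rfl, rfl⟩
    · exact ⟨(Prod.ext_iff.1 h).2, .nil _⟩
    · simp at hy
  | snoc D P Γ Ξ n x A h hn ih =>
    rintro y B T Θ S' rfl e hy hP
    have hxy : y ≠ x := fun h => hP (by simp [h])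
    rcases cons_eq_cons.1 e with ⟨h, -⟩ | ⟨_, C, rfl, rfl⟩
    · exact absurd (Prod.ext_iff.1 h).1.symm hxy
    · obtain ⟨rfl, h'⟩ := ih y B T Θ (Γ + C) rfl (by simp) hy (fun h => hP (by simp [h]))
      exact ⟨rfl, .snoc _ _ _ _ _ _ _ _ h' hn⟩

theorem Flat.prov_sub {Δ S : QCtx Sg Chan} (h : Flat Sg Δ D P S) : ∀ c ∈ P, c ∈ confChans D := by
  induction h with
  | nil => simp
  | snoc D P Γ Θ n x A h hn ih =>
    intro c hc
    rw [confChans_cons]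
    rcases mem_cons.1 hc with rfl | hc
    · exact Or.inl hn.prov_mem
    · exact Or.inr (ih c hc)

theorem Flat.chans {Δ S : QCtx Sg Chan} (h : Flat Sg Δ D P S) :
    ∀ c ∈ confChans D, c ∈ keys Δ + P := by
  induction h with
  | nil => intro c hc; simp [confChans_zero] at hc
  | snoc D P Γ Θ n x A h hn ih =>
    intro c hc
    rw [confChans_cons] at hc
    rw [add_cons, mem_cons]
    rcases hc with hc | hc
    · rcases hn.chans c hc with h' | h'
      · refine Or.inr (mem_of_le h.keys_le ?_)
        rw [keys_add]; exact mem_add.2 (Or.inl h')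
      · exact Or.inl h'
    · exact Or.inr (ih c hc)

theorem Flat.ren {Δ S : QCtx Sg Chan} (h : Flat Sg Δ D P S) (π : Equiv.Perm ℕ) :
    Flat Sg (Δ.map (Prod.map (Chan.rename π) id)) (cren π D) (P.map (Chan.rename π))
      (S.map (Prod.map (Chan.rename π) id)) := by
  induction h with
  | nil => exact .nil _
  | snoc D P Γ Θ n x A h hn ih =>
    rw [Multiset.map_add] at ih
    simp only [cren, map_cons, Prod.map_apply, id]
    exact .snoc _ _ _ _ _ _ _ _ ih (hn.ren π)

/-- The facts about two nodes of a configuration: they provide different channels and use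
different channels, and if the second uses the channel of the first, they can be replaced by one
node with the remaining context. -/
def PairFacts (Δ : QCtx Sg Chan) (n₁ n₂ : Node L TN PN) (C : Config L TN PN) (P : Multiset Chan)
    (S : QCtx Sg Chan) : Prop :=
  ∃ Γ₁ x₁ A₁ Γ₂ x₂ A₂, NT Sg Γ₁ n₁ x₁ A₁ ∧ NT Sg Γ₂ n₂ x₂ A₂ ∧ x₁ ≠ x₂ ∧
    (∀ c ∈ keys Γ₁, c ∉ keys Γ₂) ∧ (keys Γ₁).Nodup ∧ (keys Γ₂).Nodup ∧
    x₁ ∉ keys Γ₁ ∧ x₂ ∉ keys Γ₂ ∧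
    (∀ B Γ₂', Γ₂ = (x₁, B) ::ₘ Γ₂' → B = A₁ ∧ ∀ n, NT Sg (Γ₁ + Γ₂') n x₂ A₂ →
      ∃ P', P = x₁ ::ₘ P' ∧ Flat Sg Δ (n ::ₘ C) P' S) ∧
    (∀ B Γ₁', Γ₁ = (x₂, B) ::ₘ Γ₁' → B = A₂ ∧ ∀ n, NT Sg (Γ₂ + Γ₁') n x₁ A₁ →
      ∃ P', P = x₂ ::ₘ P' ∧ Flat Sg Δ (n ::ₘ C) P' S)

theorem PairFacts.swap {Δ S : QCtx Sg Chan} (h : PairFacts Δ n₁ n₂ C P S) :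
    PairFacts Δ n₂ n₁ C P S := by
  obtain ⟨Γ₁, x1, A₁, Γ₂, x2, A₂, h1, h2, h3, h4, h5, h6, h7, h8, h9, h10⟩ := h
  exact ⟨Γ₂, x2, A₂, Γ₁, x1, A₁, h2, h1, h3.symm, fun c hc hc' => h4 c hc' hc, h6, h5, h8, h7,
    h10, h9⟩

theorem pairFacts_of_ordered {Δ S Γ₁ Θ₁ Γ₂ Θ₂ : QCtx Sg Chan} {C₁ C₂ C₃ : Config L TN PN}
    {P₁ P₂ P₃ : Multiset Chan} {x1 x2 : Chan} {A₁ A₂ : QTy Sg} (h1 : Flat Sg Δ C₁ P₁ (Γ₁ + Θ₁))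
    (hn1 : NT Sg Γ₁ n₁ x1 A₁) (h2 : Flat Sg ((x1, A₁) ::ₘ Θ₁) C₂ P₂ (Γ₂ + Θ₂))
    (hn2 : NT Sg Γ₂ n₂ x2 A₂) (h3 : Flat Sg ((x2, A₂) ::ₘ Θ₂) C₃ P₃ S)
    (hnd : (keys Δ + (P₁ + x1 ::ₘ (P₂ + x2 ::ₘ P₃))).Nodup) :
    PairFacts Δ n₁ n₂ (C₁ + C₂ + C₃) (P₁ + x1 ::ₘ (P₂ + x2 ::ₘ P₃)) S := by
  have k1 := h1.keys_le
  have k2 := h2.keys_le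
  rw [keys_add] at k1 k2
  rw [keys_cons] at k2
  have hnd' : (keys Γ₁ + keys Θ₁ + (x1 ::ₘ (P₂ + x2 ::ₘ P₃))).Nodup :=
    nodup_of_le (add_le_add_left k1 _) (by rwa [add_assoc])
  have hnd2 : (keys Γ₁ + (keys Γ₂ + keys Θ₂) + x2 ::ₘ P₃).Nodup := by
    refine nodup_of_le ?_ hnd'
    have : keys Γ₁ + keys Θ₁ + (x1 ::ₘ (P₂ + x2 ::ₘ P₃)) =
        keys Γ₁ + (x1 ::ₘ keys Θ₁ + P₂) + x2 ::ₘ P₃ := by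
      simp only [← singleton_add]; abel
    rw [this]
    gcongr
  simp only [nodup_add, nodup_cons, Multiset.disjoint_left, mem_add,
    mem_cons] at hnd' hnd2
  refine ⟨Γ₁, x1, A₁, Γ₂, x2, A₂, hn1, hn2, ?_, ?_, hnd'.1.1, hnd2.1.2.1.1, ?_, ?_, ?_, ?_⟩
  · intro h; exact hnd'.2.1.1 (by simp [h])
  · intro c hc hc'; exact hnd2.1.2.2 hc (Or.inl hc')
  · intro h; exact hnd'.2.2 (Or.inl h) (Or.inl rfl)
  · intro h; exact hnd2.2.2 (Or.inr (Or.inl h)) (Or.inl rfl)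
  · rintro B Γ₂' rfl
    obtain ⟨rfl, h2'⟩ := h2.unframe x1 A₁ B Θ₁ (Γ₂' + Θ₂) rfl (by simp)
      (fun h => hnd'.2.2 (Or.inr h) (Or.inl rfl)) (fun h => hnd'.2.1.1 (Or.inl h))
    refine ⟨rfl, fun n hn => ⟨P₁ + (P₂ + x2 ::ₘ P₃), by simp, ?_⟩⟩
    have e1 := h1.trans (by simpa [add_comm] using h2'.frame Γ₁)
    have e2 := e1.trans (S' := (x2, A₂) ::ₘ Θ₂) (D' := {n}) (P' := {x2})
      (by simpa [add_assoc, add_comm, add_left_comm] using Flat.single hn Θ₂)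
    have e3 := e2.trans h3
    convert e3 using 1
    · simp only [← singleton_add]; abel
    · simp only [← singleton_add]; abel
  · rintro B Γ₁' rfl
    rw [keys_cons] at hnd'
    exact absurd rfl (fun (_ : x2 = x2) => hnd'.2.2 (Or.inl (by simp)) (Or.inr (Or.inr (Or.inl rfl))))

theorem Flat.pair {Δ S : QCtx Sg Chan} (h : Flat Sg Δ (n₁ ::ₘ n₂ ::ₘ C) P S)
    (hnd : (keys Δ + P).Nodup) : PairFacts Δ n₁ n₂ C P S := by
  obtain ⟨C₁, C₂, P₁, P₂, Γ, Θ, x, A, e, rfl, h1, hn, h2⟩ := h.split _ _ rfl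
  have : n₂ ∈ C₁ + C₂ := e ▸ mem_cons_self _ _
  rcases mem_add.1 this with hm | hm
  · obtain ⟨C₁, rfl⟩ := exists_cons_of_mem hm
    rw [cons_add, cons_inj_right] at e
    subst e
    obtain ⟨C₃, C₄, P₃, P₄, Γ', Θ', x', A', rfl, rfl, h3, hn', h4⟩ := h1.split _ _ rfl
    have e1 : P₃ + x' ::ₘ P₄ + x ::ₘ P₂ = P₃ + x' ::ₘ (P₄ + x ::ₘ P₂) := by
      simp only [← singleton_add]; abel
    rw [e1] at hnd ⊢
    exact (pairFacts_of_ordered h3 hn' h4 hn h2 hnd).swap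
  · obtain ⟨C₂, rfl⟩ := exists_cons_of_mem hm
    rw [add_cons, cons_inj_right] at e
    subst e
    obtain ⟨C₃, C₄, P₃, P₄, Γ', Θ', x', A', rfl, rfl, h3, hn', h4⟩ := h2.split _ _ rfl
    have := pairFacts_of_ordered h1 hn h3 hn' h4 hnd
    simpa [add_assoc] using this

/-- A linear structure on a configuration: a type for each channel and, for each node, the channel
that it provides and the channels that it uses. -/
structure Lin (Δ : QCtx Sg Chan) (D : Config L TN PN) (S : QCtx Sg Chan) (τ : Chan → QTy Sg)
    (prov : Node L TN PN → Chan) (U : Node L TN PN → Multiset Chan) : Prop where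
  nt : ∀ n ∈ D, NT Sg ((U n).map (fun c => (c, τ c))) n (prov n) (τ (prov n))
  nd : D.Nodup
  inj : ∀ n ∈ D, ∀ n' ∈ D, prov n = prov n' → n = n'
  prov_notMem : ∀ n ∈ D, prov n ∉ keys Δ
  use_nodup : ∀ n ∈ D, (U n).Nodup
  prov_notMem_use : ∀ n ∈ D, prov n ∉ U n
  use_disj : ∀ n ∈ D, ∀ n' ∈ D, ∀ c, c ∈ U n → c ∈ U n' → n = n'
  use_out : ∀ n ∈ D, ∀ c ∈ U n, c ∉ keys S
  use_src : ∀ n ∈ D, ∀ c ∈ U n, c ∈ keys Δ ∨ ∃ n' ∈ D, prov n' = c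
  out_src : ∀ c ∈ keys S, c ∈ keys Δ ∨ ∃ n' ∈ D, prov n' = c
  ty_in : ∀ p ∈ Δ, p.2 = τ p.1
  ty_out : ∀ p ∈ S, p.2 = τ p.1

theorem exists_types (Δ : QCtx Sg Chan) (h : (keys Δ).Nodup) :
    ∃ τ : Chan → QTy Sg, ∀ p ∈ Δ, p.2 = τ p.1 := by
  classical
  induction Δ using Multiset.induction with
  | empty => exact ⟨fun _ => Sg.q .one, by simp⟩
  | cons p Δ ih =>
    obtain ⟨x, A⟩ := p
    rw [keys_cons, nodup_cons] at h
    obtain ⟨τ, hτ⟩ := ih h.2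
    refine ⟨Function.update τ x A, fun p hp => ?_⟩
    rcases mem_cons.1 hp with rfl | hp'
    · simp
    · rw [Function.update_of_ne, hτ p hp']
      rintro rfl
      exact h.1 (mem_keys hp')

theorem Flat.lin {Δ S : QCtx Sg Chan} (h : Flat Sg Δ D P S) (hnd : (keys Δ + P).Nodup) :
    ∃ τ prov U, Lin Δ D S τ prov U ∧ P = D.map prov := by
  classical
  induction h with
  | nil =>
    obtain ⟨τ, hτ⟩ := exists_types Δ (by simpa using hnd)
    exact ⟨τ, fun _ => ⟨0, 0⟩, fun _ => 0, by
      constructor <;> first | exact hτ | simp +contextual, rfl⟩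
  | snoc D P Γ Θ n x A h hn ih =>
    rw [add_cons, nodup_cons] at hnd
    obtain ⟨hx, hnd⟩ := hnd
    obtain ⟨τ, prov, U, l, rfl⟩ := ih hnd
    have hnD : n ∉ D := fun hmem => hx (h.chans x (mem_confChans hmem hn.prov_mem))
    have kle := h.keys_le
    have lout := l.out_src
    have luse := l.use_out
    rw [keys_add] at kle lout luse
    have hxΓΘ : x ∉ keys Γ + keys Θ := fun h => hx (mem_of_le kle h)
    have hnd' := nodup_of_le kle hnd
    rw [nodup_add, Multiset.disjoint_left] at hnd'
    rw [mem_add, not_or] at hxΓΘ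
    rw [mem_add, not_or] at hx
    have hpx : ∀ m ∈ D, prov m ≠ x := fun m hm e => hx.2 (mem_map.2 ⟨m, hm, e⟩)
    obtain ⟨τ', hτ, hτx⟩ : ∃ τ' : Chan → QTy Sg, (∀ c, c ≠ x → τ' c = τ c) ∧ τ' x = A :=
      ⟨Function.update τ x A, fun c hc => Function.update_of_ne hc _ _, Function.update_self ..⟩
    obtain ⟨prov', hp, hpn⟩ : ∃ prov' : Node L TN PN → Chan, (∀ m ∈ D, prov' m = prov m) ∧
        prov' n = x := ⟨Function.update prov n x,
      fun m hm => Function.update_of_ne (ne_of_mem_of_not_mem hm hnD) _ _, Function.update_self ..⟩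
    obtain ⟨U', hU, hUn⟩ : ∃ U' : Node L TN PN → Multiset Chan, (∀ m ∈ D, U' m = U m) ∧
        U' n = keys Γ := ⟨Function.update U n (keys Γ),
      fun m hm => Function.update_of_ne (ne_of_mem_of_not_mem hm hnD) _ _, Function.update_self ..⟩
    have hΓ : (keys Γ).map (fun c => (c, τ' c)) = Γ := by
      rw [keys, map_map]
      conv_rhs => rw [← map_id Γ]
      refine Multiset.map_congr rfl (fun p hp => ?_)
      have hp1 : p.1 ≠ x := fun e => hxΓΘ.1 (e ▸ mem_keys hp)
      have := l.ty_out p (mem_add.2 (Or.inl hp))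
      simp only [Function.comp_apply, hτ _ hp1, ← this, id]
    refine ⟨τ', prov', U', ?_, ?_⟩
    · constructor
      case nt =>
        intro m hm
        rcases mem_cons.1 hm with rfl | hm
        · simpa [hΓ, hpn, hUn, hτx] using hn
        · rw [hp m hm, hU m hm, hτ _ (by grind)]
          convert l.nt m hm using 1
          refine Multiset.map_congr rfl (fun c hc => ?_)
          rw [hτ]
          have := l.use_src m hm c hc
          grind
      case nd => exact nodup_cons.2 ⟨hnD, l.nd⟩
      case inj => have := l.inj; grind
      case prov_notMem => have := l.prov_notMem; grind
      case use_nodup => have := l.use_nodup; grind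
      case prov_notMem_use => have := l.prov_notMem_use; grind
      case use_disj => have := l.use_disj; grind
      case use_out => have := l.use_src; rw [keys_cons]; grind
      case use_src => have := l.use_src; grind
      case out_src => rw [keys_cons]; grind
      case ty_in =>
        intro p hp'
        rw [hτ _ fun e => hx.1 (e ▸ mem_keys hp'), l.ty_in p hp']
      case ty_out =>
        intro p hp'
        rcases mem_cons.1 hp' with rfl | hp'
        · exact hτx.symm
        · rw [hτ _ fun e => hxΓΘ.2 (e ▸ mem_keys hp'), l.ty_out p (mem_add.2 (Or.inr hp'))]
    · rw [map_cons, hpn, Multiset.map_congr rfl hp]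

/-! ### Typed configurations as sequences -/

theorem dom_add (Δ Δ' : Ctx L TN Chan) : dom (Δ + Δ') = dom Δ ∪ dom Δ' := by
  ext c; simp [dom, exists_or]

theorem dom_cons (x : Chan) (A : Ty L TN) (Δ : Ctx L TN Chan) :
    dom ((x, A) ::ₘ Δ) = {x} ∪ dom Δ := by
  ext c; simp [dom, exists_or]

theorem dom_zero : dom (0 : Ctx L TN Chan) = ∅ := by ext; simp [dom]

theorem dom_singleton (x : Chan) (A : Ty L TN) : dom ({(x, A)} : Ctx L TN Chan) = {x} := by
  ext c; simp [dom]

theorem mem_dom {Δ : Ctx L TN Chan} {c : Chan} : c ∈ dom Δ ↔ c ∈ keys Δ := by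
  simp [dom, keys]

theorem dom_ctxEq {Δ Δ' : Ctx L TN Chan} (h : Sg.CtxEq Δ Δ') : dom Δ = dom Δ' := by
  ext c
  constructor
  · rintro ⟨A, hA⟩
    obtain ⟨q, hq, h1, -⟩ := Multiset.exists_mem_of_rel_of_mem h hA
    exact ⟨q.2, by rw [show c = q.1 from h1]; exact hq⟩
  · rintro ⟨A, hA⟩
    have h' : Multiset.Rel (fun p q : Chan × Ty L TN => q.1 = p.1 ∧ Sg.TyEq q.2 p.2) Δ' Δ :=
      Multiset.rel_flip.2 h
    obtain ⟨q, hq, h1, -⟩ := Multiset.exists_mem_of_rel_of_mem h' hA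
    exact ⟨q.2, by rw [show c = q.1 from h1.symm]; exact hq⟩

theorem ConfTyped.flat (hSg : Sg.WF) {Δ S : Ctx L TN Chan} (h : ConfTyped Sg Δ D S) :
    ∃ P, Flat Sg (Sg.qc Δ) D P (Sg.qc S) ∧ (keys (Sg.qc Δ) + P).Nodup := by
  have node : ∀ Δ₀ Δ₀' Δ C x A
      n, (∃ P, Flat Sg (Sg.qc Δ₀) C P (Sg.qc Δ) ∧
        (keys (Sg.qc Δ₀) + P).Nodup) → NT Sg (Sg.qc (Δ₀' + Δ)) n x (Sg.q A) →
      (x ::ₘ Δ₀'.map Prod.fst).Nodup →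
      Disjoint (dom Δ₀ ∪ confChans C ∪ dom Δ) ({x} ∪ dom Δ₀') →
      ∃ P, Flat Sg (Sg.qc (Δ₀ + Δ₀')) (C + {n}) P (Sg.qc {(x, A)}) ∧
        (keys (Sg.qc (Δ₀ + Δ₀')) + P).Nodup := by
    rintro Δ₀ Δ₀' Δ C x A n ⟨P, h, hnd⟩ hn hnd' hd
    refine ⟨P + {x}, ?_, ?_⟩
    · have h1 := h.frame (Sg.qc Δ₀')
      rw [← qc_add] at h1
      refine h1.trans ?_
      have h2 := Flat.single hn 0
      simpa [add_comm] using h2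
    · rw [disjoint_left] at hd
      have e : keys (Sg.qc (Δ₀ + Δ₀')) + (P + {x}) =
          (keys (Sg.qc Δ₀) + P) + (x ::ₘ keys Δ₀') := by
        simp only [qc_add, keys_add, keys_qc, ← singleton_add]; abel
      rw [e, nodup_add]
      refine ⟨hnd, hnd', ?_⟩
      rw [Multiset.disjoint_left]
      intro c hc hc'
      refine hd (a := c) ?_ ?_
      · rcases mem_add.1 hc with hc | hc
        · rw [keys_qc] at hc; exact Or.inl (Or.inl (mem_dom.2 hc))
        · exact Or.inl (Or.inr (h.prov_sub c hc))
      · rcases mem_cons.1 hc' with hc | hc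
        · exact Or.inl hc
        · exact Or.inr (mem_dom.2 hc)
  induction h with
  | emp₁ x A => exact ⟨0, .nil _, by simp⟩
  | emp₂ => exact ⟨0, .nil _, by simp⟩
  | comp Δ₀ Δ₀' Δ C C₁ x A h h₁ hd ih ih1 =>
    obtain ⟨P, hP, hnd⟩ := ih
    obtain ⟨P', hP', hnd'⟩ := ih1
    refine ⟨P + P', ?_, ?_⟩
    · rw [qc_add, qc_cons]
      refine (hP.frame _).trans ?_
      have := hP'.frame (Sg.qc Δ)
      simpa [add_comm] using this
    · rw [disjoint_left] at hd
      have e : keys (Sg.qc (Δ₀ + Δ₀')) + (P + P') =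
          (keys (Sg.qc Δ₀) + P) + (keys (Sg.qc Δ₀') + P') := by
        simp only [qc_add, keys_add]; abel
      rw [e, nodup_add]
      refine ⟨hnd, hnd', ?_⟩
      rw [Multiset.disjoint_left]
      intro c hc hc'
      have aux : ∀ {Δ S : Ctx L TN Chan} {D : Config L TN PN} {P : Multiset Chan},
          Flat Sg (Sg.qc Δ) D P (Sg.qc S) → c ∈ keys (Sg.qc Δ) + P → c ∈ dom Δ ∪ confChans D := by
        intro Δ S D P h hc
        rcases mem_add.1 hc with hc | hc
        · rw [keys_qc] at hc; exact Or.inl (mem_dom.2 hc)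
        · exact Or.inr (h.prov_sub c hc)
      exact hd (a := c) (Or.inl (aux hP hc)) (Or.inl (aux hP' hc'))
  | proc Δ₀ Δ₀' Δ C x A P h hP hnd hd ih =>
    exact node _ _ _ _ _ _ _ ih (.proc _ _ _ _ (hP.quot hSg)) hnd hd
  | msg Δ₀ Δ₀' Δ C x A M h hM hnd hd ih =>
    exact node _ _ _ _ _ _ _ ih (.msg _ _ _ _ hM.quot) hnd hd
  | conv Δ₀ Δ₀' Δ Δ' C h h0 h₁ ih =>
    rwa [← (qc_eq hSg).2 h0, ← (qc_eq hSg).2 h₁]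

theorem ConfTyped.empty (Δ : Ctx L TN Chan) (h : (keys Δ).Nodup) : ConfTyped Sg Δ 0 Δ := by
  induction Δ using Multiset.induction with
  | empty => exact .emp₂
  | cons p Δ ih =>
    obtain ⟨x, A⟩ := p
    rw [keys_cons, nodup_cons] at h
    have := ConfTyped.comp Δ {(x, A)} Δ 0 0 x A (ih h.2) (.emp₁ x A) (by
      rw [disjoint_left]
      simp only [confChans_zero, dom_singleton, Set.union_empty, Set.union_self]
      rintro c hc rfl
      exact h.1 (mem_dom.1 hc))
    rwa [add_zero, add_comm, singleton_add] at this

theorem CtxEq.refl (hSg : Sg.WF) {V : Type} (Δ : Ctx L TN V) : Sg.CtxEq Δ Δ :=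
  (qc_eq hSg).1 rfl

theorem ConfTyped.split {Δ S : Ctx L TN Chan} (h : ConfTyped Sg Δ C S) :
    ∀ Γ Θ, S = Γ + Θ → ∃ Δ₁ Δ₂ C₁ C₂, Δ = Δ₁ + Δ₂ ∧ C = C₁ + C₂ ∧
      ConfTyped Sg Δ₁ C₁ Γ ∧ ConfTyped Sg Δ₂ C₂ Θ ∧
      Disjoint (dom Δ₁ ∪ confChans C₁ ∪ dom Γ) (dom Δ₂ ∪ confChans C₂ ∪ dom Θ) := by
  let Q : Ctx L TN Chan → Config L TN PN → Ctx L TN Chan → Ctx L TN Chan → Prop :=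
    fun Δ C Γ Θ => ∃ Δ₁ Δ₂ C₁ C₂, Δ = Δ₁ + Δ₂ ∧ C = C₁ + C₂ ∧
      ConfTyped Sg Δ₁ C₁ Γ ∧ ConfTyped Sg Δ₂ C₂ Θ ∧
      Disjoint (dom Δ₁ ∪ confChans C₁ ∪ dom Γ) (dom Δ₂ ∪ confChans C₂ ∪ dom Θ)
  have swap : ∀ {Δ C Γ Θ}, Q Δ C Γ Θ → Q Δ C Θ Γ := by
    rintro _ _ Γ Θ ⟨Δ₁, Δ₂, C₁, C₂, rfl, rfl, h1, h2, hd⟩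
    exact ⟨Δ₂, Δ₁, C₂, C₁, add_comm _ _, add_comm _ _, h2, h1, hd.symm⟩
  have right : ∀ {Δ S C}, ConfTyped Sg Δ C S → Q Δ C S 0 :=
    fun h => ⟨_, 0, _, 0, by simp, by simp, h, .emp₂, by simp [dom_zero, confChans_zero]⟩
  have one : ∀ {Δ C p}, ConfTyped Sg Δ C {p} → ∀ Γ Θ, {p} = Γ + Θ → Q Δ C Γ Θ := by
    intro Δ C p h
    have mem : ∀ {Γ Θ}, {p} = Γ + Θ → p ∈ Γ → Q Δ C Γ Θ := by
      intro Γ Θ e hp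
      obtain ⟨Γ, rfl⟩ := exists_cons_of_mem hp
      rw [cons_add, ← cons_zero, cons_inj_right, eq_comm, add_eq_zero] at e
      obtain ⟨rfl, rfl⟩ := e
      exact right h
    intro Γ Θ e
    rcases mem_add.1 (e ▸ mem_singleton_self p) with hp | hp
    exacts [mem e hp, swap (mem (e.trans (add_comm _ _)) hp)]
  induction h with
  | emp₁ x A => exact one (.emp₁ x A)
  | emp₂ =>
    intro Γ Θ e
    obtain ⟨rfl, rfl⟩ := add_eq_zero.1 e.symm
    exact right .emp₂
  | proc Δ₀ Δ₀' Δ C x A P h hP hnd hd ih => exact one (.proc _ _ _ _ _ _ _ h hP hnd hd)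
  | msg Δ₀ Δ₀' Δ C x A M h hM hnd hd ih => exact one (.msg _ _ _ _ _ _ _ h hM hnd hd)
  | conv Δ₀ Δ₀' Δ Δ' C h h0 h₁ ih =>
    rintro Γ Θ rfl
    obtain ⟨Γ', Θ', h3, h4, rfl⟩ := Multiset.rel_add_right.1 h₁
    obtain ⟨Δ₁, Δ₂, C₁, C₂, rfl, rfl, h1, h2, hd⟩ := ih _ _ rfl
    obtain ⟨Δ₁', Δ₂', h5, h6, rfl⟩ := Multiset.rel_add_left.1 h0
    refine ⟨Δ₁', Δ₂', C₁, C₂, rfl, rfl, .conv _ _ _ _ _ h1 h5 h3, .conv _ _ _ _ _ h2 h6 h4, ?_⟩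
    rwa [← dom_ctxEq h3, ← dom_ctxEq h4, ← dom_ctxEq h5, ← dom_ctxEq h6]
  | comp Δ₀ Δ₀' Δ C C₁ x A h h₁ hd ih ih1 =>
    have mem : ∀ {Γ Θ}, (x, A) ::ₘ Δ = Γ + Θ → (x, A) ∈ Γ → Q (Δ₀ + Δ₀') (C + C₁) Γ Θ := by
      intro Γ Θ e hp
      obtain ⟨Γ, rfl⟩ := exists_cons_of_mem hp
      rw [cons_add, cons_inj_right] at e
      subst e
      obtain ⟨Δ₁, Δ₂, D₁, D₂, rfl, rfl, h1, h2, hd'⟩ := ih _ _ rfl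
      simp only [disjoint_left, dom_add, confChans_add, mem_union] at hd hd'
      refine ⟨Δ₁ + Δ₀', Δ₂, D₁ + C₁, D₂, by abel, by abel, .comp _ _ _ _ _ _ _ h1 h₁ ?_, h2, ?_⟩
      · simp only [disjoint_left, mem_union]
        intro c h h'; exact hd (a := c) (by grind) h'
      · simp only [disjoint_left, dom_add, confChans_add, dom_cons, mem_union]
        intro c h h'
        by_cases hc : (c ∈ dom Δ₁ ∨ c ∈ confChans D₁) ∨ c ∈ dom Γ
        · exact hd' (a := c) hc h'
        · exact hd (a := c) (by grind) (by grind)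
    intro Γ Θ e
    rcases mem_add.1 (e ▸ mem_cons_self (x, A) Δ) with hp | hp
    exacts [mem e hp, swap (mem (e.trans (add_comm _ _)) hp)]

theorem Flat.confTyped (hSg : Sg.WF) {Δ S : QCtx Sg Chan} (h : Flat Sg Δ D P S) :
    (keys Δ + P).Nodup → ∀ Δ' S', Sg.qc Δ' = Δ → Sg.qc S' = S → ConfTyped Sg Δ' D S' := by
  induction h with
  | nil =>
    rintro hnd Δ' S' rfl e
    exact .conv _ _ _ _ _ (ConfTyped.empty Δ' (by simpa [keys_qc] using hnd)) (CtxEq.refl hSg _)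
      ((qc_eq hSg).1 e.symm)
  | snoc D P Γ Θ n x A h hn ih =>
    rintro hnd Δ' S' rfl e
    rw [add_cons, nodup_cons] at hnd
    obtain ⟨hx, hnd⟩ := hnd
    obtain ⟨Γ₀, A₀, hΓ, hA, ht⟩ : ∃ Γ₀ A₀, Sg.qc Γ₀ = Γ ∧ Sg.q A₀ = A ∧
        ∀ Δ₁ C₁, ConfTyped Sg Δ₁ C₁ Γ₀ → Disjoint (dom Δ₁ ∪ confChans C₁ ∪ dom Γ₀) {x} →
          ConfTyped Sg Δ₁ (C₁ + {n}) {(x, A₀)} := by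
      cases hn with
      | proc _ _ P ht =>
        obtain ⟨Γ₀, hΓ⟩ := qc_surjective Γ
        obtain ⟨A₀, hA⟩ := Quot.exists_rep A
        refine ⟨Γ₀, A₀, hΓ, hA, fun Δ₁ C₁ h1 hd => ?_⟩
        have := ConfTyped.proc Δ₁ 0 Γ₀ C₁ x A₀ _ h1
          (by simpa using QTyped.lift hSg ht Γ₀ A₀ hΓ hA) (by simp) (by simpa [dom_zero] using hd)
        simpa using this
      | msg _ M _ ht =>
        obtain ⟨Γ₀, A₀, hΓ, hA, ht⟩ := QMsg.lift ht
        refine ⟨Γ₀, A₀, hΓ, hA, fun Δ₁ C₁ h1 hd => ?_⟩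
        have := ConfTyped.msg Δ₁ 0 Γ₀ C₁ x A₀ _ h1
          (by simpa using ht) (by simp) (by simpa [dom_zero] using hd)
        simpa using this
    obtain ⟨Θ₀, hΘ⟩ := qc_surjective Θ
    subst hΓ hA hΘ
    have hx' : ∀ c ∈ dom Δ' ∪ confChans D ∪ dom (Γ₀ + Θ₀), c ≠ x := by
      rintro c hc rfl
      refine hx ?_
      rcases hc with (hc | hc) | hc
      · rw [keys_qc]; exact mem_add.2 (Or.inl (mem_dom.1 hc))
      · exact h.chans _ hc
      · exact mem_of_le h.keys_le (by rw [← qc_add, keys_qc]; exact mem_dom.1 hc)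
    obtain ⟨Δ₁, Δ₂, C₁, C₂, rfl, rfl, h1, h2, hd⟩ :=
      ConfTyped.split (ih hnd Δ' (Γ₀ + Θ₀) rfl (by simp)) Γ₀ Θ₀ rfl
    simp only [dom_add, confChans_add, mem_union] at hx'
    simp only [disjoint_left, mem_union] at hd
    have h3 := ht Δ₁ C₁ h1 (by
      simp only [disjoint_left, mem_union, mem_singleton_iff]
      intro c hc; exact hx' c (by grind))
    have h4 := ConfTyped.comp _ _ _ _ _ _ _ h2 h3 (by
      simp only [disjoint_left, mem_union, confChans_add, confChans_singleton,
        mem_singleton_iff]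
      intro c hc hc'
      have hcx := hx' c (by grind)
      rcases hc' with (hc' | hc' | hc') | hc'
      · exact hd (a := c) (by grind) hc
      · exact hd (a := c) (by grind) hc
      · rcases hn.chans c hc' with h' | h'
        · rw [keys_qc] at h'
          exact hd (a := c) (Or.inr (mem_dom.2 h')) hc
        · exact hcx h'
      · exact hcx hc')
    have h5 : ConfTyped Sg (Δ₁ + Δ₂) (n ::ₘ (C₁ + C₂)) ((x, A₀) ::ₘ Θ₀) := by
      convert h4 using 1
      · abel
      · rw [← singleton_add]; abel
    exact .conv _ _ _ _ _ h5 (CtxEq.refl hSg _) ((qc_eq hSg).1 (by simp [e]))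

end flat

section

variable {L TN PN : Type} {Sg : Signature L TN PN}
  {B C D D' D₁ D₁' D₂ D₂' G S₁ U V W X X₁ Y Z a : Config L TN PN} {Γ Δ Δ' : Ctx L TN Chan}
  {c x y : Chan} {A T T' : Ty L TN} {K K' : Root L TN} {n n' : Node L TN PN}
  {b m : ℕ} {N N' : Set ℕ} {S : QCtx Sg Chan} {P : Proc L TN PN Chan}
  {M : Msg L} {π : Equiv.Perm ℕ} {oM : Option (Msg L)} {I : Finset L}

/-! ### Trees -/

/-- The context `S` consists of the root `K`. -/
def RootQ (Sg : Signature L TN PN) (K : Root L TN) (S : QCtx Sg Chan) : Prop :=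
  match K with
  | some (x, A) => S = {(x, Sg.q A)}
  | none => ∃ z, S = {(z, Sg.q .one)}

/-- The typing part of `Tree`, over topologically sorted configurations. -/
def QTree (Sg : Signature L TN PN) (Δ : Ctx L TN Chan) (K : Root L TN) (D : Config L TN PN) : Prop :=
  ∃ P S, Flat Sg (Sg.qc Δ) D P S ∧ (keys (Sg.qc Δ) + P).Nodup ∧ RootQ Sg K S

theorem tree_iff (hSg : Sg.WF) : Tree Sg Δ K D ↔ QTree Sg Δ K D ∧ Lineage Δ K D := by
  unfold Tree QTree
  refine and_congr_left fun _ => ?_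
  rcases K with _ | ⟨x, A⟩
  · constructor
    · rintro ⟨z, h⟩
      obtain ⟨P, h, hnd⟩ := ConfTyped.flat hSg h
      exact ⟨P, _, h, hnd, z, rfl⟩
    · rintro ⟨P, S, h, hnd, z, rfl⟩
      exact ⟨z, h.confTyped hSg hnd _ _ rfl rfl⟩
  · constructor
    · intro h
      obtain ⟨P, h, hnd⟩ := ConfTyped.flat hSg h
      exact ⟨P, _, h, hnd, rfl⟩
    · rintro ⟨P, S, h, hnd, rfl⟩
      exact h.confTyped hSg hnd _ _ rfl rfl

theorem RootQ.mem (h : RootQ Sg K S) (hK : K = some (x, A)) : (x, Sg.q A) ∈ S := by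
  subst hK
  rw [show S = _ from h]
  exact mem_singleton_self _

theorem Flat.allChans {P : Multiset Chan} (h : Flat Sg (Sg.qc Δ) D P S) (hS : RootQ Sg K S)
    (c : Chan) : c ∈ allChans Δ K D ↔ c ∈ dom Δ ∨ c ∈ P := by
  constructor
  · rintro ((hc | ⟨A, hA⟩) | hc)
    · exact Or.inl hc
    · have := mem_of_le h.keys_le (mem_keys (hS.mem hA))
      rw [keys_qc, mem_add, ← mem_dom] at this
      exact this
    · have := h.chans c hc
      rw [keys_qc, mem_add, ← mem_dom] at this
      exact this
  · rintro (hc | hc)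
    · exact Or.inl (Or.inl hc)
    · exact Or.inr (h.prov_sub c hc)

/-- A linear structure on a tree. -/
structure TreeLin (Δ : Ctx L TN Chan) (K : Root L TN) (D : Config L TN PN) (S : QCtx Sg Chan)
    (τ : Chan → QTy Sg) (prov : Node L TN PN → Chan) (U : Node L TN PN → Multiset Chan) : Prop
    extends Lin (Sg.qc Δ) D S τ prov U where
  root : RootQ Sg K S
  chans : ∀ c, c ∈ allChans Δ K D ↔ c ∈ dom Δ ∨ ∃ n ∈ D, prov n = c

theorem Tree.lin (hSg : Sg.WF) (t : Tree Sg Δ K D) :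
    ∃ S τ prov U, TreeLin (Sg := Sg) Δ K D S τ prov U := by
  obtain ⟨⟨P, S, h, hnd, hS⟩, -⟩ := (tree_iff hSg).1 t
  obtain ⟨τ, prov, U, l, rfl⟩ := h.lin hnd
  exact ⟨S, τ, prov, U, l, hS, fun c => by rw [h.allChans hS, mem_map]⟩

theorem Tree.nodup (hSg : Sg.WF) (t : Tree Sg Δ K D) : D.Nodup := by
  obtain ⟨_, _, _, _, l⟩ := t.lin hSg
  exact l.nd

theorem Tree.nodup_ctx (hSg : Sg.WF) (t : Tree Sg Δ K D) : (keys Δ).Nodup := by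
  obtain ⟨⟨P, S, h, hnd, hS⟩, -⟩ := (tree_iff hSg).1 t
  rw [keys_qc] at hnd
  exact nodup_of_le (Multiset.le_add_right _ _) hnd

theorem Lin.ev (hSg : Sg.WF) {Δ : QCtx Sg Chan} {τ : Chan → QTy Sg} {prov : Node L TN PN → Chan}
    {U : Node L TN PN → Multiset Chan} (l : Lin Δ D S τ prov U) (hn : n ∈ D) {b : Bool}
    (he : Ev b y n) : (prov n = y ∧ QPol b (τ y)) ∨ (y ∈ U n ∧ QPol (!b) (τ y)) := by
  rcases (l.nt n hn).ev_pol hSg he with ⟨rfl, h⟩ | ⟨B, h, hB⟩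
  · exact Or.inl ⟨rfl, h⟩
  · obtain ⟨c, hc, e⟩ := mem_map.1 h
    cases e
    exact Or.inr ⟨hc, hB⟩

/-- At most one node sends along a given channel, and at most one node receives along it. -/
theorem Lin.ev_unique (hSg : Sg.WF) {Δ : QCtx Sg Chan} {τ : Chan → QTy Sg}
    {prov : Node L TN PN → Chan} {U : Node L TN PN → Multiset Chan} (l : Lin Δ D S τ prov U)
    (hn : n ∈ D) (hn' : n' ∈ D) {b : Bool} (he : Ev b y n) (he' : Ev b y n') : n = n' := by
  rcases l.ev hSg hn he with ⟨h1, h2⟩ | ⟨h1, h2⟩ <;> rcases l.ev hSg hn' he' with ⟨h3, h4⟩ | ⟨h3, h4⟩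
  · exact l.inj n hn n' hn' (h1.trans h3.symm)
  · have := QPol.unique hSg h2 h4; cases b <;> simp at this
  · have := QPol.unique hSg h2 h4; cases b <;> simp at this
  · exact l.use_disj n hn n' hn' y h1 h3

theorem Tree.ev_unique (hSg : Sg.WF) (t : Tree Sg Δ K D) (hn : n ∈ D) (hn' : n' ∈ D) {b : Bool}
    (he : Ev b y n) (he' : Ev b y n') : n = n' := by
  obtain ⟨_, _, _, _, l⟩ := t.lin hSg
  exact l.ev_unique hSg hn hn' he he'

theorem Tree.ev_ctx (hSg : Sg.WF) (t : Tree Sg Δ K D) (hy : (y, T) ∈ Δ) (hn : n ∈ D) {b : Bool}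
    (he : Ev b y n) : (Sg.unf T).Pol (!b) := by
  obtain ⟨_, _, _, _, l⟩ := t.lin hSg
  have hy' : (y, Sg.q T) ∈ Sg.qc Δ := mem_map.2 ⟨_, hy, rfl⟩
  have := l.ty_in _ hy'
  rcases l.ev hSg hn he with ⟨h1, h2⟩ | ⟨h1, h2⟩
  · exact absurd (h1 ▸ mem_keys hy') (l.prov_notMem n hn)
  · rw [← this] at h2
    exact (qpol_q hSg).1 h2

theorem Tree.ev_root (hSg : Sg.WF) (t : Tree Sg Δ (some (y, T)) D) (hn : n ∈ D) {b : Bool}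
    (he : Ev b y n) : (Sg.unf T).Pol b := by
  obtain ⟨_, _, _, _, l⟩ := t.lin hSg
  have hy := l.root.mem rfl
  have := l.ty_out _ hy
  rcases l.ev hSg hn he with ⟨h1, h2⟩ | ⟨h1, h2⟩
  · rw [← this] at h2
    exact (qpol_q hSg).1 h2
  · exact absurd (mem_keys hy) (l.use_out n hn y h1)

/-- A channel along which one node sends and another one receives is internal. -/
theorem Tree.ev_internal (hSg : Sg.WF) (t : Tree Sg Δ K D) (hn : n ∈ D) (hn' : n' ∈ D)
    (he : Ev true y n) (he' : Ev false y n') : y ∉ ifaceChans Δ K := by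
  rintro (⟨T, hT⟩ | ⟨T, rfl⟩)
  · have := Ty.Pol.unique (t.ev_ctx hSg hT hn he) (t.ev_ctx hSg hT hn' he')
    simp at this
  · have := Ty.Pol.unique (t.ev_root hSg hn he) (t.ev_root hSg hn' he')
    simp at this

theorem Proc.SendsOn.mem_names {V : Type} {y : V} {P : Proc L TN PN V} (h : P.SendsOn y) :
    y ∈ P.names := by
  cases h
  · exact Or.inl rfl
  · exact Or.inl (Or.inr rfl)

theorem Node.ev_mem {b : Bool} (h : Ev b y n) : y ∈ n.chans := by
  cases h with
  | msg M => exact M.carrier_mem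
  | sends x y P h => exact Or.inr h.mem_names
  | waits x y P h => exact Or.inr h.mem_names

theorem Msg.Links.ev (h : M.Links y) : Ev true y (.msg M : Node L TN PN) := by
  have := Ev.msg (L := L) (TN := TN) (PN := PN) M
  rwa [h.carrier] at this

theorem Tree.succ_notMem_of_sendsOn (hSg : Sg.WF) (t : Tree Sg Δ K D) (hn : .proc x P ∈ D)
    (h : P.SendsOn y) : y.succ ∉ allChans Δ K D := by
  intro hs
  obtain ⟨M, hM, hl⟩ := t.2 y (Or.inr (mem_confChans hn (Or.inr h.mem_names))) _ hs rfl
    (Nat.lt_succ_self _)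
  cases t.ev_unique hSg hM hn hl.ev (.sends x y P h)

theorem Tree.root_notMem (hSg : Sg.WF) (t : Tree Sg Δ (some (x, A)) D) (hD : D ≠ 0) :
    x ∉ dom Δ := by
  obtain ⟨⟨P, S, h, hnd, hS⟩, -⟩ := (tree_iff hSg).1 t
  change S = _ at hS
  cases h with
  | nil => exact absurd rfl hD
  | snoc D P Γ Θ n x' A h hn =>
    rw [← cons_zero, cons_eq_cons] at hS
    simp only [Multiset.zero_ne_cons, and_false, exists_const, or_false, Prod.mk.injEq] at hS
    obtain ⟨⟨rfl, -⟩, -⟩ := hS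
    rw [keys_qc, nodup_add, Multiset.disjoint_left] at hnd
    intro hx
    exact hnd.2.2 (mem_dom.1 hx) (by simp)

theorem Tree.zero_some (hSg : Sg.WF) (t : Tree Sg Δ (some (x, A)) (0 : Config L TN PN)) :
    Sg.qc Δ = {(x, Sg.q A)} := by
  obtain ⟨⟨P, S, h, hnd, hS⟩, -⟩ := (tree_iff hSg).1 t
  generalize hD : (0 : Config L TN PN) = D at h
  cases h with
  | nil => exact hS
  | snoc => exact absurd hD Multiset.zero_ne_cons

/-- The class of a root. -/
def Signature.rq (Sg : Signature L TN PN) (K : Root L TN) : Option (Chan × QTy Sg) :=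
  K.map (Prod.map id Sg.q)

theorem ifaceChans_conv (h : Sg.qc Δ = Sg.qc Δ') (hK : Sg.rq K = Sg.rq K') :
    ifaceChans Δ K = ifaceChans Δ' K' := by
  have h1 : dom Δ = dom Δ' := by
    ext c
    rw [mem_dom, mem_dom, ← keys_qc (Sg := Sg), h, keys_qc]
  rw [ifaceChans, ifaceChans, h1]
  congr 1
  rcases K with _ | ⟨x, A⟩ <;> rcases K' with _ | ⟨x', A'⟩ <;> simp [Signature.rq] at hK ⊢
  rw [hK.1]

theorem Tree.conv (hSg : Sg.WF) (t : Tree Sg Δ K D) (h : Sg.qc Δ = Sg.qc Δ')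
    (hK : Sg.rq K = Sg.rq K') : Tree Sg Δ' K' D := by
  rw [tree_iff hSg] at t ⊢
  obtain ⟨⟨P, S, hF, hnd, hS⟩, hl⟩ := t
  refine ⟨⟨P, S, h ▸ hF, h ▸ hnd, ?_⟩, ?_⟩
  · rcases K with _ | ⟨x, A⟩ <;> rcases K' with _ | ⟨x', A'⟩ <;> simp [Signature.rq] at hK
    · exact hS
    · change S = _
      rw [show S = _ from hS, hK.1, hK.2]
  · unfold Lineage allChans at hl ⊢
    rwa [← ifaceChans_conv h hK]

theorem Lineage.ren (h : Lineage Δ K D) (π : Equiv.Perm ℕ) :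
    Lineage (ctxren π Δ) (rootren π K) (cren π D) := by
  unfold Lineage
  rw [allChans_ren]
  rintro _ ⟨c, hc, rfl⟩ _ ⟨c', hc', rfl⟩ hb hg
  obtain ⟨M, hM, hl⟩ := h c hc c' hc' (π.injective hb) hg
  exact ⟨_, mem_map.2 ⟨_, hM, rfl⟩, hl.ren π⟩

theorem qc_ctxren (π : Equiv.Perm ℕ) (Δ : Ctx L TN Chan) :
    Sg.qc (ctxren π Δ) = (Sg.qc Δ).map (Prod.map (Chan.rename π) id) := qc_map _ _

theorem keys_ren {α : Type} (π : Equiv.Perm ℕ) (Δ : Multiset (Chan × α)) :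
    keys (Δ.map (Prod.map (Chan.rename π) id)) = (keys Δ).map (Chan.rename π) := by
  simp only [keys, map_map]; rfl

theorem Tree.ren (hSg : Sg.WF) (t : Tree Sg Δ K D) (π : Equiv.Perm ℕ) :
    Tree Sg (ctxren π Δ) (rootren π K) (cren π D) := by
  rw [tree_iff hSg] at t ⊢
  obtain ⟨⟨P, S, hF, hnd, hS⟩, hl⟩ := t
  refine ⟨⟨_, _, by rw [qc_ctxren]; exact hF.ren π, ?_, ?_⟩, hl.ren π⟩
  · rw [qc_ctxren, keys_ren, ← Multiset.map_add]
    exact hnd.map (Chan.rename_injective π)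
  · rcases K with _ | ⟨x, A⟩
    · obtain ⟨z, rfl⟩ := hS
      exact ⟨z.rename π, rfl⟩
    · change _ = _ at hS
      subst hS
      rfl

theorem Tree.alpha (hSg : Sg.WF) (t : Tree Sg Δ K D) (h : Fixes π Δ K) :
    Tree Sg Δ K (cren π D) := by
  have := t.ren hSg π
  rwa [h.ctx, h.root] at this

theorem allChans_add (Δ : Ctx L TN Chan) (K : Root L TN) (C D : Config L TN PN) :
    allChans Δ K (C + D) = allChans Δ K C ∪ confChans D := by
  rw [allChans, allChans, confChans_add, union_assoc]

theorem ifaceChans_cons (u : Chan) (T : Ty L TN) (Δ : Ctx L TN Chan) (K : Root L TN) :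
    ifaceChans ((u, T) ::ₘ Δ) K = {u} ∪ ifaceChans Δ K := by
  rw [ifaceChans, dom_cons, union_assoc]; rfl

/-- Cut: linking two trees that are named apart. -/
theorem Tree.cut (hSg : Sg.WF) {u : Chan} (tC : Tree Sg Δ' (some (u, T)) C)
    (tD : Tree Sg ((u, T) ::ₘ Δ) K D) (ha : Apart (u, T) Δ' C Δ K D) :
    Tree Sg (Δ' + Δ) K (C + D) := by
  have uC : u ∈ allChans Δ' (some (u, T)) C := Or.inl (Or.inr ⟨T, rfl⟩)
  have uD : u ∈ allChans ((u, T) ::ₘ Δ) K D := Or.inl (Or.inl ⟨T, by simp⟩)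
  have clash : ∀ M M', .msg M ∈ C → .msg M' ∈ D → M.Links u → ¬ M'.Links u := by
    intro M M' hM hM' hl hl'
    have := Ty.Pol.unique (tC.ev_root hSg hM hl.ev)
      (tD.ev_ctx hSg (mem_cons_self _ _) hM' hl'.ev)
    simp at this
  obtain ⟨⟨P, S, hF, hnd, hS⟩, hl⟩ := (tree_iff hSg).1 tC
  obtain ⟨⟨P', S', hF', hnd', hS'⟩, hl'⟩ := (tree_iff hSg).1 tD
  have cC := hF.allChans hS
  have cD := hF'.allChans hS'
  rw [tree_iff hSg]
  refine ⟨⟨P + P', S', ?_, ?_, hS'⟩, ?_⟩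
  · change S = _ at hS
    subst hS
    rw [qc_add]
    refine (hF.frame (Sg.qc Δ)).trans ?_
    rwa [singleton_add, ← qc_cons]
  · rw [qc_cons, keys_cons, cons_add, nodup_cons] at hnd'
    have e : keys (Sg.qc (Δ' + Δ)) + (P + P') =
        (keys (Sg.qc Δ') + P) + (keys (Sg.qc Δ) + P') := by
      rw [qc_add, keys_add]; abel
    rw [e, nodup_add]
    refine ⟨hnd, hnd'.2, ?_⟩
    rw [Multiset.disjoint_left]
    intro c hc hc'
    have h1 : c ∈ ILST.allChans Δ' (some (u, T)) C := (cC c).2 (by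
      rwa [mem_add, keys_qc, ← mem_dom] at hc)
    have h2 : c ∈ ILST.allChans ((u, T) ::ₘ Δ) K D := (cD c).2 (by
      rw [mem_add, keys_qc, ← mem_dom] at hc'
      rw [dom_cons]
      exact hc'.imp_left Or.inr)
    exact hnd'.1 ((show c = u from (ha c h1 c h2).2 rfl) ▸ hc')
  · have sub : ∀ c ∈ ILST.allChans (Δ' + Δ) K (C + D), c ∈ ILST.allChans Δ' (some (u, T)) C ∨
        c ∈ ILST.allChans ((u, T) ::ₘ Δ) K D := by
      intro c hc
      rw [ILST.allChans, confChans_add, ifaceChans, dom_add] at hc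
      rw [ILST.allChans, ILST.allChans, ifaceChans_cons]
      rcases hc with ((hc | hc) | hc) | (hc | hc)
      · exact Or.inl (Or.inl (Or.inl hc))
      · exact Or.inr (Or.inl (Or.inr (Or.inl hc)))
      · exact Or.inr (Or.inl (Or.inr (Or.inr hc)))
      · exact Or.inl (Or.inr hc)
      · exact Or.inr (Or.inr hc)
    intro c hc c' hc' hb hg
    rcases sub c hc with h1 | h1 <;> rcases sub c' hc' with h2 | h2
    · obtain ⟨M, hM, h⟩ := hl c h1 c' h2 hb hg
      exact ⟨M, mem_add.2 (Or.inl hM), h⟩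
    · have hu := (ha c h1 c' h2).1 hb
      rcases lt_trichotomy c.gen u.gen with h | h | h
      · obtain ⟨M, hM, h⟩ := hl c h1 u uC hu h
        exact ⟨M, mem_add.2 (Or.inl hM), h⟩
      · obtain rfl : c = u := Chan.ext' hu h
        obtain ⟨M, hM, h⟩ := hl' c uD c' h2 hb hg
        exact ⟨M, mem_add.2 (Or.inr hM), h⟩
      · obtain ⟨M, hM, h⟩ := hl u uC c h1 hu.symm h
        obtain ⟨M', hM', h'⟩ := hl' u uD c' h2 (hu.symm.trans hb) (by omega)
        exact absurd h' (clash M M' hM hM' h)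
    · have hu := (ha c' h2 c h1).1 hb.symm
      rcases lt_trichotomy c.gen u.gen with h | h | h
      · obtain ⟨M, hM, h⟩ := hl' c h1 u uD (hb.trans hu) h
        exact ⟨M, mem_add.2 (Or.inr hM), h⟩
      · obtain rfl : c = u := Chan.ext' (hb.trans hu) h
        obtain ⟨M, hM, h⟩ := hl c uC c' h2 hb hg
        exact ⟨M, mem_add.2 (Or.inl hM), h⟩
      · obtain ⟨M', hM', h'⟩ := hl' u uD c h1 (hb.trans hu).symm h
        obtain ⟨M, hM, h⟩ := hl u uC c' h2 hu.symm (by omega)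
        exact absurd h' (clash M M' hM hM' h)
    · obtain ⟨M, hM, h⟩ := hl' c h1 c' h2 hb hg
      exact ⟨M, mem_add.2 (Or.inr hM), h⟩

/-! ### Splitting a tree at a sent channel -/

theorem QMsg.prov {Γ : QCtx Sg Chan} {A : QTy Sg} (h : QMsg Sg Γ M x A) :
    (x = M.carrier ∧ ((∃ y, M = .close y) ∨ M.carrier.succ ∈ keys Γ)) ∨
      (x = M.carrier.succ ∧ (∀ y, M ≠ .close y) ∧ M.carrier ∈ keys Γ) := by
  cases h
  · exact Or.inl ⟨rfl, Or.inr (by simp [keys, Msg.carrier])⟩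
  · exact Or.inr ⟨rfl, by simp, by simp [keys, Msg.carrier]⟩
  · exact Or.inl ⟨rfl, Or.inr (by simp [keys, Msg.carrier])⟩
  · exact Or.inr ⟨rfl, by simp, by simp [keys, Msg.carrier]⟩
  · exact Or.inl ⟨rfl, Or.inl ⟨_, rfl⟩⟩

/-- Two typings of a node differ in the provided channel only if the node is a message that links
the two channels. -/
theorem NT.prov_cases {Γ Γ' : QCtx Sg Chan} {x' : Chan} {A A' : QTy Sg} (h : NT Sg Γ n x A)
    (h' : NT Sg Γ' n x' A') : x = x' ∨
    (Ev true x n ∧ x' = x.succ ∧ x.succ ∈ keys Γ) ∨ (Ev true x' n ∧ x = x'.succ ∧ x' ∈ keys Γ) := by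
  cases h with
  | proc _ _ _ h => cases h' with | proc _ _ _ h' => exact Or.inl rfl
  | msg _ M _ h =>
    cases h' with | msg _ _ _ h' =>
    rcases h.prov with ⟨rfl, h1⟩ | ⟨rfl, h1, h2⟩ <;> rcases h'.prov with ⟨rfl, h3⟩ | ⟨rfl, h3, h4⟩
    · exact Or.inl rfl
    · exact Or.inr (Or.inl ⟨.msg _, rfl, h1.resolve_left (fun ⟨y, e⟩ => h3 y e)⟩)
    · exact Or.inr (Or.inr ⟨.msg _, rfl, h2⟩)
    · exact Or.inl rfl

theorem exists_gen_bound {α : Type*} (C : Multiset α) (f : α → ℕ) : ∃ N, ∀ n ∈ C, f n ≤ N := by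
  induction C using Multiset.induction with
  | empty => exact ⟨0, by simp⟩
  | cons a C ih =>
    obtain ⟨N, hN⟩ := ih
    refine ⟨max (f a) N, fun n hn => ?_⟩
    rcases mem_cons.1 hn with rfl | hn
    · exact le_max_left _ _
    · exact (hN n hn).trans (le_max_right _ _)

/-- In a part of a configuration that can be typed by itself, each node provides the channel that
it provides in the whole configuration. Only for a message the provided channel is not determined
by the node; a disagreement at one message entails a disagreement at the message for the next or the
preceding generation. -/
theorem Lin.prov_eq (hSg : Sg.WF) {Δ Δ' S' : QCtx Sg Chan} {τ τ' : Chan → QTy Sg}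
    {prov prov' : Node L TN PN → Chan} {U U' : Node L TN PN → Multiset Chan}
    (l : Lin Δ D S τ prov U) (l' : Lin Δ' C S' τ' prov' U') (hC : ∀ n ∈ C, n ∈ D)
    (hΔ : ∀ c ∈ keys Δ', ∀ n ∈ C, prov n ≠ c) : ∀ n ∈ C, prov' n = prov n := by
  have use : ∀ n c, c ∈ keys ((U' n).map (fun c => (c, τ' c))) → c ∈ U' n := by
    intro n c h
    obtain ⟨p, hp, rfl⟩ := mem_map.1 h
    obtain ⟨c, hc, rfl⟩ := mem_map.1 hp
    exact hc
  have hcase := fun n (hn : n ∈ C) => (l'.nt n hn).prov_cases (l.nt n (hC n hn))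
  have src : ∀ n ∈ C, ∀ c ∈ U' n, prov n = c → ∃ n' ∈ C, prov' n' = c := by
    intro n hn c hc hp
    exact (l'.use_src n hn c hc).resolve_left (fun h => hΔ c h n hn hp)
  obtain ⟨N, hN⟩ := exists_gen_bound C (fun n => (prov' n).gen)
  have up : ∀ k n, n ∈ C → Ev true (prov' n) n → prov n = (prov' n).succ →
      (prov' n).succ ∈ U' n → N + 1 ≤ (prov' n).gen + k → False := by
    intro k
    induction k with
    | zero => intro n hn _ _ _ h; have := hN n hn; omega
    | succ k ih =>
      intro n hn he hp hu hk
      obtain ⟨n', hn', h'⟩ := src n hn _ hu hp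
      have hne : n ≠ n' := by rintro rfl; exact Chan.succ_ne _ h'.symm
      rcases hcase n' hn' with h | ⟨h1, h2, h3⟩ | ⟨h1, h2, h3⟩
      · exact hne (l.inj n (hC n hn) n' (hC n' hn') (by rw [hp, ← h, h']))
      · refine ih n' hn' h1 h2 (use _ _ h3) ?_
        rw [h', Chan.succ_gen]; omega
      · have e : prov n' = prov' n := Chan.succ_inj (h2.symm.trans h')
        rw [e] at h1
        exact hne (l.ev_unique hSg (hC n hn) (hC n' hn') he h1)
  have up' : ∀ n ∈ C, Ev true (prov' n) n → prov n = (prov' n).succ → (prov' n).succ ∈ U' n →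
      False := fun n hn h1 h2 h3 => up (N + 1) n hn h1 h2 h3 (by omega)
  have down : ∀ k n, n ∈ C → prov' n = (prov n).succ → prov n ∈ U' n →
      (prov n).gen ≤ k → False := by
    intro k
    induction k using Nat.strong_induction_on with
    | _ k ih =>
      intro n hn hp hu hk
      obtain ⟨n', hn', h'⟩ := src n hn _ hu rfl
      have hne : n' ≠ n := by rintro rfl; exact Chan.succ_ne _ (hp.symm.trans h')
      rcases hcase n' hn' with h | ⟨h1, h2, h3⟩ | ⟨h1, h2, h3⟩
      · exact hne (l.inj n' (hC n' hn') n (hC n hn) (by rw [← h, h']))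
      · exact up' n' hn' h1 h2 (use _ _ h3)
      · have : (prov n).gen = (prov n').gen + 1 := by rw [← h', h2]; rfl
        exact ih (prov n').gen (by omega) n' hn' h2 (use _ _ h3) le_rfl
  intro n hn
  rcases hcase n hn with h | ⟨h1, h2, h3⟩ | ⟨h1, h2, h3⟩
  · exact h
  · exact (up' n hn h1 h2 (use _ _ h3)).elim
  · exact (down _ n hn h2 (use _ _ h3) le_rfl).elim

/-- If a tree consists of two trees and a message that carries a channel between them, the two trees
have no bases in common: by the discipline of generations, equal bases would be linked by messages,
which belong to one of the two. The message is along `y`. -/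
theorem Tree.split_disjoint (hSg : Sg.WF) {Δ₁ Δ₂ : Ctx L TN Chan} {K₁ K₂ : Root L TN}
    {S R : Config L TN PN} (hM : M.carrier = y) (t : Tree Sg Δ K (S + R + {.msg M}))
    (tS : Tree Sg Δ₁ K₁ S) (tR : Tree Sg Δ₂ K₂ R)
    (h : (Δ₁ + Δ₂ = Δ ∧ ∃ T, K = some (y, T)) ∨
      ∃ T B Δ₂', Δ₂ = (y.succ, B) ::ₘ Δ₂' ∧ Δ = (y, T) ::ₘ (Δ₁ + Δ₂')) :
    Disjoint (bases (allChans Δ₁ K₁ S)) (bases (allChans Δ₂ K₂ R)) := by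
  obtain ⟨W, τ, prov, U, l⟩ := t.lin hSg
  obtain ⟨W₁, τ₁, prov₁, U₁, l₁⟩ := tS.lin hSg
  obtain ⟨W₂, τ₂, prov₂, U₂, l₂⟩ := tR.lin hSg
  have mS : ∀ n ∈ S, n ∈ S + R + {.msg M} := fun n hn => by simp [hn]
  have mR : ∀ n ∈ R, n ∈ S + R + {.msg M} := fun n hn => by simp [hn]
  have mM : .msg M ∈ S + R + {.msg M} := by simp
  have nd := l.nd
  rw [nodup_add, nodup_add] at nd
  have dSR : ∀ n ∈ S, n ∉ R := fun n h h' => Multiset.disjoint_left.1 nd.1.2.2 h h'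
  have nM : ∀ n ∈ S + R, prov n ≠ prov (.msg M) := fun n hn h =>
    Multiset.disjoint_left.1 nd.2.2 hn (by simp [l.inj n (mem_add.2 (Or.inl hn)) _ mM h])
  have ndΔ := t.nodup_ctx hSg
  have pΔ : ∀ n ∈ S + R + {.msg M}, prov n ∉ dom Δ := fun n hn hc =>
    l.prov_notMem n hn (by rwa [keys_qc, ← mem_dom])
  have hsucc : y ∈ dom Δ → prov (.msg M) = y.succ := fun hy => by
    have hyp : prov (.msg M) ≠ y := fun e => pΔ _ mM (e ▸ hy)
    have := l.nt _ mM
    generalize prov (.msg M) = x at this hyp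
    cases this with | msg _ _ _ h =>
    rcases h.prov with ⟨rfl, -⟩ | ⟨rfl, -⟩
    · exact absurd hM hyp
    · rw [hM]
  -- the message provides `y` or `y.succ`, according to the side of the interface where `y` is
  have key : (∀ c ∈ dom Δ₁, c ∉ dom Δ₂) ∧ (∀ c ∈ dom Δ₂, ∀ n ∈ S + R, prov n ≠ c) ∧
      (∀ c ∈ dom Δ₁, ∀ n ∈ S + R, prov n ≠ c) ∧ y ∉ dom Δ₁ ∧ y ∉ dom Δ₂ ∧
      (∀ n ∈ S + R, prov n ≠ y) ∧ (∀ c ∈ dom Δ₁, c ∈ dom Δ) ∧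
      ∀ c ∈ dom Δ₂, c ∈ dom Δ ∨ prov (.msg M) = c := by
    have m' : ∀ n ∈ S + R, n ∈ S + R + {.msg M} := fun n hn => mem_add.2 (Or.inl hn)
    rcases h with ⟨rfl, T, rfl⟩ | ⟨T, B, Δ₂', rfl, rfl⟩
    · rw [keys_add, nodup_add, Multiset.disjoint_left] at ndΔ
      have hy : prov (.msg M) = y := by
        rcases l.ev hSg mM (hM ▸ .msg M : Ev true y (.msg M : Node L TN PN)) with h | h
        · exact h.1
        · exact absurd (mem_keys (l.root.mem rfl)) (l.use_out _ mM y h.1)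
      simp only [← mem_dom, dom_add, mem_union] at ndΔ pΔ ⊢
      grind
    · rw [keys_cons, nodup_cons, keys_add, nodup_add, Multiset.disjoint_left, mem_add] at ndΔ
      simp only [← mem_dom, dom_cons, dom_add, mem_union] at ndΔ pΔ hsucc ⊢
      have := Chan.succ_ne y
      grind
  obtain ⟨k, k2, k1, yS, yR, yP, s1, s2⟩ := key
  have aS : ∀ n ∈ S, n ∈ S + R := fun n hn => mem_add.2 (Or.inl hn)
  have aR : ∀ n ∈ R, n ∈ S + R := fun n hn => mem_add.2 (Or.inr hn)
  have e1 := l.prov_eq hSg l₁.toLin mS (fun c hc n hn =>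
    k1 c (by rwa [keys_qc, ← mem_dom] at hc) n (aS n hn))
  have e2 := l.prov_eq hSg l₂.toLin mR (fun c hc n hn =>
    k2 c (by rwa [keys_qc, ← mem_dom] at hc) n (aR n hn))
  have c0 := l.chans
  have c1 := l₁.chans
  have c2 := l₂.chans
  have inj := l.inj
  have disj : ∀ c ∈ allChans Δ₁ K₁ S, c ∉ allChans Δ₂ K₂ R := by grind
  have y1 : y ∉ allChans Δ₁ K₁ S := by grind
  have y2 : y ∉ allChans Δ₂ K₂ R := by grind
  have sub1 : ∀ c ∈ allChans Δ₁ K₁ S, c ∈ allChans Δ K (S + R + {.msg M}) := by grind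
  have sub2 : ∀ c ∈ allChans Δ₂ K₂ R, c ∈ allChans Δ K (S + R + {.msg M}) := by grind
  -- the next generation of a channel of one part is in the same part
  have walk : ∀ (k : ℕ) (c c' : Chan), c.base = c'.base → c.gen + k = c'.gen →
      (c ∈ allChans Δ₁ K₁ S → c' ∉ allChans Δ₂ K₂ R) ∧
      (c ∈ allChans Δ₂ K₂ R → c' ∉ allChans Δ₁ K₁ S) := by
    intro k
    induction k with
    | zero =>
      intro c c' hb hg
      obtain rfl : c = c' := Chan.ext' hb (by omega)
      exact ⟨disj c, fun h h' => disj c h' h⟩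
    | succ k ih =>
      intro c c' hb hg
      have next := ih c.succ c' hb (by simp; omega)
      have lk : ∀ {Γ K' V} {N : Msg L}, N.Links c → Node.msg N ∈ V →
          c ∈ allChans Γ K' V ∧ c.succ ∈ allChans Γ K' (V : Config L TN PN) := fun hl hN =>
        ⟨Or.inr (mem_confChans hN (Node.ev_mem hl.ev)),
          Or.inr (mem_confChans hN (by cases hl <;> simp [Node.chans, Msg.chans]))⟩
      have hy : ∀ {N : Msg L}, N.Links c → Node.msg N = (.msg M : Node L TN PN) → c = y := by
        rintro N hl ⟨⟩
        rw [← hM, hl.carrier]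
      refine ⟨fun h h' => ?_, fun h h' => ?_⟩
      · obtain ⟨N, hN, hl⟩ := t.2 c (sub1 c h) c' (sub2 c' h') hb (by omega)
        rw [mem_add, mem_add, mem_singleton] at hN
        rcases hN with (hN | hN) | hN
        exacts [next.1 (lk hl hN).2 h', disj c h (lk hl hN).1, y1 (hy hl hN ▸ h)]
      · obtain ⟨N, hN, hl⟩ := t.2 c (sub2 c h) c' (sub1 c' h') hb (by omega)
        rw [mem_add, mem_add, mem_singleton] at hN
        rcases hN with (hN | hN) | hN
        exacts [disj c (lk hl hN).1 h, next.2 (lk hl hN).2 h', y2 (hy hl hN ▸ h)]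
  rw [disjoint_left]
  rintro b ⟨c, hc, rfl⟩ ⟨c', hc', hb⟩
  rcases le_total c.gen c'.gen with hg | hg
  · exact (walk (c'.gen - c.gen) c c' hb.symm (by omega)).1 hc hc'
  · exact (walk (c.gen - c'.gen) c' c hb (by omega)).2 hc' hc

/-! ### Separated parts of a configuration -/

/-- The node is a process whose term can be typed with any additional channels. -/
def NodeAbs (n : Node L TN PN) : Prop := ∃ x P, n = .proc x P ∧ Absorb P

/-- Some node of the configuration can be typed with any additional channels. -/
def HasAbs (D : Config L TN PN) : Prop := ∃ n ∈ D, NodeAbs n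

theorem HasAbs.mono (h : HasAbs C) (hs : ∀ n ∈ C, n ∈ D) : HasAbs D := by
  obtain ⟨n, hn, ha⟩ := h
  exact ⟨n, hs n hn, ha⟩

theorem QMsg.keys_chans {Γ : QCtx Sg Chan} {A : QTy Sg} (h : QMsg Sg Γ M x A) :
    ∀ c ∈ keys Γ, c ∈ M.chans := by
  cases h <;> intro c hc <;> simp [keys, Msg.chans] at hc ⊢ <;> tauto

theorem NT.absorb {Γ : QCtx Sg Chan} {A : QTy Sg} (h : NT Sg Γ n x A) (hc : c ∈ keys Γ)
    (hn : c ∉ n.chans) : NodeAbs n := by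
  cases h with
  | proc _ _ _ h => exact ⟨_, _, rfl, h.absorb c hc (fun h => hn (Or.inr h))⟩
  | msg _ _ _ h => exact absurd (h.keys_chans c hc) hn

theorem NT.strengthen {Γ Ξ : QCtx Sg Chan} {A : QTy Sg} (h : NT Sg (Γ + Ξ) n x A)
    (hn : ∀ c ∈ keys Ξ, c ∉ n.chans) : NT Sg Γ n x A := by
  generalize e : Γ + Ξ = Γ' at h
  cases h with
  | proc _ _ _ h => exact .proc _ _ _ _ (h.strengthen Γ Ξ e.symm (fun v hv hv' => hn v hv (Or.inr hv')))
  | msg _ _ _ h =>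
    have : Ξ = 0 := by
      refine Multiset.eq_zero_of_forall_notMem (fun p hp => hn p.1 (mem_keys hp) ?_)
      exact h.keys_chans _ (mem_keys (by rw [← e]; exact mem_add.2 (Or.inr hp)))
    subst this
    rw [add_zero] at e
    subst e
    exact .msg _ _ _ _ h

theorem NT.weaken {Γ : QCtx Sg Chan} {A : QTy Sg} (h : NT Sg Γ n x A) (ha : NodeAbs n)
    (Ξ : QCtx Sg Chan) : NT Sg (Γ + Ξ) n x A := by
  obtain ⟨x', P, rfl, ha⟩ := ha
  cases h with
  | proc _ _ _ h => exact .proc _ _ _ _ (h.weaken ha Ξ)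

/-- A configuration with an absorbing node can be typed with additional channels. -/
theorem Flat.absorb {Δ : QCtx Sg Chan} {P : Multiset Chan} (h : Flat Sg Δ D P S) (ha : HasAbs D)
    (Ξ : QCtx Sg Chan) : Flat Sg (Δ + Ξ) D P S := by
  obtain ⟨n, hn, ha⟩ := ha
  obtain ⟨C, rfl⟩ := exists_cons_of_mem hn
  obtain ⟨C₁, C₂, P₁, P₂, Γ, Θ, x, A, rfl, rfl, h1, h2, h3⟩ := h.split n C rfl
  have e1 := h1.frame Ξ
  rw [show Γ + Θ + Ξ = (Γ + Ξ) + Θ by abel] at e1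
  have := (e1.trans (Flat.single (h2.weaken ha Ξ) Θ)).trans h3
  convert this using 1
  · simp only [← singleton_add]; abel
  · simp only [← singleton_add]; abel

/-- The outcome of typing two parts `G`, `U` of a configuration separately, when the channels of
`G` are in `A` and those of `U` are not. What `G` leaves are its part `S₁` of `S` and channels `W₁`
that `U` absorbs in the typing of the whole; likewise for `U`. -/
def Sep (A : Set Chan) (Δ₁ Δ₂ : QCtx Sg Chan) (G U : Config L TN PN) (P : Multiset Chan)
    (S : QCtx Sg Chan) : Prop :=
  ∃ P₁ P₂ S₁ S₂ W₁ W₂, P = P₁ + P₂ ∧ S = S₁ + S₂ ∧ (∀ c ∈ keys S₁, c ∈ A) ∧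
    (∀ c ∈ keys S₂, c ∉ A) ∧ Flat Sg Δ₁ G P₁ (S₁ + W₁) ∧ Flat Sg Δ₂ U P₂ (S₂ + W₂) ∧
    (S₂ = 0 → W₁ = 0) ∧ (S₁ = 0 → W₂ = 0) ∧
    (U ≠ 0 ∨ Δ₂ ≠ 0 → S₂ = 0 → HasAbs G) ∧ (G ≠ 0 ∨ Δ₁ ≠ 0 → S₁ = 0 → HasAbs U)

theorem Sep.symm {A : Set Chan} {Δ₁ Δ₂ : QCtx Sg Chan} {P : Multiset Chan}
    (h : Sep A Δ₁ Δ₂ G U P S) : Sep Aᶜ Δ₂ Δ₁ U G P S := by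
  obtain ⟨P₁, P₂, S₁, S₂, W₁, W₂, h1, h2, h3, h4, h5, h6, h7, h8, h9, h10⟩ := h
  exact ⟨P₂, P₁, S₂, S₁, W₂, W₁, by rw [h1, add_comm], by rw [h2, add_comm], h4,
    fun c hc => not_not.2 (h3 c hc), h6, h5, h8, h7, h10, h9⟩

theorem Sep.snoc {A : Set Chan} {Δ₁ Δ₂ Γ Θ : QCtx Sg Chan} {P : Multiset Chan} {B : QTy Sg}
    (h : Sep A Δ₁ Δ₂ G U P (Γ + Θ)) (hn : NT Sg Γ n x B) (hA : ∀ c ∈ n.chans, c ∈ A) :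
    Sep A Δ₁ Δ₂ (n ::ₘ G) U (x ::ₘ P) ((x, B) ::ₘ Θ) := by
  classical
  obtain ⟨P₁, P₂, S₁, S₂, W₁, W₂, rfl, h2, h3, h4, h5, h6, h7, h8, h9, h10⟩ := h
  have f1 : S₁ = Γ.filter (fun p => p.1 ∈ A) + Θ.filter (fun p => p.1 ∈ A) := by
    rw [← filter_add, h2, filter_add,
      Multiset.filter_eq_self.2 (fun p hp => h3 _ (mem_keys hp)),
      Multiset.filter_eq_nil.2 (fun p hp => h4 _ (mem_keys hp)), add_zero]
  have f2 : S₂ = Γ.filter (fun p => p.1 ∉ A) + Θ.filter (fun p => p.1 ∉ A) := by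
    rw [← filter_add, h2, filter_add,
      Multiset.filter_eq_nil.2 (fun p hp => not_not.2 (h3 _ (mem_keys hp))),
      Multiset.filter_eq_self.2 (fun p hp => h4 _ (mem_keys hp)), zero_add]
  have eΓ := (Multiset.filter_add_not (fun p : Chan × QTy Sg => p.1 ∈ A) Γ).symm
  have eΘ := (Multiset.filter_add_not (fun p : Chan × QTy Sg => p.1 ∈ A) Θ).symm
  have kΓ : ∀ c ∈ keys (Γ.filter (fun p => p.1 ∉ A)), c ∉ A := by
    intro c hc
    obtain ⟨p, hp, rfl⟩ := mem_map.1 hc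
    exact (Multiset.mem_filter.1 hp).2
  generalize Γ.filter (fun p => p.1 ∈ A) = Γ₁ at *
  generalize Γ.filter (fun p => p.1 ∉ A) = Γ₂ at *
  generalize Θ.filter (fun p => p.1 ∈ A) = Θ₁ at *
  generalize Θ.filter (fun p => p.1 ∉ A) = Θ₂ at *
  subst f1 f2 eΓ eΘ
  have hs : NT Sg Γ₁ n x B := hn.strengthen (fun c hc hc' => kΓ c hc (hA c hc'))
  have k3 : ∀ c ∈ keys ((x, B) ::ₘ Θ₁), c ∈ A := by
    intro c hc
    rw [keys_cons, mem_cons] at hc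
    rcases hc with rfl | hc
    · exact hA _ hn.prov_mem
    · exact h3 c (by rw [keys_add]; simp [hc])
  by_cases hΓ : Γ₂ = 0
  · subst hΓ
    refine ⟨x ::ₘ P₁, P₂, (x, B) ::ₘ Θ₁, Θ₂, W₁, W₂, by simp, by simp, k3,
      fun c hc => h4 c (by simpa using hc), ?_, by simpa using h6, by simpa using h7,
      fun h => absurd h cons_ne_zero,
      fun hU hS => (h9 hU (by simpa using hS)).mono (fun m hm => mem_cons_of_mem hm),
      fun _ h => absurd h cons_ne_zero⟩
    rw [cons_add]
    exact .snoc _ _ _ Γ₁ (Θ₁ + W₁) _ _ _ (by rwa [← add_assoc]) hs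
  · have ha : NodeAbs n := by
      obtain ⟨p, hp⟩ := Multiset.exists_mem_of_ne_zero hΓ
      exact hn.absorb (c := p.1) (by rw [keys_add]; simp [mem_keys hp])
        (fun h => kΓ _ (mem_keys hp) (hA _ h))
    refine ⟨x ::ₘ P₁, P₂, (x, B) ::ₘ Θ₁, Θ₂, 0, Γ₂ + W₂, by simp, by simp, k3,
      fun c hc => h4 c (by rw [keys_add]; simp [hc]), ?_, ?_, fun _ => rfl,
      fun h => absurd h cons_ne_zero,
      fun _ _ => ⟨n, mem_cons_self _ _, ha⟩,
      fun _ h => absurd h cons_ne_zero⟩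
    · rw [add_zero]
      refine .snoc _ _ _ (Γ₁ + W₁) Θ₁ _ _ _ ?_ (hs.weaken ha W₁)
      rwa [add_right_comm]
    · rwa [add_left_comm, ← add_assoc]

theorem Flat.separate {Δ : QCtx Sg Chan} {P : Multiset Chan} (h : Flat Sg Δ D P S) :
    ∀ (A : Set Chan) (Δ₁ Δ₂ : QCtx Sg Chan) (G U : Config L TN PN),
    Δ = Δ₁ + Δ₂ → D = G + U → (∀ c ∈ keys Δ₁, c ∈ A) → (∀ c ∈ keys Δ₂, c ∉ A) →
    (∀ c ∈ confChans G, c ∈ A) → (∀ c ∈ confChans U, c ∉ A) → Sep A Δ₁ Δ₂ G U P S := by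
  induction h with
  | nil =>
    rintro A Δ₁ Δ₂ G U rfl e h1 h2 h3 h4
    obtain ⟨rfl, rfl⟩ := add_eq_zero.1 e.symm
    exact ⟨0, 0, Δ₁, Δ₂, 0, 0, by simp, rfl, h1, h2, by rw [add_zero]; exact .nil _,
      by rw [add_zero]; exact .nil _, by simp, by simp, by simp +contextual, by simp +contextual⟩
  | snoc D P Γ Θ n x B h hn ih =>
    rintro A Δ₁ Δ₂ G U rfl e h1 h2 h3 h4
    have hm : n ∈ G + U := e ▸ mem_cons_self _ _
    rcases mem_add.1 hm with hm | hm
    · obtain ⟨G, rfl⟩ := exists_cons_of_mem hm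
      rw [cons_add, cons_inj_right] at e
      rw [confChans_cons] at h3
      exact (ih A Δ₁ Δ₂ G U rfl e h1 h2 (fun c hc => h3 c (Or.inr hc)) h4).snoc hn
        (fun c hc => h3 c (Or.inl hc))
    · obtain ⟨U, rfl⟩ := exists_cons_of_mem hm
      rw [add_cons, cons_inj_right] at e
      rw [confChans_cons] at h4
      have := ((ih A Δ₁ Δ₂ G U rfl e h1 h2 h3 (fun c hc => h4 c (Or.inr hc))).symm.snoc hn
        (fun c hc => h4 c (Or.inl hc))).symm
      rwa [compl_compl] at this

/-- The bases of `U` are different from those of `G` and of the interface. -/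
def Junk (Δ : Ctx L TN Chan) (K : Root L TN) (G U : Config L TN PN) : Prop :=
  Disjoint (bases (allChans Δ K G)) (bases (confChans U))

/-- The configuration needs no channels, can absorb any channels, and provides a channel of type
`1`, so that it can be the root of a tree with an anonymous root. -/
def Sink (Sg : Signature L TN PN) (W : Config L TN PN) : Prop :=
  HasAbs W ∧ ∃ P z, Flat Sg 0 W P {(z, Sg.q .one)} ∧ P.Nodup

/-- Typing of a configuration that uses no free channels. -/
def Closed (Sg : Signature L TN PN) (V : Config L TN PN) : Prop :=
  ∃ P S, Flat Sg 0 V P S ∧ P.Nodup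

theorem Junk.chans (h : Junk Δ K G U) : ∀ c ∈ confChans U, c ∉ allChans Δ K G :=
  fun _ hc hc' => disjoint_left.1 h (mem_bases hc') (mem_bases hc)

theorem Junk.lineage (h : Junk Δ K G U) (hl : Lineage Δ K (G + U)) : Lineage Δ K G := by
  intro c hc c' hc' hb hg
  have sub : ∀ c ∈ allChans Δ K G, c ∈ allChans Δ K (G + U) := fun c hc => by
    rw [allChans_add]; exact Or.inl hc
  obtain ⟨M, hM, hl⟩ := hl c (sub c hc) c' (sub c' hc') hb hg
  rcases mem_add.1 hM with hM | hM
  · exact ⟨M, hM, hl⟩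
  · exact absurd hc (h.chans c (mem_confChans hM (Node.ev_mem hl.ev)))

theorem Junk.lineage_add (h : Junk Δ K G V) (hl : Lineage Δ K G)
    (hV : Lineage (0 : Ctx L TN Chan) none V) : Lineage Δ K (G + V) := by
  intro c hc c' hc' hb hg
  rw [allChans_add] at hc hc'
  rcases hc with hc | hc <;> rcases hc' with hc' | hc'
  · obtain ⟨M, hM, hl⟩ := hl c hc c' hc' hb hg
    exact ⟨M, mem_add.2 (Or.inl hM), hl⟩
  · exact (disjoint_left.1 h (mem_bases hc) (hb ▸ mem_bases hc')).elim
  · exact (disjoint_left.1 h (mem_bases hc') (hb ▸ mem_bases hc)).elim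
  · obtain ⟨M, hM, hl⟩ := hV c (Or.inr hc) c' (Or.inr hc') hb hg
    exact ⟨M, mem_add.2 (Or.inr hM), hl⟩

theorem Junk.lineage_right (h : Junk Δ K G V) (hl : Lineage Δ K (G + V)) :
    Lineage (0 : Ctx L TN Chan) none V := by
  have a : ∀ c ∈ allChans (0 : Ctx L TN Chan) none V, c ∈ confChans V := by
    rintro c ((hc | ⟨A, hA⟩) | hc)
    · rw [dom_zero] at hc; exact hc.elim
    · cases hA
    · exact hc
  intro c hc c' hc' hb hg
  obtain ⟨M, hM, hl⟩ := hl c (Or.inr (by rw [confChans_add]; exact Or.inr (a c hc))) c'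
    (Or.inr (by rw [confChans_add]; exact Or.inr (a c' hc'))) hb hg
  rcases mem_add.1 hM with hM | hM
  · exact absurd (Or.inr (mem_confChans hM (Node.ev_mem hl.ev))) (h.chans c (a c hc))
  · exact ⟨M, hM, hl⟩

theorem Tree.separate (hSg : Sg.WF) (t : Tree Sg Δ K (G + U)) (h : Junk Δ K G U) :
    ∃ P S, RootQ Sg K S ∧ (keys (Sg.qc Δ) + P).Nodup ∧ Sep (allChans Δ K G) (Sg.qc Δ) 0 G U P S := by
  obtain ⟨⟨P, S, hF, hnd, hS⟩, -⟩ := (tree_iff hSg).1 t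
  refine ⟨P, S, hS, hnd, hF.separate _ _ _ _ _ (by simp) rfl (fun c hc => ?_) (by simp)
    (fun c hc => Or.inr hc) h.chans⟩
  rw [keys_qc, ← mem_dom] at hc
  exact Or.inl (Or.inl hc)

theorem singleton_eq_add {α : Type*} {a : α} {S T : Multiset α} (h : {a} = S + T) :
    (S = {a} ∧ T = 0) ∨ (S = 0 ∧ T = {a}) := by
  have hp : a ∈ S + T := h ▸ mem_singleton_self a
  rcases mem_add.1 hp with hp | hp
  · obtain ⟨S, rfl⟩ := exists_cons_of_mem hp
    rw [cons_add, ← cons_zero, cons_inj_right, eq_comm,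
      add_eq_zero] at h
    obtain ⟨rfl, rfl⟩ := h
    exact Or.inl ⟨rfl, rfl⟩
  · obtain ⟨T, rfl⟩ := exists_cons_of_mem hp
    rw [add_cons, ← cons_zero, cons_inj_right, eq_comm,
      add_eq_zero] at h
    obtain ⟨rfl, rfl⟩ := h
    exact Or.inr ⟨rfl, rfl⟩

/-- Either the root of a tree with junk is outside the junk or the junk is a sink. -/
theorem Tree.separate_cases (hSg : Sg.WF) (t : Tree Sg Δ K (G + U)) (h : Junk Δ K G U) :
    Closed Sg U ∧ ((Tree Sg Δ K G ∧ (U ≠ 0 → HasAbs G)) ∨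
      (K = none ∧ (G ≠ 0 ∨ Δ ≠ 0 → Sink Sg U))) := by
  obtain ⟨P, S, hS, hnd, P₁, P₂, S₁, S₂, W₁, W₂, rfl, rfl, h3, h4, h5, h6, h7, h8, h9, h10⟩ :=
    t.separate hSg h
  have nd : (keys (Sg.qc Δ) + P₁).Nodup ∧ P₂.Nodup := by
    rw [← add_assoc, nodup_add] at hnd
    exact ⟨hnd.1, hnd.2.1⟩
  refine ⟨⟨P₂, _, h6, nd.2⟩, ?_⟩
  have inG : S₂ = 0 → Tree Sg Δ K G ∧ (U ≠ 0 → HasAbs G) := by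
    rintro rfl
    rw [h7 rfl, add_zero] at h5
    rw [add_zero] at hS
    exact ⟨(tree_iff hSg).2 ⟨⟨P₁, S₁, h5, nd.1, hS⟩, h.lineage t.2⟩, fun hU => h9 (Or.inl hU) rfl⟩
  rcases K with _ | ⟨x, A⟩
  · obtain ⟨z, hz⟩ := hS
    rcases singleton_eq_add hz.symm with ⟨rfl, rfl⟩ | ⟨rfl, rfl⟩
    · exact Or.inl (inG rfl)
    · rw [h8 rfl, add_zero] at h6
      refine Or.inr ⟨rfl, fun hG => ⟨h10 (hG.imp_right (fun hΔ e => hΔ ?_)) rfl, P₂, z, h6, nd.2⟩⟩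
      exact Multiset.map_eq_zero.1 e
  · change S₁ + S₂ = _ at hS
    rcases singleton_eq_add hS.symm with ⟨rfl, rfl⟩ | ⟨rfl, rfl⟩
    · exact Or.inl (inG rfl)
    · exact absurd (Or.inl (Or.inr ⟨A, rfl⟩)) (h4 x (by simp))

theorem Closed.flat_disjoint (h : Junk Δ K G V) {P P' : Multiset Chan} {S' : QCtx Sg Chan}
    (hF : Flat Sg (Sg.qc Δ) G P S) (hnd : (keys (Sg.qc Δ) + P).Nodup) (hV : Flat Sg 0 V P' S')
    (hP : P'.Nodup) : (keys (Sg.qc Δ) + (P + P')).Nodup := by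
  rw [← add_assoc, nodup_add, Multiset.disjoint_left]
  refine ⟨hnd, hP, fun hc hc' => h.chans _ (hV.prov_sub _ hc') ?_⟩
  rw [mem_add, keys_qc, ← mem_dom] at hc
  exact hc.elim (fun h => Or.inl (Or.inl h)) (fun h => Or.inr (hF.prov_sub _ h))

/-- Closed junk can be added to a tree with an absorbing node. -/
theorem Tree.add_junk (hSg : Sg.WF) (t : Tree Sg Δ K G) (ha : HasAbs G) (h : Junk Δ K G V)
    (hV : Closed Sg V) (hl : Lineage (0 : Ctx L TN Chan) none V) : Tree Sg Δ K (G + V) := by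
  obtain ⟨⟨P, S, hF, hnd, hS⟩, hl'⟩ := (tree_iff hSg).1 t
  obtain ⟨P', S', hV, hP⟩ := hV
  refine (tree_iff hSg).2 ⟨⟨P + P', S, ?_, Closed.flat_disjoint h hF hnd hV hP, hS⟩,
    h.lineage_add hl' hl⟩
  have h1 := hV.frame (Sg.qc Δ)
  rw [zero_add, add_comm S'] at h1
  have h2 := h1.trans (hF.absorb ha S')
  rwa [add_comm V, add_comm P'] at h2

/-- A sink can be added to any part of a tree, as an anonymous root. -/
theorem Flat.add_sink (hSg : Sg.WF) {P : Multiset Chan} (hF : Flat Sg (Sg.qc Δ) G P S)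
    (hnd : (keys (Sg.qc Δ) + P).Nodup) (hG : Lineage Δ none G) (h : Junk Δ none G V)
    (hs : Sink Sg V) (hl : Lineage (0 : Ctx L TN Chan) none V) : Tree Sg Δ none (G + V) := by
  obtain ⟨ha, P', z, hz, hP⟩ := hs
  refine (tree_iff hSg).2 ⟨⟨P + P', _, ?_, Closed.flat_disjoint h hF hnd hz hP, z, rfl⟩,
    h.lineage_add hG hl⟩
  have := hz.absorb ha S
  rw [zero_add] at this
  exact hF.trans this

/-- The junk of a tree can be replaced by a sink. -/
theorem Tree.replace_sink (hSg : Sg.WF) (t : Tree Sg Δ none (G + U)) (hU : Junk Δ none G U)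
    (hV : Junk Δ none G V) (hs : Sink Sg V) (hl : Lineage (0 : Ctx L TN Chan) none V) :
    Tree Sg Δ none (G + V) := by
  obtain ⟨P, S, hS, hnd, P₁, P₂, S₁, S₂, W₁, W₂, rfl, rfl, h3, h4, h5, -⟩ := t.separate hSg hU
  rw [← add_assoc, nodup_add] at hnd
  exact h5.add_sink hSg hnd.1 (hU.lineage t.2) hV hs hl

theorem Sink.of_add {b : Config L TN PN} (h : Sink Sg (a + b))
    (hd : Disjoint (confChans a) (confChans b)) : Sink Sg a ∨ Sink Sg b := by
  obtain ⟨ha, P, z, hz, hP⟩ := h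
  obtain ⟨P₁, P₂, S₁, S₂, W₁, W₂, rfl, e, h3, h4, h5, h6, h7, h8, h9, h10⟩ :=
    hz.separate (confChans a) 0 0 a b (by simp) rfl (by simp) (by simp) (fun c hc => hc)
      (fun c hc hc' => disjoint_left.1 hd hc' hc)
  rw [nodup_add] at hP
  rcases singleton_eq_add e with ⟨rfl, rfl⟩ | ⟨rfl, rfl⟩
  · rw [h7 rfl, add_zero] at h5
    refine Or.inl ⟨?_, P₁, z, h5, hP.1⟩
    by_cases hb : b = 0
    · subst hb; simpa using ha
    · exact h9 (Or.inl hb) rfl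
  · rw [h8 rfl, add_zero] at h6
    refine Or.inr ⟨?_, P₂, z, h6, hP.2.1⟩
    by_cases hb : a = 0
    · subst hb; simpa using ha
    · exact h10 (Or.inl hb) rfl

/-! ### Reduction -/

/-- Local form of the rewriting rules: the process `proc(x, P)` and possibly the message that it
receives are replaced by `B`. The base `b` is that of the fresh channel of a spawn. -/
inductive Red (Sg : Signature L TN PN) (b : ℕ) :
    Chan → Proc L TN PN Chan → Option (Msg L) → Config L TN PN → Prop
  | spawn (x : Chan) (X : PN) (args : List Chan) (Q : Proc L TN PN (Option Chan))
      (hlen : args.length = (Sg.pdef X).params.length) :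
      Red Sg b x (.spawn X args Q) none
        {.proc ⟨b, 0⟩ ((Sg.pdef X).body.map
          (fun o => o.elim ⟨b, 0⟩ (fun i => args.get (i.cast hlen.symm)))),
          .proc x (Q.map (fun o => o.elim ⟨b, 0⟩ id))}
  | fwd (x z : Chan) (Y : TN) : Red Sg b x (.fwd Y x z) none {.proc x (fwder (Sg.tdef Y) x z)}
  | close (x : Chan) : Red Sg b x (.close x) none {.msg (.close x)}
  | sendLab (x y : Chan) (k : L) (P : Proc L TN PN Chan) :
      Red Sg b x (.sendLab y k P) none {.proc (bump y x) (P.map (bump y)), .msg (.lab y k)}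
  | send (x z y : Chan) (P : Proc L TN PN Chan) :
      Red Sg b x (.send z y P) none {.proc (bump y x) (P.map (bump y)), .msg (.send z y)}
  | wait (x y : Chan) (hne : x ≠ y) (Q : Proc L TN PN Chan) :
      Red Sg b x (.wait y Q) (some (.close y)) {.proc x Q}
  | case (x y : Chan) (I : Finset L) (Q : {l // l ∈ I} → Proc L TN PN Chan) (k : {l // l ∈ I}) :
      Red Sg b x (.case y I Q) (some (.lab y k.1)) {.proc (bump y x) ((Q k).map (bump y))}
  | recv (x z y : Chan) (P : Proc L TN PN (Option Chan)) :
      Red Sg b x (.recv y P) (some (.send z y))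
        {.proc (bump y x) (P.map (fun o => o.elim z (bump y)))}

/-- The part of a configuration that is rewritten. -/
def redex (x : Chan) (P : Proc L TN PN Chan) (oM : Option (Msg L)) : Config L TN PN :=
  .proc x P ::ₘ oM.elim 0 (fun M => {.msg M})

theorem Red.step (h : Red Sg b x P oM B) (hN : b ∉ N)
    (hb : b ∉ bases (confChans (C + redex x P oM))) : Step Sg N (C + redex x P oM) (C + B) := by
  cases h with
  | spawn X args Q hlen => exact .spawn C x X args Q hlen b hN hb
  | fwd z Y => exact .fwd C x z Y
  | close => exact .oneSnd C x
  | sendLab y k P =>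
    by_cases hxy : x = y
    · subst hxy
      rw [bump_self]
      exact .plusSnd C x k P
    · rw [bump_of_ne hxy, pair_comm]
      exact .ampSnd C x y (Ne.symm hxy) k P
  | send z y P =>
    by_cases hxy : x = y
    · subst hxy
      rw [bump_self]
      exact .tensorSnd C z x P
    · rw [bump_of_ne hxy, pair_comm]
      exact .lolliSnd C z y x (Ne.symm hxy) P
  | wait y hne Q =>
    rw [redex, Option.elim, ← insert_eq_cons, pair_comm]
    exact .oneRcv C y x hne Q
  | case y I Q k =>
    rw [redex, Option.elim, ← insert_eq_cons]
    by_cases hxy : x = y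
    · subst hxy
      rw [bump_self]
      exact .ampRcv C x I Q k
    · rw [bump_of_ne hxy, pair_comm]
      exact .plusRcv C y x hxy I Q k
  | recv z y P =>
    rw [redex, Option.elim, ← insert_eq_cons]
    by_cases hxy : x = y
    · subst hxy
      rw [bump_self]
      exact .lolliRcv C z x P
    · rw [bump_of_ne hxy, pair_comm]
      exact .tensorRcv C z y x hxy P

theorem Step.red (hN : N.Finite) (h : Step Sg N D D') :
    ∃ b C x P oM B, b ∉ N ∧ b ∉ bases (confChans (C + redex x P oM)) ∧ D = C + redex x P oM ∧
      D' = C + B ∧ Red Sg b x P oM B := by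
  have nonspawn : ∀ C x P oM
      B E E', (∀ b, Red Sg b x P oM B) → E = redex x P oM → E' = B →
      ∃ b C' x P oM B, b ∉ N ∧ b ∉ bases (confChans (C' + redex x P oM)) ∧
        C + E = C' + redex x P oM ∧ C + E' = C' + B ∧ Red Sg b x P oM B := by
    rintro C x P oM B E E' h rfl rfl
    obtain ⟨b, hb⟩ := exists_fresh (hN.union (bases_finite (confChans_finite (C + redex x P oM))))
    exact ⟨b, C, x, P, oM, E', fun h => hb (Or.inl h), fun h => hb (Or.inr h), rfl, rfl, h b⟩
  cases h with
  | spawn C y X args Q hlen b hN hb =>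
    exact ⟨b, C, y, _, none, _, hN, hb, rfl, rfl, .spawn y X args Q hlen⟩
  | fwd C y z Y => exact nonspawn C y _ none _ _ _ (fun b => .fwd y z Y) rfl rfl
  | oneSnd C y => exact nonspawn C y _ none _ _ _ (fun b => .close y) rfl rfl
  | oneRcv C y x hne Q =>
    exact nonspawn C x _ _ _ _ _ (fun b => .wait x y hne Q) (pair_comm _ _) rfl
  | plusSnd C y k P =>
    exact nonspawn C y _ none _ _ _ (fun b => .sendLab y y k P) rfl (by rw [bump_self])
  | plusRcv C y u hne I Q k =>
    exact nonspawn C u _ _ _ _ _ (fun b => .case u y I Q k) (pair_comm _ _)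
      (by rw [bump_of_ne hne])
  | ampSnd C y x hne k P =>
    exact nonspawn C y _ none _ _ _ (fun b => .sendLab y x k P) rfl
      (by rw [bump_of_ne hne.symm, pair_comm])
  | ampRcv C y I Q k =>
    exact nonspawn C y _ _ _ _ _ (fun b => .case y y I Q k) rfl (by rw [bump_self])
  | tensorSnd C x y P =>
    exact nonspawn C y _ none _ _ _ (fun b => .send y x y P) rfl (by rw [bump_self])
  | tensorRcv C x y u hne P =>
    exact nonspawn C u _ _ _ _ _ (fun b => .recv u x y P) (pair_comm _ _)
      (by rw [bump_of_ne hne])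
  | lolliSnd C x u y hne P =>
    exact nonspawn C y _ none _ _ _ (fun b => .send y x u P) rfl
      (by rw [bump_of_ne hne.symm, pair_comm])
  | lolliRcv C x y P =>
    exact nonspawn C y _ _ _ _ _ (fun b => .recv y x y P) rfl (by rw [bump_self])

theorem Red.unique {B' : Config L TN PN} (h : Red Sg b x P oM B) (h' : Red Sg b x P oM B') :
    B = B' := by
  cases h with
  | case y I Q k =>
    generalize e : (some (Msg.lab y k.1) : Option (Msg L)) = oM at h'
    cases h' with
    | case _ _ _ k' =>
      simp only [Option.some.injEq, Msg.lab.injEq, true_and] at e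
      rw [Subtype.ext e]
  | _ => cases h'; rfl

theorem Red.waits (h : Red Sg b x P (some M) B) : P.WaitsOn M.carrier := by
  cases h
  · exact .wait _
  · exact .case _ _
  · exact .recv _

theorem Red.not_waits (h : Red Sg b x P none B) (y : Chan) : ¬ P.WaitsOn y := by
  intro hw
  cases h <;> cases hw

theorem Red.congr {B' : Config L TN PN} (h : Red Sg b x P oM B) (e : B = B') :
    Red Sg b x P oM B' := e ▸ h

theorem Red.ren (h : Red Sg b x P oM B) (π : Equiv.Perm ℕ) :
    Red Sg (π b) (x.rename π) (P.map (Chan.rename π)) (oM.map (Msg.map (Chan.rename π)))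
      (cren π B) := by
  have pb : ∀ (y : Chan) (P : Proc L TN PN Chan), (P.map (bump y)).map (Chan.rename π) =
      (P.map (Chan.rename π)).map (bump (y.rename π)) := by
    intro y P
    rw [Proc.map_map, Proc.map_map]
    exact P.map_congr _ _ (fun v _ => bump_rename π y v)
  cases h with
  | spawn X args Q hlen =>
    have := Red.spawn (Sg := Sg) (b := π b) (x.rename π) X (args.map (Chan.rename π))
      (Q.map (Option.map (Chan.rename π))) (by simpa using hlen)
    refine Red.congr this ?_
    have e1 := Proc.map_congr (Sg.pdef X).body
      (fun o => o.elim ⟨π b, 0⟩ (fun i => (args.map (Chan.rename π)).get (i.cast (by simpa using hlen.symm))))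
      (Chan.rename π ∘ fun o => o.elim ⟨b, 0⟩ (fun i => args.get (i.cast hlen.symm)))
      (fun o _ => by cases o <;> simp [Chan.rename])
    have e2 := Proc.map_congr Q
      ((fun o => o.elim ⟨π b, 0⟩ id) ∘ Option.map (Chan.rename π))
      (Chan.rename π ∘ fun o => o.elim ⟨b, 0⟩ id)
      (fun o _ => by cases o <;> simp [Chan.rename])
    rw [Proc.map_map, e1, e2, ← Proc.map_map, ← Proc.map_map]
    rfl
  | fwd z Y =>
    have := Red.fwd (Sg := Sg) (b := π b) (x.rename π) (z.rename π) Y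
    rw [← fwder_map] at this
    exact this
  | close => exact .close _
  | sendLab y k P =>
    have := Red.sendLab (Sg := Sg) (b := π b) (x.rename π) (y.rename π) k (P.map (Chan.rename π))
    rw [← pb, ← bump_rename] at this
    exact this
  | send z y P =>
    have := Red.send (Sg := Sg) (b := π b) (x.rename π) (z.rename π) (y.rename π)
      (P.map (Chan.rename π))
    rw [← pb, ← bump_rename] at this
    exact this
  | wait y hne Q => exact .wait _ _ (fun h => hne (Chan.rename_injective π h)) _
  | case y I Q k =>
    have := Red.case (Sg := Sg) (b := π b) (x.rename π) (y.rename π) I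
      (fun l => (Q l).map (Chan.rename π)) k
    rw [← pb, ← bump_rename] at this
    exact this
  | recv z y P =>
    have := Red.recv (Sg := Sg) (b := π b) (x.rename π) (z.rename π) (y.rename π)
      (P.map (Option.map (Chan.rename π)))
    rw [← bump_rename, Proc.map_map] at this
    refine Red.congr this ?_
    have e := Proc.map_congr P
      ((fun o => o.elim (z.rename π) (bump (y.rename π))) ∘ Option.map (Chan.rename π))
      (Chan.rename π ∘ fun o => o.elim z (bump y))
      (fun o _ => by cases o <;> simp [bump_rename])
    rw [e, ← Proc.map_map]
    rfl

theorem Red.bases_subset (h : Red Sg b x P oM B) :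
    bases (confChans B) ⊆ bases (confChans (redex x P oM)) ∪ {b} := by
  have key : ∀ c ∈ confChans B, c.base = b ∨ ∃ d ∈ confChans (redex x P oM), d.base = c.base := by
    have bb : ∀ y v, (bump y v).base = v.base := bump_base
    cases h with
    | spawn X args Q hlen =>
      intro c hc
      simp only [insert_eq_cons, confChans_cons, confChans_singleton, Node.chans,
        Proc.names_map, redex, Option.elim, confChans_zero, Proc.names, mem_union,
        mem_singleton_iff, mem_image, Set.mem_empty_iff_false, or_false] at hc ⊢
      rcases hc with (rfl | ⟨o, ho, rfl⟩) | rfl | ⟨o, ho, rfl⟩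
      · exact Or.inl rfl
      · cases o with
        | none => exact Or.inl rfl
        | some i => exact Or.inr ⟨_, Or.inr (Or.inl (List.get_mem _ _)), rfl⟩
      · exact Or.inr ⟨_, Or.inl rfl, rfl⟩
      · cases o with
        | none => exact Or.inl rfl
        | some v => exact Or.inr ⟨v, Or.inr (Or.inr ho), rfl⟩
    | fwd z Y =>
      intro c hc
      simp only [confChans_singleton, Node.chans, redex, Option.elim, cons_zero,
        Proc.names] at hc ⊢
      refine Or.inr ⟨c, ?_, rfl⟩
      rcases hc with rfl | hc
      · exact Or.inl rfl
      · exact Or.inr (fwder_names _ _ _ hc)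
    | close =>
      intro c hc
      refine Or.inr ⟨c, ?_, rfl⟩
      simpa [confChans_singleton, Node.chans, redex, Proc.names, Msg.chans] using hc
    | sendLab y k P =>
      intro c hc
      simp only [insert_eq_cons, confChans_cons, confChans_singleton, Node.chans,
        Proc.names_map, redex, Option.elim, confChans_zero, Proc.names, mem_union, Msg.chans,
        mem_singleton_iff, mem_image, Set.mem_empty_iff_false, or_false,
        Set.mem_insert_iff] at hc ⊢
      rcases hc with (rfl | ⟨o, ho, rfl⟩) | rfl | rfl
      · exact Or.inr ⟨x, Or.inl rfl, (bb _ _).symm⟩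
      · exact Or.inr ⟨o, Or.inr (Or.inr ho), (bb _ _).symm⟩
      · exact Or.inr ⟨_, Or.inr (Or.inl rfl), rfl⟩
      · exact Or.inr ⟨_, Or.inr (Or.inl rfl), rfl⟩
    | send z y P =>
      intro c hc
      simp only [insert_eq_cons, confChans_cons, confChans_singleton, Node.chans,
        Proc.names_map, redex, Option.elim, confChans_zero, Proc.names, mem_union, Msg.chans,
        mem_singleton_iff, mem_image, Set.mem_empty_iff_false, or_false,
        Set.mem_insert_iff] at hc ⊢
      rcases hc with (rfl | ⟨o, ho, rfl⟩) | rfl | rfl | rfl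
      · exact Or.inr ⟨x, Or.inl rfl, (bb _ _).symm⟩
      · exact Or.inr ⟨o, Or.inr (Or.inr ho), (bb _ _).symm⟩
      · exact Or.inr ⟨_, Or.inr (Or.inl (Or.inl rfl)), rfl⟩
      · exact Or.inr ⟨_, Or.inr (Or.inl (Or.inr rfl)), rfl⟩
      · exact Or.inr ⟨_, Or.inr (Or.inl (Or.inr rfl)), rfl⟩
    | wait y hne Q =>
      intro c hc
      refine Or.inr ⟨c, ?_, rfl⟩
      simp only [confChans_singleton, Node.chans, redex, Option.elim, confChans_cons,
        Proc.names] at hc ⊢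
      rcases hc with rfl | hc
      · exact Or.inl (Or.inl rfl)
      · exact Or.inl (Or.inr (Or.inr hc))
    | case y I Q k =>
      intro c hc
      simp only [confChans_singleton, Node.chans, redex, Option.elim, confChans_cons,
        Proc.names, Proc.names_map, mem_union, mem_singleton_iff, mem_image,
        mem_ofPred_eq] at hc ⊢
      rcases hc with rfl | ⟨o, ho, rfl⟩
      · exact Or.inr ⟨x, Or.inl (Or.inl rfl), (bb _ _).symm⟩
      · exact Or.inr ⟨o, Or.inl (Or.inr (Or.inr ⟨k, ho⟩)), (bb _ _).symm⟩
    | recv z y P =>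
      intro c hc
      simp only [confChans_singleton, Node.chans, redex, Option.elim, confChans_cons,
        Proc.names, Proc.names_map, mem_union, mem_singleton_iff, mem_image,
        mem_ofPred_eq, Msg.chans, Set.mem_insert_iff] at hc ⊢
      rcases hc with rfl | ⟨o, ho, rfl⟩
      · exact Or.inr ⟨x, Or.inl (Or.inl rfl), (bb _ _).symm⟩
      · cases o with
        | none => exact Or.inr ⟨z, Or.inr (Or.inl rfl), rfl⟩
        | some v => exact Or.inr ⟨v, Or.inl (Or.inr (Or.inr ho)), (bb _ _).symm⟩
  rintro _ ⟨c, hc, rfl⟩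
  rcases key c hc with h | ⟨d, hd, h⟩
  · exact Or.inr h
  · exact Or.inl ⟨d, hd, h⟩

/-! ### Preservation of typing -/

theorem map_bump {Γ : QCtx Sg Chan} (h : y ∉ keys Γ) : Γ.map (Prod.map (bump y) id) = Γ := by
  conv_rhs => rw [← map_id Γ]
  refine Multiset.map_congr rfl (fun p hp => Prod.ext (bump_of_ne ?_) rfl)
  rintro e
  exact h (e ▸ mem_keys hp)

theorem map_elim {Γ : QCtx Sg Chan} (z : Chan) (f : Chan → Chan) :
    (Γ.map (Prod.map some id)).map (Prod.map (fun o : Option Chan => o.elim z f) id) =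
      Γ.map (Prod.map f id) := by
  simp only [map_map]; rfl

theorem zip_args {X : PN} {args : List Chan} (hlen : args.length = (Sg.pdef X).params.length)
    (b : Chan) :
    (((Finset.univ.val : Multiset (Fin (Sg.pdef X).params.length)).map
      (fun i => (some i, (Sg.pdef X).params.get i))).map
      (Prod.map (fun o : Option _ => o.elim b (fun i => args.get (i.cast hlen.symm))) id)) =
      ((args.zip (Sg.pdef X).params : List (Chan × Ty L TN)) : Ctx L TN Chan) := by
  rw [map_map, Fin.univ_val_map]
  congr 1
  refine List.ext_get (by simp [hlen]) (fun n h1 h2 => ?_)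
  simp

/-- Typing of the right-hand side of a rule without a received message. -/
theorem Red.typed_none (hSg : Sg.WF) (h : Red Sg b x P none B) {Γ : QCtx Sg Chan} {A : QTy Sg}
    (hP : QTyped Sg Γ P x A) (hnd : (x ::ₘ keys Γ).Nodup) :
    ∃ Q, Flat Sg Γ B Q {(x, A)} ∧ (Q = {x} ∨ Q = {⟨b, 0⟩, x} ∨
      ∃ y M, P.SendsOn y ∧ .msg M ∈ B ∧ M.Links y ∧ Q = {y.succ, x}) := by
  have two : ∀ {Γ₁ Γ₂} {n₁ n₂} {x1 x2} {A₁ A₂},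
      NT Sg Γ₁ n₁ x1 A₁ → NT Sg ((x1, A₁) ::ₘ Γ₂) n₂ x2 A₂ →
      Flat Sg (Γ₁ + Γ₂) {n₁, n₂} {x1, x2} {(x2, A₂)} := by
    intro Γ₁ Γ₂ n₁ n₂ x1 x2 A₁ A₂ h1 h2
    have := (Flat.single h1 Γ₂).trans (by simpa using Flat.single h2 0)
    exact this
  rw [nodup_cons] at hnd
  cases h with
  | spawn X args Q hlen =>
    cases hP with
    | spawn Γ _ _ _ _ _ hlen' hQ =>
      refine ⟨_, two (A₁ := Sg.q (Sg.pdef X).ty) (.proc _ ⟨b, 0⟩ _ _ ?_) (.proc _ _ _ _ ?_),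
        Or.inr (Or.inl rfl)⟩
      · have := ((hSg.bodies X).quot hSg).map
          (fun o => o.elim (⟨b, 0⟩ : Chan) (fun i => args.get (i.cast hlen.symm)))
        rw [← qc_map, zip_args hlen] at this
        exact this
      · have := hQ.map (fun o => o.elim (⟨b, 0⟩ : Chan) id)
        rw [map_cons, map_elim] at this
        simpa using this
  | fwd z Y =>
    cases hP
    refine ⟨{x}, ?_, Or.inl rfl⟩
    have := Flat.single (.proc _ x _ _ (fwder_typed hSg (Sg.tdef Y) x z)) 0
    rw [(q_eq hSg).2 (tyEq_tdef Sg hSg Y)]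
    simpa using this
  | close =>
    cases hP
    refine ⟨{x}, ?_, Or.inl rfl⟩
    have := Flat.single (L := L) (TN := TN) (PN := PN) (.msg _ _ _ _ (QMsg.oneR (Sg := Sg) x)) 0
    simpa using this
  | sendLab y k P =>
    cases hP with
    | plusR _ _ I A k _ h =>
      refine ⟨{x.succ, x}, ?_, Or.inr (Or.inr ⟨x, .lab x k, .sendLab _ _, by simp, .lab _, rfl⟩)⟩
      have h1 := h.map (bump x)
      rw [map_bump hnd.1] at h1
      have := two (.proc _ _ _ _ h1) (Γ₂ := 0)
        (.msg _ _ _ _ (by simpa using QMsg.plusR (Sg := Sg) x I A k))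
      simpa using this
    | ampL Γ _ _ I A _ k _ h =>
      rw [keys_cons, nodup_cons, mem_cons, not_or] at hnd
      refine ⟨{y.succ, x}, ?_, Or.inr (Or.inr ⟨y, .lab y k, .sendLab _ _, by simp, .lab _, rfl⟩)⟩
      have h1 := h.map (bump y)
      rw [map_cons, map_bump hnd.2.1] at h1
      have := two (.msg _ _ _ _ (QMsg.ampL (Sg := Sg) y I A k)) (.proc _ _ _ _ (by simpa using h1))
      rw [singleton_add] at this
      rw [bump_of_ne hnd.1.1, pair_comm]
      rwa [bump_of_ne hnd.1.1] at this
  | send z y P =>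
    cases hP with
    | tensorR Γ _ _ A B _ h =>
      rw [keys_cons, mem_cons, not_or] at hnd
      refine ⟨{x.succ, x}, ?_, Or.inr (Or.inr ⟨x, .send z x, .send _ _, by simp, .send _, rfl⟩)⟩
      have h1 := h.map (bump x)
      rw [map_bump hnd.1.2] at h1
      have := two (.proc _ _ _ _ h1) (Γ₂ := {(z, Sg.q A)})
        (.msg _ _ _ _ (by
          have := QMsg.tensorR (Sg := Sg) z x A B
          rw [pair_comm] at this
          simpa using this))
      rw [add_comm, singleton_add] at this
      simpa using this
    | lolliL Γ _ _ _ A B _ _ h =>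
      rw [keys_cons, keys_cons, nodup_cons, nodup_cons, mem_cons,
        mem_cons, not_or, not_or] at hnd
      refine ⟨{y.succ, x}, ?_, Or.inr (Or.inr ⟨y, .send z y, .send _ _, by simp, .send _, rfl⟩)⟩
      have h1 := h.map (bump y)
      rw [map_cons, map_bump hnd.2.2.1] at h1
      have := two (.msg _ _ _ _ (QMsg.lolliL (Sg := Sg) z y A B)) (.proc _ _ _ _ (by simpa using h1))
      rw [insert_eq_cons, cons_add, singleton_add] at this
      rw [bump_of_ne hnd.1.2.1, pair_comm]
      rwa [bump_of_ne hnd.1.2.1] at this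

/-- Typing of the right-hand side of a rule with a received message. -/
theorem Red.typed_some (hSg : Sg.WF) (h : Red Sg b x P (some M) B) {Δ : QCtx Sg Chan}
    {Q : Multiset Chan} (hF : PairFacts Δ (.msg M) (.proc x P) C Q S) :
    ∃ Q', Q = M.carrier ::ₘ Q' ∧ Flat Sg Δ (B + C) Q' S := by
  obtain ⟨Γ₁, x1, A₁, Γ₂, x2, A₂, h1, h2, hx, hd, hd1, hd2, hx1, hx2, f1, f2⟩ := hF
  cases h1 with | msg _ _ _ hM =>
  cases h2 with | proc _ _ _ hP =>
  cases h with
  | wait y hne Q =>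
    cases hM
    cases hP with
    | oneL Γ _ _ _ _ hQ =>
      obtain ⟨-, f⟩ := f1 _ _ rfl
      simpa [Msg.carrier] using f (.proc x Q) (.proc _ _ _ _ (by simpa using hQ))
  | case y I Q k =>
    obtain ⟨k, hk⟩ := k
    cases hM with
    | plusR y I' A k' =>
      cases hP with
      | plusL Γ _ _ _ A' _ _ hQ =>
        obtain ⟨e, f⟩ := f1 _ _ rfl
        obtain ⟨A'', e1, e2⟩ := q_labTy hSg (p := true) (I := I) (A := A') e
        cases e1
        rw [keys_cons, nodup_cons] at hd2
        have h1 := (hQ k').map (bump x1)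
        rw [map_cons, map_bump hd2.1] at h1
        rw [singleton_add, bump_of_ne (Ne.symm hx)]
        refine f _ (.proc _ _ _ _ ?_)
        rw [singleton_add, ← e2 k']
        rw [bump_of_ne (Ne.symm hx)] at h1
        simpa using h1
      | ampR _ _ _ A' _ hQ => exact absurd rfl hx
    | ampL y I' A k' =>
      cases hP with
      | plusL Γ _ _ _ A' _ _ hQ => exact absurd (by simp) (hd y (by simp))
      | ampR _ _ _ A' _ hQ =>
        obtain ⟨e, f⟩ := f2 _ 0 rfl
        obtain ⟨A'', e1, e2⟩ := q_labTy hSg (p := false) (I := I') (A := A) e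
        cases e1
        have h1 := (hQ k').map (bump x)
        rw [map_bump hx2, bump_self, ← e2 k'] at h1
        rw [singleton_add, bump_self]
        exact f _ (.proc _ _ _ _ (by simpa using h1))
  | recv z y P =>
    cases hM with
    | tensorR z y A B =>
      cases hP with
      | tensorL Γ _ _ A' B' _ _ hQ =>
        obtain ⟨e, f⟩ := f1 _ _ rfl
        obtain ⟨A'', B'', e1, e2, e3⟩ := q_sendTy hSg (p := true) (A := A') (B := B') e
        cases e1
        rw [keys_cons, nodup_cons] at hd2
        have h1 := hQ.map (fun o => o.elim z (bump x1))
        rw [map_cons, map_cons, map_elim, map_bump hd2.1] at h1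
        rw [singleton_add, bump_of_ne (Ne.symm hx)]
        refine f _ (.proc _ _ _ _ ?_)
        rw [insert_eq_cons, cons_add, singleton_add, ← e2, ← e3]
        simpa [bump_of_ne (Ne.symm hx)] using h1
      | lolliR _ _ A' B' _ hQ => exact absurd rfl hx
    | lolliL z y A B =>
      cases hP with
      | tensorL Γ _ _ A' B' _ _ hQ => exact absurd (by simp) (hd y (by simp))
      | lolliR _ _ A' B' _ hQ =>
        obtain ⟨e, f⟩ := f2 (Sg.q (.lolli A B)) {(z, Sg.q A)} (pair_comm _ _)
        obtain ⟨A'', B'', e1, e2, e3⟩ := q_sendTy hSg (p := false) (A := A) (B := B) e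
        cases e1
        have h1 := hQ.map (fun o => o.elim z (bump x))
        rw [map_cons, map_elim, map_bump hx2] at h1
        rw [singleton_add, bump_self]
        refine f _ (.proc _ _ _ _ ?_)
        rw [add_comm, singleton_add, e2, e3]
        simpa using h1

theorem Flat.red (hSg : Sg.WF) (h : Red Sg b x P oM B) {Δ : QCtx Sg Chan} {Q : Multiset Chan}
    (hF : Flat Sg Δ (C + redex x P oM) Q S) (hnd : (keys Δ + Q).Nodup) :
    ∃ Q', Flat Sg Δ (C + B) Q' S ∧ ((oM = none ∧ (Q' = Q ∨ Q' = ⟨b, 0⟩ ::ₘ Q ∨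
      ∃ y M, P.SendsOn y ∧ .msg M ∈ B ∧ M.Links y ∧ Q' = y.succ ::ₘ Q)) ∨
      ∃ M, oM = some M ∧ Q = M.carrier ::ₘ Q') := by
  cases oM with
  | none =>
    rw [redex, Option.elim, cons_zero, add_comm, singleton_add] at hF
    obtain ⟨C₁, C₂, P₁, P₂, Γ, Θ, x', A, rfl, rfl, h1, h2, h3⟩ := hF.split _ _ rfl
    cases h2 with | proc _ _ _ hP =>
    have nd : (x ::ₘ keys Γ).Nodup := by
      refine nodup_of_le ?_ hnd
      have := h1.keys_le
      rw [keys_add] at this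
      calc x ::ₘ keys Γ ≤ x ::ₘ (keys Δ + P₁) :=
            Multiset.cons_le_cons _ (le_trans (Multiset.le_add_right _ _) this)
        _ ≤ keys Δ + (P₁ + x ::ₘ P₂) := by
          have : keys Δ + (P₁ + x ::ₘ P₂) = x ::ₘ (keys Δ + P₁) + P₂ := by
            simp only [← singleton_add]; abel
          rw [this]; exact Multiset.le_add_right _ _
    obtain ⟨Q', hQ, hc⟩ := h.typed_none hSg hP nd
    refine ⟨P₁ + Q' + P₂, ?_, Or.inl ⟨rfl, ?_⟩⟩
    · have := (h1.trans (by have := hQ.frame Θ; rwa [singleton_add] at this)).trans h3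
      convert this using 1
      abel
    · rcases hc with rfl | rfl | ⟨y, M, hy, hM, hl, rfl⟩
      · exact Or.inl (by simp only [← singleton_add]; abel)
      · exact Or.inr (Or.inl (by
          simp only [insert_eq_cons, ← singleton_add]; abel))
      · exact Or.inr (Or.inr ⟨y, M, hy, hM, hl, by
          simp only [insert_eq_cons, ← singleton_add]; abel⟩)
  | some M =>
    have e : C + redex x P (some M) = .msg M ::ₘ .proc x P ::ₘ C := by
      simp only [redex, Option.elim, ← singleton_add]; abel
    rw [e] at hF
    obtain ⟨Q', e, hQ⟩ := h.typed_some hSg (hF.pair hnd)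
    exact ⟨Q', by rwa [add_comm], Or.inr ⟨M, rfl, e⟩⟩

theorem mem_redex_self (x : Chan) (P : Proc L TN PN Chan) (oM : Option (Msg L)) :
    .proc x P ∈ redex x P oM := mem_cons_self _ _

/-- Steps preserve trees, and the new channels are the fresh channel of a spawn and the next
generation of a channel along which a message is sent. -/
theorem Tree.red (hSg : Sg.WF) (h : Red Sg b x P oM B) (t : Tree Sg Δ K (C + redex x P oM))
    (hb : b ∉ bases (allChans Δ K (C + redex x P oM))) :
    Tree Sg Δ K (C + B) ∧ ∀ c ∈ allChans Δ K (C + B), c ∈ allChans Δ K (C + redex x P oM) ∨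
      c = ⟨b, 0⟩ ∨ ∃ y, c = y.succ ∧ P.SendsOn y := by
  obtain ⟨⟨Q, S, hF, hnd, hS⟩, hl⟩ := (tree_iff hSg).1 t
  obtain ⟨Q', hF', hQ⟩ := hF.red hSg h hnd
  have old := hF.allChans hS
  have new := hF'.allChans hS
  have hmem : .proc x P ∈ C + redex x P oM := mem_add.2 (Or.inr (mem_redex_self _ _ _))
  have inC : oM = none → ∀ M, .msg M ∈ C + redex x P oM → .msg M ∈ C := by
    rintro rfl M hM
    rcases mem_add.1 hM with hM | hM
    · exact hM
    · simp [redex] at hM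
  have old_iff : ∀ c, c ∈ keys (Sg.qc Δ) + Q ↔ c ∈ allChans Δ K (C + redex x P oM) := fun c => by
    rw [old, mem_add, keys_qc, mem_dom]
  refine ⟨(tree_iff hSg).2 ⟨⟨Q', S, hF', ?_, hS⟩, ?_⟩, ?_⟩
  · rcases hQ with ⟨-, rfl | rfl | ⟨y, M, hy, -, -, rfl⟩⟩ | ⟨M, rfl, rfl⟩
    · exact hnd
    · rw [add_cons, nodup_cons, old_iff]
      exact ⟨fun h => hb (mem_bases h), hnd⟩
    · rw [add_cons, nodup_cons, old_iff]
      exact ⟨t.succ_notMem_of_sendsOn hSg hmem hy, hnd⟩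
    · rw [add_cons, nodup_cons] at hnd
      exact hnd.2
  · intro c hc c' hc' hbc hg
    rw [new] at hc hc'
    rcases hQ with ⟨h0, rfl | rfl | ⟨y, M, hy, hM, hML, rfl⟩⟩ | ⟨M, rfl, rfl⟩
    · obtain ⟨M, hM, h⟩ := hl c ((old c).2 hc) c' ((old c').2 hc') hbc hg
      exact ⟨M, mem_add.2 (Or.inl (inC h0 M hM)), h⟩
    · rw [mem_cons, or_left_comm, ← old] at hc hc'
      rcases hc with rfl | hc <;> rcases hc' with rfl | hc'
      · exact absurd hg (lt_irrefl _)
      · exact absurd (by have := mem_bases hc'; rw [← hbc] at this; exact this) hb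
      · exact absurd (by have := mem_bases hc; rw [hbc] at this; exact this) hb
      · obtain ⟨M, hM, h⟩ := hl c hc c' hc' hbc hg
        exact ⟨M, mem_add.2 (Or.inl (inC h0 M hM)), h⟩
    · have hyc : y ∈ allChans Δ K (C + redex x P oM) :=
        Or.inr (mem_confChans hmem (Or.inr hy.mem_names))
      rw [mem_cons, or_left_comm, ← old] at hc hc'
      rcases hc with rfl | hc <;> rcases hc' with rfl | hc'
      · exact absurd hg (lt_irrefl _)
      · obtain ⟨N, hN, h⟩ := hl y hyc c' hc' hbc (lt_trans (Nat.lt_succ_self _) hg)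
        cases t.ev_unique hSg hN hmem h.ev (.sends x y P hy)
      · rcases eq_or_ne c y with rfl | hcy
        · exact ⟨M, mem_add.2 (Or.inr hM), hML⟩
        · have : c.gen ≠ y.gen := fun h => hcy (Chan.ext' hbc h)
          obtain ⟨N, hN, h⟩ := hl c hc y hyc hbc (by simp at hg; omega)
          exact ⟨N, mem_add.2 (Or.inl (inC h0 N hN)), h⟩
      · obtain ⟨N, hN, h⟩ := hl c hc c' hc' hbc hg
        exact ⟨N, mem_add.2 (Or.inl (inC h0 N hN)), h⟩
    · rw [add_cons, nodup_cons] at hnd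
      have sub : ∀ c, c ∈ dom Δ ∨ c ∈ Q' → c ∈ allChans Δ K (C + redex x P (some M)) := fun c h =>
        (old c).2 (h.imp_right (fun h => mem_cons_of_mem h))
      obtain ⟨N, hN, hNl⟩ := hl c (sub c hc) c' (sub c' hc') hbc hg
      rcases mem_add.1 hN with hN | hN
      · exact ⟨N, mem_add.2 (Or.inl hN), hNl⟩
      · simp only [redex, Option.elim, mem_cons, reduceCtorEq, false_or,
          mem_singleton, Node.msg.injEq] at hN
        subst hN
        rw [hNl.carrier] at hnd
        rw [mem_add, keys_qc, ← mem_dom] at hnd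
        exact absurd hc hnd.1
  · intro c hc
    rw [new] at hc
    rcases hQ with ⟨-, rfl | rfl | ⟨y, M, hy, -, -, rfl⟩⟩ | ⟨M, rfl, rfl⟩
    · exact Or.inl ((old c).2 hc)
    · rw [mem_cons, or_left_comm, ← old] at hc
      exact hc.symm.imp_right Or.inl
    · rw [mem_cons, or_left_comm, ← old] at hc
      rcases hc with rfl | hc
      · exact Or.inr (Or.inr ⟨y, rfl, hy⟩)
      · exact Or.inl hc
    · exact Or.inl ((old c).2 (hc.imp_right (fun h => mem_cons_of_mem h)))

/-! ### Metatheory of reduction -/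

/-- Zero or more steps whose fresh bases avoid `N`. -/
abbrev Reds (Sg : Signature L TN PN) (N : Set ℕ) : Config L TN PN → Config L TN PN → Prop :=
  Relation.ReflTransGen (Step Sg N)

theorem Step.fresh (hN : N.Finite) (h : Step Sg N D D') :
    ∃ b, b ∉ N ∧ bases (confChans D') ⊆ bases (confChans D) ∪ {b} ∧
      ∀ (N' : Set ℕ) (F : Config L TN PN), b ∉ N' → b ∉ bases (confChans F) →
        Step Sg N' (D + F) (D' + F) := by
  obtain ⟨b, C, x, P, oM, B, hb, hb', rfl, rfl, hr⟩ := h.red hN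
  refine ⟨b, hb, ?_, fun N' F hN' hF => ?_⟩
  · rw [confChans_add, confChans_add, bases_union, bases_union, union_assoc]
    exact Set.union_subset_union_right _ hr.bases_subset
  · rw [add_right_comm, add_right_comm C B]
    refine hr.step hN' ?_
    rw [add_right_comm, confChans_add, bases_union]
    exact fun h => h.elim hb' hF

/-- The fresh bases of a sequence of steps form a finite set; the steps can be performed next to
every configuration that avoids it. -/
theorem Reds.fresh (hN : N.Finite) (h : Reds Sg N D D') :
    ∃ B : Set ℕ, B.Finite ∧ Disjoint N B ∧ bases (confChans D') ⊆ bases (confChans D) ∪ B ∧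
      ∀ (N' : Set ℕ) (F : Config L TN PN), Disjoint N' B → Disjoint (bases (confChans F)) B →
        Reds Sg N' (D + F) (D' + F) := by
  induction h with
  | refl => exact ⟨∅, finite_empty, Set.disjoint_empty N, by simp, fun _ _ _ _ => .refl⟩
  | tail _ h ih =>
    obtain ⟨B, hB, hNB, hs, hf⟩ := ih
    obtain ⟨b, hb, hbs, hbf⟩ := h.fresh hN
    refine ⟨B ∪ {b}, hB.union (finite_singleton b), ?_, ?_, fun N' F h1 h2 => ?_⟩
    · rw [disjoint_union_right]
      exact ⟨hNB, Set.disjoint_singleton_right.2 hb⟩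
    · rw [← union_assoc]
      exact hbs.trans (Set.union_subset_union_left _ hs)
    · rw [disjoint_union_right, Set.disjoint_singleton_right] at h1 h2
      exact (hf N' F h1.1 h2.1).tail (hbf N' F h1.2 h2.2)

theorem Step.frame (hN : N.Finite) {F : Config L TN PN} (h : Step Sg N D D')
    (hF : bases (confChans F) ⊆ N) (hN' : N' ⊆ N) : Step Sg N' (D + F) (D' + F) := by
  obtain ⟨b, hb, -, hf⟩ := h.fresh hN
  exact hf N' F (fun h => hb (hN' h)) (fun h => hb (hF h))

theorem Reds.frame (hN : N.Finite) {F : Config L TN PN} (h : Reds Sg N D D')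
    (hF : bases (confChans F) ⊆ N) (hN' : N' ⊆ N) : Reds Sg N' (D + F) (D' + F) :=
  Relation.ReflTransGen.lift (· + F) (fun _ _ (h : Step Sg N _ _) => h.frame hN hF hN') _ _ h

theorem Step.anti (hN : N.Finite) (h : Step Sg N D D') (hN' : N' ⊆ N) : Step Sg N' D D' := by
  simpa using h.frame (F := 0) hN (by simp [confChans_zero, bases]) hN'

theorem Reds.anti (hN : N.Finite) (h : Reds Sg N D D') (hN' : N' ⊆ N) : Reds Sg N' D D' :=
  Relation.ReflTransGen.mono (fun _ _ (h : Step Sg N _ _) => h.anti hN hN') _ _ h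

theorem cren_redex (π : Equiv.Perm ℕ) (x : Chan) (P : Proc L TN PN Chan) (oM : Option (Msg L)) :
    cren π (redex x P oM) =
      redex (x.rename π) (P.map (Chan.rename π)) (oM.map (Msg.map (Chan.rename π))) := by
  cases oM <;> rfl

theorem notMem_bases_cren (h : b ∉ bases (confChans D)) : π b ∉ bases (confChans (cren π D)) := by
  rw [confChans_cren, bases_ren]
  rintro ⟨b', hb', e⟩
  exact h (π.injective e ▸ hb')

theorem Step.ren (hN : N.Finite) (h : Step Sg N D D') (hπ : ∀ b, π b ∈ N' → b ∈ N) :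
    Step Sg N' (cren π D) (cren π D') := by
  obtain ⟨b, C, x, P, oM, B, hb, hb', rfl, rfl, hr⟩ := h.red hN
  rw [cren_add, cren_add, cren_redex]
  refine (hr.ren π).step (fun h => hb (hπ b h)) ?_
  rw [← cren_redex, ← cren_add]
  exact notMem_bases_cren hb'

theorem Reds.ren (hN : N.Finite) (h : Reds Sg N D D') (hπ : ∀ b, π b ∈ N' → b ∈ N) :
    Reds Sg N' (cren π D) (cren π D') :=
  Relation.ReflTransGen.lift (cren π) (fun _ _ (h : Step Sg N _ _) => h.ren hN hπ) _ _ h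

theorem Reds.ren_fix (hN : N.Finite) (h : Reds Sg N D D') (hπ : ∀ b ∈ N, π b = b) :
    Reds Sg N (cren π D) (cren π D') :=
  h.ren hN (fun b hb => by
    have := hπ _ hb
    rwa [π.injective this] at hb)

/-- Up to renaming of the result, the fresh bases of a sequence of steps can be chosen outside of
any finite set. -/
theorem Reds.avoid {M : Set ℕ} (hN : N.Finite) (hM : M.Finite) (h : Reds Sg N D D')
    (hMD : M ∩ bases (confChans D) ⊆ N) :
    ∃ π : Equiv.Perm ℕ, (∀ b ∈ N, π b = b) ∧ cren π D = D ∧ Reds Sg (N ∪ M) D (cren π D') := by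
  obtain ⟨B, hB, hNB, -, hf⟩ := h.fresh hN
  obtain ⟨π, h1, h2, h3⟩ := exists_avoiding (A := B ∩ M) (B := B ∪ N ∪ M ∪ bases (confChans D))
    (hB.inter_of_left M) (((hB.union hN).union hM).union (bases_finite (confChans_finite D)))
  have fixN : ∀ b ∈ N, π b = b := fun b hb =>
    h1 b (Or.inl (Or.inl (Or.inr hb))) (fun h => hNB.notMem_of_mem_left hb h.1)
  have fixD : cren π D = D := cren_eq_self (fun b hb =>
    h1 b (Or.inr hb) (fun h => hNB.notMem_of_mem_left (hMD ⟨h.2, hb⟩) h.1))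
  refine ⟨π, fixN, fixD, ?_⟩
  have hr' := hf (π ⁻¹' (N ∪ M)) 0 ?_ (by simp [confChans_zero, bases])
  · rw [add_zero, add_zero] at hr'
    have := hr'.ren (N' := N ∪ M) ((hN.union hM).preimage π.injective.injOn) (π := π)
      (fun b hb => hb)
    rwa [fixD] at this
  · rw [disjoint_left]
    intro b hb hbB
    by_cases hbM : b ∈ M
    · have := h2 b ⟨hbB, hbM⟩
      exact this.2 (hb.elim (fun h => Or.inl (Or.inl (Or.inr h))) (fun h => Or.inl (Or.inr h)))
    · have hbb : π b = b := h1 b (Or.inl (Or.inl (Or.inl hbB))) (fun h => hbM h.2)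
      change π b ∈ N ∪ M at hb
      rw [hbb] at hb
      exact hb.elim (fun h => hNB.notMem_of_mem_left h hbB) hbM

/-! ### Steps of trees -/

theorem ifaceBases_finite (Δ : Ctx L TN Chan) (K : Root L TN) :
    (bases (ifaceChans Δ K)).Finite := bases_finite (ifaceChans_finite Δ K)

theorem confBases_finite (D : Config L TN PN) : (bases (confChans D)).Finite :=
  bases_finite (confChans_finite D)

theorem bases_allChans (Δ : Ctx L TN Chan) (K : Root L TN) (D : Config L TN PN) :
    bases (allChans Δ K D) = bases (ifaceChans Δ K) ∪ bases (confChans D) := bases_union _ _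

theorem Tree.step_chans (hSg : Sg.WF) (hN : N.Finite) (t : Tree Sg Δ K D) (h : Step Sg N D D')
    (hi : bases (ifaceChans Δ K) ⊆ N) :
    Tree Sg Δ K D' ∧ ∃ b, b ∉ N ∧ ∀ c ∈ allChans Δ K D', c ∈ allChans Δ K D ∨
      c = ⟨b, 0⟩ ∨ ∃ x P y, .proc x P ∈ D ∧ P.SendsOn y ∧ c = y.succ := by
  obtain ⟨b, C, x, P, oM, B, hb, hb', rfl, rfl, hr⟩ := h.red hN
  obtain ⟨h1, h2⟩ := t.red hSg hr (by
    rw [bases_allChans]; exact fun h => h.elim (fun h => hb (hi h)) hb')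
  refine ⟨h1, b, hb, fun c hc => (h2 c hc).imp_right (Or.imp_right ?_)⟩
  rintro ⟨y, rfl, hy⟩
  exact ⟨x, P, y, mem_add.2 (Or.inr (mem_redex_self _ _ _)), hy, rfl⟩

theorem Tree.step (hSg : Sg.WF) (t : Tree Sg Δ K D) (h : Step Sg (bases (ifaceChans Δ K)) D D') :
    Tree Sg Δ K D' :=
  (t.step_chans hSg (ifaceBases_finite Δ K) h subset_rfl).1

theorem Tree.reds (hSg : Sg.WF) (hN : N.Finite) (t : Tree Sg Δ K D) (h : Reds Sg N D D')
    (hi : bases (ifaceChans Δ K) ⊆ N) : Tree Sg Δ K D' := by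
  induction h with
  | refl => exact t
  | tail _ h ih => exact (ih.step_chans hSg hN h hi).1

theorem Tree.steps (hSg : Sg.WF) (t : Tree Sg Δ K D) (h : Steps Sg Δ K D D') : Tree Sg Δ K D' :=
  t.reds hSg (ifaceBases_finite Δ K) h subset_rfl

/-! ### Steps of juxtaposed configurations -/

theorem add_eq_cons {α : Type*} {A B C : Multiset α} {p : α} (h : A + B = p ::ₘ C) :
    (∃ A', A = p ::ₘ A' ∧ C = A' + B) ∨ ∃ B', B = p ::ₘ B' ∧ C = A + B' := by
  have hp : p ∈ A + B := h ▸ mem_cons_self p C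
  rcases mem_add.1 hp with hp | hp
  · obtain ⟨A', rfl⟩ := exists_cons_of_mem hp
    rw [cons_add, cons_inj_right] at h
    exact Or.inl ⟨A', rfl, h.symm⟩
  · obtain ⟨B', rfl⟩ := exists_cons_of_mem hp
    rw [add_cons, cons_inj_right] at h
    exact Or.inr ⟨B', rfl, h.symm⟩

/-- A step of a configuration that consists of two parts is a step of one part, after the other
part has handed over a message if need be. -/
theorem Step.split (hN : N.Finite) {A : Config L TN PN} (h : Step Sg N (A + B) W) :
    (∃ A', Step Sg (N ∪ bases (confChans B)) A A' ∧ W = A' + B) ∨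
    (∃ B', Step Sg (N ∪ bases (confChans A)) B B' ∧ W = A + B') ∨
    (∃ M A' B', A = A' + {.msg M} ∧
      Step Sg (N ∪ bases (confChans A')) ({.msg M} + B) B' ∧ W = A' + B' ∧
      ∃ x P, .proc x P ∈ B ∧ P.WaitsOn M.carrier) ∨
    (∃ M A' B', B = B' + {.msg M} ∧
      Step Sg (N ∪ bases (confChans B')) ({.msg M} + A) A' ∧ W = A' + B' ∧
      ∃ x P, .proc x P ∈ A ∧ P.WaitsOn M.carrier) := by
  obtain ⟨b, C, x, P, oM, R, hb, hb', e, rfl, hr⟩ := h.red hN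
  rw [← e] at hb'
  rw [confChans_add, bases_union] at hb'
  have st : ∀ (X Y C' : Config L TN PN), X = C' + redex x P oM → b ∉ bases (confChans X) →
      b ∉ bases (confChans Y) → Step Sg (N ∪ bases (confChans Y)) X (C' + R) := by
    rintro X Y C' rfl h1 h2
    exact hr.step (fun h => h.elim hb h2) h1
  have hA : b ∉ bases (confChans A) := fun h => hb' (Or.inl h)
  have hB : b ∉ bases (confChans B) := fun h => hb' (Or.inr h)
  cases oM with
  | none =>
    have e' : A + B = .proc x P ::ₘ C := by
      rw [e, redex, Option.elim, cons_zero, add_comm, singleton_add]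
    rcases add_eq_cons e' with ⟨A', rfl, rfl⟩ | ⟨B', rfl, rfl⟩
    · refine Or.inl ⟨A' + R, st _ _ _ ?_ hA hB, by abel⟩
      rw [redex, Option.elim, cons_zero, add_comm, singleton_add]
    · refine Or.inr (Or.inl ⟨B' + R, st _ _ _ ?_ hB hA, by abel⟩)
      rw [redex, Option.elim, cons_zero, add_comm, singleton_add]
  | some M =>
    have e' : A + B = .proc x P ::ₘ .msg M ::ₘ C := by
      rw [e, redex, Option.elim]
      simp only [← singleton_add]
      abel
    have key : ∀ C' : Config L TN PN, .proc x P ::ₘ .msg M ::ₘ C' = C' + redex x P (some M) := by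
      intro C'
      rw [redex, Option.elim]
      simp only [← singleton_add]
      abel
    have key' : ∀ C' : Config L TN PN, {.msg M} + .proc x P ::ₘ C' = C' + redex x P (some M) := by
      intro C'
      rw [redex, Option.elim]
      simp only [← singleton_add]
      abel
    rcases add_eq_cons e' with ⟨A', rfl, h'⟩ | ⟨B', rfl, h'⟩
    · rcases add_eq_cons h'.symm with ⟨A'', rfl, rfl⟩ | ⟨B'', rfl, rfl⟩
      · exact Or.inl ⟨A'' + R, st _ _ _ (key _) hA hB, by abel⟩
      · rw [confChans_cons, bases_union] at hB
        refine Or.inr (Or.inr (Or.inr ⟨M, A' + R, B'', ?_, st _ _ _ (key' _) ?_ ?_, by abel, x, P,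
          by simp, hr.waits⟩))
        · rw [add_comm, singleton_add]
        · rw [confChans_add, confChans_singleton, bases_union]
          exact fun h => h.elim (fun h => hB (Or.inl h)) hA
        · exact fun h => hB (Or.inr h)
    · rcases add_eq_cons h'.symm with ⟨A'', rfl, rfl⟩ | ⟨B'', rfl, rfl⟩
      · rw [confChans_cons, bases_union] at hA
        refine Or.inr (Or.inr (Or.inl ⟨M, A'', B' + R, ?_, st _ _ _ (key' _) ?_ ?_, by abel, x, P,
          by simp, hr.waits⟩))
        · rw [add_comm, singleton_add]
        · rw [confChans_add, confChans_singleton, bases_union]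
          exact fun h => h.elim (fun h => hA (Or.inl h)) hB
        · exact fun h => hA (Or.inr h)
      · exact Or.inr (Or.inl ⟨B'' + R, st _ _ _ (key _) hB hA, by abel⟩)

/-- Base-disjoint parts of a configuration evolve independently. -/
theorem Reds.split {M₁ M₂ : Set ℕ} (hN : N.Finite) (h1 : M₁ ⊆ N) (h2 : M₂ ⊆ N)
    {A : Config L TN PN} (h : Reds Sg N (A + B) W)
    (hd : Disjoint (M₁ ∪ bases (confChans A)) (M₂ ∪ bases (confChans B))) :
    ∃ A' B', W = A' + B' ∧ Reds Sg N A A' ∧ Reds Sg N B B' ∧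
      Disjoint (M₁ ∪ bases (confChans A')) (M₂ ∪ bases (confChans B')) := by
  induction h with
  | refl => exact ⟨A, B, rfl, .refl, .refl, hd⟩
  | tail _ h ih =>
    obtain ⟨A', B', rfl, hA, hB, hd'⟩ := ih
    have nb : ∀ {X Y X' : Config L TN PN} {M₁ M₂ : Set ℕ}, M₂ ⊆ N →
        Step Sg (N ∪ bases (confChans Y)) X X' →
        Disjoint (M₁ ∪ bases (confChans X)) (M₂ ∪ bases (confChans Y)) →
        Disjoint (M₁ ∪ bases (confChans X')) (M₂ ∪ bases (confChans Y)) := by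
      intro X Y X' M₁ M₂ h2 h hd
      obtain ⟨b, hb, hs, -⟩ := h.fresh (hN.union (confBases_finite Y))
      refine Disjoint.mono_left (b := (M₁ ∪ bases (confChans X)) ∪ {b}) ?_ ?_
      · rw [union_assoc]
        exact Set.union_subset_union_right _ hs
      · rw [disjoint_union_left, Set.disjoint_singleton_left]
        exact ⟨hd, fun h => hb (h.imp_left (fun h => h2 h))⟩
    have clash : ∀ {X Y : Config L TN PN} {M : Msg L} {x : Chan} {P : Proc L TN PN Chan},
        Disjoint (bases (confChans X)) (bases (confChans Y)) → .msg M ∈ X → .proc x P ∈ Y →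
        ¬ P.WaitsOn M.carrier := fun hd hM hP hw => hd.notMem_of_mem_left
          (mem_bases (mem_confChans hM (Msg.carrier_mem _)))
          (mem_bases (mem_confChans hP (Or.inr hw.mem_names)))
    have hd'' := hd'.mono subset_union_right subset_union_right
    rcases h.split hN with ⟨A'', hs, rfl⟩ | ⟨B'', hs, rfl⟩ |
      ⟨M, A'', B'', rfl, hs, rfl, x, P, hP, hw⟩ | ⟨M, A'', B'', rfl, hs, rfl, x, P, hP, hw⟩
    · exact ⟨A'', B', rfl, hA.tail (hs.anti (hN.union (confBases_finite _)) subset_union_left),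
        hB, nb h2 hs hd'⟩
    · exact ⟨A', B'', rfl, hA,
        hB.tail (hs.anti (hN.union (confBases_finite _)) subset_union_left),
        (nb h1 hs hd'.symm).symm⟩
    · exact absurd hw (clash hd'' (by simp) hP)
    · exact absurd hw (clash hd''.symm (by simp) hP)

theorem Proc.WaitsOn.unique {V : Type} {y z : V} {P : Proc L TN PN V} (h : P.WaitsOn y)
    (h' : P.WaitsOn z) : y = z := by
  cases h <;> cases h' <;> rfl

/-- A message along a free channel is not consumed. -/
theorem Tree.reds_msg (hSg : Sg.WF) (hN : N.Finite) (t : Tree Sg Δ K (D + {.msg M}))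
    (hi : bases (ifaceChans Δ K) ⊆ N) (hM : M.carrier ∈ ifaceChans Δ K)
    (h : Reds Sg N (D + {.msg M}) W) :
    ∃ D', W = D' + {.msg M} ∧ Reds Sg (N ∪ bases M.chans) D D' := by
  have hf : (N ∪ bases M.chans).Finite := by
    have := confBases_finite ({.msg M} : Config L TN PN)
    rw [confChans_singleton] at this
    exact hN.union this
  induction h with
  | refl => exact ⟨D, rfl, .refl⟩
  | tail h' h ih =>
    obtain ⟨D', rfl, hD⟩ := ih
    have t' := t.reds hSg hN h' hi
    have nomsg : ∀ M' x P, .msg M' ∈ D' + {.msg M} → .proc x P ∈ D' + {.msg M} →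
        P.WaitsOn M'.carrier → M'.carrier ≠ M.carrier := by
      intro M' x P h1 h2 h3 e
      exact t'.ev_internal hSg h1 h2 (Ev.msg M') (.waits _ _ _ h3) (e ▸ hM)
    rcases h.split hN with ⟨A'', hs, rfl⟩ | ⟨B'', hs, rfl⟩ |
      ⟨M', A'', B'', rfl, hs, rfl, x, P, hP, hw⟩ | ⟨M', A'', B'', e, hs, rfl, x, P, hP, hw⟩
    · rw [confChans_singleton] at hs
      exact ⟨A'', rfl, hD.tail hs⟩
    · exfalso
      obtain ⟨b, C, x, P, oM, R, -, -, e, -⟩ := hs.red (hN.union (confBases_finite _))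
      have : Node.proc x P ∈ ({Node.msg M} : Config L TN PN) :=
        e ▸ mem_add.2 (Or.inr (mem_redex_self _ _ _))
      simp at this
    · simp at hP
    · have : Node.msg M' ∈ ({Node.msg M} : Config L TN PN) := e ▸ (by simp)
      rw [mem_singleton, Node.msg.injEq] at this
      subst this
      exact absurd rfl (nomsg M' x P (by simp) (by simp [hP]) hw)

/-! ### Confluence -/

theorem AlphaEq.refl (Δ : Ctx L TN Chan) (K : Root L TN) (D : Config L TN PN) :
    AlphaEq Δ K D D := ⟨1, fun _ _ => rfl, (cren_one D).symm⟩

theorem AlphaEq.symm (h : AlphaEq Δ K D D') : AlphaEq Δ K D' D := by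
  obtain ⟨π, hπ, rfl⟩ := h
  exact ⟨π⁻¹, Fixes.inv hπ, (cren_inv_cren π D).symm⟩

theorem AlphaEq.trans {D'' : Config L TN PN} (h : AlphaEq Δ K D D') (h' : AlphaEq Δ K D' D'') :
    AlphaEq Δ K D D'' := by
  obtain ⟨π, hπ, rfl⟩ := h
  obtain ⟨ρ, hρ, rfl⟩ := h'
  exact ⟨ρ * π, Fixes.mul hρ hπ, cren_mul ρ π D⟩

theorem AlphaEq.tree (hSg : Sg.WF) (h : AlphaEq Δ K D D') (t : Tree Sg Δ K D) : Tree Sg Δ K D' := by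
  obtain ⟨π, hπ, rfl⟩ := h
  exact t.alpha hSg hπ

theorem AlphaEq.steps {E : Config L TN PN} (h : AlphaEq Δ K D D') (hs : Steps Sg Δ K D E) :
    ∃ E', Steps Sg Δ K D' E' ∧ AlphaEq Δ K E E' := by
  obtain ⟨π, hπ, rfl⟩ := h
  exact ⟨cren π E, Reds.ren_fix (ifaceBases_finite Δ K) hs hπ, π, hπ, rfl⟩

theorem mem_redex : n ∈ redex x P oM ↔ n = .proc x P ∨ ∃ M, oM = some M ∧ n = .msg M := by
  cases oM <;> simp [redex]

theorem redex_disjoint {C' : Config L TN PN} (hD : D.Nodup) {x' : Chan} {P' : Proc L TN PN Chan}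
    {oM' : Option (Msg L)} (e : D = C + redex x P oM) (e' : D = C' + redex x' P' oM')
    (hp : (.proc x P : Node L TN PN) ≠ .proc x' P') (hM : ∀ M, oM = some M → oM' ≠ some M) :
    ∃ C₀, C = C₀ + redex x' P' oM' ∧ C' = C₀ + redex x P oM := by
  have hle : redex x' P' oM' ≤ C := by
    rw [Multiset.le_iff_subset (nodup_of_le (e' ▸ Multiset.le_add_left _ _) hD)]
    intro n hn
    have hnD : n ∈ C + redex x P oM := by
      rw [← e, e']
      exact mem_add.2 (Or.inr hn)
    refine (mem_add.1 hnD).resolve_right (fun h => ?_)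
    rw [mem_redex] at h hn
    rcases h with rfl | ⟨M, h1, rfl⟩ <;> rcases hn with hn | ⟨M', h2, hn⟩
    · exact hp hn
    · cases hn
    · cases hn
    · cases hn
      exact hM _ h1 h2
  obtain ⟨C₀, rfl⟩ := Multiset.le_iff_exists_add.1 hle
  refine ⟨C₀, add_comm _ _, ?_⟩
  rw [e] at e'
  have : redex x' P' oM' + (C₀ + redex x P oM) = redex x' P' oM' + C' := by
    rw [← add_assoc, e', add_comm]
  exact (add_left_cancel this).symm

theorem Red.ren_fix (h : Red Sg b x P oM B) (hπ : ∀ a ∈ bases (confChans (redex x P oM)), π a = a) :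
    Red Sg (π b) x P oM (cren π B) := by
  have hp : (Node.proc x P : Node L TN PN).ren π = .proc x P :=
    Node.ren_eq_self (fun c hc => hπ _ (mem_bases (mem_confChans (mem_redex_self x P oM) hc)))
  have hm : oM.map (Msg.map (Chan.rename π)) = oM := by
    cases oM with
    | none => rfl
    | some M =>
      refine congrArg some (Msg.map_eq_self (fun c hc => Chan.rename_eq_self (hπ _ (mem_bases ?_))))
      exact mem_confChans (n := .msg M) (by simp [redex]) hc
  have := h.ren π
  simp only [Node.ren, Node.map, Node.proc.injEq] at hp
  rwa [hp.1, hp.2, hm] at this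

theorem swap_fix {b' a : ℕ} {S : Set ℕ} (hb : b ∉ S) (hb' : b' ∉ S) (ha : a ∈ S) :
    Equiv.swap b b' a = a :=
  Equiv.swap_apply_of_ne_of_ne (fun h => hb (h ▸ ha)) (fun h => hb' (h ▸ ha))

/-- Two steps from the same tree can be joined. Messages are unique for their carrier, so different
steps concern disjoint parts of the tree, unless they differ only in their fresh channels. -/
theorem Tree.diamond (hSg : Sg.WF) (t : Tree Sg Δ K D) (hX : Step Sg (bases (ifaceChans Δ K)) D X)
    (hY : Step Sg (bases (ifaceChans Δ K)) D Y) :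
    ∃ Z W, Relation.ReflGen (Step Sg (bases (ifaceChans Δ K))) X Z ∧
      Relation.ReflGen (Step Sg (bases (ifaceChans Δ K))) Y W ∧ AlphaEq Δ K Z W := by
  have hN := ifaceBases_finite Δ K
  obtain ⟨b, C, x, P, oM, B, hb, hbD, e, rfl, hr⟩ := hX.red hN
  obtain ⟨b', C', x', P', oM', B', hb', hbD', e', rfl, hr'⟩ := hY.red hN
  have hPD : .proc x P ∈ D := e ▸ mem_add.2 (Or.inr (mem_redex_self _ _ _))
  have hPD' : .proc x' P' ∈ D := e' ▸ mem_add.2 (Or.inr (mem_redex_self _ _ _))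
  have sub : ∀ {C} {x} {P} {oM},
      D = C + redex x P oM → bases (confChans C) ⊆ bases (confChans D) ∧
        bases (confChans (redex x P oM)) ⊆ bases (confChans D) := by
    rintro C x P oM rfl
    rw [confChans_add, bases_union]
    exact ⟨subset_union_left, subset_union_right⟩
  rw [← e] at hbD
  rw [← e'] at hbD'
  by_cases hp : (.proc x P : Node L TN PN) = .proc x' P'
  · cases hp
    have hM : oM = oM' := by
      rcases oM with _ | M <;> rcases oM' with _ | M'
      · rfl
      · exact absurd hr'.waits (hr.not_waits _)
      · exact absurd hr.waits (hr'.not_waits _)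
      · have h1 : Node.msg M ∈ D := e ▸ by simp [redex]
        have h2 : Node.msg M' ∈ D := e' ▸ by simp [redex]
        have := t.ev_unique hSg h1 h2 (Ev.msg M) (hr.waits.unique hr'.waits ▸ Ev.msg M')
        rw [Node.msg.injEq] at this
        rw [this]
    subst hM
    rw [e] at e'
    obtain rfl := add_right_cancel e'
    have h1 := hr.ren_fix (π := Equiv.swap b b')
      (fun a ha => swap_fix hbD hbD' ((sub e).2 ha))
    rw [Equiv.swap_apply_left] at h1
    obtain rfl := hr'.unique h1
    refine ⟨_, _, .refl, .refl, Equiv.swap b b', fun a ha => swap_fix hb hb' ha, ?_⟩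
    change _ = cren _ _
    rw [cren_add, cren_eq_self (fun a ha => swap_fix hbD hbD' ((sub e).1 ha))]
  · have hM : ∀ M, oM = some M → oM' ≠ some M := by
      rintro M rfl rfl
      exact hp (t.ev_unique hSg hPD hPD' (.waits _ _ _ hr.waits) (.waits _ _ _ hr'.waits))
    obtain ⟨C₀, rfl, rfl⟩ := redex_disjoint (t.nodup hSg) e e' hp hM
    obtain ⟨d, hd⟩ := exists_fresh ((hN.union (confBases_finite D)).union (finite_singleton b))
    simp only [mem_union, not_or, mem_singleton_iff] at hd
    obtain ⟨⟨hdN, hdD⟩, hdb⟩ := hd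
    have h1 := hr'.ren_fix (π := Equiv.swap b' d) (fun a ha => swap_fix hbD' hdD ((sub e').2 ha))
    rw [Equiv.swap_apply_left] at h1
    have s0 : bases (confChans C₀) ⊆ bases (confChans D) :=
      Set.Subset.trans (by rw [confChans_add, bases_union]; exact subset_union_left) (sub e').1
    have fresh : ∀ {a a'} {x} {P} {oM}
        {B R}, Red Sg a x P oM B →
        bases (confChans (redex x P oM)) ⊆ bases (confChans D) →
        bases (confChans R) ⊆ bases (confChans D) → a' ∉ bases (confChans D) → a' ≠ a →
        a' ∉ bases (confChans (C₀ + B + R)) := by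
      intro a a' x P oM B R hr h1 h2 h3 h4 h5
      rw [confChans_add, confChans_add, bases_union, bases_union] at h5
      rcases h5 with (h5 | h5) | h5
      · exact h3 (s0 h5)
      · rcases hr.bases_subset h5 with h5 | h5
        · exact h3 (h1 h5)
        · exact h4 h5
      · exact h3 (h2 h5)
    refine ⟨C₀ + B + cren (Equiv.swap b' d) B', cren (Equiv.swap b' d)⁻¹ _, .single ?_, .single ?_,
      ⟨(Equiv.swap b' d)⁻¹, Fixes.inv (fun a ha => swap_fix hb' hdN ha), rfl⟩⟩
    · rw [add_right_comm]
      exact h1.step hdN (fresh hr (sub e).2 (sub e').2 hdD hdb)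
    · have hst := hr.step (C := C₀ + cren (Equiv.swap b' d) B') hb
        (fresh h1 (sub e').2 (sub e).2 hbD (Ne.symm hdb))
      rw [add_right_comm, add_right_comm C₀ _ B] at hst
      have hren := hst.ren hN (N' := bases (ifaceChans Δ K)) (π := (Equiv.swap b' d)⁻¹) (by
        intro a ha
        have := Fixes.inv (π := Equiv.swap b' d) (Δ := Δ) (K := K)
          (fun a ha => swap_fix hb' hdN ha) _ ha
        rwa [Equiv.injective _ this] at ha)
      rw [cren_add _ (C₀ + redex x P oM), cren_inv_cren] at hren
      convert hren using 2
      refine (cren_eq_self (fun a ha => ?_)).symm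
      rw [Equiv.Perm.inv_eq_iff_eq]
      exact (swap_fix hbD' hdD ((sub e').1 ha)).symm

/-- Confluence up to renaming of bound channels. -/
theorem Tree.confluent (hSg : Sg.WF) (t : Tree Sg Δ K D) (hX : Steps Sg Δ K D X)
    (hY : Steps Sg Δ K D Y) : ∃ Z W, Steps Sg Δ K X Z ∧ Steps Sg Δ K Y W ∧ AlphaEq Δ K Z W := by
  have hN := ifaceBases_finite Δ K
  let r : Config L TN PN → Config L TN PN → Prop := fun X Y =>
    Tree Sg Δ K X ∧ ∃ Y', Relation.ReflGen (Step Sg (bases (ifaceChans Δ K))) X Y' ∧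
      AlphaEq Δ K Y' Y
  have rtree : ∀ X Y, r X Y → Tree Sg Δ K Y := by
    rintro X Y ⟨tX, Y', hY, ha⟩
    refine ha.tree hSg ?_
    cases hY with
    | refl => exact tX
    | single h => exact tX.step hSg h
  have ren : ∀ {X Y} {π}, Fixes π Δ K →
      Relation.ReflGen (Step Sg (bases (ifaceChans Δ K))) X Y →
      Relation.ReflGen (Step Sg (bases (ifaceChans Δ K))) (cren π X) (cren π Y) := by
    intro X Y π hπ h
    cases h with
    | refl => exact .refl
    | single h =>
      refine .single (h.ren hN (fun a ha => ?_))
      rwa [π.injective (hπ _ ha)] at ha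
  have dia : ∀ a b c, r a b → r a c → ∃ d, Relation.ReflGen r b d ∧ Relation.ReflTransGen r c d := by
    intro a b c hb hc
    have tb := rtree _ _ hb
    have tc := rtree _ _ hc
    obtain ⟨ta, b', hb', π, hπ, rfl⟩ := hb
    obtain ⟨-, c', hc', ρ, hρ, rfl⟩ := hc
    have join : ∃ Z W, Relation.ReflGen (Step Sg (bases (ifaceChans Δ K))) b' Z ∧
        Relation.ReflGen (Step Sg (bases (ifaceChans Δ K))) c' W ∧ AlphaEq Δ K Z W := by
      cases hb' with
      | refl => exact ⟨c', c', hc', .refl, .refl _ _ _⟩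
      | single hb' =>
        cases hc' with
        | refl => exact ⟨b', b', .refl, .single hb', .refl _ _ _⟩
        | single hc' => exact ta.diamond hSg hb' hc'
    obtain ⟨Z, W, hZ, hW, ha⟩ := join
    refine ⟨cren π Z, .single ⟨tb, _, ren hπ hZ, .refl _ _ _⟩,
      .single ⟨tc, _, ren hρ hW, ?_⟩⟩
    have h1 : AlphaEq Δ K W (cren ρ W) := ⟨ρ, hρ, rfl⟩
    exact h1.symm.trans (ha.symm.trans ⟨π, hπ, rfl⟩)
  have up : ∀ X, Steps Sg Δ K D X → Relation.ReflTransGen r D X := by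
    intro X h
    induction h with
    | refl => exact .refl
    | tail h' h ih => exact ih.tail ⟨t.steps hSg h', _, .single h, .refl _ _ _⟩
  have down : ∀ X Z, Relation.ReflTransGen r X Z → ∃ Z', Steps Sg Δ K X Z' ∧ AlphaEq Δ K Z' Z := by
    intro X Z h
    induction h with
    | refl => exact ⟨X, .refl, .refl _ _ _⟩
    | tail _ h ih =>
      obtain ⟨Y', hY, ha⟩ := ih
      obtain ⟨-, W, hW, ha'⟩ := h
      obtain ⟨W', hW', ha''⟩ := ha.symm.steps (E := W) (by
        cases hW with
        | refl => exact .refl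
        | single h => exact .single h)
      exact ⟨W', hY.trans hW', ha''.symm.trans ha'⟩
  obtain ⟨d, hd, hd'⟩ := Relation.church_rosser dia (up X hX) (up Y hY)
  obtain ⟨Z, hZ, ha⟩ := down _ _ hd
  obtain ⟨W, hW, ha'⟩ := down _ _ hd'
  exact ⟨Z, W, hZ, hW, ha.trans ha'.symm⟩

/-! ### Observations at a free channel -/

/-- An interface `Δ ⊩ K` without one of its free channels: the provided one (`right`) or one of
those used (`left`). -/
inductive Hole (L TN : Type) : Type
  | right (Δ : Ctx L TN Chan)
  | left (Δ : Ctx L TN Chan) (K : Root L TN)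

variable {H H' H₀ : Hole L TN}

namespace Hole

/-- The context of the interface with `y : T` in the hole. -/
def ctx (y : Chan) (T : Ty L TN) : Hole L TN → Ctx L TN Chan
  | right Δ => Δ
  | left Δ _ => (y, T) ::ₘ Δ

/-- The root of the interface with `y : T` in the hole. -/
def root (y : Chan) (T : Ty L TN) : Hole L TN → Root L TN
  | right _ => some (y, T)
  | left _ K => K

/-- Additional channels on the left. -/
def add (Γ : Ctx L TN Chan) : Hole L TN → Hole L TN
  | right Δ => right (Γ + Δ)
  | left Δ K => left (Γ + Δ) K

/-- The polarity of the types at which a message is sent along the channel in the hole. -/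
def pos : Hole L TN → Bool
  | right _ => true
  | left _ _ => false

/-- The channels of the interface apart from that in the hole. -/
def chans : Hole L TN → Set Chan
  | right Δ => dom Δ
  | left Δ K => ifaceChans Δ K

/-- Renaming of bases. -/
def ren (π : Equiv.Perm ℕ) : Hole L TN → Hole L TN
  | right Δ => right (ctxren π Δ)
  | left Δ K => left (ctxren π Δ) (rootren π K)

theorem pos_add (H : Hole L TN) (Γ : Ctx L TN Chan) : (H.add Γ).pos = H.pos := by cases H <;> rfl

theorem pos_ren (H : Hole L TN) (π : Equiv.Perm ℕ) : (H.ren π).pos = H.pos := by cases H <;> rfl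

theorem ctx_add (H : Hole L TN) (Γ : Ctx L TN Chan) (y : Chan) (T : Ty L TN) :
    (H.add Γ).ctx y T = Γ + H.ctx y T := by
  cases H
  · rfl
  · exact (add_cons _ _ _).symm

theorem root_add (H : Hole L TN) (Γ : Ctx L TN Chan) (y : Chan) (T : Ty L TN) :
    (H.add Γ).root y T = H.root y T := by cases H <;> rfl

theorem add_add (H : Hole L TN) (Γ Γ' : Ctx L TN Chan) :
    (H.add Γ).add Γ' = H.add (Γ' + Γ) := by
  cases H <;> simp [add, add_assoc]

theorem ctx_ren (H : Hole L TN) (π : Equiv.Perm ℕ) (y : Chan) (T : Ty L TN) :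
    (H.ren π).ctx (y.rename π) T = ctxren π (H.ctx y T) := by
  cases H <;> simp [ren, ctx, ctxren]

theorem root_ren (H : Hole L TN) (π : Equiv.Perm ℕ) (y : Chan) (T : Ty L TN) :
    (H.ren π).root (y.rename π) T = rootren π (H.root y T) := by
  cases H <;> rfl

theorem add_ren (H : Hole L TN) (π : Equiv.Perm ℕ) (Γ : Ctx L TN Chan) :
    (H.add Γ).ren π = (H.ren π).add (ctxren π Γ) := by
  cases H <;> simp [ren, add, ctxren]

theorem iface (H : Hole L TN) (y : Chan) (T : Ty L TN) :
    ifaceChans (H.ctx y T) (H.root y T) = {y} ∪ H.chans := by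
  cases H with
  | right Δ =>
    ext c
    simp only [ifaceChans, ctx, root, chans, mem_union, mem_ofPred_eq, Option.some.injEq,
      Prod.mk.injEq, mem_singleton_iff, exists_and_left, exists_eq', and_true]
    exact ⟨fun h => h.symm.imp_left Eq.symm, fun h => (h.imp_left Eq.symm).symm⟩
  | left Δ K => exact ifaceChans_cons _ _ _ _

theorem mem_iface (H : Hole L TN) (y : Chan) (T : Ty L TN) :
    y ∈ ifaceChans (H.ctx y T) (H.root y T) := by
  rw [iface]; exact Or.inl rfl

theorem chans_add (H : Hole L TN) (Γ : Ctx L TN Chan) : (H.add Γ).chans = dom Γ ∪ H.chans := by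
  cases H with
  | right Δ => exact dom_add _ _
  | left Δ K => simp only [add, chans, ifaceChans, dom_add, union_assoc]

theorem bases_succ (H : Hole L TN) (y : Chan) (T B : Ty L TN) :
    bases (ifaceChans (H.ctx y.succ B) (H.root y.succ B)) =
      bases (ifaceChans (H.ctx y T) (H.root y T)) := by
  rw [iface, iface, bases_union, bases_union]
  simp [bases, Chan.succ]

theorem fixes_succ {B : Ty L TN} :
    Fixes π (H.ctx y.succ B) (H.root y.succ B) ↔ Fixes π (H.ctx y T) (H.root y T) := by
  unfold Fixes
  rw [bases_succ]

theorem fixes_add (h : Fixes π ((H.add Γ).ctx y T) ((H.add Γ).root y T)) :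
    Fixes π (H.ctx y T) (H.root y T) ∧ ∀ b ∈ bases (dom Γ), π b = b := by
  unfold Fixes at *
  rw [iface, chans_add] at h
  rw [iface]
  exact ⟨fun b hb => h b (bases_mono (by
      rintro c (hc | hc)
      exacts [Or.inl hc, Or.inr (Or.inr hc)]) hb),
    fun b hb => h b (bases_mono (fun c hc => Or.inr (Or.inl hc)) hb)⟩

/-- The position of a free channel in the interface of a nonempty tree is unique. -/
theorem unique (hSg : Sg.WF) (t : Tree Sg (H.ctx y T) (H.root y T) D) (hD : D ≠ 0)
    (hΔ : H.ctx y T = H'.ctx y T') (hK : H.root y T = H'.root y T') : H = H' ∧ T = T' := by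
  cases H with
  | right Δ =>
    cases H' with
    | right Δ' =>
      cases hK
      exact ⟨congrArg right hΔ, rfl⟩
    | left Δ' K' =>
      refine absurd ?_ (t.root_notMem hSg hD)
      rw [hΔ, ctx, dom_cons]
      exact Or.inl rfl
  | left Δ K =>
    cases H' with
    | right Δ' =>
      have hK : K = some (y, T') := hK
      subst hK
      refine absurd ?_ (t.root_notMem hSg hD)
      rw [ctx, dom_cons]
      exact Or.inl rfl
    | left Δ' K' =>
      have hnd := t.nodup_ctx hSg
      have hK : K = K' := hK
      have hΔ : (y, T) ::ₘ Δ = (y, T') ::ₘ Δ' := hΔ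
      subst hK
      rw [ctx, keys_cons, nodup_cons] at hnd
      rcases cons_eq_cons.1 hΔ with ⟨h, rfl⟩ | ⟨-, Θ, rfl, -⟩
      · cases h
        exact ⟨rfl, rfl⟩
      · rw [keys_cons] at hnd
        exact absurd (mem_cons_self _ _) hnd.1

end Hole

/-- Relations between configurations, indexed by their interface. -/
abbrev ConfRel (L TN PN : Type) :=
  Ctx L TN Chan → Root L TN → Config L TN PN → Config L TN PN → Prop

variable {R R' : ConfRel L TN PN}

/-- The relation relates trees, and is closed under renaming. -/
structure Nominal (Sg : Signature L TN PN) (R : ConfRel L TN PN) : Prop where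
  tree : ∀ {Δ K D₁ D₂}, R Δ K D₁ D₂ → Tree Sg Δ K D₁ ∧ Tree Sg Δ K D₂
  ren : ∀ {Δ K D₁ D₂} (π : Equiv.Perm ℕ), R Δ K D₁ D₂ →
    R (ctxren π Δ) (rootren π K) (cren π D₁) (cren π D₂)
  alpha : ∀ {Δ K D₁ D₂ D₂'}, R Δ K D₁ D₂ → AlphaEq Δ K D₂ D₂' → R Δ K D₁ D₂'

theorem Nominal.ren_fix (hR : Nominal Sg R) (h : R Δ K D₁ D₂) (hπ : Fixes π Δ K) :
    R Δ K (cren π D₁) (cren π D₂) := by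
  have := hR.ren π h
  rwa [hπ.ctx, hπ.root] at this

/-- The observation of a message along the channel `y : T` in the hole `H`. The name of a sent
channel is that of the first configuration. -/
inductive OutN (Sg : Signature L TN PN) (R : ConfRel L TN PN) (H : Hole L TN) (T : Ty L TN)
    (y : Chan) (D₁ D₂ : Config L TN PN) : Prop
  | close (hH : H = .right 0) (hT : Sg.unf T = .one) (h₁ : D₁ = {.msg (.close y)})
      (h₂ : D₂ = {.msg (.close y)})
  | lab (I : Finset L) (A : {l // l ∈ I} → Ty L TN) (hT : Sg.unf T = labTy H.pos I A)
      (k : {l // l ∈ I}) (D₁' D₂' : Config L TN PN) (h₁ : D₁ = D₁' + {.msg (.lab y k.1)})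
      (h₂ : D₂ = D₂' + {.msg (.lab y k.1)})
      (h : R (H.ctx y.succ (A k)) (H.root y.succ (A k)) D₁' D₂')
  | send (H₀ : Hole L TN) (Γ : Ctx L TN Chan) (hH : H = H₀.add Γ) (A B : Ty L TN)
      (hT : Sg.unf T = sendTy H.pos A B) (x : Chan) (S₁ S₂ D₁' D₂' : Config L TN PN)
      (h₁ : D₁ = S₁ + D₁' + {.msg (.send x y)})
      (h₂ : AlphaEq (H.ctx y T) (H.root y T) D₂ (S₂ + D₂' + {.msg (.send x y)}))
      (hS : R Γ (some (x, A)) S₁ S₂)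
      (hD : R (H₀.ctx y.succ B) (H₀.root y.succ B) D₁' D₂')

/-- The observation that a process waits to receive along the channel `y : T` in the hole `H`. The
base of a received channel ranges over almost all bases. -/
inductive InN (Sg : Signature L TN PN) (R : ConfRel L TN PN) (H : Hole L TN) (T : Ty L TN)
    (y : Chan) (D₁ D₂ : Config L TN PN) : Prop
  | close (Δ : Ctx L TN Chan) (K : Root L TN) (hH : H = .left Δ K) (hT : Sg.unf T = .one)
      (h : R Δ K (D₁ + {.msg (.close y)}) (D₂ + {.msg (.close y)}))
  | lab (I : Finset L) (A : {l // l ∈ I} → Ty L TN) (hT : Sg.unf T = labTy (!H.pos) I A)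
      (h : ∀ k : {l // l ∈ I}, R (H.ctx y.succ (A k)) (H.root y.succ (A k))
        (D₁ + {.msg (.lab y k.1)}) (D₂ + {.msg (.lab y k.1)}))
  | send (A B : Ty L TN) (hT : Sg.unf T = sendTy (!H.pos) A B) (M : Set ℕ) (hM : M.Finite)
      (h : ∀ x : Chan, x.base ∉ M →
        R ((H.add {(x, A)}).ctx y.succ B) ((H.add {(x, A)}).root y.succ B)
          (D₁ + {.msg (.send x y)}) (D₂ + {.msg (.send x y)}))

/-- If a relation holds for almost all received channels, it holds for all that are new. -/
theorem Nominal.recv (hR : Nominal Sg R) {B : Ty L TN} {M : Set ℕ} (hM : M.Finite)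
    (h : ∀ x : Chan, x.base ∉ M → R ((H.add {(x, A)}).ctx y.succ B)
      ((H.add {(x, A)}).root y.succ B) (D₁ + {.msg (.send x y)}) (D₂ + {.msg (.send x y)}))
    (hx : x.base ∉ bases (allChans (H.ctx y T) (H.root y T) D₁))
    (hx' : x.base ∉ bases (allChans (H.ctx y T) (H.root y T) D₂)) :
    R ((H.add {(x, A)}).ctx y.succ B) ((H.add {(x, A)}).root y.succ B)
      (D₁ + {.msg (.send x y)}) (D₂ + {.msg (.send x y)}) := by
  obtain ⟨b, hb⟩ := exists_fresh ((hM.union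
    (bases_finite (allChans_finite (H.ctx y T) (H.root y T) D₁))).union
    (bases_finite (allChans_finite (H.ctx y T) (H.root y T) D₂)))
  simp only [mem_union, not_or, bases_allChans] at hb hx hx'
  have h1 := hR.ren (Equiv.swap b x.base) (h ⟨b, x.gen⟩ hb.1.1)
  have fD : ∀ {D : Config L TN PN}, b ∉ bases (confChans D) → x.base ∉ bases (confChans D) →
      cren (Equiv.swap b x.base) D = D := fun h h' => cren_eq_self (fun a ha => swap_fix h h' ha)
  have fx : Fixes (Equiv.swap b x.base) (H.ctx y.succ B) (H.root y.succ B) := by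
    rw [Hole.fixes_succ (T := T)]
    exact fun a ha => swap_fix hb.1.2.1 hx.1 ha
  have fy : y.rename (Equiv.swap b x.base) = y :=
    Chan.rename_eq_self (swap_fix hb.1.2.1 hx.1 (mem_bases (H.mem_iface y T)))
  have fc : ctxren (Equiv.swap b x.base) ((H.add {((⟨b, x.gen⟩ : Chan), A)}).ctx y.succ B) =
      (H.add {(x, A)}).ctx y.succ B := by
    have := fx.ctx
    rw [Hole.ctx_add, Hole.ctx_add]
    simp only [ctxren, Multiset.map_add] at this ⊢
    rw [this]
    simp [Chan.rename, Prod.map]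
  rw [cren_add, cren_add, fD hb.1.2.2 hx.2, fD hb.2.2 hx'.2, fc, Hole.root_add, cren_msg] at h1
  rw [Hole.root_add]
  have fz : (⟨b, x.gen⟩ : Chan).rename (Equiv.swap b x.base) = x :=
    Chan.ext' (Equiv.swap_apply_left _ _) rfl
  rw [fx.root, Msg.map, fy, fz] at h1
  exact h1

/-- The observations of a pair of configurations at all free channels. -/
structure Obs (Sg : Signature L TN PN) (R : ConfRel L TN PN) (Δ : Ctx L TN Chan) (K : Root L TN)
    (D₁ D₂ : Config L TN PN) : Prop where
  ups : Ups Δ K D₁ ⊆ Ups Δ K D₂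
  out : ∀ H T y, Δ = H.ctx y T → K = H.root y T → y ∈ Ups Δ K D₁ → OutN Sg R H T y D₁ D₂
  inn : ∀ H T y, Δ = H.ctx y T → K = H.root y T → y ∈ Thet Δ K D₁ → InN Sg R H T y D₁ D₂

theorem VOut.outN (hR : Nominal Sg R) (h : VOut Sg R Δ K y D₁ D₂) :
    ∃ H T, Δ = H.ctx y T ∧ K = H.root y T ∧ Tree Sg Δ K D₁ ∧ OutN Sg R H T y D₁ D₂ := by
  have send : ∀ (H₀ : Hole L TN) (Γ : Ctx L TN Chan) (T A B : Ty L TN) (x : Chan)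
      (D₁' D₂' S₁ S₂ : Config L TN PN),
      Sg.unf T = sendTy H₀.pos A B →
      AlphaEq ((H₀.add Γ).ctx y T) ((H₀.add Γ).root y T) D₁ (S₁ + D₁' + {.msg (.send x y)}) →
      AlphaEq ((H₀.add Γ).ctx y T) ((H₀.add Γ).root y T) D₂ (S₂ + D₂' + {.msg (.send x y)}) →
      R Γ (some (x, A)) S₁ S₂ → R (H₀.ctx y.succ B) (H₀.root y.succ B) D₁' D₂' →
      OutN Sg R (H₀.add Γ) T y D₁ D₂ := by
    intro H₀ Γ T A B x D₁' D₂' S₁ S₂ hT h1 h2 hS hD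
    obtain ⟨π, hπ, e⟩ := h1.symm
    have hπ : Fixes π ((H₀.add Γ).ctx y T) ((H₀.add Γ).root y T) := hπ
    obtain ⟨hπ1, hπ2⟩ := Hole.fixes_add hπ
    have fy : y.rename π = y := Chan.rename_eq_self (hπ _ (mem_bases (Hole.mem_iface _ y T)))
    have ren : ∀ S D : Config L TN PN, cren π (S + D + {.msg (.send x y)}) =
        cren π S + cren π D + {.msg (.send (x.rename π) y)} := by
      intro S D
      rw [cren_add, cren_add, cren_msg, Msg.map, fy]
    refine .send H₀ Γ rfl A B (by rwa [Hole.pos_add]) (x.rename π) (cren π S₁) (cren π S₂)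
      (cren π D₁') (cren π D₂') ?_ ?_ ?_ (hR.ren_fix hD (Hole.fixes_succ.2 hπ1))
    · rw [e]; exact ren _ _
    · exact h2.trans ⟨π, hπ, (ren _ _).symm⟩
    · have := hR.ren π hS
      rwa [ctxren_eq_self hπ2] at this
  cases h with
  | oneR T hK hT hΔ t1 t2 h1 h2 => exact ⟨.right 0, T, hΔ, hK, t1, .close rfl hT h1 h2⟩
  | plusR T I A hK hT t1 t2 k D₁' D₂' h1 h2 h =>
    exact ⟨.right Δ, T, rfl, hK, t1, .lab I A hT k D₁' D₂' h1 h2 h⟩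
  | tensorR T A B hK hT t1 t2 Δ' Δ'' hΔ x D₁' D₂' T₁ T₂ h1 h2 s1 s2 hT' hD' =>
    rw [add_comm] at hΔ
    rw [add_comm D₁'] at h1
    rw [add_comm D₂'] at h2
    subst hΔ hK
    exact ⟨(Hole.right Δ').add Δ'', T, rfl, rfl, t1,
      send (.right Δ') Δ'' T A B x D₁' D₂' T₁ T₂ hT h1 h2 hT' hD'⟩
  | ampL T I A Δ' hΔ hT t1 t2 k D₁' D₂' h1 h2 h =>
    rw [add_comm] at h1 h2
    exact ⟨.left Δ' K, T, hΔ, rfl, t1, .lab I A hT k D₁' D₂' h1 h2 h⟩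
  | lolliL T A B Δ' Δ'' hΔ hT t1 t2 x T₁ T₂ D₁' D₂' h1 h2 s1 s2 hT' hD' =>
    rw [add_right_comm] at h1 h2
    subst hΔ
    exact ⟨(Hole.left Δ'' K).add Δ', T, rfl, rfl, t1,
      send (.left Δ'' K) Δ' T A B x D₁' D₂' T₁ T₂ hT h1 h2 hT' hD'⟩

theorem OutN.vOut (hR : Nominal Sg R) (h : OutN Sg R H T y D₁ D₂)
    (t1 : Tree Sg (H.ctx y T) (H.root y T) D₁) (t2 : Tree Sg (H.ctx y T) (H.root y T) D₂) :
    VOut Sg R (H.ctx y T) (H.root y T) y D₁ D₂ := by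
  cases h with
  | close hH hT h1 h2 =>
    subst hH
    exact .oneR T rfl hT rfl t1 t2 h1 h2
  | lab I A hT k D₁' D₂' h1 h2 h =>
    cases H with
    | right Δ => exact .plusR T I A rfl hT t1 t2 k D₁' D₂' h1 h2 h
    | left Δ K =>
      rw [add_comm] at h1 h2
      exact .ampL T I A Δ rfl hT t1 t2 k D₁' D₂' h1 h2 h
  | send H₀ Γ hH A B hT x S₁ S₂ D₁' D₂' h1 h2 hS hD =>
    subst hH
    have a1 := AlphaEq.refl ((H₀.add Γ).ctx y T) ((H₀.add Γ).root y T) D₁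
    conv at a1 => arg 4; rw [h1]
    cases H₀ with
    | right Δ =>
      rw [add_comm S₁] at a1
      rw [add_comm S₂] at h2
      exact .tensorR T A B rfl hT t1 t2 Δ Γ (add_comm _ _) x D₁' D₂' S₁ S₂ a1 h2 (hR.tree hS).1
        (hR.tree hS).2 hS hD
    | left Δ K =>
      rw [add_right_comm] at a1 h2
      exact .lolliL T A B Γ Δ rfl hT t1 t2 x S₁ S₂ D₁' D₂' a1 h2 (hR.tree hS).1
        (hR.tree hS).2 hS hD

theorem VIn.inN (h : VIn Sg R Δ K y D₁ D₂) :
    ∃ H T, Δ = H.ctx y T ∧ K = H.root y T ∧ Tree Sg Δ K D₁ ∧ InN Sg R H T y D₁ D₂ := by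
  have fin := bases_finite ((allChans_finite Δ K D₁).union (allChans_finite Δ K D₂))
  cases h with
  | ampR T I A hK hT t1 t2 h => exact ⟨.right Δ, T, rfl, hK, t1, .lab I A hT h⟩
  | lolliR T A B hK hT t1 t2 h => exact ⟨.right Δ, T, rfl, hK, t1, .send A B hT _ fin h⟩
  | oneL T Δ' hΔ hT t1 t2 h =>
    rw [add_comm, add_comm _ D₂] at h
    exact ⟨.left Δ' K, T, hΔ, rfl, t1, .close Δ' K rfl hT h⟩
  | plusL T I A Δ' hΔ hT t1 t2 h =>
    refine ⟨.left Δ' K, T, hΔ, rfl, t1, .lab I A hT (fun k => ?_)⟩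
    rw [add_comm, add_comm D₂]
    exact h k
  | tensorL T A B Δ' hΔ hT t1 t2 h =>
    refine ⟨.left Δ' K, T, hΔ, rfl, t1, .send A B hT _ fin (fun x hx => ?_)⟩
    rw [add_comm, add_comm D₂, Hole.ctx_add]
    exact h x hx

theorem InN.vIn (hR : Nominal Sg R) (h : InN Sg R H T y D₁ D₂)
    (t1 : Tree Sg (H.ctx y T) (H.root y T) D₁) (t2 : Tree Sg (H.ctx y T) (H.root y T) D₂) :
    VIn Sg R (H.ctx y T) (H.root y T) y D₁ D₂ := by
  cases h with
  | close Δ K hH hT h =>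
    subst hH
    rw [add_comm, add_comm D₂] at h
    exact .oneL T Δ rfl hT t1 t2 h
  | lab I A hT h =>
    cases H with
    | right Δ => exact .ampR T I A rfl hT t1 t2 h
    | left Δ K =>
      refine .plusL T I A Δ rfl hT t1 t2 (fun k => ?_)
      rw [add_comm, add_comm _ D₂]
      exact h k
  | send A B hT M hM h =>
    have key := fun x (hx : x.base ∉ bases (allChans (H.ctx y T) (H.root y T) D₁ ∪
        allChans (H.ctx y T) (H.root y T) D₂)) => hR.recv (T := T) hM h (x := x)
      (fun h => hx (bases_mono subset_union_left h))
      (fun h => hx (bases_mono subset_union_right h))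
    cases H with
    | right Δ => exact .lolliR T A B rfl hT t1 t2 key
    | left Δ K =>
      refine .tensorL T A B Δ rfl hT t1 t2 (fun x hx => ?_)
      rw [add_comm, add_comm _ D₂]
      have := key x hx
      rwa [Hole.ctx_add] at this

theorem ne_zero_of_ups (h : y ∈ Ups Δ K D) : D ≠ 0 := by
  rintro rfl
  obtain ⟨-, M, hM, -⟩ := h
  simp at hM

theorem ne_zero_of_thet (h : y ∈ Thet Δ K D) : D ≠ 0 := by
  rintro rfl
  obtain ⟨-, x, P, hM, -⟩ := h
  simp at hM

theorem Tree.pol_ev (hSg : Sg.WF) (t : Tree Sg (H.ctx y T) (H.root y T) D) (hn : n ∈ D) {b : Bool}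
    (he : Ev b y n) : (Sg.unf T).Pol (b == H.pos) := by
  cases H with
  | right Δ =>
    have := t.ev_root hSg hn he
    simpa [Hole.pos] using this
  | left Δ K =>
    have := t.ev_ctx hSg (mem_cons_self _ _) hn he
    simpa [Hole.pos] using this

theorem Hole.outCh (h : (Sg.unf T).Pol H.pos) : y ∈ OutCh Sg (H.ctx y T) (H.root y T) := by
  cases H with
  | right Δ => exact Or.inr ⟨T, rfl, h⟩
  | left Δ K => exact Or.inl ⟨T, mem_cons_self _ _, h⟩

theorem Hole.inCh (h : (Sg.unf T).Pol (!H.pos)) : y ∈ InCh Sg (H.ctx y T) (H.root y T) := by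
  cases H with
  | right Δ => exact Or.inr ⟨T, rfl, h⟩
  | left Δ K => exact Or.inl ⟨T, mem_cons_self _ _, h⟩

theorem exists_hole (hy : y ∈ ifaceChans Δ K) :
    ∃ (H : Hole L TN) (T : Ty L TN), Δ = H.ctx y T ∧ K = H.root y T := by
  rcases hy with ⟨T, hT⟩ | ⟨T, hT⟩
  · obtain ⟨Δ', rfl⟩ := exists_cons_of_mem hT
    exact ⟨.left Δ' K, T, rfl, rfl⟩
  · exact ⟨.right Δ, T, rfl, hT⟩

theorem obs_iff (hSg : Sg.WF) (hR : Nominal Sg R) (t1 : Tree Sg Δ K D₁) (t2 : Tree Sg Δ K D₂) :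
    Obs Sg R Δ K D₁ D₂ ↔ Ups Δ K D₁ ⊆ Ups Δ K D₂ ∧
      (∀ y ∈ OutCh Sg Δ K, y ∈ Ups Δ K D₁ → VOut Sg R Δ K y D₁ D₂) ∧
      (∀ y ∈ InCh Sg Δ K, y ∈ Thet Δ K D₁ → VIn Sg R Δ K y D₁ D₂) := by
  constructor
  · rintro ⟨h1, h2, h3⟩
    refine ⟨h1, fun y _ hy => ?_, fun y _ hy => ?_⟩
    · obtain ⟨H, T, rfl, rfl⟩ := exists_hole hy.1
      exact (h2 H T y rfl rfl hy).vOut hR t1 t2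
    · obtain ⟨H, T, rfl, rfl⟩ := exists_hole hy.1
      exact (h3 H T y rfl rfl hy).vIn hR t1 t2
  · rintro ⟨h1, h2, h3⟩
    refine ⟨h1, ?_, ?_⟩
    · rintro H T y rfl rfl hy
      obtain ⟨M, hM, rfl⟩ := hy.2
      have hp := t1.pol_ev hSg hM (Ev.msg M)
      obtain ⟨H', T', e1, e2, -, h⟩ := (h2 _ (Hole.outCh (by simpa using hp)) hy).outN hR
      obtain ⟨rfl, rfl⟩ := Hole.unique hSg t1 (ne_zero_of_ups hy) e1 e2
      exact h
    · rintro H T y rfl rfl hy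
      obtain ⟨x, P, hP, hw⟩ := hy.2
      have hp := t1.pol_ev hSg hP (.waits x y P hw)
      obtain ⟨H', T', e1, e2, -, h⟩ := (h3 _ (Hole.inCh (by simpa using hp)) hy).inN
      obtain ⟨rfl, rfl⟩ := Hole.unique hSg t1 (ne_zero_of_thet hy) e1 e2
      exact h

/-! ### Renaming and the logical relation -/

theorem AlphaEq.ren (h : AlphaEq Δ K D D') (π : Equiv.Perm ℕ) :
    AlphaEq (ctxren π Δ) (rootren π K) (cren π D) (cren π D') := by
  obtain ⟨ρ, hρ, rfl⟩ := h
  refine ⟨π * ρ * π⁻¹, ?_, ?_⟩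
  · rw [ifaceChans_ren, bases_ren]
    rintro _ ⟨b, hb, rfl⟩
    simp [hρ b hb]
  · change cren π (cren ρ D) = cren _ (cren π D)
    rw [cren_mul, cren_mul, inv_mul_cancel_right]

theorem Hole.ren_inv (H : Hole L TN) (π : Equiv.Perm ℕ) : (H.ren π⁻¹).ren π = H := by
  have h1 : ∀ Δ : Ctx L TN Chan, ctxren π (ctxren π⁻¹ Δ) = Δ := fun Δ => by
    rw [ctxren_mul, mul_inv_cancel]
    exact ctxren_eq_self (fun _ _ => rfl)
  have h2 : ∀ K : Root L TN, rootren π (rootren π⁻¹ K) = K := fun K => by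
    rw [rootren_mul, mul_inv_cancel]
    exact rootren_eq_self (fun _ _ _ => rfl)
  cases H with
  | right Δ => exact congrArg right (h1 Δ)
  | left Δ K => simp only [ren, h1, h2]

theorem Chan.rename_inv (y : Chan) (π : Equiv.Perm ℕ) : (y.rename π⁻¹).rename π = y := by
  rw [Chan.rename_mul, mul_inv_cancel]; rfl

theorem OutN.ren (hR : Nominal Sg R) (h : OutN Sg R H T y D₁ D₂) (π : Equiv.Perm ℕ) :
    OutN Sg R (H.ren π) T (y.rename π) (cren π D₁) (cren π D₂) := by
  cases h with
  | close hH hT h1 h2 =>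
    subst hH h1 h2
    exact .close rfl hT rfl rfl
  | lab I A hT k D₁' D₂' h1 h2 h =>
    subst h1 h2
    refine .lab I A (by rwa [Hole.pos_ren]) k (cren π D₁') (cren π D₂') (cren_add _ _ _)
      (cren_add _ _ _) ?_
    rw [← Chan.rename_succ, Hole.ctx_ren, Hole.root_ren]
    exact hR.ren π h
  | send H₀ Γ hH A B hT x S₁ S₂ D₁' D₂' h1 h2 hS hD =>
    subst h1
    refine .send (H₀.ren π) (ctxren π Γ) (by rw [hH, Hole.add_ren]) A B (by rwa [Hole.pos_ren])
      (x.rename π) (cren π S₁) (cren π S₂) (cren π D₁') (cren π D₂') ?_ ?_ (hR.ren π hS) ?_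
    · rw [cren_add, cren_add]; rfl
    · rw [Hole.ctx_ren, Hole.root_ren]
      have := h2.ren π
      rw [cren_add, cren_add] at this
      exact this
    · rw [← Chan.rename_succ, Hole.ctx_ren, Hole.root_ren]
      exact hR.ren π hD

theorem InN.ren (hR : Nominal Sg R) (h : InN Sg R H T y D₁ D₂) (π : Equiv.Perm ℕ) :
    InN Sg R (H.ren π) T (y.rename π) (cren π D₁) (cren π D₂) := by
  cases h with
  | close Δ K hH hT h =>
    subst hH
    refine .close _ _ rfl hT ?_
    have := hR.ren π h
    rw [cren_add, cren_add] at this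
    exact this
  | lab I A hT h =>
    refine .lab I A (by rwa [Hole.pos_ren]) (fun k => ?_)
    have := hR.ren π (h k)
    rw [cren_add, cren_add, ← Hole.ctx_ren, ← Hole.root_ren] at this
    exact this
  | send A B hT M hM h =>
    refine .send A B (by rwa [Hole.pos_ren]) (π '' M) (hM.image _) (fun x hx => ?_)
    have := hR.ren π (h (x.rename π⁻¹) (fun h => hx ⟨_, h, by simp [Chan.rename]⟩))
    rw [cren_add, cren_add, cren_msg, Msg.map, Chan.rename_inv, ← Hole.ctx_ren, ← Hole.root_ren,
      Hole.add_ren] at this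
    simpa [ctxren, Chan.rename_inv, Chan.rename_succ] using this

theorem ups_ren (h : y ∈ Ups Δ K D) (π : Equiv.Perm ℕ) :
    y.rename π ∈ Ups (ctxren π Δ) (rootren π K) (cren π D) := by
  obtain ⟨h, M, hM, rfl⟩ := h
  refine ⟨?_, M.map (Chan.rename π), mem_map_of_mem (Node.ren π) hM, Msg.carrier_map _ _⟩
  rw [ifaceChans_ren]
  exact ⟨_, h, rfl⟩

theorem thet_ren (h : y ∈ Thet Δ K D) (π : Equiv.Perm ℕ) :
    y.rename π ∈ Thet (ctxren π Δ) (rootren π K) (cren π D) := by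
  obtain ⟨h, x, P, hP, hw⟩ := h
  refine ⟨?_, _, _, mem_map_of_mem (Node.ren π) hP, hw.map _⟩
  rw [ifaceChans_ren]
  exact ⟨_, h, rfl⟩

theorem ctxren_inv_ren (π : Equiv.Perm ℕ) (Δ : Ctx L TN Chan) : ctxren π⁻¹ (ctxren π Δ) = Δ := by
  rw [ctxren_mul, inv_mul_cancel]
  exact ctxren_eq_self (fun _ _ => rfl)

theorem rootren_inv_ren (π : Equiv.Perm ℕ) (K : Root L TN) : rootren π⁻¹ (rootren π K) = K := by
  rw [rootren_mul, inv_mul_cancel]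
  exact rootren_eq_self (fun _ _ _ => rfl)

theorem Obs.ren (hR : Nominal Sg R) (h : Obs Sg R Δ K D₁ D₂) (π : Equiv.Perm ℕ) :
    Obs Sg R (ctxren π Δ) (rootren π K) (cren π D₁) (cren π D₂) := by
  have back : ∀ {H : Hole L TN} {T : Ty L TN} {y : Chan}, ctxren π Δ = H.ctx y T →
      rootren π K = H.root y T →
      Δ = (H.ren π⁻¹).ctx (y.rename π⁻¹) T ∧ K = (H.ren π⁻¹).root (y.rename π⁻¹) T := by
    intro H T y h1 h2
    rw [Hole.ctx_ren, Hole.root_ren, ← h1, ← h2, ctxren_inv_ren, rootren_inv_ren]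
    exact ⟨rfl, rfl⟩
  refine ⟨fun y hy => ?_, fun H T y h1 h2 hy => ?_, fun H T y h1 h2 hy => ?_⟩
  · have := ups_ren hy π⁻¹
    rw [ctxren_inv_ren, rootren_inv_ren, cren_inv_cren] at this
    have := ups_ren (h.ups this) π
    rwa [Chan.rename_inv] at this
  · have hy' := ups_ren hy π⁻¹
    rw [ctxren_inv_ren, rootren_inv_ren, cren_inv_cren] at hy'
    have := (h.out _ _ _ (back h1 h2).1 (back h1 h2).2 hy').ren hR π
    rwa [Hole.ren_inv, Chan.rename_inv] at this
  · have hy' := thet_ren hy π⁻¹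
    rw [ctxren_inv_ren, rootren_inv_ren, cren_inv_cren] at hy'
    have := (h.inn _ _ _ (back h1 h2).1 (back h1 h2).2 hy').ren hR π
    rwa [Hole.ren_inv, Chan.rename_inv] at this

theorem AlphaEq.cancel_msg
    (hM : ∀ c ∈ M.chans, c.base ∈ bases (ifaceChans (H.ctx y T) (H.root y T)))
    (h : AlphaEq (H.ctx y T) (H.root y T) (D + {.msg M}) D') :
    ∃ D'', D' = D'' + {.msg M} ∧ AlphaEq (H.ctx y T) (H.root y T) D D'' := by
  obtain ⟨π, hπ, rfl⟩ := h
  refine ⟨cren π D, ?_, π, hπ, rfl⟩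
  change cren π _ = _
  rw [cren_add, cren_msg, Msg.map_eq_self (fun c hc => Chan.rename_eq_self (hπ _ (hM c hc)))]

theorem AlphaEq.succ {B : Ty L TN} (h : AlphaEq (H.ctx y T) (H.root y T) D D') :
    AlphaEq (H.ctx y.succ B) (H.root y.succ B) D D' := by
  obtain ⟨π, hπ, rfl⟩ := h
  exact ⟨π, Hole.fixes_succ.2 hπ, rfl⟩

theorem OutN.alpha (hR : Nominal Sg R) (h : OutN Sg R H T y D₁ D₂)
    (ha : AlphaEq (H.ctx y T) (H.root y T) D₂ D₂') : OutN Sg R H T y D₁ D₂' := by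
  have hy : y.base ∈ bases (ifaceChans (H.ctx y T) (H.root y T)) := mem_bases (H.mem_iface y T)
  cases h with
  | close hH hT h1 h2 =>
    obtain ⟨π, hπ, rfl⟩ := ha
    refine .close hH hT h1 ?_
    change cren π D₂ = _
    rw [h2, cren_msg, Msg.map, Chan.rename_eq_self (hπ _ hy)]
  | lab I A hT k D₁' D₂' h1 h2 h =>
    subst h2
    obtain ⟨D₂'', rfl, ha'⟩ := ha.cancel_msg (by
      rintro c (rfl | rfl)
      exacts [hy, hy])
    exact .lab I A hT k D₁' D₂'' h1 rfl (hR.alpha h ha'.succ)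
  | send H₀ Γ hH A B hT x S₁ S₂ D₁' D₂' h1 h2 hS hD =>
    exact .send H₀ Γ hH A B hT x S₁ S₂ D₁' D₂' h1 (ha.symm.trans h2) hS hD

/-- A renaming of bound channels can be assumed to fix a new channel. -/
theorem AlphaEq.add_send {B : Ty L TN} (h : AlphaEq (H.ctx y T) (H.root y T) D D')
    (hx : x.base ∉ bases (allChans (H.ctx y T) (H.root y T) D))
    (hx' : x.base ∉ bases (allChans (H.ctx y T) (H.root y T) D')) :
    AlphaEq ((H.add {(x, A)}).ctx y.succ B) ((H.add {(x, A)}).root y.succ B)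
      (D + {.msg (.send x y)}) (D' + {.msg (.send x y)}) := by
  obtain ⟨π, hπ, rfl⟩ := h
  rw [bases_allChans] at hx hx'
  have hy := hπ _ (mem_bases (H.mem_iface y T))
  have hxi : x.base ∉ bases (ifaceChans (H.ctx y T) (H.root y T)) := fun h => hx (Or.inl h)
  have key : ∀ b, b ≠ x.base → π b ≠ x.base → (Equiv.swap (π x.base) x.base * π) b = π b :=
    fun b h1 h2 => Equiv.swap_apply_of_ne_of_ne (fun h => h1 (π.injective h)) h2
  have fix : ∀ b ∈ bases (ifaceChans (H.ctx y T) (H.root y T)),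
      (Equiv.swap (π x.base) x.base * π) b = b := by
    intro b hb
    rw [key b (fun h => hxi (h ▸ hb)) (by rw [hπ b hb]; exact fun h => hxi (h ▸ hb)), hπ b hb]
  have fx : x.rename (Equiv.swap (π x.base) x.base * π) = x :=
    Chan.rename_eq_self (Equiv.swap_apply_left _ _)
  refine ⟨Equiv.swap (π x.base) x.base * π, ?_, ?_⟩
  · rw [Hole.bases_succ (T := T), Hole.iface, Hole.chans_add, bases_union, bases_union,
      dom_singleton]
    rintro b (hb | ⟨c, hc, rfl⟩ | hb)
    · exact fix b (by rw [Hole.iface, bases_union]; exact Or.inl hb)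
    · rw [mem_singleton_iff.1 hc]
      exact Equiv.swap_apply_left _ _
    · exact fix b (by rw [Hole.iface, bases_union]; exact Or.inr hb)
  · change _ = cren _ _
    rw [cren_add, cren_msg, Msg.map, fx, Chan.rename_eq_self (fix _ (mem_bases (H.mem_iface y T)))]
    congr 1
    refine cren_congr (fun b hb => (key b ?_ ?_).symm)
    · rintro rfl
      exact hx (Or.inr hb)
    · intro h
      refine hx' (Or.inr ?_)
      change _ ∈ bases (confChans (cren π D))
      rw [confChans_cren, bases_ren]
      exact ⟨b, hb, h⟩

theorem InN.alpha (hR : Nominal Sg R) (h : InN Sg R H T y D₁ D₂)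
    (ha : AlphaEq (H.ctx y T) (H.root y T) D₂ D₂') : InN Sg R H T y D₁ D₂' := by
  have hy : y.base ∈ bases (ifaceChans (H.ctx y T) (H.root y T)) := mem_bases (H.mem_iface y T)
  have add : ∀ M, (∀ c ∈ M.chans, c.base = y.base) →
      AlphaEq (H.ctx y T) (H.root y T) (D₂ + {.msg M}) (D₂' + {.msg M}) := by
    intro M hM
    obtain ⟨π, hπ, rfl⟩ := ha
    refine ⟨π, hπ, ?_⟩
    change _ = cren _ _
    rw [cren_add, cren_msg, Msg.map_eq_self (fun c hc => Chan.rename_eq_self (by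
      rw [hM c hc, hπ _ hy]))]
  cases h with
  | close Δ K hH hT h =>
    subst hH
    obtain ⟨π, hπ, e⟩ := add (.close y) (by rintro c rfl; rfl)
    refine .close Δ K rfl hT (hR.alpha h ⟨π, fun b hb => hπ b ?_, e⟩)
    rw [Hole.iface, bases_union]
    exact Or.inr hb
  | lab I A hT h =>
    refine .lab I A hT (fun k => hR.alpha (h k) (add _ ?_).succ)
    rintro c (rfl | rfl) <;> rfl
  | send A B hT M hM h =>
    refine .send A B hT (M ∪ (bases (allChans (H.ctx y T) (H.root y T) D₂) ∪
      bases (allChans (H.ctx y T) (H.root y T) D₂'))) (hM.union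
        ((bases_finite (allChans_finite _ _ _)).union (bases_finite (allChans_finite _ _ _))))
      (fun x hx => ?_)
    simp only [mem_union, not_or] at hx
    exact hR.alpha (h x hx.1) (ha.add_send hx.2.1 hx.2.2)

theorem Obs.alpha (hR : Nominal Sg R) (h : Obs Sg R Δ K D₁ D₂) (ha : AlphaEq Δ K D₂ D₂') :
    Obs Sg R Δ K D₁ D₂' := by
  refine ⟨fun y hy => ?_, ?_, ?_⟩
  · obtain ⟨π, hπ, rfl⟩ := ha
    have := ups_ren (h.ups hy) π
    rwa [Fixes.ctx hπ, Fixes.root hπ, Chan.rename_eq_self (hπ _ (mem_bases hy.1))] at this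
  · rintro H T y rfl rfl hy
    exact (h.out H T y rfl rfl hy).alpha hR ha
  · rintro H T y rfl rfl hy
    exact (h.inn H T y rfl rfl hy).alpha hR ha

theorem OutN.mono (hRR : ∀ Δ K D₁ D₂, R Δ K D₁ D₂ → R' Δ K D₁ D₂) (h : OutN Sg R H T y D₁ D₂) :
    OutN Sg R' H T y D₁ D₂ := by
  cases h with
  | close hH hT h1 h2 => exact .close hH hT h1 h2
  | lab I A hT k D₁' D₂' h1 h2 h => exact .lab I A hT k D₁' D₂' h1 h2 (hRR _ _ _ _ h)
  | send H₀ Γ hH A B hT x S₁ S₂ D₁' D₂' h1 h2 hS hD =>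
    exact .send H₀ Γ hH A B hT x S₁ S₂ D₁' D₂' h1 h2 (hRR _ _ _ _ hS) (hRR _ _ _ _ hD)

theorem InN.mono (hRR : ∀ Δ K D₁ D₂, R Δ K D₁ D₂ → R' Δ K D₁ D₂) (h : InN Sg R H T y D₁ D₂) :
    InN Sg R' H T y D₁ D₂ := by
  cases h with
  | close Δ K hH hT h => exact .close Δ K hH hT (hRR _ _ _ _ h)
  | lab I A hT h => exact .lab I A hT (fun k => hRR _ _ _ _ (h k))
  | send A B hT M hM h => exact .send A B hT M hM (fun x hx => hRR _ _ _ _ (h x hx))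

theorem Obs.mono (hRR : ∀ Δ K D₁ D₂, R Δ K D₁ D₂ → R' Δ K D₁ D₂) (h : Obs Sg R Δ K D₁ D₂) :
    Obs Sg R' Δ K D₁ D₂ :=
  ⟨h.ups, fun H T y h1 h2 hy => (h.out H T y h1 h2 hy).mono hRR,
    fun H T y h1 h2 hy => (h.inn H T y h1 h2 hy).mono hRR⟩

theorem E_succ_of_nominal (hSg : Sg.WF) (hE : Nominal Sg (E Sg m)) : E Sg (m + 1) Δ K D₁ D₂ ↔
      Tree Sg Δ K D₁ ∧ Tree Sg Δ K D₂ ∧ ∀ D₁', Steps Sg Δ K D₁ D₁' →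
        ∃ D₂', Steps Sg Δ K D₂ D₂' ∧ Obs Sg (E Sg m) Δ K D₁' D₂' := by
  rw [E]
  refine and_congr_right fun t1 => and_congr_right fun t2 => forall_congr' fun D₁' =>
    imp_congr_right fun h1 => exists_congr fun D₂' => and_congr_right fun h2 => ?_
  exact (obs_iff hSg hE (t1.steps hSg h1) (t2.steps hSg h2)).symm

theorem E_nominal (hSg : Sg.WF) (m : ℕ) : Nominal Sg (E Sg m) := by
  induction m with
  | zero =>
    refine ⟨fun h => h, fun π h => ⟨h.1.ren hSg π, h.2.ren hSg π⟩, fun h ha => ⟨h.1, ha.tree hSg h.2⟩⟩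
  | succ m ih =>
    refine ⟨fun h => ⟨h.1, h.2.1⟩, fun {Δ K D₁ D₂} π h => ?_, fun {Δ K D₁ D₂ D₂'} h ha => ?_⟩
    · rw [E_succ_of_nominal hSg ih] at h ⊢
      refine ⟨h.1.ren hSg π, h.2.1.ren hSg π, fun D₁' h1 => ?_⟩
      have ren : ∀ {ρ} {Δ} {K} {X Y},
          Steps Sg Δ K X Y → Steps Sg (ctxren ρ Δ) (rootren ρ K) (cren ρ X) (cren ρ Y) := by
        intro ρ Δ K X Y h
        refine Reds.ren (ifaceBases_finite Δ K) h (fun b hb => ?_)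
        rw [ifaceChans_ren, bases_ren] at hb
        obtain ⟨b', hb', e⟩ := hb
        exact ρ.injective e ▸ hb'
      have h1' := ren (ρ := π⁻¹) h1
      rw [ctxren_inv_ren, rootren_inv_ren, cren_inv_cren] at h1'
      obtain ⟨D₂', h2, ho⟩ := h.2.2 _ h1'
      refine ⟨cren π D₂', ren h2, ?_⟩
      have := ho.ren ih π
      rwa [cren_cren_inv] at this
    · rw [E_succ_of_nominal hSg ih] at h ⊢
      refine ⟨h.1, ha.tree hSg h.2.1, fun D₁' h1 => ?_⟩
      obtain ⟨X, h2, ho⟩ := h.2.2 _ h1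
      obtain ⟨X', h3, ha'⟩ := ha.steps h2
      exact ⟨X', h3, ho.alpha ih ha'⟩

theorem E_succ_iff (hSg : Sg.WF) : E Sg (m + 1) Δ K D₁ D₂ ↔
      Tree Sg Δ K D₁ ∧ Tree Sg Δ K D₂ ∧ ∀ D₁', Steps Sg Δ K D₁ D₁' →
        ∃ D₂', Steps Sg Δ K D₂ D₂' ∧ Obs Sg (E Sg m) Δ K D₁' D₂' :=
  E_succ_of_nominal hSg (E_nominal hSg m)

theorem E.pred (hSg : Sg.WF) : ∀ {Δ : Ctx L TN Chan} {K : Root L TN}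
    {D₁ D₂ : Config L TN PN}, E Sg (m + 1) Δ K D₁ D₂ → E Sg m Δ K D₁ D₂ := by
  induction m with
  | zero => exact fun h => ⟨h.1, h.2.1⟩
  | succ m ih =>
    intro Δ K D₁ D₂ h
    rw [E_succ_iff hSg] at h ⊢
    refine ⟨h.1, h.2.1, fun D₁' h1 => ?_⟩
    obtain ⟨D₂', h2, ho⟩ := h.2.2 _ h1
    exact ⟨D₂', h2, ho.mono (fun _ _ _ _ h => ih h)⟩

theorem E.le (hSg : Sg.WF) {n : ℕ} (hmn : m ≤ n) (h : E Sg n Δ K D₁ D₂) : E Sg m Δ K D₁ D₂ := by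
  induction hmn with
  | refl => exact h
  | step _ ih => exact ih (h.pred hSg)

theorem E.steps_left (hSg : Sg.WF) (h : E Sg m Δ K D₁ D₂) (hs : Steps Sg Δ K D₁ D₁') :
    E Sg m Δ K D₁' D₂ := by
  cases m with
  | zero => exact ⟨h.1.steps hSg hs, h.2⟩
  | succ m =>
    rw [E_succ_iff hSg] at h ⊢
    exact ⟨h.1.steps hSg hs, h.2.1, fun X hX => h.2.2 X (hs.trans hX)⟩

theorem E.steps_back (hSg : Sg.WF) (h : E Sg m Δ K D₁ D₂') (t : Tree Sg Δ K D₂)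
    (hs : Steps Sg Δ K D₂ D₂') : E Sg m Δ K D₁ D₂ := by
  cases m with
  | zero => exact ⟨h.1, t⟩
  | succ m =>
    rw [E_succ_iff hSg] at h ⊢
    refine ⟨h.1, t, fun X hX => ?_⟩
    obtain ⟨Y, hY, ho⟩ := h.2.2 X hX
    exact ⟨Y, hs.trans hY, ho⟩

/-! ### Type equality and the logical relation -/

/-- Equality of holes up to equality of types. -/
inductive Hole.Eqv (Sg : Signature L TN PN) : Hole L TN → Hole L TN → Prop
  | right {Δ Δ' : Ctx L TN Chan} (h : Sg.qc Δ = Sg.qc Δ') : Hole.Eqv Sg (.right Δ) (.right Δ')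
  | left {Δ Δ' : Ctx L TN Chan} {K K' : Root L TN} (h : Sg.qc Δ = Sg.qc Δ')
      (hK : Sg.rq K = Sg.rq K') : Hole.Eqv Sg (.left Δ K) (.left Δ' K')

theorem Hole.Eqv.ctx (h : Hole.Eqv Sg H H') (hT : Sg.q T = Sg.q T') :
    Sg.qc (H.ctx y T) = Sg.qc (H'.ctx y T') := by
  cases h with
  | right h => exact h
  | left h => simp [Hole.ctx, h, hT]

theorem Hole.Eqv.root (h : Hole.Eqv Sg H H') (hT : Sg.q T = Sg.q T') :
    Sg.rq (H.root y T) = Sg.rq (H'.root y T') := by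
  cases h with
  | right h => simp [Hole.root, Signature.rq, hT]
  | left h hK => exact hK

theorem Hole.Eqv.pos (h : Hole.Eqv Sg H H') : H.pos = H'.pos := by
  cases h <;> rfl

theorem qc_split (hSg : Sg.WF) (h : Sg.qc (Γ + Δ) = Sg.qc Δ') :
    ∃ Γ' Δ'', Δ' = Γ' + Δ'' ∧ Sg.qc Γ = Sg.qc Γ' ∧ Sg.qc Δ = Sg.qc Δ'' := by
  obtain ⟨Γ', Δ'', h1, h2, rfl⟩ := Multiset.rel_add_left.1 ((qc_eq hSg).1 h)
  exact ⟨Γ', Δ'', rfl, (qc_eq hSg).2 h1, (qc_eq hSg).2 h2⟩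

theorem qc_split_cons (hSg : Sg.WF) (h : Sg.qc ((y, T) ::ₘ Δ) = Sg.qc Δ') :
    ∃ T' Δ'', Δ' = (y, T') ::ₘ Δ'' ∧ Sg.q T = Sg.q T' ∧ Sg.qc Δ = Sg.qc Δ'' := by
  obtain ⟨⟨y', T'⟩, Δ'', ⟨h1, h2⟩, h3, rfl⟩ := Multiset.rel_cons_left.1 ((qc_eq hSg).1 h)
  obtain rfl : y = y' := h1
  exact ⟨T', Δ'', rfl, (q_eq hSg).2 h2, (qc_eq hSg).2 h3⟩

theorem Hole.Eqv.split (hSg : Sg.WF) (h : Hole.Eqv Sg (H₀.add Γ) H') :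
    ∃ H₀' Γ', H' = H₀'.add Γ' ∧ Sg.qc Γ = Sg.qc Γ' ∧ Hole.Eqv Sg H₀ H₀' := by
  generalize e : H₀.add Γ = H at h
  cases h with
  | right h =>
    cases H₀ with
    | left => cases e
    | right Δ =>
      cases e
      obtain ⟨Γ', Δ', rfl, h1, h2⟩ := qc_split hSg h
      exact ⟨.right Δ', Γ', rfl, h1, .right h2⟩
  | left h hK =>
    cases H₀ with
    | right => cases e
    | left Δ K =>
      cases e
      obtain ⟨Γ', Δ', rfl, h1, h2⟩ := qc_split hSg h
      exact ⟨.left Δ' _, Γ', rfl, h1, .left h2 hK⟩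

theorem exists_hole_eqv (hSg : Sg.WF) (h : Sg.qc Δ = Sg.qc (H'.ctx y T'))
    (hK : Sg.rq K = Sg.rq (H'.root y T')) :
    ∃ H T, Δ = H.ctx y T ∧ K = H.root y T ∧ Hole.Eqv Sg H H' ∧ Sg.q T = Sg.q T' := by
  cases H' with
  | right Δ' =>
    rcases K with _ | ⟨x, T⟩
    · simp [Signature.rq, Hole.root] at hK
    · simp only [Signature.rq, Hole.root, Option.map_some, Prod.map, id, Option.some.injEq,
        Prod.mk.injEq] at hK
      obtain ⟨rfl, hT⟩ := hK
      exact ⟨.right Δ, T, rfl, rfl, .right h, hT⟩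
  | left Δ' K' =>
    obtain ⟨T, Δ'', rfl, h1, h2⟩ := qc_split_cons hSg h.symm
    exact ⟨.left Δ'' K, T, rfl, rfl, .left h2.symm hK, h1.symm⟩

/-- The relation is closed under equality of types. -/
def ConvClosed (Sg : Signature L TN PN) (R : ConfRel L TN PN) : Prop :=
  ∀ ⦃Δ Δ' : Ctx L TN Chan⦄ ⦃K K' : Root L TN⦄ ⦃D₁ D₂ : Config L TN PN⦄, R Δ K D₁ D₂ →
    Sg.qc Δ = Sg.qc Δ' → Sg.rq K = Sg.rq K' → R Δ' K' D₁ D₂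

theorem q_one_iff (hSg : Sg.WF) (h : Sg.q T = Sg.q T') (hT : Sg.unf T = .one) :
    Sg.unf T' = .one := by
  have := TyEq.head ((q_eq hSg).1 h)
  rw [hT] at this
  generalize Sg.unf T' = S at this
  cases this
  rfl

theorem q_lab_iff (hSg : Sg.WF) (h : Sg.q T = Sg.q T') {p : Bool} {A : {l // l ∈ I} → Ty L TN}
    (hT : Sg.unf T = labTy p I A) :
    ∃ A', Sg.unf T' = labTy p I A' ∧ ∀ l, Sg.q (A l) = Sg.q (A' l) := by
  refine q_labTy hSg ?_
  rw [← hT, q_unf hSg, h]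

theorem q_send_iff (hSg : Sg.WF) (h : Sg.q T = Sg.q T') {p : Bool} {B : Ty L TN}
    (hT : Sg.unf T = sendTy p A B) :
    ∃ A' B', Sg.unf T' = sendTy p A' B' ∧ Sg.q A = Sg.q A' ∧ Sg.q B = Sg.q B' := by
  refine q_sendTy hSg ?_
  rw [← hT, q_unf hSg, h]

theorem Obs.conv (hSg : Sg.WF) (hR : ConvClosed Sg R) (h : Obs Sg R Δ K D₁ D₂)
    (hΔ : Sg.qc Δ = Sg.qc Δ') (hK : Sg.rq K = Sg.rq K') : Obs Sg R Δ' K' D₁ D₂ := by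
  have hi := ifaceChans_conv (Sg := Sg) hΔ hK
  have hU : ∀ D : Config L TN PN, Ups Δ' K' D = Ups Δ K D := fun D => by rw [Ups, Ups, hi]
  have hθ : ∀ D : Config L TN PN, Thet Δ' K' D = Thet Δ K D := fun D => by rw [Thet, Thet, hi]
  refine ⟨by rw [hU, hU]; exact h.ups, fun H' T' y e1 e2 hy => ?_, fun H' T' y e1 e2 hy => ?_⟩
  · rw [hU] at hy
    obtain ⟨H, T, rfl, rfl, hH, hT⟩ := exists_hole_eqv hSg (e1 ▸ hΔ) (e2 ▸ hK)
    rcases h.out H T y rfl rfl hy with ⟨rfl, h1, h2, h3⟩ | ⟨I, A, h1, k, X₁, X₂, h2, h3, h4⟩ |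
      ⟨H₀, Γ, rfl, A, B, h1, x, S₁, S₂, X₁, X₂, h2, h3, h4, h5⟩
    · cases hH with
      | right h =>
        refine .close ?_ (q_one_iff hSg hT h1) h2 h3
        rw [qc_zero] at h
        rw [Multiset.map_eq_zero.1 h.symm]
    · obtain ⟨A', h1', hA⟩ := q_lab_iff hSg hT h1
      exact .lab I A' (hH.pos ▸ h1') k X₁ X₂ h2 h3 (hR h4 (hH.ctx (hA k)) (hH.root (hA k)))
    · obtain ⟨A', B', h1', hA, hB⟩ := q_send_iff hSg hT h1
      have hp := hH.pos
      obtain ⟨H₀', Γ', rfl, hΓ, hH₀⟩ := hH.split hSg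
      refine .send H₀' Γ' rfl A' B' (hp ▸ h1') x S₁ S₂ X₁ X₂ h2 ?_ (hR h4 hΓ ?_)
        (hR h5 (hH₀.ctx hB) (hH₀.root hB))
      · rw [AlphaEq, ← e1, ← e2, ← hi]
        exact h3
      · simp [Signature.rq, hA]
  · rw [hθ] at hy
    obtain ⟨H, T, rfl, rfl, hH, hT⟩ := exists_hole_eqv hSg (e1 ▸ hΔ) (e2 ▸ hK)
    rcases h.inn H T y rfl rfl hy with ⟨Δ, K, rfl, h1, h2⟩ | ⟨I, A, h1, h2⟩ | ⟨A, B, h1, M, hM, h2⟩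
    · cases hH with
      | left h h' => exact .close _ _ rfl (q_one_iff hSg hT h1) (hR h2 h h')
    · obtain ⟨A', h1', hA⟩ := q_lab_iff hSg hT h1
      exact .lab I A' (hH.pos ▸ h1') (fun k => hR (h2 k) (hH.ctx (hA k)) (hH.root (hA k)))
    · obtain ⟨A', B', h1', hA, hB⟩ := q_send_iff hSg hT h1
      refine .send A' B' (hH.pos ▸ h1') M hM (fun x hx => hR (h2 x hx) ?_ ?_)
      · rw [Hole.ctx_add, Hole.ctx_add, qc_add, qc_add, hH.ctx hB, qc_singleton, qc_singleton, hA]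
      · rw [Hole.root_add, Hole.root_add, hH.root hB]

theorem E_conv (hSg : Sg.WF) (m : ℕ) : ConvClosed Sg (E Sg m) := by
  induction m with
  | zero => exact fun _ _ _ _ _ _ h hΔ hK => ⟨h.1.conv hSg hΔ hK, h.2.conv hSg hΔ hK⟩
  | succ m ih =>
    intro Δ Δ' K K' D₁ D₂ h hΔ hK
    rw [E_succ_iff hSg] at h ⊢
    refine ⟨h.1.conv hSg hΔ hK, h.2.1.conv hSg hΔ hK, fun D₁' h1 => ?_⟩
    rw [Steps, ← ifaceChans_conv (Sg := Sg) hΔ hK] at h1 ⊢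
    obtain ⟨D₂', h2, ho⟩ := h.2.2 _ h1
    exact ⟨D₂', h2, ho.conv hSg ih hΔ hK⟩

/-! ### Forward closure of the logical relation -/

/-- The parts into which a tree is split by a message `send x y` along a free channel `y` have no
base in common. -/
theorem Tree.send_disjoint (hSg : Sg.WF) {B : Ty L TN} {S R : Config L TN PN}
    (t : Tree Sg ((H₀.add Γ).ctx y T) ((H₀.add Γ).root y T) (S + R + {.msg (.send x y)}))
    (tS : Tree Sg Γ (some (x, A)) S) (tR : Tree Sg (H₀.ctx y.succ B) (H₀.root y.succ B) R) :
    Disjoint (bases (allChans Γ (some (x, A)) S))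
      (bases (allChans (H₀.ctx y.succ B) (H₀.root y.succ B) R)) := by
  refine t.split_disjoint hSg (y := y) rfl tS tR ?_
  cases H₀ with
  | right Δ => exact Or.inl ⟨rfl, T, rfl⟩
  | left Δ K => exact Or.inr ⟨T, B, Δ, rfl, rfl⟩

theorem reds_zero (hN : N.Finite) (h : Reds Sg N 0 D) : D = 0 := by
  induction h with
  | refl => rfl
  | tail _ h ih =>
    subst ih
    obtain ⟨b, C, x, P, oM, B, -, -, e, -⟩ := h.red hN
    have : Node.proc x P ∈ (0 : Config L TN PN) :=
      e ▸ mem_add.2 (Or.inr (mem_redex_self _ _ _))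
    simp at this

theorem msg_bases_finite (M : Msg L) : (bases M.chans).Finite := by
  have := confBases_finite ({.msg M} : Config L Empty Empty)
  rwa [confChans_singleton] at this

theorem Tree.steps_msg (hSg : Sg.WF) (t : Tree Sg (H.ctx y T) (H.root y T) (D + {.msg M}))
    (hM : M.carrier = y) (h : Steps Sg (H.ctx y T) (H.root y T) (D + {.msg M}) W) :
    ∃ D', W = D' + {.msg M} ∧
      Reds Sg (bases (ifaceChans (H.ctx y T) (H.root y T)) ∪ bases M.chans) D D' :=
  t.reds_msg hSg (ifaceBases_finite _ _) subset_rfl (by rw [hM]; exact H.mem_iface y T) h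

/-- The steps of a tree that is split by a message `send x y` along a free channel `y`. -/
theorem Tree.steps_send (hSg : Sg.WF) {B : Ty L TN} {S R : Config L TN PN}
    (t : Tree Sg ((H₀.add Γ).ctx y T) ((H₀.add Γ).root y T) (S + R + {.msg (.send x y)}))
    (tS : Tree Sg Γ (some (x, A)) S) (tR : Tree Sg (H₀.ctx y.succ B) (H₀.root y.succ B) R)
    (h : Steps Sg ((H₀.add Γ).ctx y T) ((H₀.add Γ).root y T) (S + R + {.msg (.send x y)}) W) :
    ∃ S' R', W = S' + R' + {.msg (.send x y)} ∧ Steps Sg Γ (some (x, A)) S S' ∧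
      Steps Sg (H₀.ctx y.succ B) (H₀.root y.succ B) R R' := by
  obtain ⟨Z, rfl, hZ⟩ := t.steps_msg hSg rfl h
  have hN := (ifaceBases_finite ((H₀.add Γ).ctx y T) ((H₀.add Γ).root y T)).union
    (msg_bases_finite (.send x y : Msg L))
  have hd := t.send_disjoint hSg tS tR
  rw [bases_allChans, bases_allChans] at hd
  obtain ⟨S', R', rfl, hS, hR, -⟩ := Reds.split hN (empty_subset _) (empty_subset _) hZ (by
    rw [empty_union, empty_union]
    exact hd.mono subset_union_right subset_union_right)
  refine ⟨S', R', rfl, hS.anti hN ?_, hR.anti hN ?_⟩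
  · rintro _ ⟨c, hc, rfl⟩
    rcases hc with hc | ⟨_, hc⟩
    · refine Or.inl (mem_bases ?_)
      rw [Hole.iface, Hole.chans_add]
      exact Or.inr (Or.inl hc)
    · cases hc
      exact Or.inr (mem_bases (Or.inl rfl))
  · rw [Hole.bases_succ (T := T)]
    rintro _ ⟨c, hc, rfl⟩
    refine Or.inl (mem_bases ?_)
    rw [Hole.iface] at hc ⊢
    rw [Hole.chans_add]
    exact hc.imp_right Or.inr

theorem Tree.ups_mono (hSg : Sg.WF) (t : Tree Sg Δ K D) (h : Steps Sg Δ K D D') :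
    Ups Δ K D ⊆ Ups Δ K D' := by
  rintro y ⟨hy, M, hM, rfl⟩
  obtain ⟨C, rfl⟩ := exists_cons_of_mem hM
  rw [← singleton_add, add_comm] at t h
  obtain ⟨C', rfl, -⟩ := t.reds_msg hSg (ifaceBases_finite _ _) subset_rfl hy h
  exact ⟨hy, M, by simp, rfl⟩

/-- The relation is closed under steps of the second configuration. -/
def FwdClosed (Sg : Signature L TN PN) (R : ConfRel L TN PN) : Prop :=
  ∀ ⦃Δ : Ctx L TN Chan⦄ ⦃K : Root L TN⦄ ⦃D₁ D₂ D₂' : Config L TN PN⦄, R Δ K D₁ D₂ →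
    Steps Sg Δ K D₂ D₂' → R Δ K D₁ D₂'

theorem Hole.bases_add_send (H : Hole L TN) (x y : Chan) (T A B : Ty L TN) :
    bases (ifaceChans ((H.add {(x, A)}).ctx y.succ B) ((H.add {(x, A)}).root y.succ B)) =
      bases (ifaceChans (H.ctx y T) (H.root y T)) ∪ {x.base} := by
  rw [Hole.bases_succ (T := T), Hole.iface, Hole.iface, Hole.chans_add, dom_singleton,
    bases_union, bases_union, bases_union, union_assoc, Set.union_comm (bases {x})]
  simp [bases]

/-- Steps can be performed in the presence of a message along a free channel. -/
theorem Steps.add_msg {B : Ty L TN} (hM : ∀ c ∈ M.chans, c.base = y.base)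
    (h : Steps Sg (H.ctx y T) (H.root y T) D D') :
    Steps Sg (H.ctx y.succ B) (H.root y.succ B) (D + {.msg M}) (D' + {.msg M}) := by
  refine Reds.frame (ifaceBases_finite _ _) h ?_ (by rw [Hole.bases_succ])
  rw [confChans_singleton]
  rintro _ ⟨c, hc, rfl⟩
  rw [hM c hc]
  exact mem_bases (H.mem_iface y T)

theorem Steps.add_send (h : Steps Sg (H.ctx y T) (H.root y T) D D') : ∃ M : Set ℕ, M.Finite ∧
      ∀ (x : Chan) (A B : Ty L TN), x.base ∉ M →
        Steps Sg ((H.add {(x, A)}).ctx y.succ B) ((H.add {(x, A)}).root y.succ B)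
          (D + {.msg (.send x y)}) (D' + {.msg (.send x y)}) := by
  obtain ⟨F, hF, hd, -, hf⟩ := Reds.fresh (ifaceBases_finite _ _) h
  refine ⟨F, hF, fun x A B hx => hf _ _ ?_ ?_⟩
  · rw [H.bases_add_send (T := T), disjoint_union_left, Set.disjoint_singleton_left]
    exact ⟨hd, hx⟩
  · rw [confChans_singleton, disjoint_left]
    rintro _ ⟨c, hc, rfl⟩ hcF
    have hy := hd.notMem_of_mem_left (mem_bases (H.mem_iface y T))
    rcases hc with rfl | rfl | rfl
    · exact hx hcF
    · exact hy hcF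
    · exact hy hcF

theorem OutN.fwd (hSg : Sg.WF) (hR : Nominal Sg R) (hf : FwdClosed Sg R)
    (h : OutN Sg R H T y D₁ D₂) (t : Tree Sg (H.ctx y T) (H.root y T) D₂)
    (hs : Steps Sg (H.ctx y T) (H.root y T) D₂ D₂') : OutN Sg R H T y D₁ D₂' := by
  cases h with
  | close hH hT h₁ h₂ =>
    subst h₂
    rw [← zero_add {_}] at t hs
    obtain ⟨D', rfl, hD⟩ := t.steps_msg hSg rfl hs
    obtain rfl := reds_zero ((ifaceBases_finite _ _).union (msg_bases_finite _)) hD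
    exact .close hH hT h₁ (zero_add _)
  | lab I A hT k X₁ X₂ h₁ h₂ h =>
    subst h₂
    obtain ⟨D', rfl, hD⟩ := t.steps_msg hSg rfl hs
    refine .lab I A hT k X₁ D' h₁ rfl (hf h (hD.anti
      ((ifaceBases_finite _ _).union (msg_bases_finite _)) ?_))
    rw [Hole.bases_succ (T := T)]
    exact subset_union_left
  | send H₀ Γ hH A B hT x S₁ S₂ X₁ X₂ h₁ h₂ hS hD =>
    subst hH
    obtain ⟨W, hW, ha⟩ := h₂.steps hs
    obtain ⟨S', R', rfl, h1, h2⟩ := (h₂.tree hSg t).steps_send hSg (hR.tree hS).2 (hR.tree hD).2 hW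
    exact .send H₀ Γ rfl A B hT x S₁ S' X₁ R' h₁ ha (hf hS h1) (hf hD h2)

theorem InN.fwd (hf : FwdClosed Sg R) (h : InN Sg R H T y D₁ D₂)
    (hs : Steps Sg (H.ctx y T) (H.root y T) D₂ D₂') : InN Sg R H T y D₁ D₂' := by
  cases h with
  | close Δ K hH hT h =>
    subst hH
    refine .close Δ K rfl hT (hf h ?_)
    refine Reds.frame (ifaceBases_finite _ _) hs ?_ (bases_mono ?_)
    · rw [confChans_singleton]
      rintro _ ⟨c, rfl, rfl⟩
      exact mem_bases (Hole.mem_iface (.left Δ K) _ T)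
    · rw [Hole.iface]
      exact subset_union_right
  | lab I A hT h =>
    refine .lab I A hT (fun k => hf (h k) (Steps.add_msg ?_ hs))
    rintro c (rfl | rfl) <;> rfl
  | send A B hT M hM h =>
    obtain ⟨F, hF, hs'⟩ := Steps.add_send hs
    refine .send A B hT (M ∪ F) (hM.union hF) (fun x hx => ?_)
    rw [mem_union, not_or] at hx
    exact hf (h x hx.1) (hs' x A B hx.2)

theorem Obs.fwd (hSg : Sg.WF) (hR : Nominal Sg R) (hf : FwdClosed Sg R) (h : Obs Sg R Δ K D₁ D₂)
    (t : Tree Sg Δ K D₂) (hs : Steps Sg Δ K D₂ D₂') : Obs Sg R Δ K D₁ D₂' := by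
  refine ⟨h.ups.trans (t.ups_mono hSg hs), ?_, ?_⟩
  · rintro H T y rfl rfl hy
    exact (h.out H T y rfl rfl hy).fwd hSg hR hf t hs
  · rintro H T y rfl rfl hy
    exact (h.inn H T y rfl rfl hy).fwd hf hs

theorem E_fwd (hSg : Sg.WF) (m : ℕ) : FwdClosed Sg (E Sg m) := by
  induction m with
  | zero => exact fun _ _ _ _ _ h hs => ⟨h.1, h.2.steps hSg hs⟩
  | succ m ih =>
    intro Δ K D₁ D₂ D₂' h hs
    rw [E_succ_iff hSg] at h ⊢
    refine ⟨h.1, h.2.1.steps hSg hs, fun D₁' h1 => ?_⟩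
    obtain ⟨X, hX, ho⟩ := h.2.2 _ h1
    obtain ⟨Z, W, hZ, hW, ha⟩ := h.2.1.confluent hSg hX hs
    exact ⟨W, hW, (ho.fwd hSg (E_nominal hSg m) ih (h.2.1.steps hSg hX) hZ).alpha
      (E_nominal hSg m) ha⟩

/-! ### Sinks -/

theorem Absorb.map {V : Type} {P : Proc L TN PN V} (h : Absorb P) :
    ∀ {W : Type} (f : V → W), Absorb (P.map f) := by
  induction h with
  | sendLab x k P _ ih => exact fun f => .sendLab _ _ _ (ih f)
  | case x I Q _ ih => exact fun f => .case _ _ _ (fun l => ih l f)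
  | send z x P _ ih => exact fun f => .send _ _ _ (ih f)
  | recv x P _ ih => exact fun f => .recv _ _ (ih _)
  | wait x Q _ ih => exact fun f => .wait _ _ (ih f)
  | spawn X args Q _ ih => exact fun f => .spawn _ _ _ (ih _)

theorem HasAbs.ren (h : HasAbs W) (π : Equiv.Perm ℕ) : HasAbs (cren π W) := by
  obtain ⟨n, hn, x, P, rfl, ha⟩ := h
  exact ⟨_, mem_map_of_mem (Node.ren π) hn, _, _, rfl, ha.map _⟩

theorem Sink.ren (h : Sink Sg W) (π : Equiv.Perm ℕ) : Sink Sg (cren π W) := by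
  obtain ⟨ha, P, z, hz, hP⟩ := h
  exact ⟨ha.ren π, _, _, hz.ren π, hP.map (Chan.rename_injective π)⟩

/-- A sink is a nonempty tree with an anonymous root that leaves a free channel to its absorbing
node. -/
theorem Sink.tree (hSg : Sg.WF) (h : Sink Sg W) (hl : Lineage (0 : Ctx L TN Chan) none W)
    (hc : c.base ∉ bases (confChans W)) : Tree Sg {(c, .one)} none W := by
  have hF : Flat Sg (Sg.qc {(c, .one)}) (0 : Config L TN PN) 0 (Sg.qc {(c, .one)}) := .nil _
  have hch : ∀ d ∈ allChans {(c, (.one : Ty L TN))} none (0 : Config L TN PN), d = c := by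
    rintro d ((hd | ⟨_, hd⟩) | hd)
    · rwa [dom_singleton] at hd
    · cases hd
    · rw [confChans_zero] at hd; exact hd.elim
  have := hF.add_sink hSg (by simp [keys]) (fun d hd d' hd' _ hg => by
    rw [hch d hd, hch d' hd'] at hg; exact absurd hg (lt_irrefl _)) (V := W) (by
    rw [Junk, disjoint_left]
    rintro _ ⟨d, hd, rfl⟩ h
    rw [hch d hd] at h
    exact hc h) h hl
  rwa [zero_add] at this

theorem Sink.of_tree (hSg : Sg.WF) (hW : W ≠ 0) (t : Tree Sg {(c, .one)} none W)
    (hc : c.base ∉ bases (confChans W)) : Sink Sg W := by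
  rw [← zero_add W] at t
  have hj : Junk {(c, (.one : Ty L TN))} none (0 : Config L TN PN) W := by
    rw [Junk, disjoint_left]
    rintro _ ⟨d, (hd | ⟨_, hd⟩) | hd, rfl⟩ h
    · rw [dom_singleton] at hd
      rw [mem_singleton_iff.1 hd] at h
      exact hc h
    · cases hd
    · rw [confChans_zero] at hd; exact hd.elim
  rcases (t.separate_cases hSg hj).2 with ⟨-, h⟩ | ⟨-, h⟩
  · obtain ⟨n, hn, -⟩ := h hW
    simp at hn
  · exact h (Or.inr (by simp))

theorem Red.ne_zero (h : Red Sg b x P oM B) : B ≠ 0 := by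
  cases h <;> simp

theorem Sink.reds (hSg : Sg.WF) (hN : N.Finite) {W' : Config L TN PN} (h : Sink Sg W)
    (hl : Lineage (0 : Ctx L TN Chan) none W) (hs : Reds Sg N W W') : Sink Sg W' := by
  obtain ⟨B, hB, -, hsub, hf⟩ := hs.fresh hN
  obtain ⟨c, hc⟩ := exists_fresh (hB.union (confBases_finite W))
  rw [mem_union, not_or] at hc
  have hs' := hf {c} 0 (Set.disjoint_singleton_left.2 hc.1) (by simp [confChans_zero, bases])
  rw [add_zero, add_zero] at hs'
  have t := (h.tree hSg hl (c := ⟨c, 0⟩) hc.2).reds hSg (finite_singleton c) hs' (by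
    rintro _ ⟨d, hd | ⟨_, hd⟩, rfl⟩
    · rw [dom_singleton] at hd
      rw [mem_singleton_iff.1 hd]
      rfl
    · cases hd)
  refine Sink.of_tree hSg ?_ t (fun h => (hsub h).elim hc.2 hc.1)
  cases hs.cases_tail with
  | inl e =>
    rw [e]
    obtain ⟨⟨n, hn, -⟩, -⟩ := h
    rintro rfl
    simp at hn
  | inr hs =>
    obtain ⟨_, _, hs⟩ := hs
    obtain ⟨b, C, x, P, oM, R, -, -, -, rfl, hr⟩ := hs.red hN
    rw [Ne, add_eq_zero]
    exact fun h => hr.ne_zero h.2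

/-- No reduct of the configuration contains a sink as a part that is named apart from the rest. -/
def SinkFree (Sg : Signature L TN PN) (U : Config L TN PN) : Prop :=
  ∀ U', Reds Sg ∅ U U' → ∀ a b, U' = a + b →
    Disjoint (bases (confChans a)) (bases (confChans b)) → ¬ Sink Sg a

theorem SinkFree.reds (hN : N.Finite) {U' : Config L TN PN} (h : SinkFree Sg U)
    (hs : Reds Sg N U U') : SinkFree Sg U' :=
  fun V hV => h V ((hs.anti hN (empty_subset _)).trans hV)

theorem SinkFree.ren (h : SinkFree Sg U) (π : Equiv.Perm ℕ) : SinkFree Sg (cren π U) := by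
  rintro U' hU' a b rfl hd ha
  have h1 := hU'.ren (π := π⁻¹) (N' := ∅) finite_empty (fun b hb => hb)
  rw [cren_inv_cren, cren_add] at h1
  refine h _ h1 _ _ rfl ?_ (ha.ren π⁻¹)
  rw [confChans_cren, confChans_cren, bases_ren, bases_ren]
  exact (Set.disjoint_image_iff (Equiv.injective _)).2 hd

theorem SinkFree.part {b : Config L TN PN} (h : SinkFree Sg (a + b))
    (hd : Disjoint (bases (confChans a)) (bases (confChans b))) : SinkFree Sg b := by
  rintro b' hb' c d rfl hcd hc
  obtain ⟨π, -, -, hπ⟩ := hb'.avoid finite_empty (M := bases (confChans a)) (confBases_finite a)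
    (fun x hx => (disjoint_left.1 hd hx.1 hx.2).elim)
  rw [empty_union] at hπ
  obtain ⟨B, -, hB, hs, -⟩ := hπ.fresh (confBases_finite a)
  have hda : Disjoint (bases (confChans (cren π (c + d)))) (bases (confChans a)) := by
    refine Disjoint.mono_left hs (disjoint_union_left.2 ⟨hd.symm, hB.symm⟩)
  have hf := hπ.frame (F := a) (N' := ∅) (confBases_finite a) subset_rfl (empty_subset _)
  rw [add_comm b, cren_add, add_assoc] at hf
  rw [cren_add, confChans_add, bases_union, disjoint_union_left] at hda
  refine h _ hf _ _ rfl ?_ (hc.ren π)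
  rw [confChans_add, bases_union, disjoint_union_right]
  refine ⟨?_, hda.1⟩
  rw [confChans_cren, confChans_cren, bases_ren, bases_ren]
  exact (Set.disjoint_image_iff (Equiv.injective _)).2 hcd

theorem Sink.of_part {b : Config L TN PN} (hs : Sink Sg (a + b))
    (hd : Disjoint (bases (confChans a)) (bases (confChans b))) : Sink Sg a ∨ Sink Sg b :=
  hs.of_add (disjoint_left.2 (fun _ h h' => disjoint_left.1 hd (mem_bases h) (mem_bases h')))

/-! ### Removal and addition of junk -/

theorem add_eq_add_split {α : Type*} {A B C D : Multiset α} (h : A + B = C + D) :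
    ∃ P Q R S, A = P + Q ∧ B = R + S ∧ C = P + R ∧ D = Q + S := by
  induction A using Multiset.induction generalizing C D with
  | empty => exact ⟨0, 0, C, D, by simp, by simpa using h, by simp, by simp⟩
  | cons a A ih =>
    rw [cons_add] at h
    rcases add_eq_cons h.symm with ⟨C, rfl, h'⟩ | ⟨D, rfl, h'⟩
    · obtain ⟨P, Q, R, S, rfl, rfl, rfl, rfl⟩ := ih h'
      exact ⟨a ::ₘ P, Q, R, S, by simp, rfl, by simp, rfl⟩
    · obtain ⟨P, Q, R, S, rfl, rfl, rfl, rfl⟩ := ih h'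
      exact ⟨P, a ::ₘ Q, R, S, by simp, rfl, rfl, by simp⟩

theorem Junk.mono {G' U' : Config L TN PN} (h : Junk Δ K G U)
    (h1 : bases (allChans Δ' K' G') ⊆ bases (allChans Δ K G)) (h2 : U' ≤ U) : Junk Δ' K' G' U' := by
  refine Disjoint.mono h1 (bases_mono ?_) h
  obtain ⟨V, rfl⟩ := Multiset.le_iff_exists_add.1 h2
  rw [confChans_add]
  exact subset_union_left

theorem Junk.ren (h : Junk Δ K G U) (hπ : Fixes π Δ K) : Junk Δ K (cren π G) (cren π U) := by
  have := (Set.disjoint_image_iff π.injective).2 h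
  rwa [← bases_ren, ← bases_ren, ← confChans_cren, ← allChans_ren, hπ.ctx, hπ.root] at this

/-- Adding junk to another part of the tree. -/
theorem Tree.add_part (hSg : Sg.WF) (t : Tree Sg Δ K (X + V)) (hj : Junk Δ K X V)
    (t' : Tree Sg Δ' K' G) (hj' : Junk Δ' K' G V) (ha : HasAbs X → HasAbs G)
    (hK : K = none → K' = none) (hX : K = none → X ≠ 0 ∨ Δ ≠ 0) : Tree Sg Δ' K' (G + V) := by
  obtain ⟨hV, h⟩ := t.separate_cases hSg hj
  have hl := hj.lineage_right t.2
  rcases h with ⟨-, h⟩ | ⟨rfl, h⟩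
  · by_cases hV0 : V = 0
    · subst hV0
      rwa [add_zero]
    · exact t'.add_junk hSg (ha (h hV0)) hj' hV hl
  · obtain rfl := hK rfl
    obtain ⟨⟨P, S, hF, hnd, -⟩, hl'⟩ := (tree_iff hSg).1 t'
    exact hF.add_sink hSg hnd hl' hj' (h (hX rfl)) hl

/-- Conditions under which the junk `U` can be removed from the tree `X + U`. -/
def Removable (Sg : Signature L TN PN) (Δ : Ctx L TN Chan) (K : Root L TN)
    (X U : Config L TN PN) : Prop :=
  K ≠ none ∨ SinkFree Sg U ∨ ∃ G W, X = G + W ∧ Sink Sg W ∧ Junk Δ K (G + U) W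

theorem Tree.remove (hSg : Sg.WF) (t : Tree Sg Δ K (X + U)) (hj : Junk Δ K X U)
    (hr : Removable Sg Δ K X U) (hX : K = none → X ≠ 0 ∨ Δ ≠ 0) : Tree Sg Δ K X := by
  rcases (t.separate_cases hSg hj).2 with ⟨h, -⟩ | ⟨rfl, h⟩
  · exact h
  · rcases hr with hr | hr | ⟨G, W, rfl, hs, hW⟩
    · exact absurd rfl hr
    · refine absurd (h (hX rfl)) (hr U .refl U 0 (add_zero U).symm ?_)
      simp [confChans_zero, bases]
    · have hGW : Junk Δ none G W := hW.mono (bases_mono (by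
        rw [allChans_add]; exact subset_union_left)) le_rfl
      have hG : Junk Δ none G (W + U) := by
        have h1 : Junk Δ none G U := hj.mono (bases_mono (by
          rw [allChans_add]; exact subset_union_left)) le_rfl
        rw [Junk, confChans_add, bases_union, disjoint_union_right]
        exact ⟨hGW, h1⟩
      rw [add_assoc] at t
      refine t.replace_sink hSg hG hGW hs (hW.lineage_right ?_)
      rw [add_assoc, add_comm U W]
      exact t.2

/-! ### Junk and the logical relation -/

theorem bases_conf_add (A B : Config L TN PN) :
    bases (confChans (A + B)) = bases (confChans A) ∪ bases (confChans B) := by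
  rw [confChans_add, bases_union]

theorem junk_iff :
    Junk Δ K G U ↔ Disjoint (bases (ifaceChans Δ K)) (bases (confChans U)) ∧
      Disjoint (bases (confChans G)) (bases (confChans U)) := by
  rw [Junk, bases_allChans, disjoint_union_left]

/-- Steps can be performed in the presence of junk, up to renaming of the result. -/
theorem Steps.add_junk {X' : Config L TN PN} (h : Steps Sg Δ K X X') (hj : Junk Δ K X V) :
    ∃ X'', AlphaEq Δ K X' X'' ∧ Steps Sg Δ K (X + V) (X'' + V) ∧ Junk Δ K X'' V := by
  rw [junk_iff] at hj
  obtain ⟨π, hπ, -, h'⟩ := Reds.avoid (ifaceBases_finite Δ K) (confBases_finite V) h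
    (fun b hb => (disjoint_left.1 hj.2 hb.2 hb.1).elim)
  have hN := (ifaceBases_finite Δ K).union (confBases_finite V)
  obtain ⟨B, -, hB, hs, -⟩ := h'.fresh hN
  rw [disjoint_union_left] at hB
  refine ⟨cren π X', ⟨π, hπ, rfl⟩, h'.frame hN subset_union_right subset_union_left, ?_⟩
  rw [junk_iff]
  exact ⟨hj.1, Disjoint.mono_left hs (disjoint_union_left.2 ⟨hj.2, hB.2.symm⟩)⟩

theorem HasAbs.of_add {A : Config L TN PN} (h : HasAbs (A + B)) : HasAbs A ∨ HasAbs B := by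
  obtain ⟨n, hn, h⟩ := h
  exact (mem_add.1 hn).imp (fun hn => ⟨n, hn, h⟩) (fun hn => ⟨n, hn, h⟩)

theorem not_hasAbs_msg (M : Msg L) : ¬ HasAbs ({.msg M} : Config L TN PN) := by
  rintro ⟨n, hn, x, P, rfl, -⟩
  simp at hn

theorem Hole.root_eq_none {y' : Chan} : H.root y T = none ↔ H.root y' T' = none := by
  cases H <;> simp [Hole.root]

theorem Hole.ctx_ne_zero (h : H.root y T = none) : H.ctx y T ≠ 0 := by
  cases H <;> simp_all [Hole.root, Hole.ctx]

theorem Hole.base_mem (H : Hole L TN) (y : Chan) (T : Ty L TN) :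
    y.base ∈ bases (ifaceChans (H.ctx y T) (H.root y T)) := mem_bases (H.mem_iface y T)

theorem Hole.bases_send_left (H₀ : Hole L TN) (Γ : Ctx L TN Chan) (x y : Chan) (T A : Ty L TN)
    {S : Config L TN PN} (hS : S + {.msg (.send x y)} ≤ Z) :
    bases (allChans Γ (some (x, A)) S) ⊆
      bases (allChans ((H₀.add Γ).ctx y T) ((H₀.add Γ).root y T) Z) := by
  obtain ⟨R, rfl⟩ := Multiset.le_iff_exists_add.1 hS
  refine bases_mono ?_
  rintro c ((hc | ⟨_, hc⟩) | hc)
  · left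
    rw [Hole.iface, Hole.chans_add]
    exact Or.inr (Or.inl hc)
  · cases hc
    refine Or.inr ?_
    rw [confChans_add, confChans_add, confChans_singleton]
    exact Or.inl (Or.inr (Or.inl rfl))
  · refine Or.inr ?_
    rw [confChans_add, confChans_add]
    exact Or.inl (Or.inl hc)

theorem Hole.bases_send_right (H₀ : Hole L TN) (Γ : Ctx L TN Chan) (y : Chan) (T B : Ty L TN)
    {R : Config L TN PN} (hR : R ≤ Z) :
    bases (allChans (H₀.ctx y.succ B) (H₀.root y.succ B) R) ⊆
      bases (allChans ((H₀.add Γ).ctx y T) ((H₀.add Γ).root y T) Z) := by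
  obtain ⟨S, rfl⟩ := Multiset.le_iff_exists_add.1 hR
  rw [bases_allChans, bases_allChans, H₀.bases_succ (T := T), bases_conf_add]
  refine Set.union_subset_union (bases_mono ?_) subset_union_left
  rw [Hole.iface, Hole.iface, Hole.chans_add]
  exact Set.union_subset_union_right _ subset_union_right

theorem Hole.bases_lab (H : Hole L TN) (y : Chan) (T B : Ty L TN) (h : X ≤ Z) :
    bases (allChans (H.ctx y.succ B) (H.root y.succ B) X) ⊆
      bases (allChans (H.ctx y T) (H.root y T) Z) := by
  obtain ⟨S, rfl⟩ := Multiset.le_iff_exists_add.1 h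
  rw [bases_allChans, bases_allChans, H.bases_succ (T := T), bases_conf_add]
  exact Set.union_subset_union_right _ subset_union_left

/-- The second configuration of an observation of an input can be replaced if this is possible
after adding any message along `y`; a new channel can be assumed to have a base outside of `F`. -/
theorem InN.map {F : Set ℕ} (hF : F.Finite) (h : InN Sg R H T y D₁ D₂)
    (f : ∀ Δ K M, (H.root y T = none ↔ K = none) →
      (∀ b ∈ bases (ifaceChans Δ K) ∪ bases M.chans, b ∈ F →
        b ∈ bases (ifaceChans (H.ctx y T) (H.root y T))) →
      R Δ K (D₁ + {.msg M}) (D₂ + {.msg M}) → R Δ K (D₁ + {.msg M}) (D₂' + {.msg M})) :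
    InN Sg R H T y D₁ D₂' := by
  have hy := H.base_mem y T
  cases h with
  | close Δ K hH hT h =>
    refine .close Δ K hH hT (f _ _ _ (by rw [hH]; rfl) ?_ h)
    rintro b (hb | ⟨c, rfl, rfl⟩) -
    · rw [hH, Hole.iface, bases_union]
      exact Or.inr hb
    · exact hy
  | lab I A hT h =>
    refine .lab I A hT (fun k => f _ _ _ Hole.root_eq_none ?_ (h k))
    rintro b (hb | ⟨c, rfl | rfl, rfl⟩) -
    · rwa [Hole.bases_succ (T := T)] at hb
    · exact hy
    · exact hy
  | send A B hT M hM h =>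
    refine .send A B hT (M ∪ F) (hM.union hF) (fun x hx => ?_)
    rw [mem_union, not_or] at hx
    refine f _ _ _ (by rw [Hole.root_add]; exact Hole.root_eq_none) ?_ (h x hx.1)
    rw [H.bases_add_send (T := T)]
    rintro b ((hb | hb) | ⟨c, rfl | rfl | rfl, rfl⟩) hF
    · exact hb
    · rw [mem_singleton_iff.1 hb] at hF
      exact absurd hF hx.2
    · exact absurd hF hx.2
    · exact hy
    · exact hy

/-- The relation is closed under addition of junk to the second configuration. -/
def AddClosed (Sg : Signature L TN PN) (R : ConfRel L TN PN) : Prop :=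
  ∀ ⦃Δ : Ctx L TN Chan⦄ ⦃K : Root L TN⦄ ⦃D₁ X V : Config L TN PN⦄, R Δ K D₁ X →
    Tree Sg Δ K (X + V) → Junk Δ K X V → R Δ K D₁ (X + V)

theorem OutN.add_junk (hSg : Sg.WF) (hR : Nominal Sg R) (hA : AddClosed Sg R)
    (h : OutN Sg R H T y D₁ X) (t : Tree Sg (H.ctx y T) (H.root y T) (X + V))
    (hj : Junk (H.ctx y T) (H.root y T) X V) : OutN Sg R H T y D₁ (X + V) := by
  cases h with
  | close hH hT h1 h2 =>
    subst hH h2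
    rcases (t.separate_cases hSg hj).2 with ⟨-, h⟩ | ⟨h, -⟩
    · by_cases hV : V = 0
      · exact .close rfl hT h1 (by rw [hV, add_zero])
      · exact absurd (h hV) (not_hasAbs_msg _)
    · cases h
  | lab I A hT k X₁ X₂ h1 h2 h =>
    subst h2
    have hj' : Junk (H.ctx y.succ (A k)) (H.root y.succ (A k)) X₂ V :=
      hj.mono (H.bases_lab _ _ _ (Multiset.le_add_right _ _)) le_rfl
    refine .lab I A hT k X₁ (X₂ + V) h1 (add_right_comm _ _ _) (hA h ?_ hj')
    exact t.add_part hSg hj (hR.tree h).2 hj' (fun h => h.of_add.resolve_right (not_hasAbs_msg _))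
      Hole.root_eq_none.1 (fun _ => Or.inl (by simp))
  | send H₀ Γ hH A B hT x S₁ S₂ X₁ X₂ h1 h2 hS hD =>
    subst hH
    obtain ⟨θ, hθ, e⟩ := h2
    change _ = cren θ X at e
    have ht := t.ren hSg θ
    have hj := hj.ren hθ
    rw [Fixes.ctx hθ, Fixes.root hθ, cren_add] at ht
    have ha : AlphaEq ((H₀.add Γ).ctx y T) ((H₀.add Γ).root y T) (X + V)
        (cren θ X + cren θ V) := ⟨θ, hθ, (cren_add _ _ _).symm⟩
    rw [← e] at ht hj ha
    generalize cren θ V = V at ht hj ha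
    by_cases hab : HasAbs S₂
    · have hj' : Junk Γ (some (x, A)) S₂ V := hj.mono
        (H₀.bases_send_left Γ x y T A (by rw [add_right_comm]; exact Multiset.le_add_right _ _)) le_rfl
      refine .send H₀ Γ rfl A B hT x S₁ (S₂ + V) X₁ X₂ h1 ?_ (hA hS ?_ hj') hD
      · rwa [add_right_comm S₂ V, add_right_comm _ V]
      · exact (hR.tree hS).2.add_junk hSg hab hj' (ht.separate_cases hSg hj).1
          (hj.lineage_right ht.2)
    · have hj' : Junk (H₀.ctx y.succ B) (H₀.root y.succ B) X₂ V :=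
        hj.mono (H₀.bases_send_right Γ y T B (by
          rw [add_comm S₂, add_assoc]; exact Multiset.le_add_right _ _)) le_rfl
      refine .send H₀ Γ rfl A B hT x S₁ S₂ X₁ (X₂ + V) h1 ?_ hS (hA hD ?_ hj')
      · rwa [← add_assoc, add_right_comm _ V]
      · refine ht.add_part hSg hj (hR.tree hD).2 hj' (fun h => ?_) (fun h => ?_)
          (fun _ => Or.inl (by simp))
        · exact (h.of_add.resolve_right (not_hasAbs_msg _)).of_add.resolve_left hab
        · rw [Hole.root_add] at h
          exact Hole.root_eq_none.1 h

theorem InN.add_junk (hSg : Sg.WF) (hR : Nominal Sg R) (hA : AddClosed Sg R)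
    (h : InN Sg R H T y D₁ X) (t : Tree Sg (H.ctx y T) (H.root y T) (X + V))
    (hj : Junk (H.ctx y T) (H.root y T) X V) : InN Sg R H T y D₁ (X + V) := by
  refine h.map (confBases_finite V) (fun Δ K M hK hM h => ?_)
  have hj' : Junk Δ K (X + {.msg M}) V := by
    rw [junk_iff] at hj ⊢
    rw [bases_conf_add, disjoint_union_left, confChans_singleton]
    have key : ∀ b ∈ bases (ifaceChans Δ K) ∪ bases M.chans, b ∉ bases (confChans V) :=
      fun b hb hV => disjoint_left.1 hj.1 (hM b hb hV) hV
    exact ⟨disjoint_left.2 (fun b hb => key b (Or.inl hb)), hj.2,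
      disjoint_left.2 (fun b hb => key b (Or.inr hb))⟩
  rw [add_right_comm]
  exact hA h (t.add_part hSg hj (hR.tree h).2 hj'
    (fun ⟨n, hn, h⟩ => ⟨n, mem_add.2 (Or.inl hn), h⟩) hK.1
    (fun h => Or.inr (Hole.ctx_ne_zero h))) hj'

theorem E_add (hSg : Sg.WF) (m : ℕ) : AddClosed Sg (E Sg m) := by
  induction m with
  | zero => exact fun _ _ _ _ _ h t _ => ⟨h.1, t⟩
  | succ m ih =>
    intro Δ K D₁ X V h t hj
    rw [E_succ_iff hSg] at h ⊢
    refine ⟨h.1, t, fun D₁' h1 => ?_⟩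
    obtain ⟨X', hX, ho⟩ := h.2.2 D₁' h1
    obtain ⟨X'', ha, hs, hj'⟩ := Steps.add_junk hX hj
    have ho := ho.alpha (E_nominal hSg m) ha
    have t' := t.steps hSg hs
    refine ⟨_, hs, fun y hy => ?_, ?_, ?_⟩
    · obtain ⟨h1, M, hM, h2⟩ := ho.ups hy
      exact ⟨h1, M, mem_add.2 (Or.inl hM), h2⟩
    · rintro H T y rfl rfl hy
      exact (ho.out H T y rfl rfl hy).add_junk hSg (E_nominal hSg m) ih t' hj'
    · rintro H T y rfl rfl hy
      exact (ho.inn H T y rfl rfl hy).add_junk hSg (E_nominal hSg m) ih t' hj'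

/-! ### Removal of junk -/

theorem Tree.add_sink (hSg : Sg.WF) (t : Tree Sg Δ none G) (h : Junk Δ none G V) (hs : Sink Sg V)
    (hl : Lineage (0 : Ctx L TN Chan) none V) : Tree Sg Δ none (G + V) := by
  obtain ⟨⟨P, S, hF, hnd, -⟩, hl'⟩ := (tree_iff hSg).1 t
  exact hF.add_sink hSg hnd hl' h hs hl

theorem Removable.mono {X' : Config L TN PN} (h : Removable Sg Δ K X U)
    (hK : K' = none → K = none)
    (hX : ∀ G W, X = G + W → Junk Δ K (G + U) W → ∃ G', X' = G' + W ∧ Junk Δ' K' (G' + U) W) :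
    Removable Sg Δ' K' X' U := by
  rcases h with h | h | ⟨G, W, e, hs, hj⟩
  · exact Or.inl (fun h' => h (hK h'))
  · exact Or.inr (Or.inl h)
  · obtain ⟨G', e', hj'⟩ := hX G W e hj
    exact Or.inr (Or.inr ⟨G', W, e', hs, hj'⟩)

theorem Removable.ren (h : Removable Sg Δ K X U) (hπ : Fixes π Δ K) :
    Removable Sg Δ K (cren π X) (cren π U) := by
  rcases h with h | h | ⟨G, W, rfl, hs, hj⟩
  · exact Or.inl h
  · exact Or.inr (Or.inl (h.ren π))
  · refine Or.inr (Or.inr ⟨cren π G, cren π W, cren_add _ _ _, hs.ren π, ?_⟩)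
    rw [← cren_add]
    exact hj.ren hπ

theorem Removable.steps (hSg : Sg.WF) (h : Removable Sg Δ K X U) (t : Tree Sg Δ K X)
    (hj : Junk Δ K X U) (hs : Steps Sg Δ K (X + U) W) :
    ∃ X' U', W = X' + U' ∧ Steps Sg Δ K X X' ∧ Junk Δ K X' U' ∧ Removable Sg Δ K X' U' := by
  have hN := ifaceBases_finite Δ K
  rw [Junk, bases_allChans] at hj
  obtain ⟨X', U', rfl, hX, hU, hd⟩ := Reds.split (M₁ := bases (ifaceChans Δ K)) (M₂ := ∅) hN
    subset_rfl (empty_subset _) hs (by rwa [empty_union])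
  rw [empty_union] at hd
  have hj' : Junk Δ K X' U' := by rwa [Junk, bases_allChans]
  refine ⟨X', U', rfl, hX, hj', ?_⟩
  rcases h with h | h | ⟨G, W, rfl, hW, hGW⟩
  · exact Or.inl h
  · exact Or.inr (Or.inl (h.reds hN hU))
  · rw [Junk, bases_allChans, bases_conf_add] at hGW
    have hj1 : Junk Δ K G W := by
      rw [Junk, bases_allChans]
      exact hGW.mono_left (Set.union_subset_union_right _ subset_union_left)
    obtain ⟨G', W', rfl, -, hWW, hd'⟩ := Reds.split (M₁ := bases (ifaceChans Δ K)) (M₂ := ∅) hN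
      subset_rfl (empty_subset _) hX (by rwa [empty_union, ← bases_allChans])
    refine Or.inr (Or.inr ⟨G', W', rfl, hW.reds hSg hN (hj1.lineage_right t.2) hWW, ?_⟩)
    rw [bases_conf_add] at hd
    rw [empty_union] at hd'
    simp only [disjoint_union_left, junk_iff, bases_conf_add] at *
    exact ⟨hd'.1, hd'.2, hd.2.2.symm⟩

/-- A message along a free channel is not part of the junk. -/
theorem Junk.msg (hj : Junk Δ K X U) (hM : M.carrier.base ∈ bases (ifaceChans Δ K))
    (e : X + U = Z + {.msg M}) : ∃ X', X = X' + {.msg M} ∧ Z = X' + U := by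
  rw [add_comm Z, singleton_add] at e
  rcases add_eq_cons e with ⟨X', rfl, rfl⟩ | ⟨U', rfl, -⟩
  · exact ⟨X', by rw [add_comm, singleton_add], rfl⟩
  · refine (disjoint_left.1 (junk_iff.1 hj).1 hM (mem_bases ?_)).elim
    exact mem_confChans (mem_cons_self _ _) M.carrier_mem

/-- The relation is closed under removal of removable junk from the second configuration. -/
def RemClosed (Sg : Signature L TN PN) (R : ConfRel L TN PN) : Prop :=
  ∀ ⦃Δ : Ctx L TN Chan⦄ ⦃K : Root L TN⦄ ⦃D₁ X U : Config L TN PN⦄, R Δ K D₁ (X + U) →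
    Tree Sg Δ K X → Junk Δ K X U → Removable Sg Δ K X U → R Δ K D₁ X

theorem RemClosed.apply (hSg : Sg.WF) (hR : Nominal Sg R) (hJ : RemClosed Sg R)
    (h : R Δ K D₁ (X + U)) (hj : Junk Δ K X U) (hr : Removable Sg Δ K X U)
    (hX : K = none → X ≠ 0 ∨ Δ ≠ 0) : R Δ K D₁ X :=
  hJ h ((hR.tree h).2.remove hSg hj hr hX) hj hr

/-- When a part `W` of the junk is the anonymous root, the parts of a tree split by a message can
be chosen so that the junk can be removed from both: the sink contained in `W` is moved to the
part with the anonymous root. -/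
theorem OutN.rem_sink (hSg : Sg.WF) (hR : Nominal Sg R) (hA : AddClosed Sg R)
    (hJ : RemClosed Sg R) {C : Chan × Ty L TN} (hΔ : Δ ≠ 0) {S₀ R₀ b : Config L TN PN}
    (hS : R Γ (some C) S₁ (S₀ + a)) (hD : R Δ K D₁ (R₀ + b)) (hK : K = none)
    (hd : Disjoint (bases (allChans Γ (some C) (S₀ + a))) (bases (allChans Δ K (R₀ + b))))
    (hjS : Junk Γ (some C) S₀ a) (hjR : Junk Δ K R₀ b) (e : S₀ + R₀ = G + W) (hs : Sink Sg W)
    (hW₁ : Junk Γ (some C) (G + (a + b)) W) (hW₂ : Junk Δ K (G + (a + b)) W) :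
    ∃ S R', S + R' = S₀ + R₀ ∧ R Γ (some C) S₁ S ∧ R Δ K D₁ R' := by
  subst hK
  obtain ⟨Sg', Wa, Rg, Wb, rfl, rfl, rfl, rfl⟩ := add_eq_add_split e
  simp only [junk_iff, bases_allChans, bases_conf_add, disjoint_union_left,
    disjoint_union_right] at hd hjS hjR hW₁ hW₂
  rcases hs.of_part (by tauto) with hs | hs
  · have hl : Lineage (0 : Ctx L TN Chan) none Wa := by
      refine Junk.lineage_right (Δ := Γ) (K := some C) (G := Sg' + a) ?_ (add_right_comm Sg' Wa a ▸
        (hR.tree hS).2.2)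
      simp only [junk_iff, bases_conf_add, disjoint_union_left]
      tauto
    refine ⟨Sg', Rg + Wb + Wa, by abel, ?_, ?_⟩
    · refine hJ.apply hSg hR (U := Wa + a) (by rwa [← add_assoc]) ?_ (Or.inl (by simp)) (by simp)
      simp only [junk_iff, bases_conf_add, disjoint_union_right]
      tauto
    · have hj : Junk Δ none (Rg + Wb + b) Wa := by
        simp only [junk_iff, bases_conf_add, disjoint_union_left]
        simp only [disjoint_comm] at *
        tauto
      have h := hA hD ((hR.tree hD).2.add_sink hSg hj hs hl) hj
      rw [add_right_comm _ b] at h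
      refine hJ.apply hSg hR h ?_ (Or.inr (Or.inr ⟨Rg + Wb, Wa, rfl, hs, hj⟩)) (fun _ => Or.inr hΔ)
      simp only [junk_iff, bases_conf_add, disjoint_union_left] at *
      simp only [disjoint_comm] at *
      tauto
  · refine ⟨Sg' + Wa, Rg + Wb, rfl, hJ.apply hSg hR hS ?_ (Or.inl (by simp)) (by simp),
      hJ.apply hSg hR hD ?_ (Or.inr (Or.inr ⟨Rg, Wb, rfl, hs, ?_⟩)) (fun _ => Or.inr hΔ)⟩ <;>
    · simp only [junk_iff, bases_conf_add, disjoint_union_left]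
      simp only [disjoint_comm] at *
      tauto

theorem OutN.rem (hSg : Sg.WF) (hR : Nominal Sg R) (hA : AddClosed Sg R) (hJ : RemClosed Sg R)
    (h : OutN Sg R H T y D₁ (X + U)) (t : Tree Sg (H.ctx y T) (H.root y T) (X + U))
    (hj : Junk (H.ctx y T) (H.root y T) X U) (hr : Removable Sg (H.ctx y T) (H.root y T) X U) :
    OutN Sg R H T y D₁ X := by
  have hy := H.base_mem y T
  cases h with
  | close hH hT h₁ h₂ =>
    rw [← zero_add ({_} : Config L TN PN)] at h₂
    obtain ⟨X, rfl, h⟩ := hj.msg (M := .close y) hy h₂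
    rw [eq_comm, add_eq_zero] at h
    exact .close hH hT h₁ (by rw [h.1, zero_add])
  | lab I A hT k X₁ X₂ h₁ h₂ h =>
    obtain ⟨X, rfl, rfl⟩ := hj.msg (M := .lab y k.1) hy h₂
    refine .lab I A hT k X₁ X h₁ rfl (hJ.apply hSg hR h
      (hj.mono (H.bases_lab _ _ _ (Multiset.le_add_right _ _)) le_rfl)
      (hr.mono Hole.root_eq_none.1 (fun G W e hW => ?_))
      (fun h => Or.inr (Hole.ctx_ne_zero h)))
    obtain ⟨G, rfl, rfl⟩ := Junk.msg (M := .lab y k.1) (hW.mono (bases_mono (by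
      rw [allChans_add]; exact subset_union_left)) le_rfl) hy e.symm
    exact ⟨G, rfl, hW.mono (H.bases_lab _ _ _ (by
      rw [add_right_comm]; exact Multiset.le_add_right _ _)) le_rfl⟩
  | send H₀ Γ hH A B hT x S₁ S₂ X₁ X₂ h₁ h₂ hS hD =>
    subst hH
    obtain ⟨θ, hθ, e⟩ := h₂
    change _ = cren θ _ at e
    have hj := hj.ren hθ
    have hr := hr.ren hθ
    have t := t.ren hSg θ
    rw [Fixes.ctx hθ, Fixes.root hθ, ← e] at t
    rw [cren_add] at e
    obtain ⟨X₀, e', e''⟩ := hj.msg (M := .send x y) hy e.symm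
    obtain ⟨S₀, a, R₀, b, rfl, rfl, rfl, hU⟩ := add_eq_add_split e''
    have hd := t.send_disjoint hSg (hR.tree hS).2 (hR.tree hD).2
    rw [e', hU] at hj hr
    have mS := fun Z (h : S₀ + {.msg (.send x y)} ≤ Z) => H₀.bases_send_left Γ x y T A h
    have mR := fun Z (h : R₀ ≤ Z) => H₀.bases_send_right Γ y T B h
    have hjS : Junk Γ (some (x, A)) S₀ a := hj.mono (mS _ (by
      rw [add_right_comm]; exact Multiset.le_add_right _ _)) (Multiset.le_add_right _ _)
    have hjR : Junk (H₀.ctx y.succ B) (H₀.root y.succ B) R₀ b := hj.mono (mR _ (by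
      rw [add_comm S₀, add_assoc]; exact Multiset.le_add_right _ _)) (Multiset.le_add_left _ _)
    suffices ∃ S R', S + R' = S₀ + R₀ ∧ R Γ (some (x, A)) S₁ S ∧
        R (H₀.ctx y.succ B) (H₀.root y.succ B) X₁ R' by
      obtain ⟨S, R', e1, h1, h2⟩ := this
      refine .send H₀ Γ rfl A B hT x S₁ S X₁ R' h₁ ⟨θ, hθ, ?_⟩ h1 h2
      change _ = cren θ X
      rw [e1, e']
    have simple : Removable Sg (H₀.ctx y.succ B) (H₀.root y.succ B) R₀ b →
        ∃ S R', S + R' = S₀ + R₀ ∧ R Γ (some (x, A)) S₁ S ∧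
          R (H₀.ctx y.succ B) (H₀.root y.succ B) X₁ R' := fun hr =>
      ⟨S₀, R₀, rfl, hJ.apply hSg hR hS hjS (Or.inl (by simp)) (by simp),
        hJ.apply hSg hR hD hjR hr (fun h => Or.inr (Hole.ctx_ne_zero h))⟩
    rcases hr with hr | hr | ⟨G, W, e2, hs, hW⟩
    · refine simple (Or.inl (fun h => hr ?_))
      rw [Hole.root_add]
      exact Hole.root_eq_none.1 h
    · refine simple (Or.inr (Or.inl (hr.part ?_)))
      simp only [bases_allChans, bases_conf_add, disjoint_union_left,
        disjoint_union_right] at hd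
      tauto
    · by_cases hK : H₀.root y.succ B = none
      · obtain ⟨G, rfl, e3⟩ := Junk.msg (M := .send x y) (hW.mono (bases_mono (by
          rw [allChans_add]; exact subset_union_left)) le_rfl) hy e2.symm
        exact OutN.rem_sink hSg hR hA hJ (Hole.ctx_ne_zero hK) hS hD hK hd hjS hjR e3 hs
          (hW.mono (H₀.bases_send_left Γ x y T A (add_right_comm _ _ _).le) le_rfl)
          (hW.mono (H₀.bases_send_right Γ y T B (by
            rw [add_right_comm]; exact Multiset.le_add_right _ _)) le_rfl)
      · exact simple (Or.inl hK)

theorem InN.rem (hSg : Sg.WF) (hR : Nominal Sg R) (hJ : RemClosed Sg R)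
    (h : InN Sg R H T y D₁ (X + U)) (hj : Junk (H.ctx y T) (H.root y T) X U)
    (hr : Removable Sg (H.ctx y T) (H.root y T) X U) : InN Sg R H T y D₁ X := by
  refine h.map (confBases_finite (X + U)) (fun Δ K M hK hM h => ?_)
  rw [add_right_comm] at h
  have key : ∀ G V, V ≤ X + U → Junk (H.ctx y T) (H.root y T) G V →
      Junk Δ K (G + {.msg M}) V := by
    intro G V hV hj
    obtain ⟨Z, hZ⟩ := Multiset.le_iff_exists_add.1 hV
    rw [hZ] at hM
    rw [junk_iff] at hj ⊢
    rw [bases_conf_add, disjoint_union_left, confChans_singleton]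
    have key : ∀ b ∈ bases (ifaceChans Δ K) ∪ bases M.chans, b ∉ bases (confChans V) :=
      fun b hb hV => disjoint_left.1 hj.1
        (hM b hb (by rw [bases_conf_add]; exact Or.inl hV)) hV
    exact ⟨disjoint_left.2 (fun b hb => key b (Or.inl hb)), hj.2,
      disjoint_left.2 (fun b hb => key b (Or.inr hb))⟩
  refine hJ.apply hSg hR h (key X U (Multiset.le_add_left _ _) hj) (hr.mono hK.2 ?_)
    (fun _ => Or.inl (by simp))
  rintro G W rfl hW
  refine ⟨G + {.msg M}, add_right_comm _ _ _, ?_⟩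
  rw [add_right_comm]
  exact key _ _ (by rw [add_comm G, add_assoc]; exact Multiset.le_add_right _ _) hW

theorem E_rem (hSg : Sg.WF) (m : ℕ) : RemClosed Sg (E Sg m) := by
  induction m with
  | zero => exact fun _ _ _ _ _ h t _ _ => ⟨h.1, t⟩
  | succ m ih =>
    intro Δ K D₁ X U h t hj hr
    rw [E_succ_iff hSg] at h ⊢
    refine ⟨h.1, t, fun D₁' h1 => ?_⟩
    obtain ⟨W, hW, ho⟩ := h.2.2 D₁' h1
    have tW := h.2.1.steps hSg hW
    obtain ⟨X', U', rfl, hX, hj', hr'⟩ := hr.steps hSg t hj hW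
    refine ⟨X', hX, fun y hy => ?_, ?_, ?_⟩
    · obtain ⟨h1, M, hM, rfl⟩ := ho.ups hy
      obtain ⟨C, hC⟩ := exists_cons_of_mem hM
      rw [← singleton_add, add_comm _ C] at hC
      obtain ⟨X'', rfl, -⟩ := hj'.msg (mem_bases h1) hC
      exact ⟨h1, M, by simp, rfl⟩
    · rintro H T y rfl rfl hy
      exact (ho.out H T y rfl rfl hy).rem hSg (E_nominal hSg m) (E_add hSg m) ih tW hj' hr'
    · rintro H T y rfl rfl hy
      exact (ho.inn H T y rfl rfl hy).rem hSg (E_nominal hSg m) ih hj' hr'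

/-- Junk in the second configuration can be exchanged. -/
theorem E.swap (hSg : Sg.WF) (h : E Sg m Δ K D₁ (G + U)) (t : Tree Sg Δ K (G + V))
    (hU : Junk Δ K G U) (hV : Junk Δ K G V)
    (hUV : Disjoint (bases (confChans U)) (bases (confChans V))) (hr : Removable Sg Δ K (G + V) U)
    (hX : K = none → G ≠ 0 ∨ Δ ≠ 0) : E Sg m Δ K D₁ (G + V) := by
  have hj : Junk Δ K (G + U) V := by
    rw [junk_iff, bases_conf_add, disjoint_union_left] at *
    exact ⟨hV.1, hV.2, hUV⟩
  have hj' : Junk Δ K (G + V) U := by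
    rw [junk_iff, bases_conf_add, disjoint_union_left] at *
    exact ⟨hU.1, hU.2, hUV.symm⟩
  have tU := ((E_nominal hSg m).tree h).2
  have h1 := E_add hSg m h (t.add_part hSg hV tU hj
    (fun ⟨n, hn, h⟩ => ⟨n, mem_add.2 (Or.inl hn), h⟩) id hX) hj
  rw [add_right_comm] at h1
  exact E_rem hSg m h1 t hj' hr

/-! ### The limit of the logical relation is a simulation -/

/-- The configuration contains a sink that is named apart from the rest. -/
def HasSink (Sg : Signature L TN PN) (Δ : Ctx L TN Chan) (K : Root L TN)
    (D : Config L TN PN) : Prop :=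
  ∃ G W, D = G + W ∧ Sink Sg W ∧ Junk Δ K G W

theorem HasSink.alpha (h : HasSink Sg Δ K D) (ha : AlphaEq Δ K D D') : HasSink Sg Δ K D' := by
  obtain ⟨G, W, rfl, hs, hj⟩ := h
  obtain ⟨π, hπ, rfl⟩ := ha
  exact ⟨_, _, cren_add π G W, hs.ren π, hj.ren hπ⟩

theorem HasSink.steps (hSg : Sg.WF) (h : HasSink Sg Δ K D) (t : Tree Sg Δ K D)
    (hs : Steps Sg Δ K D D') : HasSink Sg Δ K D' := by
  obtain ⟨G, W, rfl, hW, hj⟩ := h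
  obtain ⟨G', W', rfl, -, h, hd⟩ := Reds.split (M₁ := bases (ifaceChans Δ K)) (M₂ := ∅)
    (ifaceBases_finite Δ K) subset_rfl (empty_subset _) hs
    (by rwa [empty_union, ← bases_allChans])
  rw [empty_union, ← bases_allChans] at hd
  exact ⟨G', W', rfl, hW.reds hSg (ifaceBases_finite Δ K) (hj.lineage_right t.2) h, hd⟩

/-- No reduct of the configuration contains a sink that is named apart from the rest. -/
def SinkAvoiding (Sg : Signature L TN PN) (Δ : Ctx L TN Chan) (K : Root L TN)
    (D : Config L TN PN) : Prop :=
  ∀ D', Steps Sg Δ K D D' → ¬ HasSink Sg Δ K D'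

theorem SinkAvoiding.alpha (h : SinkAvoiding Sg Δ K D) (ha : AlphaEq Δ K D D') :
    SinkAvoiding Sg Δ K D' := by
  intro E' hE hs
  obtain ⟨E, h1, h2⟩ := ha.symm.steps hE
  exact h E h1 (hs.alpha h2)

theorem SinkAvoiding.sinkFree {Q : Config L TN PN} (h : SinkAvoiding Sg Δ K (Q + G))
    (hj : Junk Δ K G Q) : SinkFree Sg Q := by
  rintro Q' hQ a b rfl hab ha
  have hM := (ifaceBases_finite Δ K).union (confBases_finite G)
  rw [Junk, bases_allChans] at hj
  obtain ⟨π, -, -, hπ⟩ := hQ.avoid finite_empty hM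
    (fun x hx => (disjoint_left.1 hj hx.1 hx.2).elim)
  rw [empty_union] at hπ
  obtain ⟨B, -, hB, hs, -⟩ := hπ.fresh hM
  have hf := hπ.frame hM subset_union_right subset_union_left
  have hd : Disjoint (bases (ifaceChans Δ K) ∪ bases (confChans G))
      (bases (confChans (cren π (a + b)))) :=
    Disjoint.mono_right hs (disjoint_union_right.2 ⟨hj, hB⟩)
  rw [cren_add, bases_conf_add] at hd
  rw [cren_add, add_assoc, add_comm (cren π a)] at hf
  refine h _ hf ⟨_, _, rfl, ha.ren π, ?_⟩
  have hab' : Disjoint (bases (confChans (cren π b))) (bases (confChans (cren π a))) := by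
    rw [confChans_cren, confChans_cren, bases_ren, bases_ren]
    exact ((Set.disjoint_image_iff π.injective).2 hab).symm
  simp only [disjoint_union_left, disjoint_union_right] at hd
  rw [junk_iff, bases_conf_add, disjoint_union_left]
  exact ⟨hd.1.1, hab', hd.1.2⟩

/-- If a tree that is split by a message contains a sink, then the sink can be moved to the part
with the anonymous root. -/
theorem HasSink.move (hSg : Sg.WF) {C : Chan × Ty L TN} {S R : Config L TN PN}
    (tS : Tree Sg Γ (some C) S) (tR : Tree Sg Δ none R)
    (hd : Disjoint (bases (allChans Γ (some C) S)) (bases (allChans Δ none R)))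
    (e : S + R = G + W) (hs : Sink Sg W) (h1 : Junk Γ (some C) G W) (h2 : Junk Δ none G W) :
    ∃ S' R', S' + R' = S + R ∧ Tree Sg Γ (some C) S' ∧ Tree Sg Δ none R' ∧ HasSink Sg Δ none R' := by
  obtain ⟨Sg', Wa, Rg, Wb, rfl, rfl, rfl, rfl⟩ := add_eq_add_split e
  simp only [junk_iff, bases_allChans, bases_conf_add, disjoint_union_left,
    disjoint_union_right] at hd h1 h2
  rcases hs.of_part (by tauto) with hs | hs
  · have hj : Junk Γ (some C) Sg' Wa := by rw [junk_iff]; tauto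
    have hj' : Junk Δ none (Rg + Wb) Wa := by
      rw [junk_iff, bases_conf_add, disjoint_union_left]
      simp only [disjoint_comm] at *
      tauto
    exact ⟨Sg', Rg + Wb + Wa, by abel, tS.remove hSg hj (Or.inl (by simp)) (by simp),
      tR.add_sink hSg hj' hs (hj.lineage_right tS.2), _, _, rfl, hs, hj'⟩
  · exact ⟨_, _, rfl, tS, tR, Rg, Wb, rfl, hs, by rw [junk_iff]; tauto⟩

/-- If a reduct of a tree that is split by a message is split into related parts, then so is the
tree: the parts differ by junk from the reducts of the parts of the tree. -/
theorem E.send_transfer (hSg : Sg.WF) {B : Ty L TN} {S R S' R' : Config L TN PN}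
    (t : Tree Sg ((H₀.add Γ).ctx y T) ((H₀.add Γ).root y T) (S + R + {.msg (.send x y)}))
    (tS : Tree Sg Γ (some (x, A)) S) (tR : Tree Sg (H₀.ctx y.succ B) (H₀.root y.succ B) R)
    (hr : H₀.root y.succ B ≠ none ∨
      SinkAvoiding Sg ((H₀.add Γ).ctx y T) ((H₀.add Γ).root y T) (S + R + {.msg (.send x y)}) ∨
      HasSink Sg (H₀.ctx y.succ B) (H₀.root y.succ B) R)
    (hW : Steps Sg ((H₀.add Γ).ctx y T) ((H₀.add Γ).root y T) (S + R + {.msg (.send x y)}) W)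
    (ha : AlphaEq ((H₀.add Γ).ctx y T) ((H₀.add Γ).root y T) W (S' + R' + {.msg (.send x y)}))
    (hS : E Sg m Γ (some (x, A)) S₁ S') (hR : E Sg m (H₀.ctx y.succ B) (H₀.root y.succ B) X₁ R') :
    E Sg m Γ (some (x, A)) S₁ S ∧ E Sg m (H₀.ctx y.succ B) (H₀.root y.succ B) X₁ R := by
  obtain ⟨St, Rt, rfl, sS, sR⟩ := t.steps_send hSg tS tR hW
  have tW := t.steps hSg hW
  have hd := tW.send_disjoint hSg (tS.steps hSg sS) (tR.steps hSg sR)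
  obtain ⟨κ, hκ, e⟩ := ha.symm
  obtain ⟨hκ1, hκ2⟩ := Hole.fixes_add hκ
  have hy : y.rename κ = y := Chan.rename_eq_self (hκ _ (Hole.base_mem _ y T))
  replace e : St + Rt + {.msg (.send x y)} =
      cren κ S' + cren κ R' + {.msg (.send (x.rename κ) y)} := by
    refine e.trans ((cren_add _ _ _).trans ?_)
    rw [cren_add, cren_msg, Msg.map, hy]
  have hx : x.rename κ = x := by
    have := tW.ev_unique hSg (n := .msg (.send x y)) (n' := .msg (.send (x.rename κ) y)) (by simp)
      (by rw [e]; simp) (Ev.msg _) (Ev.msg (.send (x.rename κ) y))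
    simpa using this.symm
  have hκS : Fixes κ Γ (some (x, A)) := by
    rintro _ ⟨c, hc | ⟨_, hc⟩, rfl⟩
    · exact hκ2 _ (mem_bases hc)
    · cases hc
      exact congrArg Chan.base hx
  replace hS := (E_nominal hSg m).alpha hS ⟨κ, hκS, rfl⟩
  replace hR := (E_nominal hSg m).alpha hR ⟨κ, Hole.fixes_succ.2 hκ1, rfl⟩
  change E Sg m _ _ _ (cren κ S') at hS
  change E Sg m _ _ _ (cren κ R') at hR
  rw [hx] at e
  have e' := add_right_cancel e
  rw [e] at tW
  have hd' := tW.send_disjoint hSg ((E_nominal hSg m).tree hS).2 ((E_nominal hSg m).tree hR).2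
  generalize cren κ S' = S' at *
  generalize cren κ R' = R' at *
  obtain ⟨P, Q, R₀, V, rfl, rfl, rfl, rfl⟩ := add_eq_add_split e'
  have tS' := tS.steps hSg sS
  have tR' := tR.steps hSg sR
  -- `Q` and `R₀` are the junk by which the two ways of splitting the tree differ.
  have hxQ : x.base ∈ bases (ifaceChans Γ (some (x, A))) := mem_bases (Or.inr ⟨A, rfl⟩)
  have hyQ := H₀.base_mem y.succ B
  have hiface : bases (ifaceChans ((H₀.add Γ).ctx y T) ((H₀.add Γ).root y T)) ⊆
      bases (ifaceChans Γ (some (x, A))) ∪ bases (ifaceChans (H₀.ctx y.succ B)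
        (H₀.root y.succ B)) := by
    rw [H₀.bases_succ (T := T), Hole.iface, Hole.iface, Hole.chans_add, ← bases_union]
    refine bases_mono ?_
    rintro c (hc | hc | hc)
    · exact Or.inr (Or.inl hc)
    · exact Or.inl (Or.inl hc)
    · exact Or.inr (Or.inr hc)
  simp only [bases_allChans, bases_conf_add, disjoint_union_left,
    disjoint_union_right] at hd hd'
  obtain ⟨⟨-, -, a3⟩, ⟨b1, b2, b3⟩, -, -, c3⟩ := hd
  obtain ⟨⟨-, -, a3'⟩, ⟨b1', b2', -⟩, -, -, c3'⟩ := hd'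
  constructor
  · exact (E.swap hSg hS tS' (junk_iff.2 ⟨b1, b2⟩) (junk_iff.2 ⟨b1', b2'⟩) b3.symm
      (Or.inl (by simp)) (by simp)).steps_back hSg tS sS
  · rw [add_comm R₀ V] at sR tR' hW
    rw [add_comm Q V] at hR
    refine (E.swap hSg hR tR' (junk_iff.2 ⟨a3.symm, c3.symm⟩) (junk_iff.2 ⟨a3'.symm, c3'.symm⟩) b3
      ?_ (fun h => Or.inr (Hole.ctx_ne_zero h))).steps_back hSg tR sR
    rcases hr with hr | hr | hr
    · exact Or.inl hr
    · have hr' : SinkAvoiding Sg ((H₀.add Γ).ctx y T) ((H₀.add Γ).root y T)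
          (Q + (P + (V + R₀) + {.msg (.send x y)})) := by
        intro Z hZ
        refine hr Z (hW.trans ?_)
        rwa [add_comm P, add_assoc Q, add_assoc Q]
      refine Or.inr (Or.inl (hr'.sinkFree ?_))
      have hM : Disjoint (bases (confChans ({.msg (.send x y)} : Config L TN PN)))
          (bases (confChans Q)) := by
        rw [confChans_singleton, disjoint_left]
        rintro _ ⟨c, rfl | rfl | rfl, rfl⟩
        · exact disjoint_left.1 b1' hxQ
        · exact disjoint_left.1 a3.symm hyQ
        · exact disjoint_left.1 a3.symm hyQ
      refine junk_iff.2 ⟨Disjoint.mono_left hiface (disjoint_union_left.2 ⟨b1', a3.symm⟩), ?_⟩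
      simp only [bases_conf_add, disjoint_union_left]
      exact ⟨⟨b2', c3.symm, b3.symm⟩, hM⟩
    · obtain ⟨G, W, e2, hs, hj⟩ := hr.steps hSg tR sR
      refine Or.inr (Or.inr ⟨G, W, e2, hs, ?_⟩)
      have hQW : Disjoint (bases (confChans Q)) (bases (confChans W)) := by
        refine Disjoint.mono_right (?_ : _ ⊆ bases (confChans (V + R₀))) ?_
        · rw [e2, bases_conf_add]; exact subset_union_right
        · rw [bases_conf_add, disjoint_union_right]
          exact ⟨c3, b3⟩
      rw [junk_iff] at hj ⊢
      rw [bases_conf_add, disjoint_union_left]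
      exact ⟨hj.1, hj.2, hQW⟩

/-- The relation at all indices. -/
def EAll (Sg : Signature L TN PN) : ConfRel L TN PN := fun Δ K D₁ D₂ => ∀ m, E Sg m Δ K D₁ D₂

theorem EAll_nominal (hSg : Sg.WF) : Nominal Sg (EAll Sg) :=
  ⟨fun h => (E_nominal hSg 0).tree (h 0), fun π h m => (E_nominal hSg m).ren π (h m),
    fun h ha m => (E_nominal hSg m).alpha (h m) ha⟩

theorem InN.close_inv (h : InN Sg R H T y D₁ D₂) (hT : Sg.unf T = .one) (hH : H = .left Δ K) :
    R Δ K (D₁ + {.msg (.close y)}) (D₂ + {.msg (.close y)}) := by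
  cases h with
  | close Δ' K' hH' _ h =>
    cases hH.symm.trans hH'
    exact h
  | lab I A hT' => exact absurd (hT'.symm.trans hT) labTy_ne_one
  | send A B hT' => exact absurd (hT'.symm.trans hT) sendTy_ne_one

theorem InN.lab_inv (h : InN Sg R H T y D₁ D₂) {A : {l // l ∈ I} → Ty L TN}
    (hT : Sg.unf T = labTy (!H.pos) I A) (k : {l // l ∈ I}) :
    R (H.ctx y.succ (A k)) (H.root y.succ (A k)) (D₁ + {.msg (.lab y k.1)})
      (D₂ + {.msg (.lab y k.1)}) := by
  cases h with
  | close Δ' K' hH' hT' h => exact absurd (hT.symm.trans hT') labTy_ne_one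
  | lab I' A' hT' h =>
    obtain ⟨rfl, e⟩ := labTy_inj (hT.symm.trans hT')
    obtain rfl := eq_of_heq e
    exact h k
  | send A B hT' => exact absurd (hT.symm.trans hT') labTy_ne_sendTy

theorem InN.send_inv (h : InN Sg R H T y D₁ D₂) {B : Ty L TN}
    (hT : Sg.unf T = sendTy (!H.pos) A B) : ∃ M : Set ℕ, M.Finite ∧ ∀ x : Chan, x.base ∉ M →
      R ((H.add {(x, A)}).ctx y.succ B) ((H.add {(x, A)}).root y.succ B)
        (D₁ + {.msg (.send x y)}) (D₂ + {.msg (.send x y)}) := by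
  cases h with
  | close Δ' K' hH' hT' h => exact absurd (hT.symm.trans hT') sendTy_ne_one
  | lab I' A' hT' h => exact absurd (hT'.symm.trans hT) labTy_ne_sendTy
  | send A' B' hT' M hM h =>
    obtain ⟨rfl, rfl⟩ := sendTy_inj (hT.symm.trans hT')
    exact ⟨M, hM, h⟩

/-- Observations of inputs are closed under backward steps of the second configuration. -/
theorem InN.bwd (hSg : Sg.WF) (h : InN Sg (E Sg m) H T y D₁ W) (h0 : InN Sg (E Sg 0) H T y D₁ Y)
    (hs : Steps Sg (H.ctx y T) (H.root y T) Y W) : InN Sg (E Sg m) H T y D₁ Y := by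
  cases h0 with
  | close Δ K hH hT h0 =>
    refine .close Δ K hH hT ((h.close_inv hT hH).steps_back hSg h0.2 ?_)
    subst hH
    refine Reds.frame (ifaceBases_finite _ _) hs ?_ (bases_mono ?_)
    · rw [confChans_singleton]
      rintro _ ⟨c, rfl, rfl⟩
      exact Hole.base_mem (.left Δ K) _ T
    · rw [Hole.iface]
      exact subset_union_right
  | lab I A hT h0 =>
    refine .lab I A hT (fun k => (h.lab_inv hT k).steps_back hSg (h0 k).2 (Steps.add_msg ?_ hs))
    rintro c (rfl | rfl) <;> rfl
  | send A B hT M hM h0 =>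
    obtain ⟨M', hM', h'⟩ := h.send_inv hT
    obtain ⟨F, hF, hs'⟩ := Steps.add_send hs
    refine .send A B hT (M ∪ M' ∪ F) ((hM.union hM').union hF) (fun x hx => ?_)
    simp only [mem_union, not_or] at hx
    exact (h' x hx.1.2).steps_back hSg (h0 x hx.1.1).2 (hs' x A B hx.2)

theorem InN.all (hSg : Sg.WF) (h : ∀ m, InN Sg (E Sg m) H T y D₁ Y) :
    InN Sg (EAll Sg) H T y D₁ Y := by
  cases h 0 with
  | close Δ K hH hT _ => exact .close Δ K hH hT (fun m => (h m).close_inv hT hH)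
  | lab I A hT _ => exact .lab I A hT (fun k m => (h m).lab_inv hT k)
  | send A B hT _ _ _ =>
    refine .send A B hT (bases (allChans (H.ctx y T) (H.root y T) D₁) ∪
      bases (allChans (H.ctx y T) (H.root y T) Y)) ((bases_finite (allChans_finite _ _ _)).union
        (bases_finite (allChans_finite _ _ _))) (fun x hx m => ?_)
    rw [mem_union, not_or] at hx
    obtain ⟨M, hM, h'⟩ := (h m).send_inv hT
    exact (E_nominal hSg m).recv hM h' hx.1 hx.2

theorem OutN.lab_inv (hSg : Sg.WF) {A : {l // l ∈ I} → Ty L TN} {k : {l // l ∈ I}}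
    (h : OutN Sg R H T y (X₁ + {.msg (.lab y k.1)}) D₂)
    (t : Tree Sg (H.ctx y T) (H.root y T) (X₁ + {.msg (.lab y k.1)}))
    (hT : Sg.unf T = labTy H.pos I A) :
    ∃ X₂, D₂ = X₂ + {.msg (.lab y k.1)} ∧ R (H.ctx y.succ (A k)) (H.root y.succ (A k)) X₁ X₂ := by
  cases h with
  | close _ hT' h1 _ => exact absurd (hT.symm.trans hT') labTy_ne_one
  | lab I' A' hT' k' X₁' X₂ h1 h2 h =>
    obtain ⟨rfl, e⟩ := labTy_inj (hT.symm.trans hT')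
    obtain rfl := eq_of_heq e
    have := t.ev_unique hSg (n := .msg (.lab y k.1)) (n' := .msg (.lab y k'.1)) (by simp)
      (by rw [h1]; simp) (Ev.msg _) (Ev.msg (.lab y k'.1))
    obtain rfl : k = k' := by
      simp only [Node.msg.injEq, Msg.lab.injEq, true_and] at this
      exact Subtype.ext this
    obtain rfl := add_right_cancel h1
    exact ⟨X₂, h2, h⟩
  | send H₀ Γ hH A' B hT' => exact absurd (hT.symm.trans hT') labTy_ne_sendTy

/-- The observation of a sent channel, where the channels `Γ` and the part `S₁` of the first
configuration belong to the sent channel. -/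
inductive SendN (Sg : Signature L TN PN) (R : ConfRel L TN PN) (H : Hole L TN) (T : Ty L TN)
    (y : Chan) (Γ : Ctx L TN Chan) (S₁ D₁ D₂ : Config L TN PN) : Prop
  | mk (H₀ : Hole L TN) (hH : H = H₀.add Γ) (A B : Ty L TN)
      (hT : Sg.unf T = sendTy H.pos A B) (x : Chan) (S₂ D₁' D₂' : Config L TN PN)
      (h₁ : D₁ = S₁ + D₁' + {.msg (.send x y)})
      (h₂ : AlphaEq (H.ctx y T) (H.root y T) D₂ (S₂ + D₂' + {.msg (.send x y)}))
      (hS : R Γ (some (x, A)) S₁ S₂)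
      (hD : R (H₀.ctx y.succ B) (H₀.root y.succ B) D₁' D₂')

theorem SendN.mono (hRR : ∀ Δ K D₁ D₂, R Δ K D₁ D₂ → R' Δ K D₁ D₂)
    (h : SendN Sg R H T y Γ S₁ D₁ D₂) : SendN Sg R' H T y Γ S₁ D₁ D₂ := by
  obtain ⟨H₀, hH, A, B, hT, x, S₂, X₁, X₂, h1, h2, hS, hD⟩ := h
  exact ⟨H₀, hH, A, B, hT, x, S₂, X₁, X₂, h1, h2, hRR _ _ _ _ hS, hRR _ _ _ _ hD⟩

theorem SendN.alpha (h : SendN Sg R H T y Γ S₁ D₁ D₂)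
    (ha : AlphaEq (H.ctx y T) (H.root y T) D₂ D₂') : SendN Sg R H T y Γ S₁ D₁ D₂' := by
  obtain ⟨H₀, hH, A, B, hT, x, S₂, X₁, X₂, h1, h2, hS, hD⟩ := h
  exact ⟨H₀, hH, A, B, hT, x, S₂, X₁, X₂, h1, ha.symm.trans h2, hS, hD⟩

theorem SendN.fwd (hSg : Sg.WF) (hR : Nominal Sg R) (hf : FwdClosed Sg R)
    (h : SendN Sg R H T y Γ S₁ D₁ D₂) (t : Tree Sg (H.ctx y T) (H.root y T) D₂)
    (hs : Steps Sg (H.ctx y T) (H.root y T) D₂ D₂') : SendN Sg R H T y Γ S₁ D₁ D₂' := by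
  obtain ⟨H₀, rfl, A, B, hT, x, S₂, X₁, X₂, h₁, h₂, hS, hD⟩ := h
  obtain ⟨W, hW, ha⟩ := h₂.steps hs
  obtain ⟨S', R', rfl, h1, h2⟩ := (h₂.tree hSg t).steps_send hSg (hR.tree hS).2 (hR.tree hD).2 hW
  exact ⟨H₀, rfl, A, B, hT, x, S', X₁, R', h₁, ha, hf hS h1, hf hD h2⟩

theorem Hole.add_inj {H₀' : Hole L TN} (h : H₀.add Γ = H₀'.add Γ) : H₀ = H₀' := by
  cases H₀ <;> cases H₀' <;> simp_all [Hole.add]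

theorem SendN.inv (hSg : Sg.WF) {B : Ty L TN}
    (h : SendN Sg R (H₀.add Γ) T y Γ S₁ (S₁ + X₁ + {.msg (.send x y)}) D₂)
    (t : Tree Sg ((H₀.add Γ).ctx y T) ((H₀.add Γ).root y T) (S₁ + X₁ + {.msg (.send x y)}))
    (hT : Sg.unf T = sendTy (H₀.add Γ).pos A B) : ∃ S₂ X₂,
      AlphaEq ((H₀.add Γ).ctx y T) ((H₀.add Γ).root y T) D₂ (S₂ + X₂ + {.msg (.send x y)}) ∧
      R Γ (some (x, A)) S₁ S₂ ∧ R (H₀.ctx y.succ B) (H₀.root y.succ B) X₁ X₂ := by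
  obtain ⟨H₀', hH, A', B', hT', x', S₂, X₁', X₂, h1, h2, hS, hD⟩ := h
  obtain rfl := Hole.add_inj hH
  obtain ⟨rfl, rfl⟩ := sendTy_inj (hT.symm.trans hT')
  have := t.ev_unique hSg (n := .msg (.send x y)) (n' := .msg (.send x' y)) (by simp)
    (by rw [h1]; simp) (Ev.msg _) (Ev.msg (.send x' y))
  obtain rfl : x = x' := by simpa using this
  obtain rfl := add_left_cancel (add_right_cancel h1)
  exact ⟨S₂, X₂, h2, hS, hD⟩

/-- One of the values that a sequence takes among the subsets of a finite set is frequent. -/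
theorem exists_frequent {α : Type*} {F : Set α} (hF : F.Finite) (V : ℕ → Set α)
    (hV : ∀ m, V m ⊆ F) : ∃ m0, ∀ m, ∃ m', m ≤ m' ∧ V m' = V m0 := by
  have : Finite {s | s ⊆ F} := hF.finite_subsets
  obtain ⟨⟨s, hs⟩, hi⟩ := Finite.exists_infinite_fiber (fun m => (⟨V m, hV m⟩ : {s | s ⊆ F}))
  rw [Set.infinite_coe_iff] at hi
  obtain ⟨m0, h0⟩ := hi.nonempty
  have hs : ∀ {m}, m ∈ (fun m => (⟨V m, hV m⟩ : {s | s ⊆ F})) ⁻¹' {⟨s, hs⟩} → V m = s :=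
    fun h => congrArg Subtype.val h
  refine ⟨m0, fun m => ?_⟩
  obtain ⟨m', h', hm⟩ := hi.exists_gt m
  exact ⟨m', hm.le, (hs h').trans (hs h0).symm⟩

/-- A step of the first configuration can be simulated uniformly in the index: there are only
finitely many ways of splitting the interface and the first configuration at sent channels, so that
the configurations that match at the different indices can be assumed to agree on them. -/
theorem EAll.exists_uniform (hSg : Sg.WF) (h : EAll Sg Δ K D₁ D₂) (hs : Steps Sg Δ K D₁ D₁') :
    ∃ m0 Y, Steps Sg Δ K D₂ Y ∧ Obs Sg (E Sg m0) Δ K D₁' Y ∧ ∀ m, ∃ W, Steps Sg Δ K Y W ∧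
      Obs Sg (E Sg m) Δ K D₁' W ∧ ∀ H T y Γ S₁, Δ = H.ctx y T → K = H.root y T →
        SendN Sg (E Sg m0) H T y Γ S₁ D₁' Y → SendN Sg (E Sg m) H T y Γ S₁ D₁' W := by
  classical
  have t1 := ((h 0).1).steps hSg hs
  have t2 := (h 0).2
  choose Y hY ho using fun m => ((E_succ_iff hSg).1 (h (m + 1))).2.2 D₁' hs
  let V : ℕ → Set (Chan × Ctx L TN Chan × Config L TN PN) := fun m =>
    {p | ∃ H T, Δ = H.ctx p.1 T ∧ K = H.root p.1 T ∧
      SendN Sg (E Sg m) H T p.1 p.2.1 p.2.2 D₁' (Y m)}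
  obtain ⟨m0, hm0⟩ := exists_frequent (F := ifaceChans Δ K ×ˢ Set.Iic Δ ×ˢ Set.Iic D₁')
    ((ifaceChans_finite Δ K).prod ((Set.finite_Iic Δ).prod (Set.finite_Iic D₁'))) V (by
      rintro m ⟨y, Γ, S₁⟩ ⟨H, T, rfl, rfl, H₀, rfl, A, B, hT, x, S₂, X₁, X₂, h1, -⟩
      refine ⟨Hole.mem_iface _ y T, ?_, ?_⟩
      · rw [Set.mem_Iic, Hole.ctx_add]
        exact Multiset.le_add_right _ _
      · rw [Set.mem_Iic, h1, add_assoc]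
        exact Multiset.le_add_right _ _)
  refine ⟨m0, Y m0, hY m0, ho m0, fun m => ?_⟩
  obtain ⟨m', hm, hV⟩ := hm0 m
  obtain ⟨Z, W, hZ, hW, ha⟩ := t2.confluent hSg (hY m') (hY m0)
  have t' := t2.steps hSg (hY m')
  have mono : ∀ Δ K D₁ D₂, E Sg m' Δ K D₁ D₂ → E Sg m Δ K D₁ (D₂ : Config L TN PN) :=
    fun _ _ _ _ h => h.le hSg hm
  refine ⟨W, hW, (((ho m').mono mono).fwd hSg (E_nominal hSg m) (E_fwd hSg m) t' hZ).alpha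
    (E_nominal hSg m) ha, ?_⟩
  rintro H T y Γ S₁ rfl rfl h
  have hmem : (y, Γ, S₁) ∈ V m0 := ⟨H, T, rfl, rfl, h⟩
  rw [← hV] at hmem
  obtain ⟨H', T', e1, e2, h'⟩ := hmem
  obtain ⟨rfl, rfl⟩ := Hole.unique hSg t1 (by
    obtain ⟨H₀, hH, A, B, hT, x, S₂, X₁, X₂, h1, -⟩ := h
    rw [h1]; simp) e1 e2
  exact ((h'.mono mono).fwd hSg (E_nominal hSg m) (E_fwd hSg m) t' hZ).alpha ha

/-- The relation at all indices is a simulation: the matching configuration can be chosen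
independently of the index. -/
theorem EAll.steps (hSg : Sg.WF) (h : EAll Sg Δ K D₁ D₂) (hs : Steps Sg Δ K D₁ D₁') :
    ∃ D₂', Steps Sg Δ K D₂ D₂' ∧ Obs Sg (EAll Sg) Δ K D₁' D₂' := by
  suffices key : ∀ D₂, EAll Sg Δ K D₁ D₂ →
      (K ≠ none ∨ SinkAvoiding Sg Δ K D₂ ∨ HasSink Sg Δ K D₂) →
      ∃ D₂', Steps Sg Δ K D₂ D₂' ∧ Obs Sg (EAll Sg) Δ K D₁' D₂' by
    by_cases hr : SinkAvoiding Sg Δ K D₂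
    · exact key D₂ h (Or.inr (Or.inl hr))
    · simp only [SinkAvoiding, not_forall, not_not] at hr
      obtain ⟨D, hD, hr⟩ := hr
      obtain ⟨D₂', h1, h2⟩ := key D (fun m => E_fwd hSg m (h m) hD) (Or.inr (Or.inr hr))
      exact ⟨D₂', hD.trans h1, h2⟩
  intro D₂ h hr
  have t1 := ((h 0).1).steps hSg hs
  obtain ⟨m0, Y, hY, ho, hu⟩ := h.exists_uniform hSg hs
  have tY := (h 0).2.steps hSg hY
  replace hr : K ≠ none ∨ SinkAvoiding Sg Δ K Y ∨ HasSink Sg Δ K Y :=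
    hr.imp_right (Or.imp (fun hr Z hZ => hr Z (hY.trans hZ)) (fun hr => hr.steps hSg (h 0).2 hY))
  refine ⟨Y, hY, ho.ups, ?_, ?_⟩
  · rintro H T y rfl rfl hy
    have out := ho.out H T y rfl rfl hy
    cases out with
    | close hH hT h₁ h₂ => exact .close hH hT h₁ h₂
    | lab I A hT k X₁ X₂ h₁ h₂ h =>
      subst h₁ h₂
      refine .lab I A hT k X₁ X₂ rfl rfl (fun m => ?_)
      obtain ⟨W, hW, hoW, -⟩ := hu m
      obtain ⟨X₂', rfl, hE⟩ := (hoW.out H T y rfl rfl hy).lab_inv hSg t1 hT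
      obtain ⟨D', e, hD⟩ := tY.steps_msg hSg rfl hW
      obtain rfl := add_right_cancel e
      refine hE.steps_back hSg ((E_nominal hSg m0).tree h).2 (hD.anti
        ((ifaceBases_finite _ _).union (msg_bases_finite _)) ?_)
      rw [Hole.bases_succ (T := T)]
      exact subset_union_left
    | send H₀ Γ hH A B hT x S₁ S₂ X₁ X₂ h₁ h₂ hS hD =>
      subst hH h₁
      have hn := SendN.mk (R := E Sg m0) H₀ rfl A B hT x S₂ X₁ X₂ rfl h₂ hS hD
      have tS := ((E_nominal hSg m0).tree hS).2
      have tR := ((E_nominal hSg m0).tree hD).2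
      -- A sink that occurs in the part that belongs to the sent channel is moved to the other part.
      obtain ⟨S, R, e, tS, tR, hr⟩ : ∃ S R, S + R = S₂ + X₂ ∧ Tree Sg Γ (some (x, A)) S ∧
          Tree Sg (H₀.ctx y.succ B) (H₀.root y.succ B) R ∧ (H₀.root y.succ B ≠ none ∨
            SinkAvoiding Sg ((H₀.add Γ).ctx y T) ((H₀.add Γ).root y T) Y ∨
            HasSink Sg (H₀.ctx y.succ B) (H₀.root y.succ B) R) := by
        by_cases hK : H₀.root y.succ B = none
        · rcases hr with hr | hr | hr
          · rw [Hole.root_add] at hr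
            exact absurd (Hole.root_eq_none.1 hK) hr
          · exact ⟨S₂, X₂, rfl, tS, tR, Or.inr (Or.inl hr)⟩
          · obtain ⟨G, W, e, hs, hj⟩ := hr.alpha h₂
            obtain ⟨G, rfl, e'⟩ := Junk.msg (M := .send x y) hj (Hole.base_mem _ y T) e.symm
            have hd := (h₂.tree hSg tY).send_disjoint hSg tS tR
            have hj1 := hj.mono (H₀.bases_send_left Γ x y T A le_rfl) le_rfl
            have hj2 := hj.mono (H₀.bases_send_right Γ y T B (Multiset.le_add_right G _)) le_rfl
            rw [hK] at tR hd hj2 ⊢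
            obtain ⟨S, R, h1, h2, h3, h4⟩ := HasSink.move hSg tS tR hd e' hs hj1 hj2
            exact ⟨S, R, h1, h2, h3, Or.inr (Or.inr h4)⟩
        · exact ⟨S₂, X₂, rfl, tS, tR, Or.inl hK⟩
      rw [← e] at h₂
      have key : ∀ m, E Sg m Γ (some (x, A)) S₁ S ∧
          E Sg m (H₀.ctx y.succ B) (H₀.root y.succ B) X₁ R := by
        intro m
        obtain ⟨W, hW, -, hsend⟩ := hu m
        obtain ⟨S', R', hα, hS', hR'⟩ := (hsend _ T y Γ S₁ rfl rfl hn).inv hSg t1 hT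
        obtain ⟨W', hW', hα'⟩ := h₂.steps hW
        exact E.send_transfer hSg (h₂.tree hSg tY) tS tR
          (hr.imp_right (Or.imp_left (fun hr => hr.alpha h₂))) hW' (hα'.symm.trans hα) hS' hR'
      exact .send H₀ Γ rfl A B hT x S₁ S X₁ R rfl h₂ (fun m => (key m).1) (fun m => (key m).2)
  · rintro H T y rfl rfl hy
    refine InN.all hSg (fun m => ?_)
    obtain ⟨W, hW, hoW, -⟩ := hu m
    exact (hoW.inn H T y rfl rfl hy).bwd hSg ((ho.inn H T y rfl rfl hy).mono
      (fun _ _ _ _ h => h.le hSg (Nat.zero_le _))) hW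

end

section

variable {L TN PN : Type} {Sg : Signature L TN PN}
  {D D₁ D₂ D₂' P P₁ P₁' P₂ Q Q₁ Q₁' Q₂ X : Config L TN PN} {G G' G₀ H H' H₀ : Hole L TN}
  {Γ Δ Δp Δq : Ctx L TN Chan} {u x y : Chan} {A B T : Ty L TN} {K Kp Kq : Root L TN} {n n₁ n₂ : ℕ}
  {N : Set ℕ} {M : Msg L} {R : ConfRel L TN PN}

/-! ### Linked interfaces -/

/-- The channels in `A` and those in `B` are named apart, with the exception of `u`: the only base
that they share is that of `u`, and the only channel is `u`. -/
def Apt (u : Chan) (A B : Set Chan) : Prop :=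
  ∀ c ∈ A, ∀ c' ∈ B, (c.base = c'.base → c.base = u.base) ∧ (c = c' → c = u)

theorem Apt.symm {A B : Set Chan} (h : Apt u A B) : Apt u B A :=
  fun c hc c' hc' => ⟨fun e => e.trans ((h c' hc' c hc).1 e.symm),
    fun e => e.trans ((h c' hc' c hc).2 e.symm)⟩

theorem Apt.mono {A A' B B' : Set Chan} (h : Apt u A B) (hA : A' ⊆ A) (hB : B' ⊆ B) :
    Apt u A' B' := fun c hc c' hc' => h c (hA hc) c' (hB hc')

theorem Apt.bases {A B : Set Chan} (h : Apt u A B) {b : ℕ} (hA : b ∈ bases A) (hB : b ∈ bases B) :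
    b = u.base := by
  obtain ⟨c, hc, rfl⟩ := hA
  obtain ⟨c', hc', e⟩ := hB
  exact (h c hc c' hc').1 e.symm

theorem Apt.ren {A B : Set Chan} (h : Apt u A B) (π : Equiv.Perm ℕ) :
    Apt (u.rename π) (Chan.rename π '' A) (Chan.rename π '' B) := by
  rintro _ ⟨c, hc, rfl⟩ _ ⟨c', hc', rfl⟩
  refine ⟨fun e => congrArg π ((h c hc c' hc').1 (π.injective e)), fun e => ?_⟩
  rw [(h c hc c' hc').2 (Chan.rename_injective π e)]

theorem Apt.ren_left {A B : Set Chan} (h : Apt u A B) {π : Equiv.Perm ℕ} (hu : π u.base = u.base)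
    (hb : ∀ b ∈ ILST.bases (Chan.rename π '' A), b ∈ ILST.bases B → b = u.base) :
    Apt u (Chan.rename π '' A) B := by
  rintro c hc c' hc'
  refine ⟨fun e => hb _ (mem_bases hc) (e ▸ mem_bases hc'), ?_⟩
  rintro rfl
  have e := hb _ (mem_bases hc) (mem_bases hc')
  obtain ⟨c, hc, rfl⟩ := hc
  have e' : π c.base = π u.base := e.trans hu.symm
  have := Chan.rename_eq_self (π := π) (c := c) (by rw [π.injective e', hu])
  rw [this] at hc' ⊢
  exact (h c hc c hc').2 rfl

/-- `Dual H H' Δ K`: connecting the channels in the holes `H` and `H'` leaves the interface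
`Δ ⊩ K`. -/
inductive Dual : Hole L TN → Hole L TN → Ctx L TN Chan → Root L TN → Prop
  | right (Δ' Δ : Ctx L TN Chan) (K : Root L TN) : Dual (.right Δ') (.left Δ K) (Δ' + Δ) K
  | left (Δ' Δ : Ctx L TN Chan) (K : Root L TN) : Dual (.left Δ K) (.right Δ') (Δ' + Δ) K

theorem Dual.symm (h : Dual H H' Δ K) : Dual H' H Δ K := by
  cases h
  exacts [.left _ _ _, .right _ _ _]

theorem Dual.pos (h : Dual H H' Δ K) : H.pos = !H'.pos := by
  cases h <;> rfl

theorem Dual.chans (h : Dual H H' Δ K) : ifaceChans Δ K = H.chans ∪ H'.chans := by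
  cases h <;> simp only [ifaceChans, Hole.chans, dom_add, union_assoc]
  rw [Set.union_left_comm, Set.union_comm {c | _}, Set.union_left_comm]

theorem Dual.ren (h : Dual H H' Δ K) (π : Equiv.Perm ℕ) :
    Dual (H.ren π) (H'.ren π) (ctxren π Δ) (rootren π K) := by
  cases h <;> simp only [Hole.ren, ctxren, Multiset.map_add]
  exacts [.right _ _ _, .left _ _ _]

/-- A message that carries a channel moves its context to the other side of the link. -/
theorem Dual.send (h : Dual (H₀.add Γ) H' Δ K) :
    ∃ Δ₀, Δ = Γ + Δ₀ ∧ ∀ p, Dual H₀ (H'.add {p}) (p ::ₘ Δ₀) K := by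
  cases H₀ with
  | right Δ₁ =>
    cases h with
    | right _ Δ K =>
      refine ⟨Δ₁ + Δ, add_assoc _ _ _, fun p => ?_⟩
      have := Dual.right Δ₁ ({p} + Δ) K
      rwa [add_left_comm, singleton_add] at this
  | left Δ₁ K =>
    cases h with
    | left Δ' _ K =>
      refine ⟨Δ' + Δ₁, add_left_comm _ _ _, fun p => ?_⟩
      have := Dual.left ({p} + Δ') Δ₁ K
      rwa [add_assoc, singleton_add] at this

/-- Configurations with the interfaces `Δp ⊩ Kp` and `Δq ⊩ Kq` can be linked along `u : T`, which
one of them provides and the other uses; the interface of the result is `Δ ⊩ K`. -/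
def Link (u : Chan) (T : Ty L TN) (Δp : Ctx L TN Chan) (Kp : Root L TN) (Δq : Ctx L TN Chan)
    (Kq : Root L TN) (Δ : Ctx L TN Chan) (K : Root L TN) : Prop :=
  ∃ H H' : Hole L TN, Dual H H' Δ K ∧ Δp = H.ctx u T ∧ Kp = H.root u T ∧ Δq = H'.ctx u T ∧
    Kq = H'.root u T

theorem Dual.link (h : Dual H H' Δ K) (u : Chan) (T : Ty L TN) :
    Link u T (H.ctx u T) (H.root u T) (H'.ctx u T) (H'.root u T) Δ K :=
  ⟨H, H', h, rfl, rfl, rfl, rfl⟩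

theorem Link.symm (l : Link u T Δp Kp Δq Kq Δ K) : Link u T Δq Kq Δp Kp Δ K := by
  obtain ⟨H, H', d, rfl, rfl, rfl, rfl⟩ := l
  exact d.symm.link u T

theorem Link.iface (l : Link u T Δp Kp Δq Kq Δ K) :
    ifaceChans Δp Kp ∪ ifaceChans Δq Kq = {u} ∪ ifaceChans Δ K := by
  obtain ⟨H, H', d, rfl, rfl, rfl, rfl⟩ := l
  rw [Hole.iface, Hole.iface, d.chans, Set.union_union_union_comm, Set.union_self]

theorem Link.mem (l : Link u T Δp Kp Δq Kq Δ K) : u ∈ ifaceChans Δp Kp := by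
  obtain ⟨H, H', d, rfl, rfl, rfl, rfl⟩ := l
  exact H.mem_iface u T

theorem Link.chans (l : Link u T Δp Kp Δq Kq Δ K) (P Q : Config L TN PN) :
    allChans Δp Kp P ∪ allChans Δq Kq Q = {u} ∪ allChans Δ K (P + Q) := by
  rw [allChans, allChans, Set.union_union_union_comm, l.iface, allChans, confChans_add,
    union_assoc]

theorem Link.chans_left (l : Link u T Δp Kp Δq Kq Δ K) (P Q : Config L TN PN) {c : Chan}
    (hc : c ∈ allChans Δp Kp P) (hu : c ≠ u) : c ∈ allChans Δ K (P + Q) := by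
  have : c ∈ {u} ∪ allChans Δ K (P + Q) := by rw [← l.chans]; exact Or.inl hc
  exact this.resolve_left hu

theorem Link.iface_subset (l : Link u T Δp Kp Δq Kq Δ K) {c : Chan} (hc : c ∈ ifaceChans Δ K) :
    c ∈ ifaceChans Δp Kp ∨ c ∈ ifaceChans Δq Kq := by
  have : c ∈ ifaceChans Δp Kp ∪ ifaceChans Δq Kq := by rw [l.iface]; exact Or.inr hc
  exact this

theorem Link.bases_iface (l : Link u T Δp Kp Δq Kq Δ K) {c : ℕ}
    (hc : c ∈ bases (ifaceChans Δ K)) :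
    c ∈ bases (ifaceChans Δp Kp) ∨ c ∈ bases (ifaceChans Δq Kq) := by
  obtain ⟨c, hc, rfl⟩ := hc
  exact (l.iface_subset hc).imp mem_bases mem_bases

theorem Link.tree (hSg : Sg.WF) (l : Link u T Δp Kp Δq Kq Δ K) (tP : Tree Sg Δp Kp P)
    (tQ : Tree Sg Δq Kq Q) (ha : Apt u (allChans Δp Kp P) (allChans Δq Kq Q)) :
    Tree Sg Δ K (P + Q) := by
  obtain ⟨H, H', d, rfl, rfl, rfl, rfl⟩ := l
  cases d with
  | right Δ' Δ K => exact tP.cut hSg tQ ha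
  | left Δ' Δ K => rw [add_comm P]; exact tQ.cut hSg tP ha.symm

theorem Link.ren (l : Link u T Δp Kp Δq Kq Δ K) (π : Equiv.Perm ℕ) :
    Link (u.rename π) T (ctxren π Δp) (rootren π Kp) (ctxren π Δq) (rootren π Kq) (ctxren π Δ)
      (rootren π K) := by
  obtain ⟨H, H', d, rfl, rfl, rfl, rfl⟩ := l
  simp only [← Hole.ctx_ren, ← Hole.root_ren]
  exact (d.ren π).link _ _

theorem Link.conv (hSg : Sg.WF) (l : Link u T Δp Kp Δq Kq Δ K) {Δ' : Ctx L TN Chan}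
    {K' : Root L TN} (hΔ : Sg.qc Δ = Sg.qc Δ') (hK : Sg.rq K = Sg.rq K') :
    ∃ Δp' Kp' Δq' Kq', Link u T Δp' Kp' Δq' Kq' Δ' K' ∧ Sg.qc Δp = Sg.qc Δp' ∧
      Sg.rq Kp = Sg.rq Kp' ∧ Sg.qc Δq = Sg.qc Δq' ∧ Sg.rq Kq = Sg.rq Kq' := by
  obtain ⟨H, H', d, rfl, rfl, rfl, rfl⟩ := l
  cases d with
  | right Δ₁ Δ₂ K =>
    obtain ⟨Γ, Γ', rfl, h1, h2⟩ := qc_split hSg hΔ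
    refine ⟨_, _, _, _, (Dual.right Γ Γ' K').link u T, h1, rfl, ?_, hK⟩
    simp [Hole.ctx, h2]
  | left Δ₁ Δ₂ K =>
    obtain ⟨Γ, Γ', rfl, h1, h2⟩ := qc_split hSg hΔ
    refine ⟨_, _, _, _, (Dual.left Γ Γ' K').link u T, ?_, hK, h1, rfl⟩
    simp [Hole.ctx, h2]

/-- A bound channel of a link is provided by one of the two configurations. -/
theorem Link.mem_conf (hSg : Sg.WF) (l : Link u T Δp Kp Δq Kq Δ K) (tP : Tree Sg Δp Kp P)
    (tQ : Tree Sg Δq Kq Q) (hu : u ∉ ifaceChans Δ K) : u ∈ confChans (P + Q) := by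
  have key : ∀ {Δ'} {D}, Tree Sg Δ' (some (u, T)) D →
      u ∉ dom Δ' → u ∈ confChans D := by
    intro Δ' D t hu
    obtain ⟨_, _, _, _, l⟩ := t.lin hSg
    obtain ⟨n, hn, e⟩ := ((l.chans u).1 (Or.inl (Or.inr ⟨T, rfl⟩))).resolve_left hu
    exact mem_confChans hn (e ▸ (l.nt n hn).prov_mem)
  obtain ⟨H, H', d, rfl, rfl, rfl, rfl⟩ := l
  rw [d.chans] at hu
  rw [confChans_add]
  cases d with
  | right Δ₁ Δ₂ K => exact Or.inl (key tP fun h => hu (Or.inl h))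
  | left Δ₁ Δ₂ K => exact Or.inr (key tQ fun h => hu (Or.inr h))

/-- The hole of the channel `y` in the interface of a component that is linked along `u`, and the
hole of `y` in the interface of the whole. -/
inductive Join (u : Chan) (T : Ty L TN) :
    Hole L TN → Ctx L TN Chan → Root L TN → Hole L TN → Prop
  | right (Θ Δ : Ctx L TN Chan) (K : Root L TN) :
      Join u T (.left Θ (some (u, T))) ((u, T) ::ₘ Δ) K (.left (Θ + Δ) K)
  | left (F : Hole L TN) (Δ' : Ctx L TN Chan) :
      Join u T (F.add {(u, T)}) Δ' (some (u, T)) (F.add Δ')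

theorem Join.link (j : Join u T G Δq Kq G') (y : Chan) (A : Ty L TN) :
    Link u T (G.ctx y A) (G.root y A) Δq Kq (G'.ctx y A) (G'.root y A) := by
  cases j with
  | right Θ Δ K =>
    refine ⟨.right ((y, A) ::ₘ Θ), .left Δ Kq, ?_, rfl, rfl, rfl, rfl⟩
    have := Dual.right ((y, A) ::ₘ Θ) Δ Kq
    rwa [cons_add] at this
  | left F Δ' =>
    refine ⟨.left (F.ctx y A) (F.root y A), .right Δq, ?_, ?_, ?_, rfl, rfl⟩
    · rw [Hole.ctx_add, Hole.root_add]
      exact .left _ _ _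
    · rw [Hole.ctx_add]; rfl
    · rw [Hole.root_add]; rfl

theorem Join.pos (j : Join u T G Δq Kq G') : G'.pos = G.pos := by
  cases j with
  | right => rfl
  | left F Δ' => rw [Hole.pos_add, Hole.pos_add]

theorem Join.add (j : Join u T G Δq Kq G') (Γ : Ctx L TN Chan) :
    Join u T (G.add Γ) Δq Kq (G'.add Γ) := by
  cases j with
  | right Θ Δ K =>
    simp only [Hole.add, ← add_assoc]
    exact .right _ _ _
  | left F Δ' =>
    rw [Hole.add_add, Hole.add_add, add_comm Γ, add_comm Γ, ← Hole.add_add, ← Hole.add_add]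
    exact .left _ _

theorem Hole.add_eq_add {F : Hole L TN} {p : Chan × Ty L TN} (h : F.add {p} = G₀.add Γ) :
    (∃ Γ₁, Γ = p ::ₘ Γ₁ ∧ F = G₀.add Γ₁) ∨ ∃ G₁, G₀ = Hole.add {p} G₁ ∧ F = G₁.add Γ := by
  have key : ∀ {Δ Δ₀}, {p} + Δ = Γ + Δ₀ →
      (∃ Γ₁, Γ = p ::ₘ Γ₁ ∧ Δ = Γ₁ + Δ₀) ∨ ∃ Δ₁, Δ₀ = {p} + Δ₁ ∧ Δ = Γ + Δ₁ := by
    intro Δ Δ₀ h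
    rw [singleton_add] at h
    exact add_eq_cons h.symm
  cases F <;> cases G₀ <;> simp only [Hole.add, Hole.right.injEq, Hole.left.injEq, reduceCtorEq] at h
  · rcases key h with ⟨Γ₁, rfl, rfl⟩ | ⟨Δ₁, rfl, rfl⟩
    exacts [Or.inl ⟨Γ₁, rfl, rfl⟩, Or.inr ⟨.right Δ₁, rfl, rfl⟩]
  · obtain ⟨h, rfl⟩ := h
    rcases key h with ⟨Γ₁, rfl, rfl⟩ | ⟨Δ₁, rfl, rfl⟩
    exacts [Or.inl ⟨Γ₁, rfl, rfl⟩, Or.inr ⟨.left Δ₁ _, rfl, rfl⟩]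

/-- If the context of the component splits, then the link belongs to one of the two parts. -/
theorem Join.split (j : Join u T (G₀.add Γ) Δq Kq G') :
    (∃ G₁, G' = G₁.add Γ ∧ Join u T G₀ Δq Kq G₁) ∨
    ∃ Γ', G' = G₀.add Γ' ∧ ∀ C, Link u T Γ (some C) Δq Kq Γ' (some C) := by
  generalize hG : G₀.add Γ = G at j
  cases j with
  | right Θ Δ K =>
    cases G₀ with
    | right => cases hG
    | left Θ₀ K₀ =>
      cases hG
      exact Or.inl ⟨.left (Θ₀ + Δ) _, by rw [Hole.add, add_assoc], .right _ _ _⟩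
  | left F Δ' =>
    rcases Hole.add_eq_add hG.symm with ⟨Γ₁, rfl, rfl⟩ | ⟨G₁, rfl, rfl⟩
    · exact Or.inr ⟨_, Hole.add_add _ _ _, fun C => (Dual.left _ Γ₁ (some C)).link u T⟩
    · exact Or.inl ⟨G₁.add Δq, by rw [Hole.add_add, Hole.add_add, add_comm], .left _ _⟩

theorem Join.close (j : Join u T (.left Δp Kp) Δq Kq G') :
    ∃ Δ K, G' = .left Δ K ∧ Link u T Δp Kp Δq Kq Δ K := by
  generalize hG : Hole.left Δp Kp = G at j
  cases j with
  | right Θ Δ K =>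
    cases hG
    exact ⟨_, _, rfl, (Dual.right Δp Δ Kq).link u T⟩
  | left F Δ' =>
    cases F with
    | right => cases hG
    | left Δf Kf =>
      cases hG
      exact ⟨_, _, rfl, (Dual.left Δq Δf Kp).link u T⟩

theorem Join.right_ne (j : Join u T G Δq Kq G') : G ≠ .right 0 := by
  cases j with
  | right => rintro ⟨⟩
  | left F Δ' => cases F <;> simp [Hole.add]

theorem Link.join (l : Link u T Δp Kp Δq Kq Δ K) (hy : y ∈ ifaceChans Δp Kp) (hu : y ≠ u) :
    ∃ G G' A, Δp = G.ctx y A ∧ Kp = G.root y A ∧ Δ = G'.ctx y A ∧ K = G'.root y A ∧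
      Join u T G Δq Kq G' := by
  obtain ⟨H, H', d, rfl, rfl, rfl, rfl⟩ := l
  cases d with
  | right Δ' Δr K =>
    obtain ⟨A, hA⟩ : y ∈ dom Δ' := by
      rcases hy with h | ⟨A, h⟩
      · exact h
      · cases h; exact absurd rfl hu
    obtain ⟨Θ, rfl⟩ := exists_cons_of_mem hA
    exact ⟨_, _, A, rfl, rfl, cons_add _ _ _, rfl, .right Θ Δr K⟩
  | left Δ' Δr K =>
    rw [Hole.iface] at hy
    obtain ⟨F, A, rfl, rfl⟩ := exists_hole (hy.resolve_left hu)
    exact ⟨_, _, A, (Hole.ctx_add F {(u, T)} y A).symm, (Hole.root_add F _ y A).symm,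
      (Hole.ctx_add F _ y A).symm, (Hole.root_add F _ y A).symm, .left F Δ'⟩

/-! ### Reduction of linked configurations -/

/-- A component steps apart from the other one if its fresh channels are chosen apart: the next
generation of a channel on which it sends does not occur in the whole, by the discipline of
generations. -/
theorem Link.apt_step (hSg : Sg.WF) (l : Link u T Δp Kp Δq Kq Δ K) (tP : Tree Sg Δp Kp P)
    (tQ : Tree Sg Δq Kq Q) (ha : Apt u (allChans Δp Kp P) (allChans Δq Kq Q)) (hN : N.Finite)
    (hP : bases (allChans Δp Kp P) ⊆ N) (hQ : bases (ifaceChans Δq Kq) ⊆ N) {Q' : Config L TN PN}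
    (h : Step Sg N Q Q') : Apt u (allChans Δp Kp P) (allChans Δq Kq Q') := by
  obtain ⟨-, b, hb, hc⟩ := tQ.step_chans hSg hN h hQ
  intro c hcP c' hcQ
  rcases hc c' hcQ with h | rfl | ⟨x, R, y, hn, hs, rfl⟩
  · exact ha c hcP c' h
  · have : c.base ≠ b := fun e => hb (e ▸ hP (mem_bases hcP))
    exact ⟨fun e => absurd e this, fun e => absurd (congrArg Chan.base e) this⟩
  · refine ⟨fun e => (ha c hcP y (Or.inr ?_)).1 e, fun e => ?_⟩
    · exact mem_confChans hn (Or.inr hs.mem_names)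
    · by_contra hu
      refine (l.tree hSg tP tQ ha).succ_notMem_of_sendsOn hSg
        (mem_add.2 (Or.inr hn)) hs ?_
      rw [← e]
      exact l.chans_left P Q hcP hu

theorem Link.apt_reds (hSg : Sg.WF) (l : Link u T Δp Kp Δq Kq Δ K) (tP : Tree Sg Δp Kp P)
    (tQ : Tree Sg Δq Kq Q) (ha : Apt u (allChans Δp Kp P) (allChans Δq Kq Q)) (hN : N.Finite)
    (hP : bases (allChans Δp Kp P) ⊆ N) (hQ : bases (ifaceChans Δq Kq) ⊆ N) {Q' : Config L TN PN}
    (h : Reds Sg N Q Q') : Apt u (allChans Δp Kp P) (allChans Δq Kq Q') := by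
  induction h with
  | refl => exact ha
  | tail h h' ih => exact l.apt_step hSg tP (tQ.reds hSg hN h hQ) ih hN hP hQ h'

theorem Step.widen {D' : Config L TN PN} (h : Step Sg N D D') :
    Step Sg (N ∪ bases (confChans D)) D D' := by
  cases h with
  | spawn C y X args Q hlen b hN hb => exact .spawn C y X args Q hlen b (fun h => h.elim hN hb) hb
  | fwd => exact .fwd ..
  | oneSnd => exact .oneSnd ..
  | oneRcv _ _ _ h => exact .oneRcv _ _ _ h _
  | plusSnd => exact .plusSnd ..
  | plusRcv _ _ _ h => exact .plusRcv _ _ _ h ..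
  | ampSnd _ _ _ h => exact .ampSnd _ _ _ h ..
  | ampRcv => exact .ampRcv ..
  | tensorSnd => exact .tensorSnd ..
  | tensorRcv _ _ _ _ h => exact .tensorRcv _ _ _ _ h ..
  | lolliSnd _ _ _ _ h => exact .lolliSnd _ _ _ _ h ..
  | lolliRcv => exact .lolliRcv ..

/-- A component reduces in the whole as it does alone, up to a renaming of its fresh channels. -/
theorem Link.frame (hSg : Sg.WF) (l : Link u T Δp Kp Δq Kq Δ K) (tP : Tree Sg Δp Kp P)
    (tQ : Tree Sg Δq Kq Q) (ha : Apt u (allChans Δp Kp P) (allChans Δq Kq Q))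
    {W : Config L TN PN} (h : Steps Sg Δq Kq Q W) :
    ∃ W', AlphaEq Δq Kq W W' ∧ Steps Sg Δq Kq Q W' ∧ Steps Sg Δ K (P + Q) (P + W') ∧
      Apt u (allChans Δp Kp P) (allChans Δq Kq W') := by
  have hN := ifaceBases_finite Δq Kq
  have hM := bases_finite (allChans_finite Δp Kp P)
  obtain ⟨π, hπ, -, hW⟩ := Reds.avoid hN hM h (fun b hb => by
    rw [ha.bases hb.1 (bases_mono subset_union_right hb.2)]
    exact mem_bases l.symm.mem)
  refine ⟨cren π W, ⟨π, hπ, rfl⟩, hW.anti (hN.union hM) subset_union_left, ?_,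
    l.apt_reds hSg tP tQ ha (hN.union hM) subset_union_right subset_union_left hW⟩
  rw [add_comm P, add_comm P]
  refine Reds.frame (hN.union hM) hW
    ((bases_mono subset_union_right).trans subset_union_right) (fun b hb => ?_)
  exact (l.bases_iface hb).elim (fun h => Or.inr (bases_mono subset_union_left h)) Or.inl

/-- A renaming of a set extends by the identity on another set if both agree where they meet. -/
theorem exists_perm_glue {A B : Set ℕ} (hA : A.Finite) (hB : B.Finite) (π : Equiv.Perm ℕ)
    (h : ∀ a ∈ A, a ∈ B ∨ π a ∈ B → π a = a) :
    ∃ σ : Equiv.Perm ℕ, (∀ a ∈ A, σ a = π a) ∧ ∀ b ∈ B, σ b = b := by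
  classical
  have : Finite ↥(A ∪ B) := hA.union hB
  obtain ⟨σ, hσ⟩ := Equiv.Perm.exists_extending_pair (fun a : ↥(A ∪ B) => (a : ℕ))
    (fun a => if (a : ℕ) ∈ A then π a else a) Subtype.val_injective (by
      rintro ⟨a, ha⟩ ⟨b, hb⟩ e
      simp only [Subtype.mk.injEq] at e ⊢
      split_ifs at e with h1 h2 h2
      · exact π.injective e
      · rw [← h a h1 (Or.inr (e ▸ hb.resolve_left h2)), e]
      · rw [← h b h2 (Or.inr (e ▸ ha.resolve_left h1)), e]
      · exact e)
  refine ⟨σ, fun a ha => ?_, fun b hb => ?_⟩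
  · simpa [ha] using hσ ⟨a, Or.inl ha⟩
  · have := hσ ⟨b, Or.inr hb⟩
    simp only at this
    split_ifs at this with hb'
    · rw [this, h b hb' (Or.inl hb)]
    · exact this

theorem AlphaEq.frame (l : Link u T Δp Kp Δq Kq Δ K) {P' : Config L TN PN}
    (h : AlphaEq Δp Kp P P')
    (h1 : ∀ b ∈ bases (confChans P), b ∈ bases (allChans Δq Kq Q) → b = u.base)
    (h2 : ∀ b ∈ bases (confChans P'), b ∈ bases (allChans Δq Kq Q) → b = u.base) :
    AlphaEq Δ K (P + Q) (P' + Q) := by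
  obtain ⟨π, hπ, rfl⟩ := h
  have hu : π u.base = u.base := hπ _ (mem_bases l.mem)
  obtain ⟨σ, hσ, hσ'⟩ := exists_perm_glue (bases_finite (allChans_finite Δp Kp P))
    (bases_finite (allChans_finite Δq Kq Q)) π (fun a ha hab => by
      rw [bases_allChans] at ha
      rcases ha with ha | ha
      · exact hπ a ha
      · rcases hab with hb | hb
        · rw [h1 a ha hb, hu]
        · have : π a = u.base := h2 _ (by
            change _ ∈ bases (confChans (cren π P))
            rw [confChans_cren, bases_ren]; exact ⟨a, ha, rfl⟩) hb
          rw [π.injective (this.trans hu.symm), hu])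
  refine ⟨σ, fun b hb => ?_, ?_⟩
  · rcases l.bases_iface hb with h | h
    · rw [hσ b (bases_mono subset_union_left h), hπ b h]
    · exact hσ' b (bases_mono subset_union_left h)
  · change cren π P + Q = cren σ (P + Q)
    rw [cren_add, cren_eq_self (π := σ) (D := Q) (fun b hb => hσ' b
      (bases_mono subset_union_right hb)), cren_congr (π := σ) (ρ := π) (D := P)
      (fun b hb => hσ b (bases_mono subset_union_right hb))]

/-! ### Composites of related configurations -/

/-- Pairs of configurations that are obtained by linking `n` pairs related at every index. The
first configuration is the juxtaposition of the parts itself, the second one an `α`-variant of it;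
linked channels are bound. -/
inductive Comp (Sg : Signature L TN PN) : ℕ → ConfRel L TN PN
  | base {Δ K D₁ D₂ : _} (h : EAll Sg Δ K D₁ D₂) : Comp Sg 1 Δ K D₁ D₂
  | cut {n₁ n₂ u T Δp Kp Δq Kq Δ K P₁ P₂ Q₁ Q₂ D₂ : _} (l : Link u T Δp Kp Δq Kq Δ K)
      (hP : Comp Sg n₁ Δp Kp P₁ P₂) (hQ : Comp Sg n₂ Δq Kq Q₁ Q₂)
      (a₁ : Apt u (allChans Δp Kp P₁) (allChans Δq Kq Q₁))
      (a₂ : Apt u (allChans Δp Kp P₂) (allChans Δq Kq Q₂)) (hu : u ∉ ifaceChans Δ K)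
      (hα : AlphaEq Δ K (P₂ + Q₂) D₂) : Comp Sg (n₁ + n₂) Δ K (P₁ + Q₁) D₂

/-- Composites of at most `n` pairs. -/
def CompLE (Sg : Signature L TN PN) (n : ℕ) : ConfRel L TN PN :=
  fun Δ K D₁ D₂ => ∃ n' ≤ n, Comp Sg n' Δ K D₁ D₂

/-- Composites of any number of pairs. -/
def CompAny (Sg : Signature L TN PN) : ConfRel L TN PN :=
  fun Δ K D₁ D₂ => ∃ n, Comp Sg n Δ K D₁ D₂

theorem CompLE.any (h : CompLE Sg n Δ K D₁ D₂) : CompAny Sg Δ K D₁ D₂ :=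
  h.imp fun _ h => h.2

theorem Comp.pos (h : Comp Sg n Δ K D₁ D₂) : 0 < n := by
  induction h with
  | base => exact Nat.one_pos
  | cut l hP hQ a1 a2 hu hα ihP ihQ => exact Nat.add_pos_left ihP _

theorem Comp.nominal (hSg : Sg.WF) (n : ℕ) : Nominal Sg (Comp Sg n) where
  tree h := by
    induction h with
    | base h => exact (EAll_nominal hSg).tree h
    | cut l hP hQ a1 a2 hu hα ihP ihQ =>
      exact ⟨l.tree hSg ihP.1 ihQ.1 a1, hα.tree hSg (l.tree hSg ihP.2 ihQ.2 a2)⟩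
  ren π h := by
    induction h with
    | base h => exact .base ((EAll_nominal hSg).ren π h)
    | cut l hP hQ a1 a2 hu hα ihP ihQ =>
      rw [cren_add]
      refine .cut (l.ren π) ihP ihQ ?_ ?_ ?_ (cren_add π _ _ ▸ hα.ren π)
      · rw [allChans_ren, allChans_ren]; exact a1.ren π
      · rw [allChans_ren, allChans_ren]; exact a2.ren π
      · rw [ifaceChans_ren]
        exact fun h => hu ((Chan.rename_injective π).mem_set_image.1 h)
  alpha h ha := by
    cases h with
    | base h => exact .base ((EAll_nominal hSg).alpha h ha)
    | cut l hP hQ a1 a2 hu hα => exact .cut l hP hQ a1 a2 hu (hα.trans ha)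

theorem CompLE.nominal (hSg : Sg.WF) (n : ℕ) : Nominal Sg (CompLE Sg n) where
  tree h := by obtain ⟨n', -, h⟩ := h; exact (Comp.nominal hSg n').tree h
  ren π h := by obtain ⟨n', hn, h⟩ := h; exact ⟨n', hn, (Comp.nominal hSg n').ren π h⟩
  alpha h ha := by obtain ⟨n', hn, h⟩ := h; exact ⟨n', hn, (Comp.nominal hSg n').alpha h ha⟩

theorem CompAny.nominal (hSg : Sg.WF) : Nominal Sg (CompAny Sg) where
  tree h := by obtain ⟨n', h⟩ := h; exact (Comp.nominal hSg n').tree h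
  ren π h := by obtain ⟨n', h⟩ := h; exact ⟨n', (Comp.nominal hSg n').ren π h⟩
  alpha h ha := by obtain ⟨n', h⟩ := h; exact ⟨n', (Comp.nominal hSg n').alpha h ha⟩

theorem Comp.convClosed (hSg : Sg.WF) (n : ℕ) : ConvClosed Sg (Comp Sg n) := by
  intro Δ Δ' K K' D₁ D₂ h
  induction h generalizing Δ' K' with
  | base h => exact fun hΔ hK => .base fun m => E_conv hSg m (h m) hΔ hK
  | cut l hP hQ a1 a2 hu hα ihP ihQ =>
    intro hΔ hK
    obtain ⟨Δp', Kp', Δq', Kq', l', e1, e2, e3, e4⟩ := l.conv hSg hΔ hK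
    have i := ifaceChans_conv (Sg := Sg) hΔ hK
    have ip := ifaceChans_conv (Sg := Sg) e1 e2
    have iq := ifaceChans_conv (Sg := Sg) e3 e4
    unfold allChans at a1 a2
    rw [ip, iq] at a1 a2
    unfold AlphaEq at hα
    rw [i] at hu hα
    exact .cut l' (ihP e1 e2) (ihQ e3 e4) a1 a2 hu hα

theorem CompLE.link (l : Link u T Δp Kp Δq Kq Δ K)
    (hP : CompLE Sg n₁ Δp Kp P₁ P₂) (hQ : CompLE Sg n₂ Δq Kq Q₁ Q₂)
    (a1 : Apt u (allChans Δp Kp P₁) (allChans Δq Kq Q₁))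
    (a2 : Apt u (allChans Δp Kp P₂) (allChans Δq Kq Q₂)) (hu : u ∉ ifaceChans Δ K) :
    CompLE Sg (n₁ + n₂) Δ K (P₁ + Q₁) (P₂ + Q₂) := by
  obtain ⟨m1, h1, hP⟩ := hP
  obtain ⟨m2, h2, hQ⟩ := hQ
  exact ⟨_, Nat.add_le_add h1 h2, .cut l hP hQ a1 a2 hu (.refl _ _ _)⟩

/-- Composites are closed under linking. If the linked channel remains free, then one of the two
components is empty. -/
theorem CompAny.link (hSg : Sg.WF) (l : Link u T Δp Kp Δq Kq Δ K)
    (hP : CompAny Sg Δp Kp P₁ P₂) (hQ : CompAny Sg Δq Kq Q₁ Q₂)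
    (a1 : Apt u (allChans Δp Kp P₁) (allChans Δq Kq Q₁))
    (a2 : Apt u (allChans Δp Kp P₂) (allChans Δq Kq Q₂)) :
    CompAny Sg Δ K (P₁ + Q₁) (P₂ + Q₂) := by
  by_cases hu : u ∈ ifaceChans Δ K
  swap
  · obtain ⟨m1, hP⟩ := hP
    obtain ⟨m2, hQ⟩ := hQ
    exact ⟨_, .cut l hP hQ a1 a2 hu (.refl _ _ _)⟩
  have key : ∀ {Δ' Δ} {K} {P₁ P₂ Q₁ Q₂},
      CompAny Sg Δ' (some (u, T)) P₁ P₂ → CompAny Sg ((u, T) ::ₘ Δ) K Q₁ Q₂ →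
      u ∈ ifaceChans (Δ' + Δ) K → CompAny Sg (Δ' + Δ) K (P₁ + Q₁) (P₂ + Q₂) := by
    intro Δ' Δ K P₁ P₂ Q₁ Q₂ hP hQ hu
    have tP := (CompAny.nominal hSg).tree hP
    have tQ := (CompAny.nominal hSg).tree hQ
    have zero : ∀ {Δ} {D} {A},
        Tree Sg Δ (some (u, A)) D → u ∈ dom Δ → D = 0 :=
      fun t h => by_contra fun hD => t.root_notMem hSg hD h
    rw [ifaceChans, dom_add] at hu
    rcases hu with (hu | hu) | ⟨A, rfl⟩
    · obtain rfl := zero tP.1 hu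
      obtain rfl := zero tP.2 hu
      obtain ⟨m, hQ⟩ := hQ
      refine ⟨m, ?_⟩
      rw [zero_add, zero_add]
      refine Comp.convClosed hSg m hQ ?_ rfl
      rw [qc_add, tP.1.zero_some hSg, qc_cons, singleton_add]
    · have := tQ.1.nodup_ctx hSg
      rw [keys_cons, nodup_cons] at this
      exact absurd (mem_dom.1 hu) this.1
    · have hu : u ∈ dom ((u, T) ::ₘ Δ) := by rw [dom_cons]; exact Or.inl rfl
      obtain rfl := zero tQ.1 hu
      obtain rfl := zero tQ.2 hu
      have e := tQ.1.zero_some hSg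
      rw [qc_cons, ← cons_zero] at e
      rcases cons_eq_cons.1 e with ⟨eT, eΔ⟩ | ⟨-, Θ, -, h⟩
      · obtain ⟨m, hP⟩ := hP
        refine ⟨m, ?_⟩
        rw [add_zero, add_zero]
        refine Comp.convClosed hSg m hP ?_ ?_
        · rw [qc_add, eΔ, add_zero]
        · simp only [Signature.rq, Option.map_some, Prod.map_apply, id_eq]
          rw [(Prod.mk.inj eT).2]
      · exact absurd h.symm (cons_ne_zero)
  obtain ⟨H, H', d, rfl, rfl, rfl, rfl⟩ := l
  cases d with
  | right Δ' Δ K => exact key hP hQ hu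
  | left Δ' Δ K => rw [add_comm P₁, add_comm P₂]; exact key hQ hP hu

/-- The second configuration reduces to one that forms a composite with the first one. -/
def Sim (Sg : Signature L TN PN) : ConfRel L TN PN :=
  fun Δ K D₁ D₂ => ∃ W, Steps Sg Δ K D₂ W ∧ CompAny Sg Δ K D₁ W

theorem Sim.alpha (hSg : Sg.WF) (h : Sim Sg Δ K D₁ D₂) (ha : AlphaEq Δ K D₂ D₂') :
    Sim Sg Δ K D₁ D₂' := by
  obtain ⟨W, hW, h⟩ := h
  obtain ⟨W', hW', ha'⟩ := ha.steps hW
  exact ⟨W', hW', (CompAny.nominal hSg).alpha h ha'⟩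

theorem Sim.steps_back (h : Sim Sg Δ K D₁ D₂') (hs : Steps Sg Δ K D₂ D₂') : Sim Sg Δ K D₁ D₂ := by
  obtain ⟨W, hW, h⟩ := h
  exact ⟨W, hs.trans hW, h⟩

/-- A simulated step of one component is simulated in the whole. -/
theorem Link.sim (hSg : Sg.WF) (l : Link u T Δp Kp Δq Kq Δ K) (hP : CompAny Sg Δp Kp P₁ P₂)
    (tQ₁ : Tree Sg Δq Kq Q₁) (tQ₂ : Tree Sg Δq Kq Q₂)
    (a1 : Apt u (allChans Δp Kp P₁) (allChans Δq Kq Q₁))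
    (a2 : Apt u (allChans Δp Kp P₂) (allChans Δq Kq Q₂)) (hN : N.Finite)
    (hNP : bases (allChans Δp Kp P₁) ⊆ N) (hNQ : bases (ifaceChans Δq Kq) ⊆ N)
    (h : Step Sg N Q₁ Q₁') (hs : Sim Sg Δq Kq Q₁' Q₂) : Sim Sg Δ K (P₁ + Q₁') (P₂ + Q₂) := by
  obtain ⟨W, hW, hc⟩ := hs
  have tP := (CompAny.nominal hSg).tree hP
  obtain ⟨W', ha, -, hW', a2'⟩ := l.frame hSg tP.2 tQ₂ a2 hW
  exact ⟨_, hW', .link hSg l hP ((CompAny.nominal hSg).alpha hc ha)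
    (l.apt_step hSg tP.1 tQ₁ a1 hN hNP hNQ h) a2'⟩

/-- The components of the second configuration can be reduced independently, and their bound
channels can be renamed apart from those of the components of the first one. -/
theorem Link.normalize (hSg : Sg.WF) (l : Link u T Δp Kp Δq Kq Δ K) (tP : Tree Sg Δp Kp P₂)
    (tQ : Tree Sg Δq Kq Q₂) (a1 : Apt u (allChans Δp Kp P₁) (allChans Δq Kq Q₁))
    (a2 : Apt u (allChans Δp Kp P₂) (allChans Δq Kq Q₂)) {p q : Config L TN PN → Prop}
    (hp : ∀ D D', p D → AlphaEq Δp Kp D D' → p D') (hq : ∀ D D', q D → AlphaEq Δq Kq D D' → q D')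
    (h1 : ∃ D, Steps Sg Δp Kp P₂ D ∧ p D) (h2 : ∃ D, Steps Sg Δq Kq Q₂ D ∧ q D) :
    ∃ P₂' Q₂' W, p P₂' ∧ q Q₂' ∧ Apt u (allChans Δp Kp P₂') (allChans Δq Kq Q₂') ∧
      (∀ b ∈ bases (allChans Δp Kp P₁), b ∈ bases (allChans Δq Kq Q₂') → b = u.base) ∧
      (∀ b ∈ bases (allChans Δp Kp P₂'), b ∈ bases (allChans Δq Kq Q₁) → b = u.base) ∧
      Steps Sg Δ K (P₂ + Q₂) W ∧ AlphaEq Δ K W (P₂' + Q₂') := by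
  obtain ⟨P', hP', pP⟩ := h1
  obtain ⟨Q', hQ', qQ⟩ := h2
  obtain ⟨Y, αQ, hY, sQ, aQ⟩ := l.frame hSg tP tQ a2 hQ'
  obtain ⟨X, αP, hX, sP, aP⟩ := l.symm.frame hSg (tQ.steps hSg hY) tP aQ.symm hP'
  have aP := aP.symm
  have fI := (ifaceBases_finite Δp Kp).union (ifaceBases_finite Δq Kq)
  have fp := fun D : Config L TN PN => bases_finite (allChans_finite Δp Kp D)
  have fq := fun D : Config L TN PN => bases_finite (allChans_finite Δq Kq D)
  set I := bases (ifaceChans Δp Kp) ∪ bases (ifaceChans Δq Kq) with hI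
  obtain ⟨ρ, hB, hA, -⟩ := exists_avoiding
    (A := (bases (allChans Δp Kp P₁) ∪ bases (allChans Δq Kq Q₁) ∪ bases (allChans Δp Kp X) ∪
      bases (allChans Δq Kq Y)) \ I) (B := I)
    (((((fp _).union (fq _)).union (fp _)).union (fq _)).subset Set.sdiff_subset) fI
  have hρ : ∀ b ∈ I, ρ b = b := fun b hb => hB b hb fun h => h.2 hb
  have fixP : Fixes ρ Δp Kp := fun b hb => hρ b (Or.inl hb)
  have fixQ : Fixes ρ Δq Kq := fun b hb => hρ b (Or.inr hb)
  have hu : u.rename ρ = u := Chan.rename_eq_self (fixP _ (mem_bases l.mem))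
  have eP : allChans Δp Kp (cren ρ X) = Chan.rename ρ '' allChans Δp Kp X := by
    rw [← allChans_ren, fixP.ctx, fixP.root]
  have eQ : allChans Δq Kq (cren ρ Y) = Chan.rename ρ '' allChans Δq Kq Y := by
    rw [← allChans_ren, fixQ.ctx, fixQ.root]
  refine ⟨cren ρ X, cren ρ Y, Y + X, hp _ _ pP (αP.trans ⟨ρ, fixP, rfl⟩),
    hq _ _ qQ (αQ.trans ⟨ρ, fixQ, rfl⟩), ?_, ?_, ?_, ?_, ⟨ρ, ?_, ?_⟩⟩
  · rw [eP, eQ]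
    have := aP.ren ρ
    rwa [hu] at this
  · intro b hb hb'
    rw [eQ, bases_ren] at hb'
    obtain ⟨a, ha, rfl⟩ := hb'
    by_cases haI : a ∈ I
    · rw [hρ a haI] at hb ⊢
      rcases haI with h | h
      · exact aP.bases (bases_mono subset_union_left h) ha
      · exact a1.bases hb (bases_mono subset_union_left h)
    · have := hA a ⟨Or.inr ha, haI⟩
      exact absurd ⟨Or.inl (Or.inl (Or.inl hb)), this.2⟩ this.1
  · intro b hb hb'
    rw [eP, bases_ren] at hb
    obtain ⟨a, ha, rfl⟩ := hb
    by_cases haI : a ∈ I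
    · rw [hρ a haI] at hb' ⊢
      rcases haI with h | h
      · exact a1.bases (bases_mono subset_union_left h) hb'
      · exact aP.bases ha (bases_mono subset_union_left h)
    · have := hA a ⟨Or.inl (Or.inr ha), haI⟩
      exact absurd ⟨Or.inl (Or.inl (Or.inr hb')), this.2⟩ this.1
  · exact sQ.trans (by rw [add_comm]; exact sP)
  · exact fun b hb => hρ b (l.bases_iface hb)
  · change _ = cren ρ (Y + X)
    rw [cren_add, add_comm]

/-! ### Observations of composites -/

/-- The observations of composites of `n` pairs; adding a message does not increase the number of
pairs. -/
def CObs (Sg : Signature L TN PN) (n : ℕ) : ConfRel L TN PN :=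
  fun Δ K D₁ D₂ => Obs Sg (CompAny Sg) Δ K D₁ D₂ ∧ ∀ H T y, Δ = H.ctx y T → K = H.root y T →
    y ∈ Thet Δ K D₁ → InN Sg (CompLE Sg n) H T y D₁ D₂

theorem CObs.alpha (hSg : Sg.WF) (h : CObs Sg n Δ K D₁ D₂) (ha : AlphaEq Δ K D₂ D₂') :
    CObs Sg n Δ K D₁ D₂' := by
  refine ⟨h.1.alpha (CompAny.nominal hSg) ha, ?_⟩
  rintro H T y rfl rfl hy
  exact (h.2 H T y rfl rfl hy).alpha (CompLE.nominal hSg n) ha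

theorem Hole.chans_succ_subset (H : Hole L TN) (y : Chan) (T B : Ty L TN) (hM : y.succ ∈ M.chans) :
    allChans (H.ctx y.succ B) (H.root y.succ B) X ⊆
      allChans (H.ctx y T) (H.root y T) (X + {.msg M}) := by
  rw [allChans, Hole.iface, allChans, Hole.iface, confChans_add, confChans_singleton]
  rintro c ((rfl | h) | h)
  exacts [Or.inr (Or.inr hM), Or.inl (Or.inr h), Or.inr (Or.inl h)]

/-- The parts of a configuration with a message along `y` that carries a channel. -/
theorem Hole.chans_send_subset (H₀ : Hole L TN) (Γ : Ctx L TN Chan) (x y : Chan) (T A B : Ty L TN)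
    (S X : Config L TN PN) :
    allChans Γ (some (x, A)) S ⊆ allChans ((H₀.add Γ).ctx y T) ((H₀.add Γ).root y T)
      (S + X + {.msg (.send x y)}) ∧
    allChans (H₀.ctx y.succ B) (H₀.root y.succ B) X ⊆
      allChans ((H₀.add Γ).ctx y T) ((H₀.add Γ).root y T) (S + X + {.msg (.send x y)}) := by
  simp only [allChans, Hole.iface, Hole.chans_add, confChans_add, confChans_singleton]
  constructor
  · rintro c ((h | ⟨A, h⟩) | h)
    · exact Or.inl (Or.inr (Or.inl h))
    · cases h
      exact Or.inr (Or.inr (Or.inl rfl))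
    · exact Or.inr (Or.inl (Or.inl h))
  · rintro c ((rfl | h) | h)
    · exact Or.inr (Or.inr (Or.inr (Or.inr rfl)))
    · exact Or.inl (Or.inr (Or.inr h))
    · exact Or.inr (Or.inl (Or.inr h))

/-- The bound channels of the second configuration can be renamed apart from any finite set. -/
theorem AlphaEq.send_avoid (hR : Nominal Sg R) {S₁ S₂ X₁ X₂ : Config L TN PN}
    (h : AlphaEq ((H₀.add Γ).ctx y T) ((H₀.add Γ).root y T) D₂ (S₂ + X₂ + {.msg (.send x y)}))
    (hS : R Γ (some (x, A)) S₁ S₂) (hX : R (H₀.ctx y.succ B) (H₀.root y.succ B) X₁ X₂) {F : Set ℕ}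
    (hF : F.Finite) : ∃ S₂' X₂',
      AlphaEq ((H₀.add Γ).ctx y T) ((H₀.add Γ).root y T) D₂ (S₂' + X₂' + {.msg (.send x y)}) ∧
      R Γ (some (x, A)) S₁ S₂' ∧ R (H₀.ctx y.succ B) (H₀.root y.succ B) X₁ X₂' ∧
      ∀ b ∈ bases (confChans (S₂' + X₂' + {.msg (.send x y)} : Config L TN PN)), b ∈ F →
        b = x.base ∨ b ∈ bases (ifaceChans ((H₀.add Γ).ctx y T) ((H₀.add Γ).root y T)) := by
  set I := bases (ifaceChans ((H₀.add Γ).ctx y T) ((H₀.add Γ).root y T)) with hI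
  have fI : I.Finite := ifaceBases_finite _ _
  set Z := S₂ + X₂ + {.msg (.send x y)} with hZ
  obtain ⟨ρ, hB, hA, -⟩ := exists_avoiding (A := bases (confChans Z) \ (I ∪ {x.base}))
    (B := F ∪ (I ∪ {x.base})) ((confBases_finite Z).subset Set.sdiff_subset)
    (hF.union (fI.union (finite_singleton _)))
  have hρ : ∀ b ∈ I ∪ {x.base}, ρ b = b := fun b hb => hB b (Or.inr hb) fun h => h.2 hb
  have fI : Fixes ρ ((H₀.add Γ).ctx y T) ((H₀.add Γ).root y T) := fun b hb => hρ b (Or.inl hb)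
  obtain ⟨f0, fΓ⟩ := Hole.fixes_add fI
  have hx : x.rename ρ = x := Chan.rename_eq_self (hρ _ (Or.inr rfl))
  have hy : y.rename ρ = y := Chan.rename_eq_self (fI _ (Hole.base_mem _ _ _))
  have e : cren ρ Z = cren ρ S₂ + cren ρ X₂ + {.msg (.send x y)} := by
    rw [hZ, cren_add, cren_add, cren_msg, Msg.map, hx, hy]
  refine ⟨cren ρ S₂, cren ρ X₂, h.trans ⟨ρ, fI, e.symm⟩, hR.alpha hS ⟨ρ, ?_, rfl⟩,
    hR.alpha hX ⟨ρ, Hole.fixes_succ.2 f0, rfl⟩, ?_⟩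
  · rintro b ⟨c, hc | ⟨A, hc⟩, rfl⟩
    · exact fΓ _ (mem_bases hc)
    · cases hc
      exact hρ _ (Or.inr rfl)
  · rw [← e, confChans_cren, bases_ren]
    rintro _ ⟨a, ha, rfl⟩ hF
    by_cases h : a ∈ I ∪ {x.base}
    · rw [hρ a h]
      exact h.symm
    · exact absurd (Or.inl hF) (hA a ⟨ha, h⟩).2

theorem AlphaEq.apt (h : AlphaEq Δp Kp D₂ D₂') (hu : u ∈ ifaceChans Δp Kp) {S : Set Chan}
    (ha : Apt u (allChans Δp Kp D₂) S)
    (hb : ∀ b ∈ bases (confChans D₂'), b ∈ bases S → b = u.base) : Apt u (allChans Δp Kp D₂') S := by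
  obtain ⟨π, hπ, rfl⟩ := h
  have hπ : Fixes π Δp Kp := hπ
  have e : allChans Δp Kp (cren π D₂) = Chan.rename π '' allChans Δp Kp D₂ := by
    rw [← allChans_ren, hπ.ctx, hπ.root]
  change Apt u (allChans Δp Kp (cren π D₂)) S
  rw [e]
  refine ha.ren_left (hπ _ (mem_bases hu)) (fun b hb' hS => ?_)
  rw [← e, bases_allChans] at hb'
  rcases hb' with h | h
  · exact ha.bases (bases_mono subset_union_left h) hS
  · exact hb b h hS

/-- Bound channels of the second configuration are renamed apart from the other component. -/
theorem OutN.send_avoid (hR : Nominal Sg R) {S₁ S₂ X₁ X₂ : Config L TN PN}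
    (l : Link u T ((H₀.add Γ).ctx y B) ((H₀.add Γ).root y B) Δq Kq Δ K)
    (h : AlphaEq ((H₀.add Γ).ctx y B) ((H₀.add Γ).root y B) P₂ (S₂ + X₂ + {.msg (.send x y)}))
    {B' : Ty L TN} (hS : R Γ (some (x, A)) S₁ S₂)
    (hX : R (H₀.ctx y.succ B') (H₀.root y.succ B') X₁ X₂)
    (a2 : Apt u (allChans ((H₀.add Γ).ctx y B) ((H₀.add Γ).root y B) P₂) (allChans Δq Kq Q₂))
    (hx : x.base ∈ bases (allChans Δq Kq Q₂) → x.base = u.base) : ∃ S₂' X₂',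
      R Γ (some (x, A)) S₁ S₂' ∧ R (H₀.ctx y.succ B') (H₀.root y.succ B') X₁ X₂' ∧
      Apt u (allChans ((H₀.add Γ).ctx y B) ((H₀.add Γ).root y B)
        (S₂' + X₂' + {.msg (.send x y)})) (allChans Δq Kq Q₂) ∧
      AlphaEq ((H₀.add Γ).ctx y B) ((H₀.add Γ).root y B) P₂ (S₂' + X₂' + {.msg (.send x y)}) ∧
      AlphaEq Δ K (P₂ + Q₂) (S₂' + X₂' + {.msg (.send x y)} + Q₂) := by
  obtain ⟨S₂', X₂', hα, hS', hX', hb⟩ := h.send_avoid hR hS hX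
    (bases_finite (allChans_finite Δq Kq Q₂))
  have hb' : ∀ b ∈ bases (confChans (S₂' + X₂' + {.msg (.send x y)} : Config L TN PN)),
      b ∈ bases (allChans Δq Kq Q₂) → b = u.base := by
    intro b h h'
    rcases hb b h h' with rfl | h
    · exact hx h'
    · exact a2.bases (bases_mono subset_union_left h) h'
  exact ⟨S₂', X₂', hS', hX', hα.apt l.mem a2 hb', hα, hα.frame l
    (fun b h => a2.bases (bases_mono subset_union_right h)) hb'⟩

/-- A message along a free channel of one component is observed in the whole. A channel that is
carried by it comes with the other component if the part that provides it is linked to that. -/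
theorem OutN.link (hSg : Sg.WF) (j : Join u T G Δq Kq G') (h : OutN Sg (CompAny Sg) G B y P₁ P₂)
    (hQ : CompAny Sg Δq Kq Q₁ Q₂)
    (a1 : Apt u (allChans (G.ctx y B) (G.root y B) P₁) (allChans Δq Kq Q₁))
    (a2 : Apt u (allChans (G.ctx y B) (G.root y B) P₂) (allChans Δq Kq Q₂))
    (hx : ∀ b ∈ bases (allChans (G.ctx y B) (G.root y B) P₁),
      b ∈ bases (allChans Δq Kq Q₂) → b = u.base) :
    OutN Sg (CompAny Sg) G' B y (P₁ + Q₁) (P₂ + Q₂) := by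
  cases h with
  | close hH => exact absurd hH j.right_ne
  | lab I A hT k X₁ X₂ h1 h2 h =>
    subst h1 h2
    have sub := fun X : Config L TN PN => G.chans_succ_subset y B (A k) (X := X)
      (M := .lab y k.1) (Or.inr rfl)
    refine .lab I A (by rw [j.pos, hT]) k (X₁ + Q₁) (X₂ + Q₂) (add_right_comm _ _ _)
      (add_right_comm _ _ _) ?_
    exact .link hSg (j.link _ _) h hQ (a1.mono (sub _) subset_rfl) (a2.mono (sub _) subset_rfl)
  | send H₀ Γ hH A B' hT x S₁ S₂ X₁ X₂ h1 h2 hS hD =>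
    subst h1 hH
    obtain ⟨S₂', X₂', hS', hD', a2', -, hα⟩ := OutN.send_avoid (CompAny.nominal hSg) (j.link y B)
      h2 hS hD a2 (hx _ (mem_bases (Or.inr (mem_confChans
        (mem_add.2 (Or.inr (mem_singleton_self _))) (Or.inl rfl)))))
    have sub := H₀.chans_send_subset (PN := PN) Γ x y B A B'
    rcases j.split with ⟨G₁, rfl, j'⟩ | ⟨Γ', rfl, l'⟩
    · refine .send G₁ Γ rfl A B' (by rw [j.pos, hT]) x S₁ S₂' (X₁ + Q₁) (X₂' + Q₂) ?_ ?_ hS'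
        (.link hSg (j'.link _ _) hD' hQ (a1.mono (sub _ _).2 subset_rfl)
          (a2'.mono (sub _ _).2 subset_rfl))
      · abel
      · convert hα using 1; abel
    · refine .send H₀ Γ' rfl A B' (by rw [j.pos, hT]) x (S₁ + Q₁) (S₂' + Q₂) X₁ X₂' ?_ ?_
        (.link hSg (l' _) hS' hQ (a1.mono (sub _ _).1 subset_rfl)
          (a2'.mono (sub _ _).1 subset_rfl)) hD'
      · abel
      · convert hα using 1; abel

/-- A pending message from `y` to its next generation is unique. -/
theorem Tree.not_links (hSg : Sg.WF) {Y : Config L TN PN} (t : Tree Sg Δ K Y) {N : Msg L}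
    (h : X + {.msg M} ≤ Y) (hM : M.Links y) (hN : N.Links y) : .msg N ∉ X := by
  intro hX
  have e := t.ev_unique hSg (mem_of_le h (mem_add.2 (Or.inl hX)))
    (mem_of_le h (mem_add.2 (Or.inr (mem_singleton_self _))))
    hN.ev hM.ev
  have nd := nodup_of_le h (t.nodup hSg)
  rw [add_comm, singleton_add, nodup_cons] at nd
  exact nd.1 (e ▸ hX)

theorem Tree.notMem_of_links (hSg : Sg.WF) {Y : Config L TN PN} (tX : Tree Sg Δp Kp X)
    (t : Tree Sg Δ K Y) (h : X + {.msg M} ≤ Y) (hM : M.Links y) (hy : y.succ ∈ allChans Δp Kp X) :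
    y ∉ allChans Δp Kp X := by
  intro hy'
  obtain ⟨N, hN, hl⟩ := tX.2 y hy' y.succ hy rfl (Nat.lt_succ_self _)
  exact t.not_links hSg h hM hl hN

/-- If `y` is a channel of one component that waits for a message along `y`, then the next
generation of `y` is new to the other component. -/
theorem Link.succ_notMem (hSg : Sg.WF) (l : Link u T Δp Kp Δq Kq Δ K) (tP : Tree Sg Δp Kp P)
    (tQ : Tree Sg Δq Kq Q) (ha : Apt u (allChans Δp Kp P) (allChans Δq Kq Q))
    (hy : y ∈ allChans Δp Kp P) (hu : y ≠ u) (hM : M.Links y) {Δ' : Ctx L TN Chan}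
    {K' : Root L TN} (t : Tree Sg Δ' K' (P + {.msg M})) : y.succ ∉ allChans Δq Kq Q := by
  intro hs
  by_cases e : y.succ = u
  · exact tP.notMem_of_links hSg t le_rfl hM (e ▸ Or.inl l.mem) hy
  · have hs' := l.symm.chans_left Q P hs e
    rw [add_comm] at hs'
    obtain ⟨N, hN, hl⟩ := (l.tree hSg tP tQ ha).2 y (l.chans_left P Q hy hu) _ hs' rfl
      (Nat.lt_succ_self _)
    rcases mem_add.1 hN with h | h
    · exact t.not_links hSg le_rfl hM hl h
    · exact hu ((ha y hy y (Or.inr (mem_confChans h (hl.carrier ▸ N.carrier_mem)))).2 rfl)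

theorem Apt.extend {A A' S : Set Chan} (ha : Apt u A S) (hy : y ∈ A) (hs : y.succ ∉ S)
    (h : ∀ c ∈ A', c ∈ A ∨ c = y.succ ∨ c.base ∉ ILST.bases S) : Apt u A' S := by
  intro c hc c' hc'
  rcases h c hc with h | rfl | h
  · exact ha c h c' hc'
  · exact ⟨fun e => (ha y hy c' hc').1 e, fun e => absurd (e ▸ hc') hs⟩
  · exact ⟨fun e => absurd (e ▸ mem_bases hc') h, fun e => absurd (e ▸ mem_bases hc') h⟩

/-- A component that waits for a message along a free channel does so in the whole. -/
theorem InN.link (hSg : Sg.WF) (j : Join u T G Δq Kq G') (h : InN Sg (CompLE Sg n₁) G B y P₁ P₂)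
    (hQ : CompLE Sg n₂ Δq Kq Q₁ Q₂)
    (tP : Tree Sg (G.ctx y B) (G.root y B) P₁ ∧ Tree Sg (G.ctx y B) (G.root y B) P₂)
    (a1 : Apt u (allChans (G.ctx y B) (G.root y B) P₁) (allChans Δq Kq Q₁))
    (a2 : Apt u (allChans (G.ctx y B) (G.root y B) P₂) (allChans Δq Kq Q₂))
    (hu : u ∉ ifaceChans (G'.ctx y B) (G'.root y B)) :
    InN Sg (CompLE Sg (n₁ + n₂)) G' B y (P₁ + Q₁) (P₂ + Q₂) := by
  have l := j.link y B
  have tQ := (CompLE.nominal hSg n₂).tree hQ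
  have hyu : y ≠ u := fun e => hu (e ▸ G'.mem_iface y B)
  have hG : u ∉ G'.chans := fun h => hu (by rw [Hole.iface]; exact Or.inr h)
  have hyP : ∀ P : Config L TN PN, y ∈ allChans (G.ctx y B) (G.root y B) P :=
    fun P => Or.inl (G.mem_iface y B)
  have huQ : ∀ Q : Config L TN PN, u ∈ allChans Δq Kq Q := fun Q => Or.inl l.symm.mem
  have hG' : G.chans ⊆ ifaceChans (G.ctx y B) (G.root y B) := by
    rw [Hole.iface]; exact subset_union_right
  cases h with
  | close Δy Ky hH hT h =>
    subst hH
    obtain ⟨Δ, K, rfl, l'⟩ := j.close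
    have sub : ∀ P : Config L TN PN, allChans Δy Ky (P + {.msg (.close y)}) ⊆
        allChans ((Hole.left Δy Ky).ctx y B) ((Hole.left Δy Ky).root y B) P := by
      intro P
      rw [allChans_add, confChans_singleton]
      rintro c ((h | h) | rfl)
      exacts [Or.inl (hG' h), Or.inr h, hyP P]
    refine .close Δ K rfl hT ?_
    rw [add_right_comm, add_right_comm P₂]
    exact .link l' h hQ (a1.mono (sub _) subset_rfl) (a2.mono (sub _) subset_rfl) hG
  | lab I A hT h =>
    refine .lab I A (by rw [j.pos, hT]) fun k => ?_
    have t := (CompLE.nominal hSg n₁).tree (h k)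
    have s1 := l.succ_notMem hSg tP.1 tQ.1 a1 (hyP _) hyu (.lab k.1) t.1
    have s2 := l.succ_notMem hSg tP.2 tQ.2 a2 (hyP _) hyu (.lab k.1) t.2
    have sub : ∀ P : Config L TN PN, ∀ S, ∀ c ∈ allChans (G.ctx y.succ (A k))
        (G.root y.succ (A k)) (P + {.msg (.lab y k.1)}),
        c ∈ allChans (G.ctx y B) (G.root y B) P ∨ c = y.succ ∨ c.base ∉ bases S := by
      intro P S
      rw [allChans_add, confChans_singleton, allChans, Hole.iface]
      rintro c (((h | h) | h) | h | h)
      exacts [Or.inr (Or.inl h), Or.inl (Or.inl (hG' h)), Or.inl (Or.inr h), Or.inl (h ▸ hyP P),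
        Or.inr (Or.inl h)]
    rw [add_right_comm, add_right_comm P₂]
    refine .link (j.link _ _) (h k) hQ (a1.extend (hyP _) s1 (sub _ _))
      (a2.extend (hyP _) s2 (sub _ _)) ?_
    rw [Hole.iface]
    rintro (h | h)
    exacts [s1 (h ▸ huQ _), hG h]
  | send A B' hT M hM h =>
    have fin := fun Q : Config L TN PN => bases_finite (allChans_finite Δq Kq Q)
    refine .send A B' (by rw [j.pos, hT]) (M ∪ (bases (allChans Δq Kq Q₁) ∪
      bases (allChans Δq Kq Q₂))) (hM.union ((fin _).union (fin _))) fun x hx => ?_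
    simp only [mem_union, not_or] at hx
    obtain ⟨hxM, hx1, hx2⟩ := hx
    have t := (CompLE.nominal hSg n₁).tree (h x hxM)
    have s1 := l.succ_notMem hSg tP.1 tQ.1 a1 (hyP _) hyu (.send x) t.1
    have s2 := l.succ_notMem hSg tP.2 tQ.2 a2 (hyP _) hyu (.send x) t.2
    have sub : ∀ P : Config L TN PN, ∀ S, x.base ∉ bases S → ∀ c ∈ allChans
        ((G.add {(x, A)}).ctx y.succ B') ((G.add {(x, A)}).root y.succ B')
        (P + {.msg (.send x y)}),
        c ∈ allChans (G.ctx y B) (G.root y B) P ∨ c = y.succ ∨ c.base ∉ bases S := by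
      intro P S hS
      rw [allChans_add, confChans_singleton, allChans, Hole.iface, Hole.chans_add, dom_singleton]
      rintro c (((h | h | h) | h) | h | h | h)
      exacts [Or.inr (Or.inl h), Or.inr (Or.inr (h ▸ hS)), Or.inl (Or.inl (hG' h)),
        Or.inl (Or.inr h), Or.inr (Or.inr (h ▸ hS)), Or.inl (h ▸ hyP P), Or.inr (Or.inl h)]
    rw [add_right_comm, add_right_comm P₂]
    refine .link ((j.add _).link _ _) (h x hxM) hQ (a1.extend (hyP _) s1 (sub _ _ hx1))
      (a2.extend (hyP _) s2 (sub _ _ hx2)) ?_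
    rw [Hole.iface, Hole.chans_add, dom_singleton]
    rintro (h | h | h)
    exacts [s1 (h ▸ huQ _), hx1 (h ▸ mem_bases (huQ _)), hG h]

/-- The observations of one component are observations of the whole. -/
theorem CObs.half (hSg : Sg.WF) (l : Link u T Δp Kp Δq Kq Δ K) (hP : CompLE Sg n₁ Δp Kp P₁ P₂)
    (oP : CObs Sg n₁ Δp Kp P₁ P₂) (hQ : CompLE Sg n₂ Δq Kq Q₁ Q₂)
    (a1 : Apt u (allChans Δp Kp P₁) (allChans Δq Kq Q₁))
    (a2 : Apt u (allChans Δp Kp P₂) (allChans Δq Kq Q₂))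
    (hx : ∀ b ∈ bases (allChans Δp Kp P₁), b ∈ bases (allChans Δq Kq Q₂) → b = u.base)
    (hu : u ∉ ifaceChans Δ K) (hΔ : Δ = H.ctx y B) (hK : K = H.root y B) :
    (∀ M : Msg L, .msg M ∈ P₁ → M.carrier = y → (∃ M' : Msg L, .msg M' ∈ P₂ ∧ M'.carrier = y) ∧
      OutN Sg (CompAny Sg) H B y (P₁ + Q₁) (P₂ + Q₂)) ∧
    ∀ x R, .proc x R ∈ P₁ → R.WaitsOn y →
      InN Sg (CompLE Sg (n₁ + n₂)) H B y (P₁ + Q₁) (P₂ + Q₂) := by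
  have tP := (CompLE.nominal hSg n₁).tree hP
  have tQ := (CompLE.nominal hSg n₂).tree hQ
  have hy : y ∈ ifaceChans Δ K := by subst hΔ hK; exact H.mem_iface y B
  have hyu : y ≠ u := fun e => hu (e ▸ hy)
  have key : ∀ n ∈ P₁, y ∈ n.chans → y ∈ ifaceChans Δp Kp ∧ ∃ G, Δp = G.ctx y B ∧
      Kp = G.root y B ∧ Join u T G Δq Kq H := by
    intro n hn hyn
    have hp : y ∈ ifaceChans Δp Kp := by
      refine (l.iface_subset hy).resolve_right fun h => hyu ?_
      exact (a1 y (Or.inr (mem_confChans hn hyn)) y (Or.inl h)).2 rfl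
    obtain ⟨G, G', A, e1, e2, e3, e4, j⟩ := l.join hp hyu
    have t := l.tree hSg tP.1 tQ.1 a1
    have hD : P₁ + Q₁ ≠ 0 := by
      intro e
      have : n ∈ P₁ + Q₁ := mem_add.2 (Or.inl hn)
      rw [e] at this
      exact Multiset.notMem_zero _ this
    rw [hΔ, hK] at t
    obtain ⟨rfl, rfl⟩ := Hole.unique hSg t hD (hΔ.symm.trans e3) (hK.symm.trans e4)
    exact ⟨hp, G, e1, e2, j⟩
  constructor
  · rintro M hM rfl
    obtain ⟨hp, G, rfl, rfl, j⟩ := key _ hM M.carrier_mem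
    have hU : M.carrier ∈ Ups (G.ctx M.carrier B) (G.root M.carrier B) P₁ := ⟨hp, M, hM, rfl⟩
    exact ⟨(oP.1.ups hU).2, .link hSg j (oP.1.out _ _ _ rfl rfl hU) hQ.any a1 a2 hx⟩
  · intro x R hR hw
    obtain ⟨hp, G, rfl, rfl, j⟩ := key _ hR (Or.inr hw.mem_names)
    exact .link hSg j (oP.2 _ _ _ rfl rfl ⟨hp, x, R, hR, hw⟩) hQ tP a1 a2 (by rwa [← hΔ, ← hK])

theorem CObs.link (hSg : Sg.WF) (l : Link u T Δp Kp Δq Kq Δ K)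
    (hP : CompLE Sg n₁ Δp Kp P₁ P₂) (oP : CObs Sg n₁ Δp Kp P₁ P₂)
    (hQ : CompLE Sg n₂ Δq Kq Q₁ Q₂) (oQ : CObs Sg n₂ Δq Kq Q₁ Q₂)
    (a1 : Apt u (allChans Δp Kp P₁) (allChans Δq Kq Q₁))
    (a2 : Apt u (allChans Δp Kp P₂) (allChans Δq Kq Q₂))
    (hx : ∀ b ∈ bases (allChans Δp Kp P₁), b ∈ bases (allChans Δq Kq Q₂) → b = u.base)
    (hx' : ∀ b ∈ bases (allChans Δp Kp P₂), b ∈ bases (allChans Δq Kq Q₁) → b = u.base)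
    (hu : u ∉ ifaceChans Δ K) : CObs Sg (n₁ + n₂) Δ K (P₁ + Q₁) (P₂ + Q₂) := by
  have hl := fun {y B} {H : Hole L TN} (hΔ : Δ = H.ctx y B) (hK : K = H.root y B) =>
    CObs.half hSg l hP oP hQ a1 a2 hx hu hΔ hK
  have hr := fun {y B} {H : Hole L TN} (hΔ : Δ = H.ctx y B) (hK : K = H.root y B) =>
    CObs.half hSg l.symm hQ oQ hP a1.symm a2.symm (fun b h h' => hx' b h' h) hu hΔ hK
  rw [add_comm Q₁, add_comm Q₂, add_comm n₂] at hr
  have inn : ∀ H B y, Δ = H.ctx y B → K = H.root y B → y ∈ Thet Δ K (P₁ + Q₁) →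
      InN Sg (CompLE Sg (n₁ + n₂)) H B y (P₁ + Q₁) (P₂ + Q₂) := by
    rintro H B y hΔ hK ⟨-, x, R, hR, hw⟩
    exact (mem_add.1 hR).elim (fun h => (hl hΔ hK).2 x R h hw)
      (fun h => (hr hΔ hK).2 x R h hw)
  refine ⟨⟨?_, ?_, fun H B y hΔ hK hy => (inn H B y hΔ hK hy).mono fun _ _ _ _ => CompLE.any⟩,
    inn⟩
  · rintro y ⟨hy, M, hM, e⟩
    obtain ⟨H, B, hΔ, hK⟩ := exists_hole hy
    refine ⟨hy, ?_⟩
    rcases mem_add.1 hM with h | h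
    · obtain ⟨M', hM', e'⟩ := ((hl hΔ hK).1 M h e).1
      exact ⟨M', mem_add.2 (Or.inl hM'), e'⟩
    · obtain ⟨M', hM', e'⟩ := ((hr hΔ hK).1 M h e).1
      exact ⟨M', mem_add.2 (Or.inr hM'), e'⟩
  · rintro H B y hΔ hK ⟨-, M, hM, e⟩
    exact (mem_add.1 hM).elim (fun h => ((hl hΔ hK).1 M h e).2)
      (fun h => ((hr hΔ hK).1 M h e).2)

/-- The second configuration of a composite reduces to one with the observations of the first. -/
theorem Comp.exists_obs (hSg : Sg.WF) (h : Comp Sg n Δ K D₁ D₂) :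
    ∃ D, Steps Sg Δ K D₂ D ∧ CompLE Sg n Δ K D₁ D ∧ CObs Sg n Δ K D₁ D := by
  induction h with
  | base h =>
    obtain ⟨D, hD, o⟩ := h.steps hSg .refl
    have le : ∀ Δ K D₁ D₂, EAll Sg Δ K D₁ D₂ → CompLE Sg 1 Δ K D₁ D₂ :=
      fun _ _ _ _ h => ⟨1, le_rfl, .base h⟩
    refine ⟨D, hD, le _ _ _ _ fun m => E_fwd hSg m (h m) hD,
      o.mono fun _ _ _ _ h => (le _ _ _ _ h).any, ?_⟩
    exact fun H T y hΔ hK hy => (o.inn H T y hΔ hK hy).mono le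
  | @cut n₁ n₂ u T Δp Kp Δq Kq Δ K P₁ P₂ Q₁ Q₂ D₂ l hP hQ a1 a2 hu hα ihP ihQ =>
    obtain ⟨P, Q, W, ⟨hP', oP⟩, ⟨hQ', oQ⟩, a, hx, hx', hs, hW⟩ := l.normalize hSg
      ((Comp.nominal hSg _).tree hP).2 ((Comp.nominal hSg _).tree hQ).2 a1 a2
      (p := fun D => CompLE Sg n₁ Δp Kp P₁ D ∧ CObs Sg n₁ Δp Kp P₁ D)
      (q := fun D => CompLE Sg n₂ Δq Kq Q₁ D ∧ CObs Sg n₂ Δq Kq Q₁ D)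
      (fun D D' h ha => ⟨(CompLE.nominal hSg _).alpha h.1 ha, h.2.alpha hSg ha⟩)
      (fun D D' h ha => ⟨(CompLE.nominal hSg _).alpha h.1 ha, h.2.alpha hSg ha⟩) ihP ihQ
    obtain ⟨W', hs', hW'⟩ := hα.steps hs
    have hα' := hW.symm.trans hW'
    exact ⟨W', hs', (CompLE.nominal hSg _).alpha (.link l hP' hQ' a1 a hu) hα',
      (CObs.link hSg l hP' oP hQ' oQ a1 a hx hx' hu).alpha hSg hα'⟩

/-! ### Simulation of steps of composites -/

/-- Single steps of composites of at most `n` pairs are simulated. -/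
def StepSim (Sg : Signature L TN PN) (n : ℕ) : Prop :=
  ∀ ⦃Δ : Ctx L TN Chan⦄ ⦃K : Root L TN⦄ ⦃D₁ D₁' D₂ : Config L TN PN⦄, CompLE Sg n Δ K D₁ D₂ →
    Step Sg (bases (ifaceChans Δ K)) D₁ D₁' → Sim Sg Δ K D₁' D₂

/-- A step inside of one component. -/
theorem Link.sim_right (hSg : Sg.WF) (l : Link u T Δp Kp Δq Kq Δ K)
    (hP : CompLE Sg n₁ Δp Kp P₁ P₂) (hQ : CompLE Sg n₂ Δq Kq Q₁ Q₂)
    (a1 : Apt u (allChans Δp Kp P₁) (allChans Δq Kq Q₁))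
    (a2 : Apt u (allChans Δp Kp P₂) (allChans Δq Kq Q₂)) (hu : u ∉ ifaceChans Δ K)
    (ih : StepSim Sg n₂)
    (h : Step Sg (bases (ifaceChans Δ K) ∪ bases (confChans P₁)) Q₁ Q₁') :
    Sim Sg Δ K (P₁ + Q₁') (P₂ + Q₂) := by
  have tP := (CompLE.nominal hSg n₁).tree hP
  have tQ := (CompLE.nominal hSg n₂).tree hQ
  have hN := ((ifaceBases_finite Δ K).union (confBases_finite P₁)).union (confBases_finite Q₁)
  have sub : bases (allChans Δp Kp P₁ ∪ allChans Δq Kq Q₁) ⊆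
      bases (ifaceChans Δ K) ∪ bases (confChans P₁) ∪ bases (confChans Q₁) := by
    rw [l.chans, union_assoc, ← bases_conf_add, ← bases_allChans]
    refine bases_mono (Set.union_subset ?_ subset_rfl)
    rintro _ rfl
    exact Or.inr (l.mem_conf hSg tP.1 tQ.1 hu)
  have hq := (bases_mono (subset_union_left.trans subset_union_right)).trans sub
  exact l.sim hSg hP.any tQ.1 tQ.2 a1 a2 hN ((bases_mono subset_union_left).trans sub) hq
    h.widen (ih hQ (h.widen.anti hN hq))

/-- A step in which one component receives a message from the other one. The message is handed over
before the step, so that the step takes place inside of the receiving component; this leaves the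
receiving component with the same number of pairs. The components are then linked along the next
generation of `u`, and along the channel that the message carries. -/
theorem Dual.sim_msg (hSg : Sg.WF) (d : Dual H H' Δ K) (e : P₁ = X + {.msg M})
    (hM : M.carrier = u) (oP : OutN Sg (CompAny Sg) H T u P₁ P₂)
    (oQ : InN Sg (CompLE Sg n₂) H' T u Q₁ Q₂)
    (tP : Tree Sg (H.ctx u T) (H.root u T) P₁ ∧ Tree Sg (H.ctx u T) (H.root u T) P₂)
    (a1 : Apt u (allChans (H.ctx u T) (H.root u T) P₁) (allChans (H'.ctx u T) (H'.root u T) Q₁))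
    (a2 : Apt u (allChans (H.ctx u T) (H.root u T) P₂) (allChans (H'.ctx u T) (H'.root u T) Q₂))
    (hx : ∀ b ∈ bases (allChans (H.ctx u T) (H.root u T) P₁),
      b ∈ bases (allChans (H'.ctx u T) (H'.root u T) Q₂) → b = u.base) (ih : StepSim Sg n₂)
    (h : Step Sg (bases (ifaceChans Δ K) ∪ bases (confChans X)) ({.msg M} + Q₁) D) :
    Sim Sg Δ K (X + D) (P₂ + Q₂) := by
  have hpos : H.pos = !H'.pos := d.pos
  have hQu : ∀ Q : Config L TN PN, u ∈ allChans (H'.ctx u T) (H'.root u T) Q :=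
    fun Q => Or.inl (H'.mem_iface u T)
  have hN := ((ifaceBases_finite Δ K).union (confBases_finite X)).union
    (confBases_finite ({.msg M} + Q₁))
  have hH' : bases H'.chans ⊆ bases (ifaceChans Δ K) := by
    rw [d.chans, bases_union]; exact subset_union_right
  have hH : bases H.chans ⊆ bases (ifaceChans Δ K) := by
    rw [d.chans, bases_union]; exact subset_union_left
  have hMN : bases M.chans ⊆ bases (confChans ({.msg M} + Q₁ : Config L TN PN)) := by
    rw [bases_conf_add, confChans_singleton]; exact subset_union_left
  have huN : u.base ∈ bases (confChans ({.msg M} + Q₁ : Config L TN PN)) :=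
    hMN (hM ▸ mem_bases M.carrier_mem)
  -- The message is determined by the observation along `u`.
  have same : ∀ {X' : Config L TN PN} {M' : Msg L}, P₁ = X' + {.msg M'} → M'.carrier = u →
      M' = M ∧ X' = X := by
    intro X' M' e' hM'
    have m : ∀ {X : Config L TN PN} {M : Msg L}, P₁ = X + {.msg M} → .msg M ∈ P₁ :=
      fun e => e ▸ mem_add.2 (Or.inr (mem_singleton_self _))
    have := tP.1.ev_unique hSg (m e') (m e) (hM' ▸ Ev.msg M') (hM ▸ Ev.msg M)
    cases this
    exact ⟨rfl, add_right_cancel (e'.symm.trans e)⟩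
  cases oP with
  | close hH hT h1 h2 =>
    subst hH h2
    obtain ⟨rfl, rfl⟩ := same (h1.trans (zero_add _).symm) rfl
    cases d with
    | right _ Δ K =>
      have hQ := oQ.close_inv hT rfl
      rw [zero_add] at hN h ⊢
      rw [add_comm] at h
      rw [add_comm _ Q₂, zero_add]
      exact ih hQ (h.anti ((ifaceBases_finite Δ K).union (confBases_finite _))
        subset_union_left)
  | lab I A hT k X₁ X₂ h1 h2 hX =>
    subst h1 h2
    obtain ⟨rfl, rfl⟩ := same rfl rfl
    have hQ := oQ.lab_inv (hpos ▸ hT) k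
    have tX := (CompAny.nominal hSg).tree hX
    have tQ := (CompLE.nominal hSg n₂).tree hQ
    have apt : ∀ {X Q : Config L TN PN}, Tree Sg (H.ctx u T) (H.root u T) (X + {.msg (.lab u k.1)}) →
        Tree Sg (H.ctx u.succ (A k)) (H.root u.succ (A k)) X →
        Apt u (allChans (H.ctx u T) (H.root u T) (X + {.msg (.lab u k.1)}))
          (allChans (H'.ctx u T) (H'.root u T) Q) →
        Apt u.succ (allChans (H.ctx u.succ (A k)) (H.root u.succ (A k)) X)
          (allChans (H'.ctx u.succ (A k)) (H'.root u.succ (A k)) (Q + {.msg (.lab u k.1)})) := by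
      intro X Q t tX a c hc c' hc'
      have hcu : c ≠ u := fun e => tX.notMem_of_links hSg t le_rfl (.lab k.1)
        (Or.inl (H.mem_iface _ _)) (e ▸ hc)
      have hcP := H.chans_succ_subset u T (A k) (M := .lab u k.1) (Or.inr rfl) hc
      rw [allChans_add, confChans_singleton, allChans, Hole.iface] at hc'
      have hc' : c' ∈ allChans (H'.ctx u T) (H'.root u T) Q ∨ c' = u.succ := by
        rcases hc' with ((h | h) | h) | h | h
        exacts [Or.inr h, Or.inl (Or.inl (by rw [Hole.iface]; exact Or.inr h)), Or.inl (Or.inr h),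
          Or.inl (h ▸ hQu Q), Or.inr h]
      rcases hc' with h | rfl
      · exact ⟨(a c hcP c' h).1, fun e => absurd ((a c hcP c' h).2 e) hcu⟩
      · exact ⟨id, id⟩
    have hq : bases (ifaceChans (H'.ctx u.succ (A k)) (H'.root u.succ (A k))) ⊆
        bases (ifaceChans Δ K) ∪ bases (confChans X₁) ∪
          bases (confChans ({.msg (.lab u k.1)} + Q₁ : Config L TN PN)) := by
      rw [Hole.iface, bases_union]
      rintro b (⟨_, rfl, rfl⟩ | hb)
      exacts [Or.inr huN, Or.inl (Or.inl (hH' hb))]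
    have hp : bases (allChans (H.ctx u.succ (A k)) (H.root u.succ (A k)) X₁) ⊆
        bases (ifaceChans Δ K) ∪ bases (confChans X₁) ∪
          bases (confChans ({.msg (.lab u k.1)} + Q₁ : Config L TN PN)) := by
      rw [bases_allChans, Hole.iface, bases_union]
      rintro b ((⟨_, rfl, rfl⟩ | hb) | hb)
      exacts [Or.inr huN, Or.inl (Or.inl (hH hb)), Or.inl (Or.inr hb)]
    have h' := h.widen
    rw [add_comm _ Q₁] at h' hN hp hq
    rw [add_assoc, add_comm _ Q₂]
    exact (d.link u.succ (A k)).sim hSg hX tQ.1 tQ.2 (apt tP.1 tX.1 a1) (apt tP.2 tX.2 a2) hN hp hq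
      h' (ih hQ (h'.anti hN hq))
  | send H₀ Γ hH₀ A B hT x S₁ S₂ X₁ X₂ h1 h2 hS hX =>
    subst h1 hH₀
    obtain ⟨rfl, rfl⟩ := same rfl rfl
    obtain ⟨S₂, X₂, hS, hX, a2, hα, hα'⟩ := OutN.send_avoid (CompAny.nominal hSg)
      (d.link u T) h2 hS hX a2 (hx _ (mem_bases (Or.inr (mem_confChans
        (mem_add.2 (Or.inr (mem_singleton_self _))) (Or.inl rfl)))))
    refine Sim.alpha hSg ?_ hα'.symm
    have tP₂ := hα.tree hSg tP.2
    have tS := (CompAny.nominal hSg).tree hS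
    have tX := (CompAny.nominal hSg).tree hX
    have dj1 := tP.1.send_disjoint hSg tS.1 tX.1
    have dj2 := tP₂.send_disjoint hSg tS.2 tX.2
    have hxS : ∀ S : Config L TN PN, x ∈ allChans Γ (some (x, A)) S :=
      fun S => Or.inl (Or.inr ⟨A, rfl⟩)
    have huX : ∀ X : Config L TN PN, u.succ ∈ allChans (H₀.ctx u.succ B) (H₀.root u.succ B) X :=
      fun X => Or.inl (H₀.mem_iface _ _)
    have sub := fun S X : Config L TN PN => H₀.chans_send_subset Γ x u T A B S X
    have hxu : x.base ≠ u.base := by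
      have := mem_bases (huX X₁)
      exact fun e => disjoint_left.1 dj1 (mem_bases (hxS _)) (e ▸ this)
    -- The carried channel is new to the receiving component.
    have hxQ₁ : x.base ∉ bases (allChans (H'.ctx u T) (H'.root u T) Q₁) := fun h =>
      hxu (a1.bases (mem_bases ((sub _ _).1 (hxS _))) h)
    have hxQ₂ : x.base ∉ bases (allChans (H'.ctx u T) (H'.root u T) Q₂) := fun h =>
      hxu (a2.bases (mem_bases ((sub _ _).1 (hxS _))) h)
    obtain ⟨M, hM, hQ⟩ := oQ.send_inv (hpos ▸ hT)
    have hQ := (CompLE.nominal hSg n₂).recv hM hQ hxQ₁ hxQ₂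
    have tQ := (CompLE.nominal hSg n₂).tree hQ
    obtain ⟨Δ₀, rfl, d'⟩ := d.send
    have d' := d' (x, A)
    have recv : ∀ {Q : Config L TN PN} {c : Chan}, c ∈ allChans ((H'.add {(x, A)}).ctx u.succ B)
        ((H'.add {(x, A)}).root u.succ B) (Q + {.msg (.send x u)}) →
        c ∈ allChans (H'.ctx u T) (H'.root u T) Q ∨ c = u.succ ∨ c = x := by
      intro Q c hc
      rw [allChans_add, confChans_singleton, allChans, Hole.iface, Hole.chans_add,
        dom_singleton] at hc
      rcases hc with ((h | h | h) | h) | h | h | h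
      exacts [Or.inr (Or.inl h), Or.inr (Or.inr h),
        Or.inl (Or.inl (by rw [Hole.iface]; exact Or.inr h)), Or.inl (Or.inr h),
        Or.inr (Or.inr h), Or.inl (h ▸ hQu Q), Or.inr (Or.inl h)]
    have apt : ∀ {S X Q : Config L TN PN},
        Tree Sg ((H₀.add Γ).ctx u T) ((H₀.add Γ).root u T) (S + X + {.msg (.send x u)}) →
        Tree Sg Γ (some (x, A)) S → Tree Sg (H₀.ctx u.succ B) (H₀.root u.succ B) X →
        Apt u (allChans ((H₀.add Γ).ctx u T) ((H₀.add Γ).root u T) (S + X + {.msg (.send x u)}))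
          (allChans (H'.ctx u T) (H'.root u T) Q) →
        Tree Sg ((H'.add {(x, A)}).ctx u.succ B) ((H'.add {(x, A)}).root u.succ B)
          (Q + {.msg (.send x u)}) →
        Apt u.succ (allChans (H₀.ctx u.succ B) (H₀.root u.succ B) X)
          (allChans ((H'.add {(x, A)}).ctx u.succ B) ((H'.add {(x, A)}).root u.succ B)
            (Q + {.msg (.send x u)})) ∧
        Tree Sg ((x, A) ::ₘ Δ₀) K (X + (Q + {.msg (.send x u)})) ∧
        Apt x (allChans Γ (some (x, A)) S)
          (allChans ((x, A) ::ₘ Δ₀) K (X + (Q + {.msg (.send x u)}))) := by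
      intro S X Q t tS tX a tQ
      have dj := t.send_disjoint hSg tS tX
      have ne : ∀ {c c' : Chan}, c ∈ allChans Γ (some (x, A)) S →
          c' ∈ allChans (H₀.ctx u.succ B) (H₀.root u.succ B) X → c.base ≠ c'.base :=
        fun h h' e => disjoint_left.1 dj (mem_bases h) (e ▸ mem_bases h')
      have aX : Apt u.succ (allChans (H₀.ctx u.succ B) (H₀.root u.succ B) X)
          (allChans ((H'.add {(x, A)}).ctx u.succ B) ((H'.add {(x, A)}).root u.succ B)
            (Q + {.msg (.send x u)})) := by
        intro c hc c' hc'
        have hcu : c ≠ u := fun e => tX.notMem_of_links hSg t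
          (by rw [add_assoc]; exact Multiset.le_add_left _ _) (.send x) (huX _) (e ▸ hc)
        have hcP := (sub S X).2 hc
        rcases recv hc' with h | rfl | rfl
        · exact ⟨(a c hcP c' h).1, fun e => absurd ((a c hcP c' h).2 e) hcu⟩
        · exact ⟨id, id⟩
        · exact ⟨fun e => absurd e.symm (ne (hxS S) hc),
            fun e => absurd (congrArg Chan.base e).symm (ne (hxS S) hc)⟩
      refine ⟨aX, (d'.link u.succ B).tree hSg tX tQ aX, fun c hc c' hc' => ?_⟩
      have hc' : c' ∈ allChans (H₀.ctx u.succ B) (H₀.root u.succ B) X ∪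
          allChans ((H'.add {(x, A)}).ctx u.succ B) ((H'.add {(x, A)}).root u.succ B)
            (Q + {.msg (.send x u)}) := by
        rw [(d'.link u.succ B).chans]; exact Or.inr hc'
      by_cases e' : c' = x
      · subst e'; exact ⟨id, id⟩
      have e : c.base ≠ c'.base := by
        intro e
        rcases hc' with h | h
        · exact ne hc h e
        · rcases recv h with h | rfl | rfl
          · exact ne hc (huX X) ((a c ((sub S X).1 hc) c' h).1 e)
          · exact ne hc (huX X) e
          · exact e' rfl
      exact ⟨fun h => absurd h e, fun h => absurd (congrArg Chan.base h) e⟩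
    obtain ⟨aX₁, tY₁, aS₁⟩ := apt tP.1 tS.1 tX.1 a1 tQ.1
    obtain ⟨aX₂, tY₂, aS₂⟩ := apt tP₂ tS.2 tX.2 a2 tQ.2
    set N := bases (ifaceChans (Γ + Δ₀) K) ∪ bases (confChans (S₁ + X₁)) ∪
      bases (confChans ({.msg (.send x u)} + Q₁ : Config L TN PN)) with hNdef
    have hxN : x.base ∈ N := Or.inr (hMN ⟨x, Or.inl rfl, rfl⟩)
    have huN : u.base ∈ N := Or.inr huN
    have hΓ : bases (dom Γ) ∪ bases H₀.chans ⊆ N := by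
      rw [Hole.chans_add, bases_union] at hH
      exact fun b hb => Or.inl (Or.inl (hH hb))
    have hq : bases (ifaceChans ((H'.add {(x, A)}).ctx u.succ B)
        ((H'.add {(x, A)}).root u.succ B)) ⊆ N := by
      rw [Hole.bases_add_send H' x u T, Hole.iface, bases_union]
      rintro b ((⟨_, rfl, rfl⟩ | hb) | rfl)
      exacts [huN, Or.inl (Or.inl (hH' hb)), hxN]
    have hp : bases (allChans (H₀.ctx u.succ B) (H₀.root u.succ B) X₁) ⊆ N := by
      rw [bases_allChans, Hole.iface, bases_union]
      rintro b ((⟨_, rfl, rfl⟩ | hb) | hb)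
      exacts [huN, hΓ (Or.inr hb), Or.inl (Or.inr (by rw [bases_conf_add]; exact Or.inr hb))]
    have hs : bases (allChans Γ (some (x, A)) S₁) ⊆ N := by
      rw [bases_allChans, ifaceChans, bases_union]
      rintro b ((hb | ⟨_, ⟨A, hA⟩, rfl⟩) | hb)
      · exact hΓ (Or.inl hb)
      · cases hA
        exact hxN
      · exact Or.inl (Or.inr (by rw [bases_conf_add]; exact Or.inl hb))
    have hy : bases (ifaceChans ((x, A) ::ₘ Δ₀) K) ⊆ N := by
      rw [ifaceChans_cons, bases_union]
      rintro b (⟨_, rfl, rfl⟩ | hb)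
      · exact hxN
      · refine Or.inl (Or.inl (bases_mono ?_ hb))
        rw [ifaceChans, ifaceChans, dom_add]
        exact Set.union_subset_union_left _ subset_union_right
    have h' := h.widen
    rw [add_comm _ Q₁] at h'
    rw [add_comm _ Q₁] at hNdef
    rw [← hNdef] at h'
    have sX : Sim Sg ((x, A) ::ₘ Δ₀) K (X₁ + D) (X₂ + (Q₂ + {.msg (.send x u)})) :=
      (d'.link u.succ B).sim hSg hX tQ.1 tQ.2 aX₁ aX₂ hN hp hq h' (ih hQ (h'.anti hN hq))
    have st : Step Sg N (X₁ + (Q₁ + {.msg (.send x u)})) (X₁ + D) := by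
      rw [add_comm X₁, add_comm X₁]
      exact h'.frame hN ((bases_mono subset_union_right).trans hp) subset_rfl
    have := ((Dual.right Γ Δ₀ K).link x A).sim hSg hS tY₁ tY₂ aS₁ aS₂ hN hs hy st sX
    convert this using 1 <;> abel

/-- A message between two components is sent along the linked channel. -/
theorem Link.sim_msg (hSg : Sg.WF) (l : Link u T Δp Kp Δq Kq Δ K) (hP : Comp Sg n₁ Δp Kp P₁ P₂)
    (hQ : Comp Sg n₂ Δq Kq Q₁ Q₂) (a1 : Apt u (allChans Δp Kp P₁) (allChans Δq Kq Q₁))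
    (a2 : Apt u (allChans Δp Kp P₂) (allChans Δq Kq Q₂)) (ih : StepSim Sg n₂)
    (e : P₁ = X + {.msg M})
    (h : Step Sg (bases (ifaceChans Δ K) ∪ bases (confChans X)) ({.msg M} + Q₁) D)
    (hw : ∃ x R, .proc x R ∈ Q₁ ∧ R.WaitsOn M.carrier) : Sim Sg Δ K (X + D) (P₂ + Q₂) := by
  obtain ⟨P, Q, W, ⟨hP', oP⟩, ⟨-, oQ⟩, a, hx, -, hs, hW⟩ := l.normalize hSg
    ((Comp.nominal hSg _).tree hP).2 ((Comp.nominal hSg _).tree hQ).2 a1 a2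
    (p := fun D => CompLE Sg n₁ Δp Kp P₁ D ∧ CObs Sg n₁ Δp Kp P₁ D)
    (q := fun D => CompLE Sg n₂ Δq Kq Q₁ D ∧ CObs Sg n₂ Δq Kq Q₁ D)
    (fun D D' h ha => ⟨(CompLE.nominal hSg _).alpha h.1 ha, h.2.alpha hSg ha⟩)
    (fun D D' h ha => ⟨(CompLE.nominal hSg _).alpha h.1 ha, h.2.alpha hSg ha⟩)
    (hP.exists_obs hSg) (hQ.exists_obs hSg)
  refine .steps_back (.alpha hSg ?_ hW.symm) hs
  obtain ⟨x, R, hR, hw⟩ := hw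
  have hMP : .msg M ∈ P₁ := e ▸ mem_add.2 (Or.inr (mem_singleton_self _))
  have hM : M.carrier = u := (a1 _ (Or.inr (mem_confChans hMP M.carrier_mem)) _
    (Or.inr (mem_confChans hR (Or.inr hw.mem_names)))).2 rfl
  have tP := (CompLE.nominal hSg n₁).tree hP'
  obtain ⟨H, H', d, rfl, rfl, rfl, rfl⟩ := l
  exact d.sim_msg hSg e hM (oP.1.out _ _ _ rfl rfl ⟨H.mem_iface _ _, M, hMP, hM⟩)
    (oQ.2 _ _ _ rfl rfl ⟨H'.mem_iface _ _, x, R, hR, hM ▸ hw⟩) tP a1 a hx ih h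

/-- The steps of composites are simulated, by induction on the number of pairs: a step either takes
place inside of one component, or hands a message over to one. -/
theorem Comp.stepSim (hSg : Sg.WF) (n : ℕ) : StepSim Sg n := by
  induction n using Nat.strong_induction_on with
  | h n ih =>
    rintro Δ K D₁ D₁' D₂ ⟨n', hn, h⟩ hs
    cases h with
    | base h => exact ⟨D₂, .refl, 1, .base fun m => (h m).steps_left hSg (.single hs)⟩
    | @cut n₁ n₂ u T Δp Kp Δq Kq _ _ P₁ P₂ Q₁ Q₂ _ l hP hQ a1 a2 hu hα =>
      have ih1 : StepSim Sg n₁ := ih n₁ (by have := hQ.pos; omega)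
      have ih2 : StepSim Sg n₂ := ih n₂ (by have := hP.pos; omega)
      refine Sim.alpha hSg ?_ hα
      rcases hs.split (ifaceBases_finite Δ K) with ⟨A', h, rfl⟩ | ⟨B', h, rfl⟩ |
        ⟨M, A', B', e, h, rfl, hw⟩ | ⟨M, A', B', e, h, rfl, hw⟩
      · rw [add_comm, add_comm P₂]
        exact l.symm.sim_right hSg ⟨_, le_rfl, hQ⟩ ⟨_, le_rfl, hP⟩ a1.symm a2.symm hu ih1 h
      · exact l.sim_right hSg ⟨_, le_rfl, hP⟩ ⟨_, le_rfl, hQ⟩ a1 a2 hu ih2 h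
      · exact l.sim_msg hSg hP hQ a1 a2 ih2 e h hw
      · rw [add_comm, add_comm P₂]
        exact l.symm.sim_msg hSg hQ hP a1.symm a2.symm ih1 e h hw

theorem CompAny.steps (hSg : Sg.WF) {D₁' : Config L TN PN} (h : CompAny Sg Δ K D₁ D₂)
    (hs : Steps Sg Δ K D₁ D₁') : Sim Sg Δ K D₁' D₂ := by
  induction hs with
  | refl => exact ⟨D₂, .refl, h⟩
  | tail _ hs ih =>
    obtain ⟨W, hW, n, hc⟩ := ih
    exact (Comp.stepSim hSg n ⟨n, le_rfl, hc⟩ hs).steps_back hW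

/-- Composites of related configurations are related. -/
theorem CompAny.eAll (hSg : Sg.WF) (h : CompAny Sg Δ K D₁ D₂) : EAll Sg Δ K D₁ D₂ := by
  intro m
  induction m generalizing Δ K D₁ D₂ with
  | zero => exact (CompAny.nominal hSg).tree h
  | succ m ih =>
    have t := (CompAny.nominal hSg).tree h
    rw [E_succ_iff hSg]
    refine ⟨t.1, t.2, fun D₁' hs => ?_⟩
    obtain ⟨W, hW, n, hc⟩ := h.steps hSg hs
    obtain ⟨W', hW', -, o⟩ := hc.exists_obs hSg
    exact ⟨W', hW.trans hW', o.1.mono fun _ _ _ _ h => ih h⟩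

/-- The empty configuration is related to itself. -/
theorem EAll.zero (hSg : Sg.WF) (u : Chan) (T : Ty L TN) :
    EAll Sg {(u, T)} (some (u, T)) (0 : Config L TN PN) 0 := by
  have t : Tree Sg {(u, T)} (some (u, T)) (0 : Config L TN PN) := by
    refine ⟨.emp₁ u T, fun c hc c' hc' _ h => ?_⟩
    have key : ∀ c ∈ allChans {(u, T)} (some (u, T)) (0 : Config L TN PN), c = u := by
      rintro c ((hc | ⟨A, hc⟩) | hc)
      · rwa [dom_singleton] at hc
      · cases hc; rfl
      · rw [confChans_zero] at hc; exact hc.elim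
    rw [key c hc, key c' hc'] at h
    exact absurd h (lt_irrefl _)
  intro m
  cases m with
  | zero => exact ⟨t, t⟩
  | succ m =>
    rw [E_succ_iff hSg]
    refine ⟨t, t, fun D hs => ⟨0, .refl, ?_⟩⟩
    obtain rfl := reds_zero (ifaceBases_finite _ _) hs
    exact ⟨fun _ h => h, fun _ _ _ _ _ h => absurd rfl (ne_zero_of_ups h),
      fun _ _ _ _ _ h => absurd rfl (ne_zero_of_thet h)⟩

end

end ILST

/-- Linking: the logical relation is closed under parallel composition. -/
theorem mainTheorem4 {L TN PN : Type} (Sg : ILST.Signature L TN PN) (hSg : Sg.WF)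
    (Δ : ILST.Ctx L TN ILST.Chan) (u : ILST.Chan) (T : ILST.Ty L TN) (K : ILST.Root L TN)
    (D₁ D₂ : ILST.Config L TN PN) :
    (∀ m : ℕ, ILST.E Sg m ((u, T) ::ₘ Δ) K D₁ D₂) ↔
      ∀ (Δ' : ILST.Ctx L TN ILST.Chan) (T₁ T₂ : ILST.Config L TN PN),
        (∀ m : ℕ, ILST.E Sg m Δ' (some (u, T)) T₁ T₂) →
        ILST.Apart (u, T) Δ' T₁ Δ K D₁ → ILST.Apart (u, T) Δ' T₂ Δ K D₂ →
        ∀ k : ℕ, ILST.E Sg k (Δ' + Δ) K (T₁ + D₁) (T₂ + D₂) := by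
  constructor
  · intro hD Δ' T₁ T₂ hT a₁ a₂
    exact ILST.CompAny.eAll hSg (ILST.CompAny.link hSg ((ILST.Dual.right Δ' Δ K).link u T)
      ⟨1, .base hT⟩ ⟨1, .base hD⟩ a₁ a₂)
  · intro h
    -- The empty configuration `u : T ⊩ u : T` is neutral for linking along `u`.
    have apart : ∀ D : ILST.Config L TN PN, ILST.Apart (u, T) {(u, T)} 0 Δ K D := by
      rintro D c ((hc | ⟨A, hc⟩) | hc) c' -
      · rw [ILST.dom_singleton] at hc
        exact ⟨fun _ => congrArg _ hc, fun _ => hc⟩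
      · cases hc
        exact ⟨fun _ => rfl, fun _ => rfl⟩
      · rw [ILST.confChans_zero] at hc
        exact hc.elim
    have := h {(u, T)} 0 0 (ILST.EAll.zero hSg u T) (apart _) (apart _)
    simpa only [zero_add, Multiset.singleton_add] using this
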